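/- Let $n\ge 3$, let $C_0^\infty=C_0^\infty(\mathbb R^n;\mathbb C)$, and let $$Pf(x)=\frac1{|\mathbb S^{n-1}|}\int_{\mathbb S^{n-1}}f(|x|\omega)\,d\sigma(\omega),\qquad P^\perp=\mathrm{Id}-P,$$ be the projection onto the radial functions in $L^2(\mathbb R^n)$ and its complement. For an operator $T$ on $L^2(\mathbb R^n)$, $\||x|^{-1}T|x|^{-1}\|_{L^2\to L^2}\le K$ means that for every $f\in L^2$ with $|x|^{-1}f\in L^2$ the function $|x|^{-1}T(|x|^{-1}f)$ belongs to $L^2$ and has norm at most $K\|f\|_{L^2}$. (1) (Critical case.) The closure in $L^2(\mathbb R^n)$ of the quadratic form $$\int_{\mathbb R^n}\Big(|\nabla u|^2-\tfrac{(n-2)^2}{4}|x|^{-2}|u|^2\Big)dx,\qquad u\in C_0^\infty,$$ is the form of a self-adjoint operator $H_0=-\Delta-\frac{(n-2)^2}{4}|x|^{-2}$ for which every $z\in\mathbb C\setminus[0,\infty)$ lies in the resolvent set, and $$\sup_{z\in\mathbb C\setminus[0,\infty)}\big\||x|^{-1}P^\perp(H_0-z)^{-1}P^\perp|x|^{-1}\big\|_{L^2\to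 L^2}<\infty .$$ (2) (Subcritical case.) There is a constant $C>0$, depending only on $n$, such that the following holds. Let $\delta>0$ and let $V_\delta:\mathbb R^n\to\mathbb R$ be such that $|x|V_\delta\in L^{n,\infty}(\mathbb R^n)$ and $x\cdot\nabla V_\delta\in L^{n/2,\infty}(\mathbb R^n)$ (weak Lebesgue spaces; $x\cdot\nabla V_\delta$ is taken in the sense of distributions), and such that for all $u\in C_0^\infty$ $$\int\big(|\nabla u|^2+V_\delta|u|^2\big)dx\ge\delta\int|\nabla u|^2dx,\qquad \int\big(|\nabla u|^2-(V_\delta+x\cdot\nabla V_\delta)|u|^2\big)dx\ge\delta\int|\nabla u|^2dx .$$ Then the closure in $L^2(\mathbb R^n)$ of the quadratic form $\int(|\nabla u|^2+V_\delta|u|^2)dx$, $u\in C_0^\infty$, is the form of a self-adjoint operator $H_\delta=-\Delta+V_\delta$ for which every $z\in\mathbb C\setminus[0,\infty)$ lies in the resolvent set, and $$\sup_{z\in\mathbb C\setminus[0,\infty)}\big\||x|^{-1}(H_\delta-z)^{-1}|x|^{-1}\big\|_{L^2\to L^2}\le C\delta^{-2}.$$ -/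

import Mathlib

open MeasureTheory Filter Topology
open scoped ENNReal NNReal ComplexConjugate

noncomputable section

namespace WeightedResolvent

/-- The Euclidean space `ℝⁿ`. -/
abbrev E (n : ℕ) : Type := EuclideanSpace ℝ (Fin n)

/-- The complex Hilbert space `L²(ℝⁿ)`. -/
abbrev L2 (n : ℕ) : Type := Lp ℂ 2 (volume : Measure (E n))

/-! ### Projection onto radial functions -/

/-- The spherical mean `(Pf)(x) = |S^{n-1}|⁻¹ ∫_{S^{n-1}} f(|x| θ) dσ(θ)`, where `σ` is the surface
measure of the unit sphere and `⨍` denotes the average. -/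
def radialAverage {n : ℕ} (f : E n → ℂ) (x : E n) : ℂ :=
  ⨍ θ : Metric.sphere (0 : E n) 1, f (‖x‖ • (θ : E n)) ∂(volume : Measure (E n)).toSphere

theorem lintegral_polar {n : ℕ} [Nontrivial (E n)] (F : E n → ℝ≥0∞) :
    ∫⁻ x, F x = ∫⁻ p : Metric.sphere (0 : E n) 1 × Set.Ioi (0 : ℝ), F (p.2.1 • (p.1 : E n))
      ∂((volume : Measure (E n)).toSphere.prod
        (Measure.volumeIoiPow (Module.finrank ℝ (E n) - 1))) := by
  have h := (volume : Measure (E n)).measurePreserving_homeomorphUnitSphereProd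
  rw [← h.lintegral_comp_emb (Homeomorph.measurableEmbedding _)]
  have key : ∀ x : ({0}ᶜ : Set (E n)),
      F ((homeomorphUnitSphereProd (E n) x).2.1 • ((homeomorphUnitSphereProd (E n) x).1 : E n))
        = F x := by
    intro x
    have := (homeomorphUnitSphereProd (E n)).symm_apply_apply x
    have h2 := congrArg Subtype.val this
    rw [homeomorphUnitSphereProd_symm_apply_coe] at h2
    rw [h2]
  simp_rw [key]
  rw [lintegral_subtype_comap (measurableSet_singleton _).compl F]
  simp

theorem stronglyMeasurable_radialAverage {n : ℕ} {f : E n → ℂ} (hf : StronglyMeasurable f) :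
    StronglyMeasurable (radialAverage f) := by
  unfold radialAverage average
  have h : StronglyMeasurable
      (fun p : E n × Metric.sphere (0 : E n) 1 => f (‖p.1‖ • (p.2 : E n))) :=
    hf.comp_measurable (by fun_prop)
  exact h.integral_prod_right'

theorem enorm_average_sq_le {α : Type*} [MeasurableSpace α] (μ : Measure α) [IsFiniteMeasure μ]
    {g : α → ℂ} (hg : AEStronglyMeasurable g μ) :
    ‖⨍ a, g a ∂μ‖ₑ ^ 2 ≤ (μ Set.univ)⁻¹ * ∫⁻ a, ‖g a‖ₑ ^ 2 ∂μ := by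
  rcases eq_or_ne μ 0 with rfl | hμ
  · simp
  have : NeZero μ := ⟨hμ⟩
  have hg' : AEStronglyMeasurable g ((μ Set.univ)⁻¹ • μ) := hg.smul_measure _
  rw [average_eq']
  have h1 := enorm_integral_le_lintegral_enorm (μ := (μ Set.univ)⁻¹ • μ) g
  rw [← eLpNorm_one_eq_lintegral_enorm] at h1
  have h2 := h1.trans (eLpNorm_le_eLpNorm_of_exponent_le (p := 1) (q := 2) (by norm_num) hg')
  have h3 : eLpNorm g 2 ((μ Set.univ)⁻¹ • μ) ^ 2 = (μ Set.univ)⁻¹ * ∫⁻ a, ‖g a‖ₑ ^ 2 ∂μ := by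
    rw [eLpNorm_eq_lintegral_rpow_enorm_toReal (by norm_num) (by norm_num), lintegral_smul_measure,
      ← ENNReal.rpow_natCast, ← ENNReal.rpow_mul]
    simp
  rw [← h3]
  gcongr

theorem memLp_radialAverage {n : ℕ} {f : E n → ℂ} (hf : StronglyMeasurable f)
    (h2 : MemLp f 2) : MemLp (radialAverage f) 2 := by
  rcases subsingleton_or_nontrivial (E n) with hE | hE
  · have h0 : (volume : Measure (E n)).toSphere = 0 :=
      (Measure.toSphere_eq_zero_iff volume).2 hE
    have : radialAverage f = fun _ => 0 := by
      funext x
      simp [radialAverage, h0]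
    rw [this]
    exact MemLp.zero'
  refine ⟨(stronglyMeasurable_radialAverage hf).aestronglyMeasurable, ?_⟩
  have hfin := h2.2
  rw [eLpNorm_lt_top_iff_lintegral_rpow_enorm_lt_top (by norm_num) (by norm_num)] at hfin ⊢
  refine lt_of_le_of_lt ?_ hfin
  simp only [ENNReal.toReal_ofNat, ENNReal.rpow_ofNat]
  set σ := (volume : Measure (E n)).toSphere with hσ
  have hσ0 : σ Set.univ ≠ 0 := by
    rw [Measure.measure_univ_ne_zero]
    exact Measure.toSphere_ne_zero volume
  have hσt : σ Set.univ ≠ ∞ := measure_ne_top _ _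
  have hm : Measurable
      (fun p : Metric.sphere (0 : E n) 1 × Set.Ioi (0 : ℝ) => ‖f (p.2.1 • (p.1 : E n))‖ₑ ^ 2) :=
    ((hf.comp_measurable (by fun_prop :
      Measurable fun p : Metric.sphere (0 : E n) 1 × Set.Ioi (0 : ℝ) =>
        p.2.1 • (p.1 : E n))).enorm).pow_const 2
  calc ∫⁻ x, ‖radialAverage f x‖ₑ ^ 2
      ≤ ∫⁻ x : E n, (σ Set.univ)⁻¹ *
          ∫⁻ θ : Metric.sphere (0 : E n) 1, ‖f (‖x‖ • (θ : E n))‖ₑ ^ 2 ∂σ := by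
        refine lintegral_mono fun x => enorm_average_sq_le σ ?_
        exact (hf.comp_measurable (by fun_prop)).aestronglyMeasurable
    _ = ∫⁻ x, ‖f x‖ₑ ^ 2 := by
        rw [lintegral_polar, lintegral_polar (fun x => ‖f x‖ₑ ^ 2)]
        have hn : ∀ p : Metric.sphere (0 : E n) 1 × Set.Ioi (0 : ℝ),
            ‖p.2.1 • (p.1 : E n)‖ = p.2.1 := by
          intro p
          rw [norm_smul, norm_eq_of_mem_sphere, mul_one, Real.norm_eq_abs,
            abs_of_pos (Set.mem_Ioi.1 p.2.2)]
        simp_rw [hn]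
        have hm' : Measurable (fun r : Set.Ioi (0 : ℝ) =>
            ∫⁻ θ : Metric.sphere (0 : E n) 1, ‖f (r.1 • (θ : E n))‖ₑ ^ 2 ∂σ) :=
          hm.lintegral_prod_left'
        have hm'' : Measurable (fun p : Metric.sphere (0 : E n) 1 × Set.Ioi (0 : ℝ) =>
            (σ Set.univ)⁻¹ *
              ∫⁻ θ : Metric.sphere (0 : E n) 1, ‖f (p.2.1 • (θ : E n))‖ₑ ^ 2 ∂σ) :=
          (hm'.comp measurable_snd).const_mul _
        rw [lintegral_prod_symm _ hm.aemeasurable, lintegral_prod_symm _ hm''.aemeasurable]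
        simp only [lintegral_const]
        refine lintegral_congr fun r => ?_
        rw [mul_comm, ← mul_assoc, ENNReal.mul_inv_cancel hσ0 hσt, one_mul]

/-- The operator `P` on `L²(ℝⁿ)`: projection onto the radial functions. -/
def radialProj {n : ℕ} (f : L2 n) : L2 n :=
  (memLp_radialAverage (Lp.stronglyMeasurable f) (Lp.memLp f)).toLp (radialAverage f)

/-- The operator `P^⊥ = Id - P`. -/
def radialPerp {n : ℕ} (f : L2 n) : L2 n := f - radialProj f

/-! ### Schrödinger operators defined by closing quadratic forms -/

/-- `C_0^∞(ℝⁿ)`: smooth compactly supported complex-valued functions. -/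
def IsTestFunction {n : ℕ} (φ : E n → ℂ) : Prop :=
  ContDiff ℝ (⊤ : ℕ∞) φ ∧ HasCompactSupport φ

/-- The partial derivative `∂_i φ`. -/
def partialDeriv {n : ℕ} (i : Fin n) (φ : E n → ℂ) (x : E n) : ℂ :=
  fderiv ℝ φ x (EuclideanSpace.single i 1)

/-- `|∇φ(x)|²`. -/
def gradSq {n : ℕ} (φ : E n → ℂ) (x : E n) : ℝ :=
  ∑ i, ‖partialDeriv i φ x‖ ^ 2

/-- The sesquilinear form of `-Δ + V` on test functions,
`∫ (∇φ · conj ∇ψ + V φ conj ψ) dx`. -/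
def schrodingerForm {n : ℕ} (V : E n → ℝ) (φ ψ : E n → ℂ) : ℂ :=
  ∫ x, ((∑ i, partialDeriv i φ x * conj (partialDeriv i ψ x)) + (V x : ℂ) * φ x * conj (ψ x))

/-- `φ` is a sequence of test functions that converges to `u` in `L²` and is Cauchy for the
quadratic form of `-Δ + V`. -/
structure IsFormApprox {n : ℕ} (V : E n → ℝ) (φ : ℕ → E n → ℂ) (u : L2 n) : Prop where
  test : ∀ k, IsTestFunction (φ k)
  tendsto : Tendsto (fun k => eLpNorm (fun x => φ k x - u x) 2 volume) atTop (𝓝 0)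
  cauchy : Tendsto (fun p : ℕ × ℕ => schrodingerForm V (φ p.1 - φ p.2) (φ p.1 - φ p.2))
    atTop (𝓝 0)

/-- The domain of the closure of the form of `-Δ + V`. -/
def formDomain {n : ℕ} (V : E n → ℝ) : Set (L2 n) := {u | ∃ φ, IsFormApprox V φ u}

/-- `c` is the value at `(u, v)` of the closure of the form of `-Δ + V`. -/
def IsClosedFormValue {n : ℕ} (V : E n → ℝ) (u v : L2 n) (c : ℂ) : Prop :=
  ∃ φ ψ, IsFormApprox V φ u ∧ IsFormApprox V ψ v ∧
    Tendsto (fun k => schrodingerForm V (φ k) (ψ k)) atTop (𝓝 c)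

/-- The graph of the operator associated with the closure `q` of the form of `-Δ + V`: the pairs
`(u, g)` with `u` in the form domain and `q(u, v) = ⟨g, v⟩` for all `v` in the form domain, where
`⟨g, v⟩ = ∫ g conj v dx` is Mathlib's `inner ℂ v g`. -/
def formOperatorGraph {n : ℕ} (V : E n → ℝ) : Set (L2 n × L2 n) :=
  {p | p.1 ∈ formDomain V ∧ ∀ v ∈ formDomain V, IsClosedFormValue V p.1 v (inner ℂ v p.2)}

/-- `H` is the self-adjoint operator on `L²(ℝⁿ)` associated with the closure of the form of
`-Δ + V`. -/
def IsSchrodingerOperator {n : ℕ} (V : E n → ℝ) (H : L2 n →ₗ.[ℂ] L2 n) : Prop :=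
  IsSelfAdjoint H ∧ (H.graph : Set (L2 n × L2 n)) = formOperatorGraph V

/-- `R = (H - z)⁻¹`, a bounded everywhere defined two-sided inverse of `H - z`. -/
def IsResolvent {n : ℕ} (H : L2 n →ₗ.[ℂ] L2 n) (z : ℂ) (R : L2 n →L[ℂ] L2 n) : Prop :=
  (∀ f : L2 n, ∃ hf : R f ∈ H.domain, H ⟨R f, hf⟩ - z • R f = f) ∧
  ∀ u : H.domain, R (H u - z • (u : L2 n)) = u

/-- `‖|x|⁻¹ T |x|⁻¹‖_{L² → L²} ≤ C`: whenever `f` and `g = |x|⁻¹ f` are in `L²`, the function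
`|x|⁻¹ T g` is in `L²` and its norm is at most `C ‖f‖`. (Such `f` are dense in `L²`.) -/
def WeightedBound {n : ℕ} (T : L2 n → L2 n) (C : ℝ) : Prop :=
  ∀ f g : L2 n, (g =ᵐ[volume] fun x => ((‖x‖⁻¹ : ℝ) : ℂ) * f x) →
    MemLp (fun x => ((‖x‖⁻¹ : ℝ) : ℂ) * T g x) 2 ∧
    eLpNorm (fun x => ((‖x‖⁻¹ : ℝ) : ℂ) * T g x) 2 volume ≤ ENNReal.ofReal (C * ‖f‖)

/-! ### The potentials -/

/-- The critical inverse-square potential `-((n-2)²/4) |x|⁻²`. -/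
def criticalPotential (n : ℕ) (x : E n) : ℝ := -(((n : ℝ) - 2) ^ 2 / 4) * (‖x‖ ^ 2)⁻¹

/-- The weak Lebesgue space `L^{p,∞}(ℝⁿ)`, `0 < p < ∞`: `sup_{t>0} t |{|f| > t}|^{1/p} < ∞`. -/
def MemWeakLp {n : ℕ} (f : E n → ℝ) (p : ℝ) : Prop :=
  AEStronglyMeasurable f volume ∧
    ⨆ t : ℝ≥0, (t : ℝ≥0∞) * (volume {x | (t : ℝ) < ‖f x‖}) ^ (1 / p) < ∞

/-- `W = x · ∇V` in the sense of distributions: `∫ V div(x φ) dx = -∫ W φ dx` for all test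
functions, where `div(x φ) = n φ + x · ∇φ`. -/
def IsWeakEulerDerivative {n : ℕ} (V W : E n → ℝ) : Prop :=
  ∀ φ : E n → ℂ, IsTestFunction φ →
    ∫ x, (V x : ℂ) * ((n : ℂ) * φ x + fderiv ℝ φ x x) = -∫ x, (W x : ℂ) * φ x

/-- The class of subcritical potentials: `|x| V ∈ L^{n,∞}`, `x · ∇V ∈ L^{n/2,∞}`, and the form
inequalities `-Δ + V ≥ -δΔ`, `-Δ - V - x · ∇V ≥ -δΔ` on test functions. -/
def IsSubcritical {n : ℕ} (δ : ℝ) (V : E n → ℝ) : Prop :=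
  MemWeakLp (fun x => ‖x‖ * V x) n ∧
  ∃ W : E n → ℝ, IsWeakEulerDerivative V W ∧ MemWeakLp W ((n : ℝ) / 2) ∧
    (∀ u : E n → ℂ, IsTestFunction u →
      δ * ∫ x, gradSq u x ≤ ∫ x, (gradSq u x + V x * ‖u x‖ ^ 2)) ∧
    (∀ u : E n → ℂ, IsTestFunction u →
      δ * ∫ x, gradSq u x ≤ ∫ x, (gradSq u x - (V x + W x) * ‖u x‖ ^ 2))

end WeightedResolvent

end

/-! Both parts follow from one a priori bound, `IsWeakSolution.weighted_estimate`. Let u in H¹ solve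
(-Δ + V - z)u = f with z = λ + iε outside [0,∞), and put F = ‖|x| f‖, X = ‖|x|⁻¹ u‖, W = x·∇V. If
the form of -Δ + V is nonnegative and the forms of -Δ + V and -Δ - V - W dominate δ‖∇·‖² on radial
multiples of u, with δ ≤ 1, then δ² X ≤ 6(n+2) F.

Pairing the equation with u gives |ε|‖u‖² ≤ FX. If λ ≤ |ε|, the real part, coercivity and Hardy's
inequality already finish. If λ > |ε|, choose κ with κ² = λ and κε ≥ 0, and let v = e^{-iκ|x|} u,
which has the same modulus as u. Three identities are combined: the virial identity ‖∇u‖² - ½∫W|u|²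
= Re⟨Au, zu + f⟩ with A = x·∇ + n/2, the energy identity, and the imaginary part of the equation
tested with |x|u, which evaluates the radial flux ∫ Im(∂ᵣu ū). Virial, minus half the energy, minus
κ times the flux, gives ½(‖∇v‖² - ∫(V + W)|u|²) = ε(Y - κM) + terms in f, where M = ∫|x||u|² and Y =
∫|x| Im(∂ᵣu ū). The left side is at least (δ/2)‖∇v‖². The terms in f regroup into a pairing of x f
with ∇v, of size F‖∇v‖, and a multiple of Re⟨f,u⟩ ≤ FX. Nonnegativity of the form at √|x| v gives
2κ(Y - κM) ≤ (F + X/4)‖u‖, and |ε|λ^{-1/2}‖u‖ ≤ √|ε| ‖u‖ ≤ √(FX). Since Hardy gives X ≤ 2‖∇v‖, what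
remains is a quadratic inequality for ‖∇v‖.

For the rigorous version |x| is replaced in the multipliers by √(|x|² + η²) (`reg`), with η → 0 at
the end. The weighted integrals are finite because Im z ≠ 0 forces u and ∇u to decay
(`IsWeakSolution.memLp_reg_mul`). The virial identity needs no second derivatives of u: with U_t the
unitary dilations and q the form, q(U_t u - u) is nonnegative and vanishes at t = 0, so its
t-derivative vanishes there (`virial`).

Subcritical case: the weak Lebesgue hypotheses make V and W form bounded (a dyadic truncation
argument based on Sobolev's inequality, and Hardy), so the form inequalities extend to H¹ and the
resolvent produces H¹ solutions. Plane waves show δ ≤ 1.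

Critical case: V is homogeneous of degree -2, so W = -2V and the two form hypotheses coincide.
Coercivity is available for functions with vanishing spherical means, by a Poincaré inequality on
spheres (`exists_coercive_criticalPotential`). This class is stable under radial multipliers, the
only ones used. The critical form is a sum of squares ‖∇u + ((n-2)/2)|x|⁻²x u‖², and although the
resolvent is only obtained as a form limit, its part with vanishing spherical means lies in H¹
(`exists_isWeakSolution_critical`).

The self-adjoint operators come from completing the form domain (`exists_operator_of_closable`). -/

noncomputable section

namespace WeightedResolvent

/-! ### Squared `L²` norms, pairings and `L²` convergence of functions -/

/-- The squared `L²` norm. -/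
def sqNorm {n : ℕ} (f : E n → ℂ) : ℝ≥0∞ := ∫⁻ x, ‖f x‖ₑ ^ 2

/-- The pairing `∫ f conj g`. -/
def pairing {n : ℕ} (f g : E n → ℂ) : ℂ := ∫ x, f x * conj (g x)

/-- Convergence in `L²` of a family of functions. -/
structure L2Tendsto {n : ℕ} {ι : Type*} (l : Filter ι) (F : ι → E n → ℂ) (f : E n → ℂ) : Prop where
  mem : ∀ i, MemLp (F i) 2
  lim : MemLp f 2
  tendsto : Tendsto (fun i => sqNorm (fun x => F i x - f x)) l (𝓝 0)

section
variable {n : ℕ}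

theorem eLpNorm_sq_eq (f : E n → ℂ) : eLpNorm f 2 volume ^ 2 = sqNorm f := by
  rw [sqNorm, eLpNorm_eq_lintegral_rpow_enorm_toReal (by norm_num) (by norm_num)]
  rw [← ENNReal.rpow_natCast, ← ENNReal.rpow_mul]
  simp

theorem memLp_of_sqNorm_lt_top {f : E n → ℂ} (hf : AEStronglyMeasurable f volume)
    (h : sqNorm f < ∞) : MemLp f 2 := by
  refine ⟨hf, ?_⟩
  rw [← eLpNorm_sq_eq] at h
  by_contra hc
  simp only [not_lt, top_le_iff] at hc
  rw [hc] at h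
  simp at h

theorem _root_.MeasureTheory.MemLp.sqNorm_lt_top {f : E n → ℂ} (hf : MemLp f 2) : sqNorm f < ∞ := by
  rw [← eLpNorm_sq_eq]
  exact ENNReal.pow_lt_top hf.2

theorem tendsto_eLpNorm_iff {ι : Type*} {l : Filter ι} {F : ι → E n → ℂ} :
    Tendsto (fun i => eLpNorm (F i) 2 volume) l (𝓝 0) ↔
      Tendsto (fun i => sqNorm (F i)) l (𝓝 0) := by
  constructor
  · intro h
    have := (ENNReal.continuous_pow 2).tendsto 0 |>.comp h
    simpa [Function.comp_def, eLpNorm_sq_eq] using this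
  · intro h
    have := (ENNReal.continuous_rpow_const (y := (1/2 : ℝ))).tendsto 0 |>.comp h
    have h2 : ∀ i, sqNorm (F i) ^ (1/2 : ℝ) = eLpNorm (F i) 2 volume := fun i => by
      rw [← eLpNorm_sq_eq, ← ENNReal.rpow_natCast, ← ENNReal.rpow_mul]; simp
    simp only [Function.comp_def, h2] at this
    simpa using this

theorem enorm_add_sq_le (a b : ℂ) : ‖a + b‖ₑ ^ 2 ≤ 2 * ‖a‖ₑ ^ 2 + 2 * ‖b‖ₑ ^ 2 := by
  have h : ‖a + b‖₊ ^ 2 ≤ 2 * ‖a‖₊ ^ 2 + 2 * ‖b‖₊ ^ 2 := by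
    rw [← NNReal.coe_le_coe]
    push_cast
    have := norm_add_le a b
    nlinarith [sq_nonneg (‖a‖ - ‖b‖), norm_nonneg (a + b), norm_nonneg a, norm_nonneg b]
  simp only [enorm_eq_nnnorm]
  exact_mod_cast h

theorem sqNorm_add_le {f g : E n → ℂ} (hf : AEStronglyMeasurable f volume) :
    sqNorm (fun x => f x + g x) ≤ 2 * sqNorm f + 2 * sqNorm g := by
  unfold sqNorm
  have hm : AEMeasurable (fun x => 2 * ‖f x‖ₑ ^ 2) := (hf.enorm.pow_const 2).const_mul _
  calc ∫⁻ x, ‖f x + g x‖ₑ ^ 2 ≤ ∫⁻ x, (2 * ‖f x‖ₑ ^ 2 + 2 * ‖g x‖ₑ ^ 2) :=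
        lintegral_mono fun x => enorm_add_sq_le _ _
    _ = _ := by
        rw [lintegral_add_left' hm, lintegral_const_mul' _ _ (by norm_num),
          lintegral_const_mul' _ _ (by norm_num)]

theorem sqNorm_mul_le {f g : E n → ℂ} {C : ℝ≥0∞} (hC : C ≠ ∞) (h : ∀ᵐ x, ‖f x‖ₑ ^ 2 ≤ C * ‖g x‖ₑ ^ 2) :
    sqNorm f ≤ C * sqNorm g := by
  unfold sqNorm
  rw [← lintegral_const_mul' _ _ hC]
  exact lintegral_mono_ae h

theorem sqNorm_eq_ofReal {f : E n → ℂ} (hf : MemLp f 2) :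
    sqNorm f = ENNReal.ofReal (∫ x, ‖f x‖ ^ 2) := by
  rw [ofReal_integral_eq_lintegral_ofReal]
  · unfold sqNorm
    congr 1 with x
    rw [ENNReal.ofReal_pow (norm_nonneg _), ofReal_norm]
  · exact hf.integrable_norm_pow (by norm_num)
  · exact ae_of_all _ fun x => by positivity

theorem integral_norm_sq_eq {f : E n → ℂ} (hf : AEStronglyMeasurable f volume) :
    ∫ x, ‖f x‖ ^ 2 = (sqNorm f).toReal := by
  rw [integral_eq_lintegral_of_nonneg_ae (ae_of_all _ fun x => by positivity)
    (hf.norm.aemeasurable.pow_const 2).aestronglyMeasurable]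
  unfold sqNorm
  congr 2 with x
  rw [ENNReal.ofReal_pow (norm_nonneg _), ofReal_norm]

theorem integrable_mul_conj {f g : E n → ℂ} (hf : MemLp f 2) (hg : MemLp g 2) :
    Integrable (fun x => f x * conj (g x)) := by
  have hg' : MemLp (fun x => conj (g x)) 2 := hg.star
  exact hf.integrable_mul hg'

theorem pairing_eq_inner {f g : E n → ℂ} (hf : MemLp f 2) (hg : MemLp g 2) :
    pairing f g = inner ℂ (hg.toLp g) (hf.toLp f) := by
  rw [L2.inner_def]
  refine integral_congr_ae ?_
  filter_upwards [hf.coeFn_toLp, hg.coeFn_toLp] with x h1 h2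
  rw [h1, h2]
  rfl

theorem pairing_self (f : E n → ℂ) : pairing f f = ((∫ x, ‖f x‖ ^ 2 : ℝ) : ℂ) := by
  unfold pairing
  rw [← integral_complex_ofReal]
  congr 1 with x
  rw [Complex.mul_conj, Complex.normSq_eq_norm_sq]

theorem norm_toLp_sq {f : E n → ℂ} (hf : MemLp f 2) : ‖hf.toLp f‖ ^ 2 = ∫ x, ‖f x‖ ^ 2 := by
  have := pairing_eq_inner hf hf
  rw [pairing_self, inner_self_eq_norm_sq_to_K] at this
  exact Complex.ofReal_injective (by simpa using this.symm)

theorem norm_pairing_le {f g : E n → ℂ} (hf : MemLp f 2) (hg : MemLp g 2) :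
    ‖pairing f g‖ ≤ √(∫ x, ‖f x‖ ^ 2) * √(∫ x, ‖g x‖ ^ 2) := by
  rw [pairing_eq_inner hf hg, ← norm_toLp_sq hf, ← norm_toLp_sq hg, Real.sqrt_sq (norm_nonneg _),
    Real.sqrt_sq (norm_nonneg _), mul_comm]
  exact norm_inner_le_norm _ _

theorem conj_pairing (f g : E n → ℂ) : conj (pairing f g) = pairing g f := by
  unfold pairing
  rw [← integral_conj]
  congr 1 with x
  simp [mul_comm]

variable {ι : Type*} {l : Filter ι} {F G : ι → E n → ℂ} {f g : E n → ℂ}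

theorem L2Tendsto.toLp (h : L2Tendsto l F f) :
    Tendsto (fun i => (h.mem i).toLp (F i)) l (𝓝 (h.lim.toLp f)) := by
  rw [Lp.tendsto_Lp_iff_tendsto_eLpNorm'']
  exact tendsto_eLpNorm_iff.2 h.tendsto

theorem L2Tendsto.of_toLp (hF : ∀ i, MemLp (F i) 2) (hf : MemLp f 2)
    (h : Tendsto (fun i => (hF i).toLp (F i)) l (𝓝 (hf.toLp f))) : L2Tendsto l F f := by
  refine ⟨hF, hf, ?_⟩
  rw [Lp.tendsto_Lp_iff_tendsto_eLpNorm''] at h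
  exact tendsto_eLpNorm_iff.1 h

theorem L2Tendsto.pairing (hF : L2Tendsto l F f) (hG : L2Tendsto l G g) :
    Tendsto (fun i => pairing (F i) (G i)) l (𝓝 (pairing f g)) := by
  rw [pairing_eq_inner hF.lim hG.lim]
  simp_rw [fun i => pairing_eq_inner (hF.mem i) (hG.mem i)]
  exact hG.toLp.inner hF.toLp

theorem L2Tendsto.add (hF : L2Tendsto l F f) (hG : L2Tendsto l G g) :
    L2Tendsto l (fun i x => F i x + G i x) (fun x => f x + g x) :=
  .of_toLp (fun i => (hF.mem i).add (hG.mem i)) (hF.lim.add hG.lim) (hF.toLp.add hG.toLp)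

theorem L2Tendsto.sub (hF : L2Tendsto l F f) (hG : L2Tendsto l G g) :
    L2Tendsto l (fun i x => F i x - G i x) (fun x => f x - g x) :=
  .of_toLp (fun i => (hF.mem i).sub (hG.mem i)) (hF.lim.sub hG.lim) (hF.toLp.sub hG.toLp)

theorem L2Tendsto.const (l : Filter ι) (hf : MemLp f 2) : L2Tendsto l (fun _ => f) f :=
  ⟨fun _ => hf, hf, by simpa [sqNorm] using tendsto_const_nhds⟩

theorem L2Tendsto.comp {κ : Type*} {l' : Filter κ} (hF : L2Tendsto l F f) {k : κ → ι}
    (hk : Tendsto k l' l) : L2Tendsto l' (fun j => F (k j)) f :=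
  ⟨fun _ => hF.mem _, hF.lim, hF.tendsto.comp hk⟩

theorem L2Tendsto.congr' (hF : L2Tendsto l F f) (hF' : ∀ i, F i =ᵐ[volume] G i)
    (hf : f =ᵐ[volume] g) : L2Tendsto l G g := by
  refine ⟨fun i => (memLp_congr_ae (hF' i)).1 (hF.mem i), (memLp_congr_ae hf).1 hF.lim, ?_⟩
  refine hF.tendsto.congr fun i => ?_
  refine lintegral_congr_ae ?_
  filter_upwards [hF' i, hf] with x h1 h2
  rw [h1, h2]

theorem L2Tendsto.unique [l.NeBot] (hF : L2Tendsto l F f) (hG : L2Tendsto l F g) :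
    f =ᵐ[volume] g := by
  have := tendsto_nhds_unique hF.toLp hG.toLp
  exact (MemLp.toLp_eq_toLp_iff hF.lim hG.lim).1 this

theorem L2Tendsto.of_sqNorm_le (hG : L2Tendsto l G g) (hF : ∀ i, MemLp (F i) 2) (hf : MemLp f 2)
    {C : ℝ≥0∞} (hC : C ≠ ∞)
    (h : ∀ i, sqNorm (fun x => F i x - f x) ≤ C * sqNorm (fun x => G i x - g x)) :
    L2Tendsto l F f := by
  refine ⟨hF, hf, ?_⟩
  have := ENNReal.Tendsto.const_mul hG.tendsto (Or.inr hC)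
  rw [mul_zero] at this
  exact tendsto_of_tendsto_of_tendsto_of_le_of_le tendsto_const_nhds this (fun _ => zero_le) h

theorem memLp_mul_bdd {f ψ : E n → ℂ} (hψ : AEStronglyMeasurable ψ volume) {C : ℝ}
    (hC : ∀ x, ‖ψ x‖ ≤ C) (hf : MemLp f 2) : MemLp (fun x => ψ x * f x) 2 := by
  refine MemLp.of_le_mul (c := C) hf (hψ.mul hf.1) (ae_of_all _ fun x => ?_)
  rw [norm_mul]
  exact mul_le_mul_of_nonneg_right (hC x) (norm_nonneg _)

theorem L2Tendsto.mul_bdd (hF : L2Tendsto l F f) {ψ : E n → ℂ}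
    (hψ : AEStronglyMeasurable ψ volume) {C : ℝ} (hC : ∀ x, ‖ψ x‖ ≤ C) :
    L2Tendsto l (fun i x => ψ x * F i x) (fun x => ψ x * f x) := by
  refine hF.of_sqNorm_le (fun i => memLp_mul_bdd hψ hC (hF.mem i)) (memLp_mul_bdd hψ hC hF.lim)
    (C := ENNReal.ofReal C ^ 2) (by finiteness) fun i => ?_
  refine sqNorm_mul_le (by finiteness) (ae_of_all _ fun x => ?_)
  rw [← mul_sub, enorm_mul, mul_pow]
  gcongr
  rw [← ofReal_norm]
  exact ENNReal.ofReal_le_ofReal (hC x)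

theorem L2Tendsto.const_mul (hF : L2Tendsto l F f) (c : ℂ) :
    L2Tendsto l (fun i x => c * F i x) (fun x => c * f x) :=
  hF.mul_bdd (ψ := fun _ => c) aestronglyMeasurable_const (fun _ => le_rfl)

theorem L2Tendsto.of_dominated [l.IsCountablyGenerated] {b : E n → ℝ}
    (hF : ∀ i, AEStronglyMeasurable (F i) volume)
    (hf : AEStronglyMeasurable f volume) (hb : MemLp b 2) (hFb : ∀ i, ∀ᵐ x, ‖F i x‖ ≤ b x)
    (hfb : ∀ᵐ x, ‖f x‖ ≤ b x)
    (h : ∀ᵐ x, Tendsto (fun i => F i x) l (𝓝 (f x))) : L2Tendsto l F f := by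
  have hb' : MemLp (fun x => ((b x : ℝ) : ℂ)) 2 := hb.ofReal
  refine ⟨fun i => hb.mono (hF i) ?_, hb.mono hf ?_, ?_⟩
  · filter_upwards [hFb i] with x hx using hx.trans (le_abs_self _)
  · filter_upwards [hfb] with x hx using hx.trans (le_abs_self _)
  have h0 : (0 : ℝ≥0∞) = ∫⁻ _ : E n, 0 := by simp
  rw [h0]
  unfold sqNorm
  refine tendsto_lintegral_filter_of_dominated_convergence'
    (fun x => 4 * ‖((b x : ℝ) : ℂ)‖ₑ ^ 2) ?_ ?_ ?_ ?_
  · exact Eventually.of_forall fun i => ((hF i).sub hf).enorm.pow_const 2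
  · refine Eventually.of_forall fun i => ?_
    filter_upwards [hFb i, hfb] with x h1 h2
    have e1 : ‖F i x‖ₑ ≤ ‖((b x : ℝ) : ℂ)‖ₑ := by
      rw [enorm_le_iff_norm_le]; simpa using h1.trans (le_abs_self _)
    have e2 : ‖f x‖ₑ ≤ ‖((b x : ℝ) : ℂ)‖ₑ := by
      rw [enorm_le_iff_norm_le]; simpa using h2.trans (le_abs_self _)
    have := enorm_add_sq_le (F i x) (- f x)
    rw [← sub_eq_add_neg, enorm_neg] at this
    refine this.trans ?_
    calc _ ≤ 2 * ‖((b x : ℝ) : ℂ)‖ₑ ^ 2 + 2 * ‖((b x : ℝ) : ℂ)‖ₑ ^ 2 := by gcongr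
      _ = _ := by ring
  · rw [lintegral_const_mul' _ _ (by norm_num)]
    exact ENNReal.mul_ne_top (by norm_num) hb'.sqNorm_lt_top.ne
  · filter_upwards [h] with x hx
    have : Tendsto (fun i => ‖F i x - f x‖ₑ ^ 2) l (𝓝 (‖f x - f x‖ₑ ^ 2)) :=
      ((ENNReal.continuous_pow 2).tendsto _).comp (hx.sub tendsto_const_nhds).enorm
    simpa using this

theorem L2Tendsto.integral_norm_sq (hF : L2Tendsto l F f) :
    Tendsto (fun i => ∫ x, ‖F i x‖ ^ 2) l (𝓝 (∫ x, ‖f x‖ ^ 2)) := by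
  have := hF.toLp.norm.pow 2
  simp_rw [norm_toLp_sq] at this
  exact this

theorem exists_L2Tendsto_of_cauchy {F : ℕ → E n → ℂ} (hF : ∀ k, MemLp (F k) 2)
    (h : Tendsto (fun p : ℕ × ℕ => sqNorm (fun x => F p.1 x - F p.2 x)) atTop (𝓝 0)) :
    ∃ f, L2Tendsto atTop F f := by
  have hc : CauchySeq (fun k => (hF k).toLp (F k)) := by
    rw [cauchySeq_iff_tendsto_dist_atTop_0]
    have h2 := tendsto_eLpNorm_iff.2 h
    have h3 := (ENNReal.tendsto_toReal ENNReal.zero_ne_top).comp h2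
    refine h3.congr fun p => ?_
    rw [dist_eq_norm, ← MemLp.toLp_sub, Lp.norm_toLp]
    rfl
  obtain ⟨g, hg⟩ := cauchySeq_tendsto_of_complete hc
  refine ⟨g, .of_toLp hF (Lp.memLp g) ?_⟩
  rwa [Lp.toLp_coeFn]

/-- Quasi-triangle inequality for `sqNorm` through an intermediate function. -/
theorem sqNorm_sub_le {f g h : E n → ℂ} (hf : MemLp f 2) (hg : MemLp g 2) :
    sqNorm (fun x => f x - h x) ≤ 2 * sqNorm (fun x => f x - g x)
      + 2 * sqNorm (fun x => g x - h x) := by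
  have := sqNorm_add_le (f := fun x => f x - g x) (g := fun x => g x - h x) (hf.1.sub hg.1)
  simpa using this

end

/-! ### Test functions -/

section
variable {n : ℕ}

theorem IsTestFunction.continuous {φ : E n → ℂ} (h : IsTestFunction φ) : Continuous φ :=
  h.1.continuous

theorem IsTestFunction.differentiable {φ : E n → ℂ} (h : IsTestFunction φ) :
    Differentiable ℝ φ :=
  h.1.differentiable (by simp)

theorem IsTestFunction.memLp {φ : E n → ℂ} (h : IsTestFunction φ) : MemLp φ 2 :=
  h.continuous.memLp_of_hasCompactSupport h.2

theorem IsTestFunction.add {φ ψ : E n → ℂ} (h : IsTestFunction φ) (h' : IsTestFunction ψ) :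
    IsTestFunction (fun x => φ x + ψ x) :=
  ⟨h.1.add h'.1, h.2.add h'.2⟩

theorem IsTestFunction.sub {φ ψ : E n → ℂ} (h : IsTestFunction φ) (h' : IsTestFunction ψ) :
    IsTestFunction (fun x => φ x - ψ x) :=
  ⟨h.1.sub h'.1, h.2.sub h'.2⟩

theorem IsTestFunction.smooth_mul {φ ψ : E n → ℂ} (hψ : ContDiff ℝ (⊤ : ℕ∞) ψ)
    (h : IsTestFunction φ) : IsTestFunction (fun x => ψ x * φ x) :=
  ⟨hψ.mul h.1, h.2.mul_left⟩

theorem IsTestFunction.const_mul {φ : E n → ℂ} (c : ℂ) (h : IsTestFunction φ) :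
    IsTestFunction (fun x => c * φ x) :=
  h.smooth_mul contDiff_const

theorem contDiff_conj : ContDiff ℝ (⊤ : ℕ∞) (fun z : ℂ => conj z) :=
  Complex.conjCLE.contDiff

theorem IsTestFunction.conj {φ : E n → ℂ} (h : IsTestFunction φ) :
    IsTestFunction (fun x => conj (φ x)) :=
  ⟨contDiff_conj.comp h.1, h.2.comp_left (by simp)⟩

theorem contDiff_partialDeriv {φ : E n → ℂ} (h : ContDiff ℝ (⊤ : ℕ∞) φ) (i : Fin n) :
    ContDiff ℝ (⊤ : ℕ∞) (partialDeriv i φ) :=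
  (h.fderiv_right (m := ((⊤ : ℕ∞) : WithTop ℕ∞)) (by simp)).clm_apply contDiff_const

theorem IsTestFunction.partialDeriv {φ : E n → ℂ} (h : IsTestFunction φ) (i : Fin n) :
    IsTestFunction (partialDeriv i φ) :=
  ⟨contDiff_partialDeriv h.1 i,
    h.2.fderiv_apply (𝕜 := ℝ) (EuclideanSpace.single i 1)⟩

theorem partialDeriv_mul {φ ψ : E n → ℂ} {x : E n} (i : Fin n) (hψ : DifferentiableAt ℝ ψ x)
    (hφ : DifferentiableAt ℝ φ x) :
    partialDeriv i (fun y => ψ y * φ y) x =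
      ψ x * partialDeriv i φ x + partialDeriv i ψ x * φ x := by
  unfold partialDeriv
  rw [fderiv_fun_mul hψ hφ]
  simp [mul_comm]

theorem partialDeriv_sub {φ ψ : E n → ℂ} {x : E n} (i : Fin n) (hφ : DifferentiableAt ℝ φ x)
    (hψ : DifferentiableAt ℝ ψ x) :
    partialDeriv i (fun y => φ y - ψ y) x = partialDeriv i φ x - partialDeriv i ψ x := by
  unfold partialDeriv
  rw [fderiv_fun_sub hφ hψ]
  rfl

theorem partialDeriv_add {φ ψ : E n → ℂ} {x : E n} (i : Fin n) (hφ : DifferentiableAt ℝ φ x)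
    (hψ : DifferentiableAt ℝ ψ x) :
    partialDeriv i (fun y => φ y + ψ y) x = partialDeriv i φ x + partialDeriv i ψ x := by
  unfold partialDeriv
  rw [fderiv_fun_add hφ hψ]
  rfl

theorem partialDeriv_const_mul {φ : E n → ℂ} {x : E n} (i : Fin n) (c : ℂ)
    (hφ : DifferentiableAt ℝ φ x) :
    partialDeriv i (fun y => c * φ y) x = c * partialDeriv i φ x := by
  rw [partialDeriv_mul i (by fun_prop) hφ]
  simp [partialDeriv]

theorem partialDeriv_conj {φ : E n → ℂ} {x : E n} (i : Fin n) (hφ : DifferentiableAt ℝ φ x) :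
    partialDeriv i (fun y => conj (φ y)) x = conj (partialDeriv i φ x) := by
  unfold partialDeriv
  have h := (Complex.conjCLE.hasFDerivAt (x := φ x)).comp x hφ.hasFDerivAt
  have h' : HasFDerivAt (fun y => conj (φ y))
      ((Complex.conjCLE : ℂ →L[ℝ] ℂ).comp (fderiv ℝ φ x)) x := h
  rw [h'.fderiv]
  simp

theorem fderiv_apply_eq_sum (φ : E n → ℂ) (x v : E n) :
    fderiv ℝ φ x v = ∑ i, (v i : ℂ) * partialDeriv i φ x := by
  have hv : v = ∑ i, v i • EuclideanSpace.single i (1 : ℝ) := by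
    ext j
    simp [Finset.sum_apply, Pi.single_apply]
  conv_lhs => rw [hv, map_sum]
  simp [partialDeriv]

theorem integral_partialDeriv_eq_zero {φ : E n → ℂ} (h : IsTestFunction φ) (i : Fin n) :
    ∫ x, partialDeriv i φ x = 0 := by
  -- Integration by parts against the constant function 1, whose derivative vanishes.
  have := integral_smul_fderiv_eq_neg_fderiv_smul_of_integrable (𝕜 := ℝ)
    (μ := (volume : Measure (E n)))
    (f := fun _ : E n => (1 : ℝ)) (g := φ) (v := EuclideanSpace.single i 1)
  simp only [fderiv_fun_const, Pi.zero_apply, zero_apply,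
    zero_smul, one_smul, integral_zero, neg_zero] at this
  exact this (integrable_zero _ _ _)
    ((h.partialDeriv i).continuous.integrable_of_hasCompactSupport (h.partialDeriv i).2)
    (h.continuous.integrable_of_hasCompactSupport h.2) (by fun_prop) fun x _ => h.differentiable x

/-- Integration by parts against a test function. -/
theorem integral_mul_partialDeriv {φ ψ : E n → ℂ} (hψ : ContDiff ℝ (⊤ : ℕ∞) ψ)
    (h : IsTestFunction φ) (i : Fin n) :
    ∫ x, ψ x * partialDeriv i φ x = -∫ x, partialDeriv i ψ x * φ x := by
  have h0 := integral_partialDeriv_eq_zero (h.smooth_mul hψ) i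
  have h1 : IsTestFunction (fun x => ψ x * partialDeriv i φ x) := (h.partialDeriv i).smooth_mul hψ
  have h2 : IsTestFunction (fun x => partialDeriv i ψ x * φ x) :=
    h.smooth_mul (contDiff_partialDeriv hψ i)
  have e : (fun x => partialDeriv i (fun y => ψ y * φ y) x)
      = fun x => ψ x * partialDeriv i φ x + partialDeriv i ψ x * φ x := by
    funext x
    exact partialDeriv_mul i (hψ.differentiable (by simp) x) (h.differentiable x)
  rw [e, integral_add (h1.continuous.integrable_of_hasCompactSupport h1.2)
    (h2.continuous.integrable_of_hasCompactSupport h2.2)] at h0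
  exact eq_neg_of_add_eq_zero_left h0

/-! ### The regularized radius -/

/-- `√(|x|² + η²)`. -/
def reg (η : ℝ) (x : E n) : ℝ := √(‖x‖ ^ 2 + η ^ 2)

theorem reg_pos {η : ℝ} (hη : 0 < η) (x : E n) : 0 < reg η x := Real.sqrt_pos.2 (by positivity)

theorem reg_sq (η : ℝ) (x : E n) : reg η x ^ 2 = ‖x‖ ^ 2 + η ^ 2 := Real.sq_sqrt (by positivity)

theorem norm_le_reg (η : ℝ) (x : E n) : ‖x‖ ≤ reg η x :=
  Real.le_sqrt_of_sq_le (by nlinarith [sq_nonneg η])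

theorem le_reg (η : ℝ) (x : E n) : η ≤ reg η x :=
  Real.le_sqrt_of_sq_le (by nlinarith [sq_nonneg ‖x‖])

/-- The purpose of the regularization: for η > 0 a smooth function of `reg η` is smooth through the
origin, so multiplication by it preserves test functions. -/
theorem contDiff_reg {η : ℝ} (hη : 0 < η) : ContDiff ℝ (⊤ : ℕ∞) (reg η : E n → ℝ) :=
  ((contDiff_norm_sq ℝ).add contDiff_const).sqrt fun x => by positivity

theorem continuous_reg (η : ℝ) : Continuous (reg η : E n → ℝ) := by
  unfold reg; fun_prop

theorem hasFDerivAt_reg {η : ℝ} (hη : 0 < η) (x : E n) :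
    HasFDerivAt (reg η) ((reg η x)⁻¹ • innerSL ℝ x) x := by
  have h : HasFDerivAt (fun y : E n => ‖y‖ ^ 2 + η ^ 2) (2 • innerSL ℝ x) x :=
    (hasStrictFDerivAt_norm_sq x).hasFDerivAt.add_const _
  have h2 := h.sqrt (by positivity)
  refine h2.congr_fderiv ?_
  ext v
  simp [reg]
  field_simp

theorem contDiff_comp_reg {η : ℝ} (hη : 0 < η) {f : ℝ → ℂ}
    (hf : ContDiffOn ℝ (⊤ : ℕ∞) f (Set.Ioi 0)) :
    ContDiff ℝ (⊤ : ℕ∞) (fun x : E n => f (reg η x)) :=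
  hf.comp_contDiff (contDiff_reg hη) fun x => reg_pos hη x

theorem partialDeriv_comp_reg {η : ℝ} (hη : 0 < η) {f : ℝ → ℂ} {f' : ℂ} {x : E n}
    (hf : HasDerivAt f f' (reg η x)) (i : Fin n) :
    partialDeriv i (fun y => f (reg η y)) x = f' * ((x i / reg η x : ℝ) : ℂ) := by
  unfold partialDeriv
  have := hf.hasFDerivAt.comp x (hasFDerivAt_reg hη x)
  have h2 : HasFDerivAt (fun y : E n => f (reg η y)) _ x := this
  rw [h2.fderiv]
  simp [EuclideanSpace.inner_single_right]
  ring

theorem abs_coord_div_reg_le {η : ℝ} (hη : 0 < η) (x : E n) (i : Fin n) :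
    ‖((x i / reg η x : ℝ) : ℂ)‖ ≤ 1 := by
  rw [Complex.norm_real, norm_div, Real.norm_of_nonneg (reg_pos hη x).le,
    div_le_one (reg_pos hη x)]
  exact (PiLp.norm_apply_le x i).trans (norm_le_reg η x)

/-! ### The Sobolev space `H¹` -/

/-- `u` belongs to `H¹(ℝⁿ)` and its gradient is `G`: the pair is an `L²` limit of test functions
and their gradients. -/
def IsH1 (u : E n → ℂ) (G : Fin n → E n → ℂ) : Prop :=
  ∃ φ : ℕ → E n → ℂ, (∀ k, IsTestFunction (φ k)) ∧ L2Tendsto atTop φ u ∧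
    ∀ i, L2Tendsto atTop (fun k => partialDeriv i (φ k)) (G i)

variable {u w : E n → ℂ} {G K : Fin n → E n → ℂ}

theorem IsH1.memLp (h : IsH1 u G) : MemLp u 2 := h.choose_spec.2.1.lim

theorem IsH1.memLp_grad (h : IsH1 u G) (i : Fin n) : MemLp (G i) 2 :=
  (h.choose_spec.2.2 i).lim

theorem IsTestFunction.isH1 {φ : E n → ℂ} (h : IsTestFunction φ) :
    IsH1 φ (fun i => WeightedResolvent.partialDeriv i φ) :=
  ⟨fun _ => φ, fun _ => h, .const _ h.memLp, fun i => .const _ (h.partialDeriv i).memLp⟩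

theorem IsH1.congr (h : IsH1 u G) (hu : u =ᵐ[volume] w) (hG : ∀ i, G i =ᵐ[volume] K i) :
    IsH1 w K := by
  obtain ⟨φ, h1, h2, h3⟩ := h
  exact ⟨φ, h1, h2.congr' (fun _ => ae_eq_rfl) hu, fun i =>
    (h3 i).congr' (fun _ => ae_eq_rfl) (hG i)⟩

theorem IsH1.sub (h : IsH1 u G) (h' : IsH1 w K) :
    IsH1 (fun x => u x - w x) (fun i x => G i x - K i x) := by
  obtain ⟨φ, h1, h2, h3⟩ := h
  obtain ⟨ψ, h1', h2', h3'⟩ := h'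
  refine ⟨fun k x => φ k x - ψ k x, fun k => (h1 k).sub (h1' k), h2.sub h2', fun i => ?_⟩
  have e : ∀ k, partialDeriv i (fun x => φ k x - ψ k x)
      = fun x => partialDeriv i (φ k) x - partialDeriv i (ψ k) x := fun k => by
    funext x
    exact partialDeriv_sub i ((h1 k).differentiable x) ((h1' k).differentiable x)
  simp_rw [e]
  exact (h3 i).sub (h3' i)

/-- `H¹` is closed. -/
theorem IsH1.of_tendsto {U : ℕ → E n → ℂ} {D : ℕ → Fin n → E n → ℂ}
    (h : ∀ k, IsH1 (U k) (D k)) (hU : L2Tendsto atTop U u)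
    (hD : ∀ i, L2Tendsto atTop (fun k => D k i) (G i)) : IsH1 u G := by
  -- Diagonal choice: the k-th test function approximates `U k` and its gradient within 1/(k+1) in
  -- squared norm.
  have key : ∀ k : ℕ, ∃ φ : E n → ℂ, IsTestFunction φ ∧
      sqNorm (fun x => φ x - U k x) < ((k : ℝ≥0∞) + 1)⁻¹ ∧
      ∀ i, sqNorm (fun x => partialDeriv i φ x - D k i x) < ((k : ℝ≥0∞) + 1)⁻¹ := by
    intro k
    obtain ⟨φ, h1, h2, h3⟩ := h k
    have hpos : (0 : ℝ≥0∞) < ((k : ℝ≥0∞) + 1)⁻¹ := by simp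
    have e1 := h2.tendsto.eventually_lt_const hpos
    have e2 := eventually_all.2 fun i => (h3 i).tendsto.eventually_lt_const hpos
    obtain ⟨j, hj1, hj2⟩ := (e1.and e2).exists
    exact ⟨φ j, h1 j, hj1, hj2⟩
  choose φ h1 h2 h3 using key
  have hz : Tendsto (fun k : ℕ => 2 * ((k : ℝ≥0∞) + 1)⁻¹) atTop (𝓝 0) := by
    have := (ENNReal.tendsto_inv_nat_nhds_zero).comp (tendsto_add_atTop_nat 1)
    have := ENNReal.Tendsto.const_mul (a := 2) this (Or.inr (by norm_num))
    simpa [Function.comp_def] using this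
  refine ⟨φ, h1, ⟨fun k => (h1 k).memLp, hU.lim, ?_⟩,
    fun i => ⟨fun k => ((h1 k).partialDeriv i).memLp, (hD i).lim, ?_⟩⟩
  · have := hz.add (ENNReal.Tendsto.const_mul (a := 2) hU.tendsto (Or.inr (by norm_num)))
    simp only [mul_zero, add_zero] at this
    refine tendsto_of_tendsto_of_tendsto_of_le_of_le tendsto_const_nhds this
      (fun _ => zero_le) fun k => ?_
    refine (sqNorm_sub_le (h1 k).memLp (hU.mem k)).trans ?_
    have := (h2 k).le
    gcongr
  · have := hz.add (ENNReal.Tendsto.const_mul (a := 2) (hD i).tendsto (Or.inr (by norm_num)))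
    simp only [mul_zero, add_zero] at this
    refine tendsto_of_tendsto_of_tendsto_of_le_of_le tendsto_const_nhds this
      (fun _ => zero_le) fun k => ?_
    refine (sqNorm_sub_le ((h1 k).partialDeriv i).memLp ((hD i).mem k)).trans ?_
    have := (h3 k i).le
    gcongr

theorem IsH1.smooth_mul (h : IsH1 u G) {ψ : E n → ℂ} (hψ : ContDiff ℝ (⊤ : ℕ∞) ψ) {C : ℝ}
    (hC : ∀ x, ‖ψ x‖ ≤ C) (hC' : ∀ i x, ‖partialDeriv i ψ x‖ ≤ C) :
    IsH1 (fun x => ψ x * u x) (fun i x => ψ x * G i x + partialDeriv i ψ x * u x) := by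
  obtain ⟨φ, h1, h2, h3⟩ := h
  refine ⟨fun k x => ψ x * φ k x, fun k => (h1 k).smooth_mul hψ,
    h2.mul_bdd hψ.continuous.aestronglyMeasurable hC, fun i => ?_⟩
  have e : ∀ k, partialDeriv i (fun x => ψ x * φ k x)
      = fun x => ψ x * partialDeriv i (φ k) x + partialDeriv i ψ x * φ k x := fun k => by
    funext x
    exact partialDeriv_mul i (hψ.differentiable (by simp) x) ((h1 k).differentiable x)
  simp_rw [e]
  exact ((h3 i).mul_bdd hψ.continuous.aestronglyMeasurable hC).add
    (h2.mul_bdd (contDiff_partialDeriv hψ i).continuous.aestronglyMeasurable (hC' i))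

/-- Multiplication of an `H¹` function by a bounded radial function with bounded derivative. -/
theorem IsH1.radial_mul (h : IsH1 u G) {η : ℝ} (hη : 0 < η) {f f' : ℝ → ℂ}
    (hf : ContDiffOn ℝ (⊤ : ℕ∞) f (Set.Ioi 0)) (hf' : ∀ s, 0 < s → HasDerivAt f (f' s) s) {C : ℝ}
    (hC : ∀ s, η ≤ s → ‖f s‖ ≤ C) (hC' : ∀ s, η ≤ s → ‖f' s‖ ≤ C) :
    IsH1 (fun x => f (reg η x) * u x)
      (fun i x => f (reg η x) * G i x + f' (reg η x) * ((x i / reg η x : ℝ) : ℂ) * u x) := by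
  have e : ∀ i x, partialDeriv i (fun y : E n => f (reg η y)) x
      = f' (reg η x) * ((x i / reg η x : ℝ) : ℂ) := fun i x =>
    partialDeriv_comp_reg hη (hf' _ (reg_pos hη x)) i
  have := h.smooth_mul (contDiff_comp_reg hη hf) (C := C) (fun x => hC _ (le_reg η x)) (fun i x => ?_)
  · simp_rw [e] at this
    exact this
  · rw [e, norm_mul]
    calc _ ≤ C * 1 := mul_le_mul (hC' _ (le_reg η x)) (abs_coord_div_reg_le hη x i)
          (norm_nonneg _) ((norm_nonneg _).trans (hC' _ (le_reg η x)))
      _ = C := mul_one C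

/-- Multiplication of a weighted `H¹` function by a radial function of linear growth. -/
theorem IsH1.radial_mul_of_weighted (h : IsH1 u G) {η : ℝ} (hη : 0 < η)
    (hu : MemLp (fun x => ((reg η x : ℝ) : ℂ) * u x) 2)
    (hG : ∀ i, MemLp (fun x => ((reg η x : ℝ) : ℂ) * G i x) 2) {f f' : ℝ → ℂ}
    (hf : ContDiffOn ℝ (⊤ : ℕ∞) f (Set.Ioi 0)) (hf' : ∀ s, 0 < s → HasDerivAt f (f' s) s) {C : ℝ}
    (hC : ∀ s, η ≤ s → ‖f s‖ ≤ C * s) (hC' : ∀ s, η ≤ s → ‖f' s‖ ≤ C * s) :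
    IsH1 (fun x => f (reg η x) * u x)
      (fun i x => f (reg η x) * G i x + f' (reg η x) * ((x i / reg η x : ℝ) : ℂ) * u x) := by
  have hC0 : 0 ≤ C := by
    have := (norm_nonneg _).trans (hC η le_rfl)
    by_contra hc
    nlinarith
  have hfc : Continuous (fun x : E n => f (reg η x)) := (contDiff_comp_reg hη hf).continuous
  have hm := continuous_reg (n := n) η
  have hderiv : ∀ s, 0 < s → deriv f s = f' s := fun s hs => (hf' s hs).deriv
  have hf'c : Continuous (fun x : E n => f' (reg η x)) := by
    have h1 : ContinuousOn (deriv f) (Set.Ioi 0) :=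
      hf.continuousOn_deriv_of_isOpen isOpen_Ioi (by simp)
    have h2 := h1.comp_continuous hm fun x => reg_pos hη x
    refine h2.congr fun x => hderiv _ (reg_pos hη x)
  have hcoord : ∀ i : Fin n, Continuous (fun x : E n => ((x i / reg η x : ℝ) : ℂ)) := fun i => by
    refine Complex.continuous_ofReal.comp (Continuous.div (by fun_prop) hm fun x => ?_)
    exact (reg_pos hη x).ne'
  -- Damping: f(s)/(1 + a_k s) is bounded with bounded derivative on s ≥ η, so the bounded case
  -- applies for each k. As a_k → 0 the products converge by domination with multiples of m|u| and
  -- m|Gᵢ|, and H¹ is closed.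
  set a : ℕ → ℝ := fun k => ((k : ℝ) + 1)⁻¹ with ha
  have hapos : ∀ k, 0 < a k := fun k => by positivity
  have hale : ∀ k, a k ≤ 1 := fun k => inv_le_one_of_one_le₀ (by simp)
  have ha0 : Tendsto a atTop (𝓝 0) := tendsto_inv_atTop_zero.comp
    (tendsto_atTop_add_const_right _ _ tendsto_natCast_atTop_atTop)
  set g : ℕ → ℝ → ℂ := fun k s => f s * ((1 + a k * s : ℝ) : ℂ)⁻¹ with hg
  set g' : ℕ → ℝ → ℂ := fun k s => f' s * ((1 + a k * s : ℝ) : ℂ)⁻¹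
    + f s * (-((a k : ℝ) : ℂ) / ((1 + a k * s : ℝ) : ℂ) ^ 2) with hg'
  have hne : ∀ k s, 0 < s → ((1 + a k * s : ℝ) : ℂ) ≠ 0 := fun k s hs => by
    rw [Complex.ofReal_ne_zero]
    have := mul_pos (hapos k) hs
    positivity
  have hden : ∀ k s, 0 < s → 1 ≤ 1 + a k * s := fun k s hs => by
    have := mul_pos (hapos k) hs
    linarith
  have hgd : ∀ k s, 0 < s → HasDerivAt (g k) (g' k s) s := fun k s hs => by
    have h1 : HasDerivAt (fun s : ℝ => ((1 + a k * s : ℝ) : ℂ)) ((a k : ℝ) : ℂ) s := by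
      have : HasDerivAt (fun s : ℝ => 1 + a k * s) (a k) s := by
        simpa using ((hasDerivAt_id s).const_mul (a k)).const_add 1
      exact this.ofReal_comp
    exact (hf' s hs).mul (h1.fun_inv (hne k s hs))
  have hginv : ∀ k s, 0 < s → ‖((1 + a k * s : ℝ) : ℂ)⁻¹‖ = (1 + a k * s)⁻¹ := fun k s hs => by
    rw [norm_inv, Complex.norm_real, Real.norm_of_nonneg (by linarith [hden k s hs])]
  have hgC : ∀ k s, η ≤ s → ‖g k s‖ ≤ C * s * (1 + a k * s)⁻¹ := fun k s hs => by
    have hs0 : 0 < s := hη.trans_le hs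
    rw [hg, norm_mul, hginv k s hs0]
    have := hden k s hs0
    gcongr
    exact hC s hs
  have hg'C : ∀ k s, η ≤ s → ‖g' k s‖ ≤ C * s * (1 + a k * s)⁻¹ + C * s * (a k / (1 + a k * s) ^ 2) :=
    fun k s hs => by
    have hs0 : 0 < s := hη.trans_le hs
    have h1 := hden k s hs0
    refine (norm_add_le _ _).trans ?_
    rw [norm_mul, norm_mul, hginv k s hs0, norm_div, norm_neg, norm_pow, Complex.norm_real,
      Complex.norm_real, Real.norm_of_nonneg (hapos k).le, Real.norm_of_nonneg (by linarith)]
    have := hC s hs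
    have := hC' s hs
    have := hapos k
    gcongr
  have hsle : ∀ k s, 0 < s → s * (1 + a k * s)⁻¹ ≤ (a k)⁻¹ := fun k s hs => by
    have := hden k s hs
    have := hapos k
    rw [← div_eq_mul_inv, div_le_iff₀ (by linarith)]
    field_simp
    linarith
  have hsle2 : ∀ k s, 0 < s → s * (a k / (1 + a k * s) ^ 2) ≤ 1 := fun k s hs => by
    have := hden k s hs
    have := hapos k
    rw [← mul_div_assoc, div_le_one (by positivity)]
    nlinarith
  have hstep : ∀ k, IsH1 (fun x => g k (reg η x) * u x)
      (fun i x => g k (reg η x) * G i x + g' k (reg η x) * ((x i / reg η x : ℝ) : ℂ) * u x) := by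
    intro k
    refine h.radial_mul hη ?_ (hgd k) (C := C * (a k)⁻¹ + C) ?_ ?_
    · refine hf.mul (ContDiffOn.inv ?_ fun s hs => hne k s hs)
      exact (Complex.ofRealCLM.contDiff.comp
        (contDiff_const.add (contDiff_const.mul contDiff_id))).contDiffOn
    · intro s hs
      have := hsle k s (hη.trans_le hs)
      have h2 := hgC k s hs
      rw [mul_assoc] at h2
      nlinarith [mul_le_mul_of_nonneg_left this hC0]
    · intro s hs
      have h1 := hsle k s (hη.trans_le hs)
      have h2 := hsle2 k s (hη.trans_le hs)
      have h3 := hg'C k s hs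
      rw [mul_assoc, mul_assoc] at h3
      nlinarith [mul_le_mul_of_nonneg_left h1 hC0, mul_le_mul_of_nonneg_left h2 hC0]
  have hlim1 : ∀ s, 0 < s → Tendsto (fun k => ((1 + a k * s : ℝ) : ℂ)⁻¹) atTop (𝓝 1) := by
    intro s hs
    have h1 : Tendsto (fun k => 1 + a k * s) atTop (𝓝 (1 + 0 * s)) :=
      tendsto_const_nhds.add (ha0.mul_const s)
    have h2 := ((Complex.continuous_ofReal.tendsto _).comp h1).inv₀ (by simp)
    simpa [Function.comp_def] using h2
  have hgle : ∀ k s, η ≤ s → ‖g k s‖ ≤ C * s := fun k s hs => by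
    have hs0 : 0 < s := hη.trans_le hs
    refine (hgC k s hs).trans (mul_le_of_le_one_right (by positivity) ?_)
    exact inv_le_one_of_one_le₀ (hden k s hs0)
  have hg'le : ∀ k s, η ≤ s → ‖g' k s‖ ≤ 2 * C * s := fun k s hs => by
    have hs0 : 0 < s := hη.trans_le hs
    have h1 : C * s * (1 + a k * s)⁻¹ ≤ C * s :=
      mul_le_of_le_one_right (by positivity) (inv_le_one_of_one_le₀ (hden k s hs0))
    have h2 : C * s * (a k / (1 + a k * s) ^ 2) ≤ C * s := by
      refine mul_le_of_le_one_right (by positivity) ?_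
      have := hden k s hs0
      rw [div_le_one (by positivity)]
      nlinarith [hale k]
    linarith [hg'C k s hs]
  refine IsH1.of_tendsto hstep ?_ fun i => ?_
  · refine L2Tendsto.of_dominated (b := fun x => C * ‖((reg η x : ℝ) : ℂ) * u x‖)
      (fun k => (hstep k).memLp.1) (hfc.aestronglyMeasurable.mul h.memLp.1)
      (hu.norm.const_mul C) (fun k => ae_of_all _ fun x => ?_) (ae_of_all _ fun x => ?_)
      (ae_of_all _ fun x => ?_)
    · rw [norm_mul, norm_mul _ (u x), Complex.norm_real (reg η x),
        Real.norm_of_nonneg (reg_pos hη x).le, ← mul_assoc]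
      have := hgle k _ (le_reg η x)
      gcongr
    · rw [norm_mul, norm_mul _ (u x), Complex.norm_real (reg η x),
        Real.norm_of_nonneg (reg_pos hη x).le, ← mul_assoc]
      have := hC _ (le_reg η x)
      gcongr
    · have := (hlim1 _ (reg_pos hη x)).const_mul (f (reg η x))
      simpa only [mul_one] using this.mul_const (u x)
  · refine L2Tendsto.of_dominated
      (b := fun x => C * ‖((reg η x : ℝ) : ℂ) * G i x‖ + 2 * C * ‖((reg η x : ℝ) : ℂ) * u x‖)
      (fun k => ((hstep k).memLp_grad i).1)
      ((hfc.aestronglyMeasurable.mul (h.memLp_grad i).1).add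
        ((hf'c.mul (hcoord i)).aestronglyMeasurable.mul h.memLp.1))
      (((hG i).norm.const_mul C).add (hu.norm.const_mul (2 * C)))
      (fun k => ae_of_all _ fun x => ?_) (ae_of_all _ fun x => ?_) (ae_of_all _ fun x => ?_)
    · refine (norm_add_le _ _).trans ?_
      simp only [norm_mul, Complex.norm_real, Real.norm_of_nonneg (reg_pos hη x).le]
      have h1 := hgle k _ (le_reg η x)
      have h2 := hg'le k _ (le_reg η x)
      have h3 := abs_coord_div_reg_le hη x i
      rw [Complex.norm_real] at h3
      have h4 : ‖g' k (reg η x)‖ * ‖x i / reg η x‖ ≤ 2 * C * reg η x :=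
        (mul_le_of_le_one_right (norm_nonneg _) h3).trans h2
      rw [← mul_assoc, ← mul_assoc]
      gcongr
    · refine (norm_add_le _ _).trans ?_
      simp only [norm_mul, Complex.norm_real, Real.norm_of_nonneg (reg_pos hη x).le]
      have h1 := hC _ (le_reg η x)
      have h2 := hC' _ (le_reg η x)
      have h3 := abs_coord_div_reg_le hη x i
      rw [Complex.norm_real] at h3
      have h4 : ‖f' (reg η x)‖ * ‖x i / reg η x‖ ≤ 2 * C * reg η x :=
        (mul_le_of_le_one_right (norm_nonneg _) h3).trans (by nlinarith [mul_nonneg hC0 (reg_pos hη x).le])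
      rw [← mul_assoc, ← mul_assoc]
      gcongr
    · have h1 := hlim1 _ (reg_pos hη x)
      have h2 : Tendsto (fun k => -((a k : ℝ) : ℂ) / ((1 + a k * reg η x : ℝ) : ℂ) ^ 2) atTop (𝓝 0) := by
        have h3 := ((Complex.continuous_ofReal.tendsto _).comp ha0).neg.mul (h1.pow 2)
        simp only [Complex.ofReal_zero, neg_zero, zero_mul] at h3
        refine h3.congr fun k => ?_
        simp [div_eq_mul_inv]
      have h4 : Tendsto (fun k => g' k (reg η x)) atTop (𝓝 (f' (reg η x))) := by
        simpa only [mul_one, mul_zero, add_zero] using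
          (h1.const_mul (f' (reg η x))).add (h2.const_mul (f (reg η x)))
      have h5 : Tendsto (fun k => g k (reg η x)) atTop (𝓝 (f (reg η x))) := by
        simpa only [mul_one] using h1.const_mul (f (reg η x))
      exact (h5.mul_const _).add ((h4.mul_const _).mul_const _)

/-- The weak gradient of an `H¹` function. -/
theorem IsH1.integral_mul_partialDeriv (h : IsH1 u G) {ψ : E n → ℂ} (hψ : IsTestFunction ψ)
    (i : Fin n) : pairing u (partialDeriv i ψ) = -pairing (G i) ψ := by
  obtain ⟨φ, h1, h2, h3⟩ := h
  have e1 := h2.pairing (.const atTop (hψ.partialDeriv i).memLp)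
  have e2 := ((h3 i).pairing (.const atTop hψ.memLp)).neg
  refine tendsto_nhds_unique e1 (e2.congr fun k => ?_)
  unfold pairing
  have := WeightedResolvent.integral_mul_partialDeriv (h1 k).1 hψ.conj i
  simp_rw [partialDeriv_conj i (hψ.differentiable _)] at this
  rw [this]

end

/-! ### Self-adjoint operators with bounded positive inverse -/

section
variable {H : Type*} [NormedAddCommGroup H] [InnerProductSpace ℂ H]

/-- The graph `{(u, g) | u = S (u + g)}` of the operator `S⁻¹ - 1`. -/
def inverseSubOneGraph (S : H →L[ℂ] H) : Submodule ℂ (H × H) where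
  carrier := {p | p.1 = S (p.1 + p.2)}
  zero_mem' := by simp
  add_mem' := by
    intro a b ha hb
    simp only [Set.mem_ofPred_eq, Prod.fst_add, Prod.snd_add, map_add] at *
    conv_lhs => rw [ha, hb]
    abel
  smul_mem' := by
    intro c a ha
    simp only [Set.mem_ofPred_eq, Prod.smul_fst, Prod.smul_snd, map_add, map_smul] at *
    conv_lhs => rw [ha, smul_add]

theorem mem_inverseSubOneGraph {S : H →L[ℂ] H} {p : H × H} :
    p ∈ inverseSubOneGraph S ↔ p.1 = S (p.1 + p.2) := Iff.rfl

theorem mk_mem_inverseSubOneGraph (S : H →L[ℂ] H) (h : H) :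
    (S h, h - S h) ∈ inverseSubOneGraph S := by
  simp [mem_inverseSubOneGraph]

/-- The operator `S⁻¹ - 1`. -/
def inverseSubOne (S : H →L[ℂ] H) : H →ₗ.[ℂ] H := (inverseSubOneGraph S).toLinearPMap

theorem graph_inverseSubOne {S : H →L[ℂ] H} (hinj : Function.Injective S) :
    (inverseSubOne S).graph = inverseSubOneGraph S := by
  refine Submodule.toLinearPMap_graph_eq _ fun x hx hx0 => ?_
  rw [mem_inverseSubOneGraph, hx0, zero_add] at hx
  exact hinj (by rw [← hx, map_zero])

variable [CompleteSpace H]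

/-- The domain contains the range of S. A vector v orthogonal to that range satisfies ‖Sv‖² =
⟨S(Sv), v⟩ = 0, hence v = 0. -/
theorem dense_domain_inverseSubOne {S : H →L[ℂ] H} (hS : IsSelfAdjoint S)
    (hinj : Function.Injective S) : Dense ((inverseSubOne S).domain : Set H) := by
  rw [Submodule.dense_iff_topologicalClosure_eq_top, Submodule.topologicalClosure_eq_top_iff,
    Submodule.eq_bot_iff]
  intro v hv
  rw [Submodule.mem_orthogonal] at hv
  have h1 : S v ∈ (inverseSubOne S).domain := by
    have := mk_mem_inverseSubOneGraph S v
    rw [← graph_inverseSubOne hinj] at this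
    exact LinearPMap.mem_domain_of_mem_graph this
  have h2 : ∀ w, inner ℂ (S w) v = (0 : ℂ) := fun w => by
    have := mk_mem_inverseSubOneGraph S w
    rw [← graph_inverseSubOne hinj] at this
    exact hv _ (LinearPMap.mem_domain_of_mem_graph this)
  have hsym := hS.isSymmetric
  have h3 : S v = 0 := by
    rw [← inner_self_eq_zero (𝕜 := ℂ)]
    have := h2 (S v)
    rwa [show inner ℂ (S (S v)) v = inner ℂ (S v) (S v) from hsym _ _] at this
  exact hinj (by rw [h3, map_zero])

/-- The adjoint graph is computed by pairing with the graph elements (Sw, w - Sw): moving S across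
the inner product leaves exactly the condition p.1 = S(p.1 + p.2). -/
theorem isSelfAdjoint_inverseSubOne {S : H →L[ℂ] H} (hS : IsSelfAdjoint S)
    (hinj : Function.Injective S) : IsSelfAdjoint (inverseSubOne S) := by
  have hd := dense_domain_inverseSubOne hS hinj
  have hsym := hS.isSymmetric
  rw [LinearPMap.isSelfAdjoint_def]
  refine LinearPMap.eq_of_eq_graph ?_
  rw [LinearPMap.adjoint_graph_eq_graph_adjoint hd, graph_inverseSubOne hinj]
  ext p
  rw [Submodule.mem_adjoint_iff, mem_inverseSubOneGraph]
  have hs : ∀ a b, inner ℂ (S a) b = inner ℂ a (S b) := fun a b => hsym a b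
  constructor
  · intro h
    have h1 : ∀ w, inner ℂ w (p.1 - S (p.1 + p.2)) = (0 : ℂ) := by
      intro w
      have := h _ _ (mk_mem_inverseSubOneGraph S w)
      rw [inner_sub_left, hs, hs] at this
      rw [map_add, inner_sub_right, inner_add_right, ← sub_sub]
      exact this
    have := h1 (p.1 - S (p.1 + p.2))
    rw [inner_self_eq_zero] at this
    exact sub_eq_zero.1 this
  · intro hp a b hab
    rw [mem_inverseSubOneGraph] at hab
    simp only at hab
    -- Both ⟨b, p.1⟩ and ⟨a, p.2⟩ contain ⟨Sb, p.2⟩ or ⟨Sa, p.2⟩. The two ways of expanding ⟨a, p.1⟩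
    -- supply the missing relation between them.
    have e1 : inner ℂ b p.1 = inner ℂ (S b) p.1 + (inner ℂ (S b) p.2 : ℂ) := by
      conv_lhs => rw [hp]
      rw [← hs, inner_add_right]
    have e2 : inner ℂ a p.2 = inner ℂ (S a) p.2 + (inner ℂ (S b) p.2 : ℂ) := by
      conv_lhs => rw [hab]
      rw [map_add, inner_add_left]
    have e3 : inner ℂ a p.1 = inner ℂ (S a) p.1 + (inner ℂ (S b) p.1 : ℂ) := by
      conv_lhs => rw [hab]
      rw [map_add, inner_add_left]
    have e4 : inner ℂ a p.1 = inner ℂ (S a) p.1 + (inner ℂ (S a) p.2 : ℂ) := by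
      conv_lhs => rw [hp]
      rw [← hs, inner_add_right]
    rw [e1, e2]
    linear_combination e4 - e3

/-- Since 0 ≤ S ≤ 1, the spectrum of S lies in [0,1], and t ↦ t⁻¹ - 1 maps (0,1] into [0,∞). Hence
(1+z)⁻¹ is not in the spectrum when z is off the half-line. The value z = -1 is trivial. -/
theorem exists_inverse_one_sub_smul {S : H →L[ℂ] H} (hS : S.IsPositive) (hS1 : (1 - S).IsPositive)
    {z : ℂ} (hz : ¬ ∃ t : ℝ, 0 ≤ t ∧ z = (t : ℂ)) :
    ∃ B : H →L[ℂ] H, (1 - (1 + z) • S) * B = 1 ∧ B * (1 - (1 + z) • S) = 1 := by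
  rcases eq_or_ne (1 + z) 0 with h0 | h0
  · exact ⟨1, by simp [h0], by simp [h0]⟩
  have hu : IsUnit (algebraMap ℂ (H →L[ℂ] H) (1 + z)⁻¹ - S) := by
    by_contra hc
    have hmem : (1 + z)⁻¹ ∈ spectrum ℂ S := hc
    have hsa : IsSelfAdjoint S := hS.isSelfAdjoint
    have hre := hsa.mem_spectrum_eq_re hmem
    set t : ℝ := ((1 + z)⁻¹).re with ht
    rw [hre] at hmem
    have h1 : t ∈ spectrum ℝ S := (spectrum.algebraMap_mem_iff ℂ (r := t)).1 hmem
    have h2 : 0 ≤ t := spectrum_nonneg_of_nonneg ((ContinuousLinearMap.nonneg_iff_isPositive S).2 hS) h1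
    have h3 : 1 - t ∈ spectrum ℝ (1 - S) := by
      have := spectrum.sub_singleton_eq (R := ℝ) S 1
      have h5 := spectrum.singleton_sub_eq (R := ℝ) S 1
      rw [map_one] at h5
      rw [← h5]
      exact Set.sub_mem_sub rfl h1
    have h4 : 0 ≤ 1 - t :=
      spectrum_nonneg_of_nonneg ((ContinuousLinearMap.nonneg_iff_isPositive (1 - S)).2 hS1) h3
    have hz' : (1 + z) = ((t⁻¹ : ℝ) : ℂ) := by
      rw [Complex.ofReal_inv, ← hre, inv_inv]
    have ht0 : t ≠ 0 := by
      intro h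
      rw [h] at hz'
      exact h0 (by simpa using hz')
    refine hz ⟨t⁻¹ - 1, ?_, ?_⟩
    · have : 0 < t := lt_of_le_of_ne h2 (Ne.symm ht0)
      rw [sub_nonneg]
      exact (one_le_inv₀ this).2 (by linarith)
    · push_cast
      rw [← Complex.ofReal_inv, ← hz']
      ring
  have hu' : IsUnit (1 - (1 + z) • S) := by
    have h1 : (1 - (1 + z) • S) = (1 + z) • (algebraMap ℂ (H →L[ℂ] H) (1 + z)⁻¹ - S) := by
      rw [smul_sub, Algebra.algebraMap_eq_smul_one, smul_smul, mul_inv_cancel₀ h0, one_smul]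
    rw [h1]
    exact (isUnit_smul_iff (Units.mk0 _ h0) _).2 hu
  obtain ⟨b, hb⟩ := hu'
  exact ⟨↑b⁻¹, by rw [← hb]; simp, by rw [← hb]; simp⟩

/-- Formally (S⁻¹ - 1 - z)⁻¹ = S(1 - (1+z)S)⁻¹. -/
theorem exists_resolvent_inverseSubOne {S : H →L[ℂ] H} (hS : S.IsPositive)
    (hS1 : (1 - S).IsPositive) (hinj : Function.Injective S)
    {z : ℂ} (hz : ¬ ∃ t : ℝ, 0 ≤ t ∧ z = (t : ℂ)) :
    ∃ R : H →L[ℂ] H,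
      (∀ f : H, ∃ hf : R f ∈ (inverseSubOne S).domain, inverseSubOne S ⟨R f, hf⟩ - z • R f = f) ∧
      ∀ u : (inverseSubOne S).domain, R (inverseSubOne S u - z • (u : H)) = u := by
  obtain ⟨B, hB1, hB2⟩ := exists_inverse_one_sub_smul hS hS1 hz
  have hB1' : ∀ f, B f - (1 + z) • S (B f) = f := fun f => by
    have := congrArg (fun T : H →L[ℂ] H => T f) hB1
    simpa using this
  have hB2' : ∀ f, B (f - (1 + z) • S f) = f := fun f => by
    have := congrArg (fun T : H →L[ℂ] H => T f) hB2
    simpa using this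
  refine ⟨S ∘L B, fun f => ?_, fun u => ?_⟩
  · have h1 := mk_mem_inverseSubOneGraph S (B f)
    rw [← graph_inverseSubOne hinj] at h1
    have hd := LinearPMap.mem_domain_of_mem_graph h1
    refine ⟨hd, ?_⟩
    have h2 := (LinearPMap.image_iff hd).2 h1
    simp only [ContinuousLinearMap.comp_apply]
    rw [← h2]
    conv_rhs => rw [← hB1' f]
    rw [add_smul, one_smul]
    abel
  · have h1 := (inverseSubOne S).mem_graph u
    rw [graph_inverseSubOne hinj, mem_inverseSubOneGraph] at h1
    simp only at h1
    set g := inverseSubOne S u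
    have h2 : g - z • (u : H) = ((u : H) + g) - (1 + z) • S ((u : H) + g) := by
      rw [← h1, add_smul, one_smul]
      abel
    rw [ContinuousLinearMap.comp_apply, h2, hB2', ← h1]

end

/-! ### The operator of a closable form -/

/-- Here T carries the inner product q + ⟨J·, J·⟩, so the form itself is the difference of inner
products that appears in the conclusion. Complete T and extend J to K. Then S = K K* plays the role
of (1 + H)⁻¹, because ⟨w, K*h⟩ = ⟨Kw, h⟩ says that KK*h solves the form equation with right-hand
side h. The last clause keeps an approximating sequence along which the form against each fixed y
converges. It is the source of the weak equation satisfied by resolvents. -/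
theorem exists_operator_of_closable {T H : Type*} [NormedAddCommGroup T] [InnerProductSpace ℂ T]
    [NormedAddCommGroup H] [InnerProductSpace ℂ H] [CompleteSpace H] (J : T →L[ℂ] H)
    (hJ : ∀ x, ‖J x‖ ≤ ‖x‖) (hJd : DenseRange J)
    (hcl : ∀ x : ℕ → T, CauchySeq x → Tendsto (fun k => J (x k)) atTop (𝓝 0) →
      Tendsto x atTop (𝓝 0)) :
    ∃ S : H →L[ℂ] H, S.IsPositive ∧ (1 - S).IsPositive ∧ Function.Injective S ∧
      (∀ u g, u = S (u + g) ↔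
        (∃ x : ℕ → T, CauchySeq x ∧ Tendsto (fun k => J (x k)) atTop (𝓝 u)) ∧
        ∀ v, (∃ y : ℕ → T, CauchySeq y ∧ Tendsto (fun k => J (y k)) atTop (𝓝 v)) →
          ∃ x y : ℕ → T, (CauchySeq x ∧ Tendsto (fun k => J (x k)) atTop (𝓝 u)) ∧
            (CauchySeq y ∧ Tendsto (fun k => J (y k)) atTop (𝓝 v)) ∧
            Tendsto (fun k => inner ℂ (y k) (x k) - inner ℂ (J (y k)) (J (x k))) atTop
              (𝓝 (inner ℂ v g))) ∧
      ∀ u g, u = S (u + g) →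
        ∃ x : ℕ → T, CauchySeq x ∧ Tendsto (fun k => J (x k)) atTop (𝓝 u) ∧
          ∀ y, Tendsto (fun k => inner ℂ y (x k)) atTop (𝓝 (inner ℂ (J y) (u + g) : ℂ)) := by
  let ι : T →L[ℂ] UniformSpace.Completion T := UniformSpace.Completion.toComplL
  have hι : ∀ x, ι x = (x : UniformSpace.Completion T) := fun _ => rfl
  have hdι : DenseRange ι := UniformSpace.Completion.denseRange_coe
  have huι : IsUniformInducing ι := UniformSpace.Completion.isUniformInducing_coe T
  let K : UniformSpace.Completion T →L[ℂ] H := J.extend ι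
  have hK : ∀ x, K (ι x) = J x := fun x => J.extend_eq hdι huι x
  have hKn : ∀ w, ‖K w‖ ≤ ‖w‖ := fun w => by
    refine hdι.induction_on (p := fun w => ‖K w‖ ≤ ‖w‖) w
      (isClosed_le (by fun_prop) (by fun_prop)) fun x => ?_
    rw [hK, hι, UniformSpace.Completion.norm_coe]
    exact hJ x
  have hseq : ∀ w : UniformSpace.Completion T, ∃ x : ℕ → T, Tendsto (fun k => ι (x k)) atTop (𝓝 w) := by
    intro w
    have : w ∈ closure (Set.range ι) := hdι w
    obtain ⟨y, hy1, hy2⟩ := mem_closure_iff_seq_limit.1 this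
    choose x hx using hy1
    exact ⟨x, by simpa [hx] using hy2⟩
  have hcs : ∀ {x : ℕ → T}, CauchySeq (fun k => ι (x k)) ↔ CauchySeq x := fun {x} => by
    have := huι.cauchy_map_iff (F := Filter.map x atTop)
    rwa [Filter.map_map] at this
  have hcau : ∀ {x : ℕ → T} {w}, Tendsto (fun k => ι (x k)) atTop (𝓝 w) → CauchySeq x :=
    fun h => hcs.1 h.cauchySeq
  have hcau' : ∀ {x : ℕ → T}, CauchySeq x → ∃ w, Tendsto (fun k => ι (x k)) atTop (𝓝 w) :=
    fun h => cauchySeq_tendsto_of_complete (hcs.2 h)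
  have hKt : ∀ {x : ℕ → T} {w}, Tendsto (fun k => ι (x k)) atTop (𝓝 w) →
      Tendsto (fun k => J (x k)) atTop (𝓝 (K w)) := fun {x w} h => by
    have := (K.continuous.tendsto w).comp h
    simpa only [Function.comp_def, hK] using this
  -- Closability is precisely the injectivity of the extension of J to the completion.
  have hKinj : ∀ w, K w = 0 → w = 0 := by
    intro w hw
    obtain ⟨x, hx⟩ := hseq w
    have h1 := hKt hx
    rw [hw] at h1
    have h2 := hcl x (hcau hx) h1
    have h3 := (ι.continuous.tendsto 0).comp h2
    rw [map_zero] at h3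
    exact tendsto_nhds_unique hx h3
  have hKinj' : ∀ w w', K w = K w' → w = w' := fun w w' h =>
    sub_eq_zero.1 (hKinj _ (by rw [map_sub, h, sub_self]))
  have hpair : ∀ {x : ℕ → T} {u}, CauchySeq x ∧ Tendsto (fun k => J (x k)) atTop (𝓝 u) →
      ∃ w, Tendsto (fun k => ι (x k)) atTop (𝓝 w) ∧ K w = u := fun {x u} ⟨h1, h2⟩ => by
    obtain ⟨w, hw⟩ := hcau' h1
    exact ⟨w, hw, tendsto_nhds_unique (hKt hw) h2⟩
  have hin : ∀ (x y : ℕ → T) w w', Tendsto (fun k => ι (x k)) atTop (𝓝 w) →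
      Tendsto (fun k => ι (y k)) atTop (𝓝 w') →
      Tendsto (fun k => inner ℂ (y k) (x k) - (inner ℂ (J (y k)) (J (x k)) : ℂ)) atTop
        (𝓝 (inner ℂ w' w - inner ℂ (K w') (K w))) := fun x y w w' hx hy => by
    have h1 := hy.inner (𝕜 := ℂ) hx
    simp only [hι, UniformSpace.Completion.inner_coe] at h1
    exact h1.sub ((hKt hy).inner (hKt hx))
  let A := ContinuousLinearMap.adjoint K
  have hAdef : ∀ w h, inner ℂ w (A h) = (inner ℂ (K w) h : ℂ) :=
    fun w h => ContinuousLinearMap.adjoint_inner_right K w h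
  have hSA : ∀ h, inner ℂ (K (A h)) h = ((‖A h‖ : ℂ) ^ 2) := fun h => by
    rw [← hAdef, inner_self_eq_norm_sq_to_K]
    rfl
  have hAn : ∀ h, ‖A h‖ ≤ ‖h‖ := fun h => by
    have h1 : ‖A h‖ ^ 2 ≤ ‖A h‖ * ‖h‖ := by
      have := norm_inner_le_norm (𝕜 := ℂ) (K (A h)) h
      rw [hSA, norm_pow, Complex.norm_real, norm_norm] at this
      exact this.trans (mul_le_mul_of_nonneg_right (hKn _) (norm_nonneg _))
    by_contra hc
    rw [not_le] at hc
    nlinarith [norm_nonneg h]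
  -- The Riesz step: u = S(u + g) is equivalent to the form equation q(u, ·) = ⟨g, ·⟩ on the
  -- completed form domain.
  have hrep : ∀ u g w, K w = u → (u = K (A (u + g)) ↔ ∀ w', inner ℂ w' w - inner ℂ (K w') u =
      (inner ℂ (K w') g : ℂ)) := by
    intro u g w hw
    constructor
    · intro h w'
      have : w = A (u + g) := hKinj' _ _ (hw.trans h)
      rw [this, hAdef, inner_add_right]
      ring
    · intro h
      have : w = A (u + g) := by
        refine ext_inner_left ℂ fun w' => ?_
        rw [hAdef, inner_add_right, ← h w']
        ring
      rw [← this, hw]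
  refine ⟨K ∘L A, ContinuousLinearMap.isPositive_self_comp_adjoint K, ?_, ?_, ?_, ?_⟩
  · rw [ContinuousLinearMap.isPositive_iff_complex]
    intro h
    have h1 : (inner ℂ ((1 - K ∘L A) h) h : ℂ) = ((‖h‖ ^ 2 - ‖A h‖ ^ 2 : ℝ) : ℂ) := by
      have h2 : (1 - K ∘L A) h = h - K (A h) := rfl
      rw [h2, inner_sub_left, hSA, inner_self_eq_norm_sq_to_K]
      push_cast
      rfl
    rw [h1]
    refine ⟨by rw [RCLike.re_to_complex, Complex.ofReal_re], ?_⟩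
    have := hAn h
    rw [RCLike.re_to_complex, Complex.ofReal_re]
    nlinarith [norm_nonneg (A h)]
  · rw [injective_iff_map_eq_zero]
    intro h hh
    have h0 : A h = 0 := hKinj _ hh
    have h1 : ∀ x, inner ℂ (J x) h = (0 : ℂ) := fun x => by
      rw [← hK, ← hAdef, h0, inner_zero_right]
    exact hJd.eq_zero_of_inner_left (𝕜 := ℂ) fun x => by
      rw [← inner_conj_symm, h1, map_zero]
  · intro u g
    simp only [ContinuousLinearMap.comp_apply]
    constructor
    · intro h
      have hu : K (A (u + g)) = u := h.symm
      obtain ⟨x, hx⟩ := hseq (A (u + g))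
      refine ⟨⟨x, hcau hx, hu ▸ hKt hx⟩, ?_⟩
      rintro v ⟨y, hy⟩
      obtain ⟨w', hw', rfl⟩ := hpair hy
      refine ⟨x, y, ⟨hcau hx, hu ▸ hKt hx⟩, hy, ?_⟩
      have := hin x y _ _ hx hw'
      rw [hu, (hrep u g _ hu).1 h w'] at this
      exact this
    · rintro ⟨⟨x, hx⟩, h⟩
      obtain ⟨w, hw, hwu⟩ := hpair hx
      rw [hrep u g w hwu]
      intro w'
      obtain ⟨y, hy⟩ := hseq w'
      obtain ⟨x', y', hx', hy', hlim⟩ := h (K w') ⟨y, hcau hy, hKt hy⟩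
      obtain ⟨a, ha, hau⟩ := hpair hx'
      obtain ⟨b, hb, hbu⟩ := hpair hy'
      have e1 : a = w := hKinj' _ _ (hau.trans hwu.symm)
      have e2 : b = w' := hKinj' _ _ hbu
      subst e1 e2
      have := hin x' y' _ _ ha hb
      rw [hau] at this
      exact tendsto_nhds_unique this hlim
  · intro u g h
    simp only [ContinuousLinearMap.comp_apply] at h
    obtain ⟨x, hx⟩ := hseq (A (u + g))
    refine ⟨x, hcau hx, ?_, fun y => ?_⟩
    · rw [h]
      simpa only [← h] using hKt hx
    · have h1 := (tendsto_const_nhds (x := ι y) (f := (atTop : Filter ℕ))).inner (𝕜 := ℂ) hx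
      rw [hAdef, hK] at h1
      simpa only [hι, UniformSpace.Completion.inner_coe] using h1


/-! ### The Schrödinger form on test functions -/

section
variable {n : ℕ}

/-- The form of `-Δ + V` is well defined, nonnegative and closable on test functions. -/
structure IsClosableForm (V : E n → ℝ) : Prop where
  meas : AEStronglyMeasurable V volume
  integrable : ∀ φ : E n → ℂ, IsTestFunction φ → Integrable (fun x => V x * ‖φ x‖ ^ 2)
  nonneg : ∀ φ : E n → ℂ, IsTestFunction φ → 0 ≤ (schrodingerForm V φ φ).re
  closable : ∀ φ : ℕ → E n → ℂ, (∀ k, IsTestFunction (φ k)) →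
    Tendsto (fun k => sqNorm (φ k)) atTop (𝓝 0) →
    Tendsto (fun p : ℕ × ℕ => schrodingerForm V (φ p.1 - φ p.2) (φ p.1 - φ p.2)) atTop (𝓝 0) →
    Tendsto (fun k => schrodingerForm V (φ k) (φ k)) atTop (𝓝 0)

theorem integrable_potential_mul {V : E n → ℝ} (hm : AEStronglyMeasurable V volume)
    {φ ψ : E n → ℂ} (hφ : AEStronglyMeasurable φ volume) (hψ : AEStronglyMeasurable ψ volume)
    (h1 : Integrable (fun x => V x * ‖φ x‖ ^ 2)) (h2 : Integrable (fun x => V x * ‖ψ x‖ ^ 2)) :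
    Integrable (fun x => (V x : ℂ) * φ x * conj (ψ x)) := by
  refine Integrable.mono' (h1.norm.add h2.norm)
    ((Complex.continuous_ofReal.comp_aestronglyMeasurable hm |>.mul hφ).mul
      (Complex.continuous_conj.comp_aestronglyMeasurable hψ)) (ae_of_all _ fun x => ?_)
  simp only [norm_mul, Complex.norm_real, Pi.add_apply, norm_pow, norm_norm, RCLike.norm_conj]
  nlinarith [norm_nonneg (V x), mul_nonneg (norm_nonneg (V x)) (sq_nonneg (‖φ x‖ - ‖ψ x‖)),
    mul_nonneg (norm_nonneg (V x)) (sq_nonneg (‖φ x‖)), mul_nonneg (norm_nonneg (V x)) (sq_nonneg (‖ψ x‖))]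

theorem integrable_gradient_mul {φ ψ : E n → ℂ} (hφ : IsTestFunction φ) (hψ : IsTestFunction ψ) :
    Integrable (fun x => ∑ i, partialDeriv i φ x * conj (partialDeriv i ψ x)) :=
  integrable_finsetSum _ fun i _ =>
    integrable_mul_conj (hφ.partialDeriv i).memLp (hψ.partialDeriv i).memLp

theorem schrodingerForm_eq {V : E n → ℝ} {φ ψ : E n → ℂ} (hφ : IsTestFunction φ)
    (hψ : IsTestFunction ψ) (h : Integrable (fun x => (V x : ℂ) * φ x * conj (ψ x))) :
    schrodingerForm V φ ψ = ∑ i, pairing (partialDeriv i φ) (partialDeriv i ψ)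
      + ∫ x, (V x : ℂ) * φ x * conj (ψ x) := by
  unfold schrodingerForm
  rw [integral_add (integrable_gradient_mul hφ hψ) h, integral_finsetSum _ fun i _ =>
    integrable_mul_conj (hφ.partialDeriv i).memLp (hψ.partialDeriv i).memLp]
  rfl

theorem conj_schrodingerForm (V : E n → ℝ) (φ ψ : E n → ℂ) :
    conj (schrodingerForm V φ ψ) = schrodingerForm V ψ φ := by
  unfold schrodingerForm
  rw [← integral_conj]
  congr 1 with x
  simp only [map_add, map_sum, map_mul, Complex.conj_conj, Complex.conj_ofReal]
  congr 1
  · exact Finset.sum_congr rfl fun i _ => mul_comm _ _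
  · ring

theorem schrodingerForm_self (V : E n → ℝ) (φ : E n → ℂ) :
    schrodingerForm V φ φ = ((∫ x, (gradSq φ x + V x * ‖φ x‖ ^ 2) : ℝ) : ℂ) := by
  unfold schrodingerForm gradSq
  rw [← integral_complex_ofReal]
  congr 1 with x
  simp only [Complex.mul_conj, Complex.normSq_eq_norm_sq, mul_assoc]
  push_cast
  rfl

theorem schrodingerForm_const_mul (V : E n → ℝ) {φ ψ : E n → ℂ} (c : ℂ) (hφ : IsTestFunction φ) :
    schrodingerForm V ψ (fun x => c * φ x) = conj c * schrodingerForm V ψ φ := by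
  unfold schrodingerForm
  rw [← integral_const_mul]
  congr 1 with x
  simp_rw [partialDeriv_const_mul _ c (hφ.differentiable x)]
  simp only [map_mul, mul_add, Finset.mul_sum]
  congr 1
  · exact Finset.sum_congr rfl fun i _ => by ring
  · ring

/-- The space of test functions. -/
def testSubmodule (n : ℕ) : Submodule ℂ (E n → ℂ) where
  carrier := {φ | IsTestFunction φ}
  zero_mem' := ⟨contDiff_const, HasCompactSupport.zero⟩
  add_mem' h h' := h.add h'
  smul_mem' c _ h := h.const_mul c

/-- The space of test functions, without topology. -/
def TestSpace (n : ℕ) : Type := testSubmodule n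

instance : AddCommGroup (TestSpace n) := inferInstanceAs (AddCommGroup (testSubmodule n))

instance : Module ℂ (TestSpace n) := inferInstanceAs (Module ℂ (testSubmodule n))

/-- The function underlying an element of `TestSpace`. -/
def TestSpace.fn (φ : TestSpace n) : E n → ℂ := φ.1

theorem TestSpace.test (φ : TestSpace n) : IsTestFunction φ.fn := φ.2

theorem TestSpace.fn_add (φ ψ : TestSpace n) : (φ + ψ).fn = fun x => φ.fn x + ψ.fn x := rfl

theorem TestSpace.fn_smul (c : ℂ) (φ : TestSpace n) : (c • φ).fn = fun x => c * φ.fn x := rfl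

theorem TestSpace.fn_sub (φ ψ : TestSpace n) : (φ - ψ).fn = φ.fn - ψ.fn := by
  have h : (φ - ψ) + ψ = φ := sub_add_cancel φ ψ
  have h2 := TestSpace.fn_add (φ - ψ) ψ
  rw [h] at h2
  funext x
  have := congrFun h2 x
  simp only [Pi.sub_apply]
  rw [this]
  ring

/-- Embedding of test functions in `L²`. -/
def TestSpace.toL2 : TestSpace n →ₗ[ℂ] L2 n where
  toFun φ := φ.test.memLp.toLp φ.fn
  map_add' _ _ := rfl
  map_smul' _ _ := rfl

theorem TestSpace.inner_toL2 (φ ψ : TestSpace n) :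
    inner ℂ φ.toL2 ψ.toL2 = pairing ψ.fn φ.fn :=
  (pairing_eq_inner ψ.test.memLp φ.test.memLp).symm

namespace IsClosableForm
variable {V : E n → ℝ} (hV : IsClosableForm V)
include hV

theorem integrable_mul {φ ψ : E n → ℂ} (hφ : IsTestFunction φ) (hψ : IsTestFunction ψ) :
    Integrable (fun x => (V x : ℂ) * φ x * conj (ψ x)) :=
  integrable_potential_mul hV.meas hφ.memLp.1 hψ.memLp.1 (hV.integrable _ hφ) (hV.integrable _ hψ)

theorem form_add {φ φ' ψ : E n → ℂ} (hφ : IsTestFunction φ) (hφ' : IsTestFunction φ')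
    (hψ : IsTestFunction ψ) : schrodingerForm V ψ (fun x => φ x + φ' x) =
      schrodingerForm V ψ φ + schrodingerForm V ψ φ' := by
  unfold schrodingerForm
  refine Eq.trans ?_ (integral_add ((integrable_gradient_mul hψ hφ).add (hV.integrable_mul hψ hφ))
    ((integrable_gradient_mul hψ hφ').add (hV.integrable_mul hψ hφ')))
  congr 1 with x
  simp_rw [partialDeriv_add _ (hφ.differentiable x) (hφ'.differentiable x)]
  simp only [map_add, mul_add, Finset.sum_add_distrib]
  ring

/-- The inner product `q(ψ, φ) + ⟨ψ, φ⟩` on test functions. -/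
@[reducible]
def core : InnerProductSpace.Core ℂ (TestSpace n) where
  inner φ ψ := schrodingerForm V ψ.fn φ.fn + pairing ψ.fn φ.fn
  conj_inner_symm φ ψ := by rw [map_add, conj_schrodingerForm, conj_pairing]
  re_inner_nonneg φ := by
    have h1 := hV.nonneg _ φ.test
    rw [pairing_self, map_add]
    have h2 : 0 ≤ ∫ x, ‖φ.fn x‖ ^ 2 := integral_nonneg fun x => by positivity
    simpa using add_nonneg h1 h2
  add_left φ ψ χ := by
    simp only [TestSpace.fn_add]
    rw [hV.form_add φ.test ψ.test χ.test]
    simp only [← TestSpace.fn_add, ← TestSpace.inner_toL2, map_add, inner_add_left]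
    ring
  smul_left φ ψ c := by
    simp only [TestSpace.fn_smul]
    rw [schrodingerForm_const_mul V c φ.test]
    simp only [← TestSpace.fn_smul, ← TestSpace.inner_toL2, map_smul, inner_smul_left]
    ring
  definite φ h := by
    rw [schrodingerForm_self, pairing_self, ← Complex.ofReal_add] at h
    have h1 := hV.nonneg _ φ.test
    rw [schrodingerForm_self, Complex.ofReal_re] at h1
    have h2 : 0 ≤ ∫ x, ‖φ.fn x‖ ^ 2 := integral_nonneg fun x => by positivity
    have h3 := Complex.ofReal_eq_zero.1 h
    have h4 : ∫ x, ‖φ.fn x‖ ^ 2 = 0 := by linarith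
    rw [integral_eq_zero_iff_of_nonneg (fun x => by positivity)
      (φ.test.memLp.integrable_norm_pow (by norm_num))] at h4
    have h5 : φ.fn =ᵐ[volume] fun _ => 0 := by
      filter_upwards [h4] with x hx
      simpa using hx
    have h6 := (φ.test.continuous.ae_eq_iff_eq volume continuous_const).1 h5
    exact Subtype.ext h6

/-- Besides the resolvent, the conclusion records that R f is a form limit of test functions φ_k
with q(φ_k, ψ) → ⟨f + z R f, ψ⟩. This weak equation is all that the later estimates use. It is
stated through limits because the form domain is not assumed to be contained in H¹. -/
theorem exists_operator : ∃ H : L2 n →ₗ.[ℂ] L2 n, IsSchrodingerOperator V H ∧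
    ∀ z : ℂ, (¬ ∃ t : ℝ, 0 ≤ t ∧ z = (t : ℂ)) → ∃ R : L2 n →L[ℂ] L2 n, IsResolvent H z R ∧
      ∀ f, ∃ φ, IsFormApprox V φ (R f) ∧ ∀ ψ, IsTestFunction ψ →
        Tendsto (fun k => schrodingerForm V (φ k) ψ) atTop
          (𝓝 (pairing f ψ + z * pairing (R f) ψ)) := by
  let c : InnerProductSpace.Core ℂ (TestSpace n) := hV.core
  let i1 : NormedAddCommGroup (TestSpace n) := c.toNormedAddCommGroup
  let i2 : InnerProductSpace ℂ (TestSpace n) := InnerProductSpace.ofCore c.toCore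
  have hin : ∀ φ ψ : TestSpace n,
      inner ℂ φ ψ = schrodingerForm V ψ.fn φ.fn + pairing ψ.fn φ.fn := fun _ _ => rfl
  have hnsq : ∀ φ : TestSpace n, ‖φ‖ ^ 2 = (schrodingerForm V φ.fn φ.fn).re + ‖φ.toL2‖ ^ 2 := by
    intro φ
    have h1 : (inner ℂ φ φ).re = ‖φ‖ ^ 2 := (InnerProductSpace.norm_sq_eq_re_inner (𝕜 := ℂ) φ).symm
    rw [← h1, hin, Complex.add_re, ← TestSpace.inner_toL2]
    congr 1
    exact (InnerProductSpace.norm_sq_eq_re_inner (𝕜 := ℂ) φ.toL2).symm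
  have hJn : ∀ φ : TestSpace n, ‖φ.toL2‖ ≤ ‖φ‖ := fun φ => by
    have := hnsq φ
    have h2 := hV.nonneg _ φ.test
    exact le_of_sq_le_sq (by linarith) (norm_nonneg _)
  let J : TestSpace n →L[ℂ] L2 n := LinearMap.mkContinuous TestSpace.toL2 1 fun φ => by
    rw [one_mul]; exact hJn φ
  have hJ : ∀ φ, J φ = φ.toL2 := fun _ => rfl
  have hJ' : ∀ φ, J φ = φ.test.memLp.toLp φ.fn := fun _ => rfl
  have hJd : DenseRange J := by
    refine (Lp.dense_hasCompactSupport_contDiff (F := ℂ) (μ := (volume : Measure (E n)))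
      (p := 2) (by norm_num)).mono ?_
    rintro f ⟨g, hg1, hg2, hg3⟩
    refine ⟨⟨g, hg3, hg2⟩, ?_⟩
    refine Lp.ext ?_
    exact (MemLp.coeFn_toLp (TestSpace.test ⟨g, hg3, hg2⟩).memLp).trans hg1.symm
  have hseqn : ∀ φ : ℕ → TestSpace n, Tendsto (fun k => J (φ k)) atTop (𝓝 0) ↔
      Tendsto (fun k => sqNorm (φ k).fn) atTop (𝓝 0) := fun φ => by
    have h0 : (0 : L2 n) = MemLp.toLp (fun _ => (0 : ℂ)) MemLp.zero' := rfl
    rw [h0]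
    simp only [hJ']
    rw [Lp.tendsto_Lp_iff_tendsto_eLpNorm'']
    rw [← tendsto_eLpNorm_iff]
    refine tendsto_congr fun k => ?_
    congr 1
    funext x
    simp
  have hform : ∀ φ : TestSpace n, schrodingerForm V φ.fn φ.fn =
      (((schrodingerForm V φ.fn φ.fn).re : ℝ) : ℂ) := fun φ => by
    rw [schrodingerForm_self, Complex.ofReal_re]
  have hcauchy : ∀ φ : ℕ → TestSpace n, CauchySeq φ → Tendsto (fun p : ℕ × ℕ =>
      schrodingerForm V ((φ p.1).fn - (φ p.2).fn) ((φ p.1).fn - (φ p.2).fn)) atTop (𝓝 0) := by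
    intro φ hφ
    have h1 := (cauchySeq_iff_tendsto_dist_atTop_0.1 hφ).pow 2
    simp only [ne_eq, OfNat.ofNat_ne_zero, not_false_eq_true, zero_pow] at h1
    simp_rw [← TestSpace.fn_sub]
    rw [tendsto_zero_iff_norm_tendsto_zero]
    refine squeeze_zero (fun _ => norm_nonneg _) (fun p => ?_) h1
    rw [hform, Complex.norm_real, Real.norm_of_nonneg (hV.nonneg _ (TestSpace.test _)),
      dist_eq_norm, hnsq]
    nlinarith [norm_nonneg (φ p.1 - φ p.2).toL2]
  have hcl : ∀ φ : ℕ → TestSpace n, CauchySeq φ → Tendsto (fun k => J (φ k)) atTop (𝓝 0) →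
      Tendsto φ atTop (𝓝 0) := by
    intro φ hφ h0
    have h1 := hV.closable (fun k => (φ k).fn) (fun k => (φ k).test) ((hseqn φ).1 h0) (hcauchy φ hφ)
    rw [tendsto_zero_iff_norm_tendsto_zero]
    have h2 : Tendsto (fun k => ‖φ k‖ ^ 2) atTop (𝓝 0) := by
      simp_rw [hnsq]
      have e1 := (Complex.continuous_re.tendsto _).comp h1
      have e2 := h0.norm.pow 2
      simpa [Function.comp_def, hJ] using e1.add e2
    have h3 := (Real.continuous_sqrt.tendsto 0).comp h2
    simpa [Function.comp_def, Real.sqrt_sq (norm_nonneg _)] using h3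
  obtain ⟨S, hS, hS1, hSi, hgraph, happ⟩ := exists_operator_of_closable J hJn hJd hcl
  -- The norm of the test space satisfies ‖φ‖² = q(φ,φ) + ‖φ‖²_{L²}, so being Cauchy there amounts
  -- to being Cauchy both in L² and for the form.
  have happrox : ∀ (φ : ℕ → TestSpace n) (u : L2 n), (CauchySeq φ ∧
      Tendsto (fun k => J (φ k)) atTop (𝓝 u)) ↔ IsFormApprox V (fun k => (φ k).fn) u := by
    intro φ u
    have e : Tendsto (fun k => J (φ k)) atTop (𝓝 u) ↔
        Tendsto (fun k => eLpNorm (fun x => (φ k).fn x - u x) 2 volume) atTop (𝓝 0) := by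
      conv_lhs => rw [← Lp.toLp_coeFn u (Lp.memLp u)]
      simp only [hJ']
      rw [Lp.tendsto_Lp_iff_tendsto_eLpNorm'']
      rfl
    constructor
    · rintro ⟨h1, h2⟩
      exact ⟨fun k => (φ k).test, e.1 h2, hcauchy φ h1⟩
    · rintro ⟨_, h2, h3⟩
      refine ⟨?_, e.2 h2⟩
      rw [cauchySeq_iff_tendsto_dist_atTop_0]
      have h4 := (cauchySeq_iff_tendsto_dist_atTop_0.1 (e.2 h2).cauchySeq).pow 2
      have h5 := (Complex.continuous_re.tendsto _).comp h3
      have h6 : Tendsto (fun p : ℕ × ℕ => dist (φ p.1) (φ p.2) ^ 2) atTop (𝓝 0) := by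
        have := h5.add h4
        simp only [Complex.zero_re, ne_eq, OfNat.ofNat_ne_zero, not_false_eq_true, zero_pow,
          add_zero] at this
        refine this.congr fun p => ?_
        rw [dist_eq_norm, dist_eq_norm, hnsq, TestSpace.fn_sub, hJ, hJ, map_sub]
        rfl
      have h7 := (Real.continuous_sqrt.tendsto 0).comp h6
      simpa [Function.comp_def, Real.sqrt_sq dist_nonneg] using h7
  have hlift : ∀ (φ : ℕ → E n → ℂ) (u : L2 n), IsFormApprox V φ u →
      ∃ φ' : ℕ → TestSpace n, φ = fun k => (φ' k).fn := fun φ u h =>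
    ⟨fun k => ⟨φ k, h.test k⟩, rfl⟩
  have hdom : ∀ u, (∃ x : ℕ → TestSpace n, CauchySeq x ∧ Tendsto (fun k => J (x k)) atTop (𝓝 u)) ↔
      u ∈ formDomain V := by
    intro u
    constructor
    · rintro ⟨φ, h⟩
      exact ⟨_, (happrox φ u).1 h⟩
    · rintro ⟨φ, h⟩
      obtain ⟨φ', rfl⟩ := hlift φ u h
      exact ⟨φ', (happrox φ' u).2 h⟩
  have hdiff : ∀ φ ψ : TestSpace n, inner ℂ ψ φ - inner ℂ (J ψ) (J φ) =
      schrodingerForm V φ.fn ψ.fn := fun φ ψ => by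
    rw [hin, hJ, hJ, TestSpace.inner_toL2]
    ring
  refine ⟨inverseSubOne S, ⟨isSelfAdjoint_inverseSubOne hS.isSelfAdjoint hSi, ?_⟩, ?_⟩
  · rw [graph_inverseSubOne hSi]
    ext ⟨u, g⟩
    rw [SetLike.mem_coe, mem_inverseSubOneGraph]
    simp only
    rw [hgraph, hdom]
    simp_rw [hdom, hdiff]
    refine and_congr Iff.rfl (forall₂_congr fun v _ => ?_)
    constructor
    · rintro ⟨x, y, hx, hy, h⟩
      exact ⟨_, _, (happrox x u).1 hx, (happrox y v).1 hy, h⟩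
    · rintro ⟨φ, ψ, hφ, hψ, h⟩
      obtain ⟨φ', rfl⟩ := hlift φ u hφ
      obtain ⟨ψ', rfl⟩ := hlift ψ v hψ
      exact ⟨φ', ψ', (happrox φ' u).2 hφ, (happrox ψ' v).2 hψ, h⟩
  · intro z hz
    obtain ⟨R, hR⟩ := exists_resolvent_inverseSubOne hS hS1 hSi hz
    refine ⟨R, hR, fun f => ?_⟩
    obtain ⟨hd, he⟩ := hR.1 f
    have hmem := (inverseSubOne S).mem_graph ⟨R f, hd⟩
    rw [graph_inverseSubOne hSi, mem_inverseSubOneGraph] at hmem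
    have hval : inverseSubOne S ⟨R f, hd⟩ = f + z • R f := sub_eq_iff_eq_add.1 he
    rw [hval] at hmem
    obtain ⟨x, hx1, hx2, hx3⟩ := happ (R f) (f + z • R f) hmem
    refine ⟨_, (happrox x _).1 ⟨hx1, hx2⟩, fun ψ hψ => ?_⟩
    have h1 := hx3 ⟨ψ, hψ⟩
    have h2 := (tendsto_const_nhds (x := J ⟨ψ, hψ⟩) (f := (atTop : Filter ℕ))).inner (𝕜 := ℂ) hx2
    have h3 : Tendsto (fun k => schrodingerForm V (x k).fn ψ) atTop
        (𝓝 (inner ℂ (J ⟨ψ, hψ⟩) (R f + (f + z • R f)) - inner ℂ (J ⟨ψ, hψ⟩) (R f))) :=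
      (h1.sub h2).congr fun k => hdiff (x k) ⟨ψ, hψ⟩
    have e1 : ∀ w : L2 n, inner ℂ (J ⟨ψ, hψ⟩) w = pairing w ψ := fun w => by
      have := pairing_eq_inner (Lp.memLp w) hψ.memLp
      rw [Lp.toLp_coeFn] at this
      exact this.symm
    rw [inner_add_right, inner_add_right, inner_smul_right, e1, e1] at h3
    convert h3 using 2
    ring

end IsClosableForm
end

/-! ### Weights bounded relative to the gradient -/

section
variable {n : ℕ}

theorem L2Tendsto.sqNorm {ι : Type*} {l : Filter ι} {F : ι → E n → ℂ} {f : E n → ℂ}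
    (h : L2Tendsto l F f) : Tendsto (fun i => sqNorm (F i)) l (𝓝 (sqNorm f)) := by
  rw [sqNorm_eq_ofReal h.lim]
  simp_rw [fun i => sqNorm_eq_ofReal (h.mem i)]
  exact (ENNReal.continuous_ofReal.tendsto _).comp h.integral_norm_sq

theorem L2Tendsto.exists_subseq_ae {F : ℕ → E n → ℂ} {f : E n → ℂ} (h : L2Tendsto atTop F f) :
    ∃ k : ℕ → ℕ, StrictMono k ∧ ∀ᵐ x, Tendsto (fun j => F (k j) x) atTop (𝓝 (f x)) :=
  (tendstoInMeasure_of_tendsto_eLpNorm (p := 2) (by norm_num) (fun i => (h.mem i).1) h.lim.1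
    (tendsto_eLpNorm_iff.2 h.tendsto)).exists_seq_tendsto_ae

/-- Multiplication by `b` is bounded from the homogeneous Sobolev space to `L²`. -/
structure GradBounded (b : E n → ℂ) (C : ℝ≥0∞) : Prop where
  meas : AEStronglyMeasurable b volume
  ne_top : C ≠ ∞
  bound : ∀ φ : E n → ℂ, IsTestFunction φ →
    sqNorm (fun x => b x * φ x) ≤ C * ∑ i, sqNorm (partialDeriv i φ)

variable {u w : E n → ℂ} {G K : Fin n → E n → ℂ} {b : E n → ℂ} {C : ℝ≥0∞}

/-- Fatou's lemma along an almost everywhere convergent subsequence. Square integrability of b u is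
thus a consequence and not a prerequisite. -/
theorem GradBounded.bound_isH1 (hb : GradBounded b C) (h : IsH1 u G) :
    sqNorm (fun x => b x * u x) ≤ C * ∑ i, sqNorm (G i) := by
  obtain ⟨φ, h1, h2, h3⟩ := h
  obtain ⟨k, hk, hae⟩ := h2.exists_subseq_ae
  have hlim : Tendsto (fun j => C * ∑ i, sqNorm (partialDeriv i (φ (k j)))) atTop
      (𝓝 (C * ∑ i, sqNorm (G i))) := by
    refine ENNReal.Tendsto.const_mul (tendsto_finsetSum _ fun i _ => ?_) (Or.inr hb.ne_top)
    exact (h3 i).sqNorm.comp hk.tendsto_atTop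
  calc sqNorm (fun x => b x * u x)
      = ∫⁻ x, liminf (fun j => ‖b x * φ (k j) x‖ₑ ^ 2) atTop := by
        refine lintegral_congr_ae ?_
        filter_upwards [hae] with x hx
        refine Eq.symm (Tendsto.liminf_eq ?_)
        exact ((ENNReal.continuous_pow 2).tendsto _).comp (hx.const_mul (b x)).enorm
    _ ≤ liminf (fun j => ∫⁻ x, ‖b x * φ (k j) x‖ₑ ^ 2) atTop :=
        lintegral_liminf_le' fun j =>
          ((hb.meas.mul (h1 (k j)).memLp.1).enorm.pow_const 2)
    _ ≤ liminf (fun j => C * ∑ i, sqNorm (partialDeriv i (φ (k j)))) atTop :=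
        liminf_le_liminf (Eventually.of_forall fun j => hb.bound _ (h1 (k j)))
    _ = _ := hlim.liminf_eq

theorem IsH1.sum_sqNorm_lt_top (h : IsH1 u G) : ∑ i, sqNorm (G i) < ∞ :=
  ENNReal.sum_lt_top.2 fun i _ => (h.memLp_grad i).sqNorm_lt_top

theorem GradBounded.memLp (hb : GradBounded b C) (h : IsH1 u G) :
    MemLp (fun x => b x * u x) 2 :=
  memLp_of_sqNorm_lt_top (hb.meas.mul h.memLp.1)
    ((hb.bound_isH1 h).trans_lt (ENNReal.mul_lt_top hb.ne_top.lt_top h.sum_sqNorm_lt_top))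

theorem GradBounded.tendsto {ι : Type*} {l : Filter ι} (hb : GradBounded b C)
    {U : ι → E n → ℂ} {D : ι → Fin n → E n → ℂ}
    (hU : ∀ k, IsH1 (U k) (D k)) (hu : IsH1 u G)
    (hD : ∀ i, L2Tendsto l (fun k => D k i) (G i)) :
    L2Tendsto l (fun k x => b x * U k x) (fun x => b x * u x) := by
  refine ⟨fun k => hb.memLp (hU k), hb.memLp hu, ?_⟩
  have hlim : Tendsto (fun k => C * ∑ i, sqNorm (fun x => D k i x - G i x)) l (𝓝 0) := by
    have : Tendsto (fun k => C * ∑ i, sqNorm (fun x => D k i x - G i x)) l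
        (𝓝 (C * ∑ _i : Fin n, 0)) :=
      ENNReal.Tendsto.const_mul (tendsto_finsetSum _ fun i _ => (hD i).tendsto) (Or.inr hb.ne_top)
    simpa using this
  refine tendsto_of_tendsto_of_tendsto_of_le_of_le tendsto_const_nhds hlim (fun _ => zero_le)
    fun k => ?_
  have := hb.bound_isH1 ((hU k).sub hu)
  simpa only [mul_sub] using this

/-- The potential `V` is bounded relative to the Dirichlet form. -/
structure FormBounded (V : E n → ℝ) (C : ℝ≥0∞) : Prop where
  meas : AEStronglyMeasurable V volume
  bdd : GradBounded (fun x => ((√|V x| : ℝ) : ℂ)) C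

/-- The sign of `V`, as a complex function. -/
def potSign (V : E n → ℝ) (x : E n) : ℂ := if 0 ≤ V x then 1 else -1

/-- Splitting V as √|V| · sgn V · √|V| turns the potential form into an L² pairing, so every
continuity statement for it reduces to boundedness of multiplication by √|V|. -/
theorem potential_mul_eq (V : E n → ℝ) (u w : E n → ℂ) (x : E n) :
    (V x : ℂ) * u x * conj (w x) = (((√|V x| : ℝ) : ℂ) * u x)
      * conj (potSign V x * (((√|V x| : ℝ) : ℂ) * w x)) := by
  have h1 : (V x : ℂ) = ((√|V x| : ℝ) : ℂ) * ((√|V x| : ℝ) : ℂ) * potSign V x := by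
    rw [← Complex.ofReal_mul, Real.mul_self_sqrt (abs_nonneg _), potSign]
    split_ifs with h
    · rw [abs_of_nonneg h, mul_one]
    · rw [abs_of_neg (not_le.1 h)]
      push_cast
      ring
  have h2 : conj (potSign V x) = potSign V x := by
    rw [potSign]
    split_ifs <;> simp
  rw [map_mul, map_mul, h2, Complex.conj_ofReal]
  conv_lhs => rw [h1]
  ring

namespace FormBounded
variable {V : E n → ℝ} (hV : FormBounded V C)
include hV

theorem potSign_meas : AEStronglyMeasurable (potSign V) volume := by
  have h : Measurable (fun t : ℝ => if 0 ≤ t then (1 : ℂ) else -1) :=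
    Measurable.ite measurableSet_Ici measurable_const measurable_const
  exact (h.comp_aemeasurable hV.meas.aemeasurable).aestronglyMeasurable

omit hV in
theorem norm_potSign_le (x : E n) : ‖potSign V x‖ ≤ 1 := by
  rw [potSign]; split_ifs <;> simp

theorem memLp_sign (hw : IsH1 w K) :
    MemLp (fun x => potSign V x * (((√|V x| : ℝ) : ℂ) * w x)) 2 :=
  memLp_mul_bdd hV.potSign_meas norm_potSign_le (hV.bdd.memLp hw)

theorem integrable (hu : IsH1 u G) (hw : IsH1 w K) :
    Integrable (fun x => (V x : ℂ) * u x * conj (w x)) := by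
  simp_rw [potential_mul_eq]
  exact integrable_mul_conj (hV.bdd.memLp hu) (hV.memLp_sign hw)

theorem tendsto {ι : Type*} {l : Filter ι}
    {U W : ι → E n → ℂ} {D F : ι → Fin n → E n → ℂ}
    (hU : ∀ k, IsH1 (U k) (D k)) (hu : IsH1 u G)
    (hD : ∀ i, L2Tendsto l (fun k => D k i) (G i))
    (hW : ∀ k, IsH1 (W k) (F k)) (hw : IsH1 w K)
    (hF : ∀ i, L2Tendsto l (fun k => F k i) (K i)) :
    Tendsto (fun k => ∫ x, (V x : ℂ) * U k x * conj (W k x)) l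
      (𝓝 (∫ x, (V x : ℂ) * u x * conj (w x))) := by
  simp_rw [potential_mul_eq]
  exact (hV.bdd.tendsto hU hu hD).pairing
    ((hV.bdd.tendsto hW hw hF).mul_bdd hV.potSign_meas norm_potSign_le)

theorem integrable_sq (hu : IsH1 u G) : Integrable (fun x => V x * ‖u x‖ ^ 2) := by
  have := (hV.integrable hu hu).re
  refine this.congr (ae_of_all _ fun x => ?_)
  simp only [mul_assoc, Complex.mul_conj, Complex.normSq_eq_norm_sq]
  rw [← Complex.ofReal_mul]
  exact Complex.ofReal_re _

omit hV in
theorem integral_self (V : E n → ℝ) (u : E n → ℂ) :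
    ∫ x, (V x : ℂ) * u x * conj (u x) = ((∫ x, V x * ‖u x‖ ^ 2 : ℝ) : ℂ) := by
  rw [← integral_complex_ofReal]
  congr 1 with x
  rw [mul_assoc, Complex.mul_conj, Complex.normSq_eq_norm_sq]
  push_cast
  rfl

end FormBounded

/-! ### Hardy's inequality -/

/-- Integration by parts for the Euler operator `x · ∇`. -/
theorem integral_mul_euler {g ψ : E n → ℂ} (hg : ContDiff ℝ (⊤ : ℕ∞) g) (hψ : IsTestFunction ψ) :
    ∫ x, g x * ((n : ℂ) * ψ x + fderiv ℝ ψ x x) = -∫ x, fderiv ℝ g x x * ψ x := by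
  have hc : ∀ i : Fin n, ContDiff ℝ (⊤ : ℕ∞) (fun x : E n => ((x i : ℝ) : ℂ)) := fun i =>
    Complex.ofRealCLM.contDiff.comp (EuclideanSpace.proj (𝕜 := ℝ) i).contDiff
  have hpc : ∀ (i : Fin n) (x : E n), partialDeriv i (fun x : E n => ((x i : ℝ) : ℂ)) x = 1 := by
    intro i x
    have h : HasFDerivAt (fun x : E n => ((x i : ℝ) : ℂ))
        (Complex.ofRealCLM.comp (EuclideanSpace.proj (𝕜 := ℝ) i)) x :=
      (Complex.ofRealCLM.comp (EuclideanSpace.proj (𝕜 := ℝ) i)).hasFDerivAt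
    rw [partialDeriv, h.fderiv]
    simp
  have hi : ∀ {f : E n → ℂ}, IsTestFunction f → Integrable f := fun h =>
    h.continuous.integrable_of_hasCompactSupport h.2
  have key : ∀ i : Fin n, ∫ x, (((x i : ℝ) : ℂ) * g x) * partialDeriv i ψ x =
      -∫ x, (((x i : ℝ) : ℂ) * partialDeriv i g x + g x) * ψ x := fun i => by
    rw [integral_mul_partialDeriv ((hc i).mul hg) hψ i]
    congr 2 with x
    rw [partialDeriv_mul i ((hc i).differentiable (by simp) x) (hg.differentiable (by simp) x), hpc,
      one_mul]
  have t1 : ∀ i : Fin n, IsTestFunction (fun x => (((x i : ℝ) : ℂ) * g x) * partialDeriv i ψ x) :=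
    fun i => (hψ.partialDeriv i).smooth_mul ((hc i).mul hg)
  have t2 : ∀ i : Fin n, IsTestFunction
      (fun x => (((x i : ℝ) : ℂ) * partialDeriv i g x + g x) * ψ x) :=
    fun i => hψ.smooth_mul (((hc i).mul (contDiff_partialDeriv hg i)).add hg)
  have e1 : ∀ x, g x * ((n : ℂ) * ψ x + fderiv ℝ ψ x x) =
      ∑ i, (((x i : ℝ) : ℂ) * g x) * partialDeriv i ψ x + (n : ℂ) * (g x * ψ x) := fun x => by
    rw [fderiv_apply_eq_sum, mul_add, Finset.mul_sum, add_comm]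
    congr 1
    · exact Finset.sum_congr rfl fun i _ => by ring
    · ring
  have e2 : ∀ x, ∑ i, (((x i : ℝ) : ℂ) * partialDeriv i g x + g x) * ψ x =
      fderiv ℝ g x x * ψ x + (n : ℂ) * (g x * ψ x) := fun x => by
    rw [fderiv_apply_eq_sum, Finset.sum_mul]
    simp only [add_mul, Finset.sum_add_distrib, Finset.sum_const, Finset.card_univ,
      Fintype.card_fin, nsmul_eq_mul]
  have t3 : IsTestFunction (fun x => (n : ℂ) * (g x * ψ x)) := (hψ.smooth_mul hg).const_mul _
  have t4 : IsTestFunction (fun x => fderiv ℝ g x x * ψ x) :=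
    hψ.smooth_mul ((hg.fderiv_right (m := ((⊤ : ℕ∞) : WithTop ℕ∞)) (by simp)).clm_apply contDiff_id)
  simp_rw [e1]
  rw [integral_add (integrable_finsetSum _ fun i _ => hi (t1 i)) (hi t3),
    integral_finsetSum _ fun i _ => hi (t1 i), Finset.sum_congr rfl fun i _ => key i,
    Finset.sum_neg_distrib, ← integral_finsetSum _ fun i _ => hi (t2 i)]
  simp_rw [e2]
  rw [integral_add (hi t4) (hi t3)]
  ring

/-- The Euler derivative of `|φ|²`. -/
theorem fderiv_mul_conj_self {φ : E n → ℂ} {x : E n} (hφ : DifferentiableAt ℝ φ x) (v : E n) :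
    fderiv ℝ (fun y => φ y * conj (φ y)) x v = ((2 * (conj (φ x) * fderiv ℝ φ x v).re : ℝ) : ℂ) := by
  have h1 : ∀ i, partialDeriv i (fun y => φ y * conj (φ y)) x =
      φ x * conj (partialDeriv i φ x) + partialDeriv i φ x * conj (φ x) := fun i => by
    have hc : DifferentiableAt ℝ (fun y => conj (φ y)) x :=
      (Complex.conjCLE.differentiableAt (x := φ x)).comp x hφ
    rw [partialDeriv_mul i hφ hc, partialDeriv_conj i hφ]
  have h2 : fderiv ℝ (fun y => φ y * conj (φ y)) x v = conj (φ x) * fderiv ℝ φ x v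
      + conj (conj (φ x) * fderiv ℝ φ x v) := by
    rw [fderiv_apply_eq_sum, fderiv_apply_eq_sum φ]
    simp_rw [h1]
    simp only [Finset.mul_sum, map_sum, map_mul, Complex.conj_ofReal, Complex.conj_conj,
      ← Finset.sum_add_distrib]
    exact Finset.sum_congr rfl fun i _ => by ring
  rw [h2, Complex.add_conj]

theorem fderiv_comp_reg_self {η : ℝ} (hη : 0 < η) {f : ℝ → ℂ} {f' : ℂ} {x : E n}
    (hf : HasDerivAt f f' (reg η x)) :
    fderiv ℝ (fun y => f (reg η y)) x x = f' * ((‖x‖ ^ 2 / reg η x : ℝ) : ℂ) := by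
  rw [fderiv_apply_eq_sum]
  simp_rw [partialDeriv_comp_reg hη hf]
  have : ((‖x‖ ^ 2 / reg η x : ℝ) : ℂ) = ∑ i, ((x i * (x i / reg η x) : ℝ) : ℂ) := by
    rw [← Complex.ofReal_sum, EuclideanSpace.real_norm_sq_eq, Finset.sum_div]
    congr 1
    exact Finset.sum_congr rfl fun i _ => by ring
  rw [this, Finset.mul_sum]
  refine Finset.sum_congr rfl fun i _ => ?_
  push_cast
  ring

/-- `∫ (|x|² + η²)⁻¹ (n ψ + x · ∇ψ) = 2 ∫ |x|² (|x|² + η²)⁻² ψ`. -/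
theorem integral_reg_inv_sq_euler {η : ℝ} (hη : 0 < η) {ψ : E n → ℂ} (hψ : IsTestFunction ψ) :
    ∫ x, (((reg η x ^ 2)⁻¹ : ℝ) : ℂ) * ((n : ℂ) * ψ x + fderiv ℝ ψ x x) =
      ∫ x, ((2 * ‖x‖ ^ 2 * ((reg η x ^ 2)⁻¹) ^ 2 : ℝ) : ℂ) * ψ x := by
  set f : ℝ → ℂ := fun s => (((s ^ 2)⁻¹ : ℝ) : ℂ) with hf
  have hfc : ContDiffOn ℝ (⊤ : ℕ∞) f (Set.Ioi 0) := by
    refine Complex.ofRealCLM.contDiff.comp_contDiffOn ?_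
    refine ContDiffOn.inv (by fun_prop) fun s hs => ?_
    have : (0 : ℝ) < s := hs
    positivity
  have hd : ∀ s : ℝ, 0 < s → HasDerivAt f ((-(2 * s) / (s ^ 2) ^ 2 : ℝ) : ℂ) s := fun s hs => by
    have := ((hasDerivAt_pow 2 s).fun_inv (by positivity)).ofReal_comp
    simpa [hf] using this
  have := integral_mul_euler (contDiff_comp_reg hη hfc) hψ
  simp_rw [hf] at this
  rw [this, ← integral_neg]
  congr 1 with x
  have hpos := reg_pos hη x
  rw [fderiv_comp_reg_self hη (hd _ hpos), ← neg_mul, ← Complex.ofReal_mul, ← Complex.ofReal_neg]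
  congr 2
  field_simp

/-- Expand |∇φ + a m⁻² x φ|² ≥ 0 with m = `reg η` and a = (n-2)/2. The cross term is an Euler
derivative of |φ|² and is integrated by parts. -/
theorem hardy_reg (hn : 3 ≤ n) {η : ℝ} (hη : 0 < η) {φ : E n → ℂ} (hφ : IsTestFunction φ) :
    (((n : ℝ) - 2) ^ 2 / 4) * ∫ x, (reg η x ^ 2)⁻¹ * ‖φ x‖ ^ 2 ≤ ∫ x, gradSq φ x := by
  set a : ℝ := ((n : ℝ) - 2) / 2 with ha
  have hn' : (3 : ℝ) ≤ n := by exact_mod_cast hn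
  have ha0 : 0 < a := by rw [ha]; linarith
  have hc := continuous_reg (n := n) η
  have hne : ∀ x : E n, reg η x ^ 2 ≠ 0 := fun x => by have := reg_pos hη x; positivity
  have hinv : Continuous fun x : E n => (reg η x ^ 2)⁻¹ := (hc.pow 2).inv₀ hne
  have hfd : Continuous fun x => fderiv ℝ φ x x :=
    (hφ.1.continuous_fderiv (by simp)).clm_apply continuous_id
  have hint : ∀ {f : E n → ℝ}, Continuous f → HasCompactSupport f → Integrable f := fun h h' =>
    h.integrable_of_hasCompactSupport h'
  have hcs : HasCompactSupport fun x => ‖φ x‖ ^ 2 := hφ.2.comp_left (g := fun z => ‖z‖ ^ 2) (by simp)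
  have hcφ := hφ.continuous
  have hcsE : HasCompactSupport fun x => 2 * (conj (φ x) * fderiv ℝ φ x x).re := by
    refine hφ.2.mono fun x hx => ?_
    rw [Function.mem_support] at hx ⊢
    exact fun h => hx (by simp [h])
  have hcE : Continuous fun x => 2 * (conj (φ x) * fderiv ℝ φ x x).re := by fun_prop
  have hgc : Continuous (gradSq φ) := by
    unfold gradSq
    exact continuous_finsetSum _ fun i _ => (hφ.partialDeriv i).continuous.norm.pow 2
  have hgcs : HasCompactSupport (gradSq φ) := by
    refine (hφ.2.fderiv (𝕜 := ℝ)).mono fun x hx => ?_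
    rw [Function.mem_support] at hx ⊢
    exact fun h => hx (by simp [gradSq, partialDeriv, h])
  have ψt : IsTestFunction (fun y => φ y * conj (φ y)) := hφ.conj.smooth_mul hφ.1
  have hE : ∫ x, (reg η x ^ 2)⁻¹ * (n * ‖φ x‖ ^ 2 + 2 * (conj (φ x) * fderiv ℝ φ x x).re) =
      ∫ x, (2 * ‖x‖ ^ 2 * ((reg η x ^ 2)⁻¹) ^ 2) * ‖φ x‖ ^ 2 := by
    have h := integral_reg_inv_sq_euler hη ψt
    simp_rw [fderiv_mul_conj_self (hφ.differentiable _), Complex.mul_conj,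
      Complex.normSq_eq_norm_sq] at h
    refine Complex.ofReal_injective ?_
    rw [← integral_complex_ofReal, ← integral_complex_ofReal]
    push_cast at h ⊢
    exact h
  have hpt : ∀ x, 0 ≤ gradSq φ x
      + (a * ((reg η x ^ 2)⁻¹ * (n * ‖φ x‖ ^ 2 + 2 * (conj (φ x) * fderiv ℝ φ x x).re))
      + (a ^ 2 * ‖x‖ ^ 2 * ((reg η x ^ 2)⁻¹) ^ 2 - a * n * (reg η x ^ 2)⁻¹) * ‖φ x‖ ^ 2) := by
    intro x
    set g := (reg η x ^ 2)⁻¹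
    have h0 : 0 ≤ ∑ i, ‖partialDeriv i φ x + ((a * g * x i : ℝ) : ℂ) * φ x‖ ^ 2 := by positivity
    have h1 : ∀ i, ‖partialDeriv i φ x + ((a * g * x i : ℝ) : ℂ) * φ x‖ ^ 2 =
        ‖partialDeriv i φ x‖ ^ 2 + a * g * (2 * (conj (φ x) * ((x i : ℂ) * partialDeriv i φ x)).re)
        + a ^ 2 * g ^ 2 * ‖φ x‖ ^ 2 * x i ^ 2 := fun i => by
      simp only [← Complex.normSq_eq_norm_sq, Complex.normSq_apply, Complex.add_re, Complex.add_im,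
        Complex.mul_re, Complex.mul_im, Complex.ofReal_re, Complex.ofReal_im, Complex.conj_re,
        Complex.conj_im]
      ring
    have h2 : ∑ i, ‖partialDeriv i φ x + ((a * g * x i : ℝ) : ℂ) * φ x‖ ^ 2 =
        gradSq φ x + a * g * (2 * (conj (φ x) * fderiv ℝ φ x x).re)
        + a ^ 2 * g ^ 2 * ‖φ x‖ ^ 2 * ‖x‖ ^ 2 := by
      have h3 : (conj (φ x) * fderiv ℝ φ x x).re =
          ∑ i, (conj (φ x) * ((x i : ℂ) * partialDeriv i φ x)).re := by
        rw [fderiv_apply_eq_sum, Finset.mul_sum, Complex.re_sum]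
      simp only [h1, h3, Finset.sum_add_distrib, ← Finset.mul_sum]
      rw [← EuclideanSpace.real_norm_sq_eq]
      rfl
    rw [h2] at h0
    linarith
  have i1 : Integrable fun x : E n =>
      (reg η x ^ 2)⁻¹ * (n * ‖φ x‖ ^ 2 + 2 * (conj (φ x) * fderiv ℝ φ x x).re) :=
    hint (by fun_prop) ((hcs.mul_left (f := fun _ => (n : ℝ))).add hcsE).mul_left
  have i2 : Integrable fun x : E n =>
      (a ^ 2 * ‖x‖ ^ 2 * ((reg η x ^ 2)⁻¹) ^ 2 - a * n * (reg η x ^ 2)⁻¹) * ‖φ x‖ ^ 2 :=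
    hint (by fun_prop) hcs.mul_left
  have i3 : Integrable fun x : E n => (2 * ‖x‖ ^ 2 * ((reg η x ^ 2)⁻¹) ^ 2) * ‖φ x‖ ^ 2 :=
    hint (by fun_prop) hcs.mul_left
  have i4 : Integrable (gradSq φ) := hint hgc hgcs
  have i5 : Integrable fun x : E n => (reg η x ^ 2)⁻¹ * ‖φ x‖ ^ 2 :=
    hint (by fun_prop) hcs.mul_left
  have hI := integral_nonneg_of_ae (μ := (volume : Measure (E n))) (ae_of_all _ hpt)
  have i12 : Integrable fun x : E n =>
      a * ((reg η x ^ 2)⁻¹ * (n * ‖φ x‖ ^ 2 + 2 * (conj (φ x) * fderiv ℝ φ x x).re))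
      + (a ^ 2 * ‖x‖ ^ 2 * ((reg η x ^ 2)⁻¹) ^ 2 - a * n * (reg η x ^ 2)⁻¹) * ‖φ x‖ ^ 2 :=
    (i1.const_mul a).add i2
  rw [integral_add i4 i12, integral_add (i1.const_mul a) i2,
    integral_const_mul, hE, ← integral_const_mul, ← integral_add (i3.const_mul a) i2] at hI
  rw [← integral_const_mul]
  have hle : ∫ x, (((n : ℝ) - 2) ^ 2 / 4) * ((reg η x ^ 2)⁻¹ * ‖φ x‖ ^ 2) ≤
      ∫ x, -(a * ((2 * ‖x‖ ^ 2 * ((reg η x ^ 2)⁻¹) ^ 2) * ‖φ x‖ ^ 2) +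
        (a ^ 2 * ‖x‖ ^ 2 * ((reg η x ^ 2)⁻¹) ^ 2 - a * n * (reg η x ^ 2)⁻¹) * ‖φ x‖ ^ 2) := by
    refine integral_mono (i5.const_mul _) ((i3.const_mul a).add i2).neg fun x => ?_
    have hp : 0 < reg η x ^ 2 := by have := reg_pos hη x; positivity
    have h1 : ‖x‖ ^ 2 * (reg η x ^ 2)⁻¹ ≤ 1 := by
      rw [← div_eq_mul_inv, div_le_one hp, reg_sq]
      nlinarith [sq_nonneg η]
    have h2 : 0 ≤ (reg η x ^ 2)⁻¹ * ‖φ x‖ ^ 2 := by positivity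
    set g := (reg η x ^ 2)⁻¹
    -- With n = 2a + 2 and |x|²g ≤ 1, the coefficient of |φ|² on the right is at least (2a² + 2a -
    -- (a² + 2a)) g = a² g.
    have e2 : (n : ℝ) = 2 * a + 2 := by rw [ha]; ring
    simp only [e2]
    have h3 := mul_le_mul_of_nonneg_right h1 h2
    nlinarith [mul_le_mul_of_nonneg_left h3 (by positivity : 0 ≤ a ^ 2 + 2 * a)]
  rw [integral_neg] at hle
  linarith

theorem sum_sqNorm_partialDeriv {φ : E n → ℂ} (hφ : IsTestFunction φ) :
    ∑ i, sqNorm (partialDeriv i φ) = ENNReal.ofReal (∫ x, gradSq φ x) := by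
  unfold gradSq
  rw [integral_finsetSum _ fun i _ => (hφ.partialDeriv i).memLp.integrable_norm_pow (by norm_num),
    ENNReal.ofReal_sum_of_nonneg fun i _ => integral_nonneg fun x => by positivity]
  exact Finset.sum_congr rfl fun i _ => sqNorm_eq_ofReal (hφ.partialDeriv i).memLp

/-- **Hardy's inequality**, with a constant uniform in the dimension. -/
theorem gradBounded_norm_inv (hn : 3 ≤ n) :
    GradBounded (fun x : E n => ((‖x‖⁻¹ : ℝ) : ℂ)) 4 := by
  have hm : Measurable fun x : E n => ((‖x‖⁻¹ : ℝ) : ℂ) := by fun_prop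
  refine ⟨hm.aestronglyMeasurable, by norm_num, fun φ hφ => ?_⟩
  set η : ℕ → ℝ := fun k => ((k : ℝ) + 1)⁻¹ with hη
  have hηpos : ∀ k, 0 < η k := fun k => by positivity
  have hη0 : Tendsto η atTop (𝓝 0) := tendsto_inv_atTop_zero.comp
    (tendsto_atTop_add_const_right _ _ tendsto_natCast_atTop_atTop)
  have hbound : ∀ k, ∫⁻ x, ‖((((reg (η k) x)⁻¹ : ℝ) : ℂ)) * φ x‖ₑ ^ 2 ≤
      4 * ∑ i, sqNorm (partialDeriv i φ) := fun k => by
    have hmem : MemLp (fun x => (((reg (η k) x)⁻¹ : ℝ) : ℂ) * φ x) 2 := by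
      have hc : Continuous fun x : E n => (((reg (η k) x)⁻¹ : ℝ) : ℂ) :=
        Complex.continuous_ofReal.comp
          ((continuous_reg (η k)).inv₀ fun x => (reg_pos (hηpos k) x).ne')
      exact (hc.mul hφ.continuous).memLp_of_hasCompactSupport hφ.2.mul_left
    have h1 := sqNorm_eq_ofReal hmem
    unfold sqNorm at h1
    rw [h1, sum_sqNorm_partialDeriv hφ, show (4 : ℝ≥0∞) = ENNReal.ofReal 4 by norm_num,
      ← ENNReal.ofReal_mul (by norm_num)]
    refine ENNReal.ofReal_le_ofReal ?_
    have h2 := hardy_reg hn (hηpos k) hφ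
    have e : ∀ x, ‖(((reg (η k) x)⁻¹ : ℝ) : ℂ) * φ x‖ ^ 2 = (reg (η k) x ^ 2)⁻¹ * ‖φ x‖ ^ 2 :=
      fun x => by
        rw [norm_mul, Complex.norm_real, mul_pow, norm_inv, Real.norm_of_nonneg
          (reg_pos (hηpos k) x).le, inv_pow]
    simp_rw [e]
    have h3 : 0 ≤ ∫ x, (reg (η k) x ^ 2)⁻¹ * ‖φ x‖ ^ 2 := integral_nonneg fun x => by positivity
    have hn' : (3 : ℝ) ≤ n := by exact_mod_cast hn
    -- For n ≥ 3 the sharp constant (n-2)²/4 is at least 1/4. The weaker constant 4 suffices for the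
    -- resolvent bound.
    have h4 : 1 / 4 ≤ ((n : ℝ) - 2) ^ 2 / 4 := by nlinarith
    linarith [mul_le_mul_of_nonneg_right h4 h3]
  have hne : ∀ᵐ x : E n, x ≠ 0 := by
    have : Nontrivial (E n) := by
      have : Nonempty (Fin n) := ⟨⟨0, by omega⟩⟩
      infer_instance
    simp [ae_iff]
  -- Fatou's lemma as η → 0.
  calc sqNorm (fun x => ((‖x‖⁻¹ : ℝ) : ℂ) * φ x)
      = ∫⁻ x, liminf (fun k => ‖((((reg (η k) x)⁻¹ : ℝ) : ℂ)) * φ x‖ₑ ^ 2) atTop := by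
        refine lintegral_congr_ae ?_
        filter_upwards [hne] with x hx
        refine Eq.symm (Tendsto.liminf_eq ?_)
        refine ((ENNReal.continuous_pow 2).tendsto _).comp (Tendsto.enorm ?_)
        refine Tendsto.mul_const _ ((Complex.continuous_ofReal.tendsto _).comp ?_)
        refine Tendsto.inv₀ ?_ (norm_ne_zero_iff.2 hx)
        have hc : Continuous fun s : ℝ => reg s x := by unfold reg; fun_prop
        have := (hc.tendsto 0).comp hη0
        simpa [reg, Function.comp_def] using this
    _ ≤ liminf (fun k => ∫⁻ x, ‖((((reg (η k) x)⁻¹ : ℝ) : ℂ)) * φ x‖ₑ ^ 2) atTop := by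
        refine lintegral_liminf_le' fun k => ?_
        have hc : Measurable fun x : E n => (((reg (η k) x)⁻¹ : ℝ) : ℂ) :=
          Complex.measurable_ofReal.comp ((continuous_reg (η k)).measurable.inv)
        exact ((hc.mul hφ.continuous.measurable).enorm.pow_const 2).aemeasurable
    _ ≤ liminf (fun _ : ℕ => 4 * ∑ i, sqNorm (partialDeriv i φ)) atTop :=
        liminf_le_liminf (Eventually.of_forall hbound)
    _ = _ := by simp

end

/-! ### Weak Lebesgue potentials are form bounded -/

section
variable {n : ℕ}

/-- Integrals of weak `L^p` functions over sets of finite measure. -/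
theorem MemWeakLp.setLIntegral_le {W : E n → ℝ} {p : ℝ} (hp : 1 < p) (hW : MemWeakLp W p) :
    ∃ C : ℝ≥0∞, C ≠ ∞ ∧ ∀ D : Set (E n), MeasurableSet D → volume D ≠ ∞ →
      ∫⁻ x in D, ‖W x‖ₑ ≤ C * volume D ^ (1 - 1 / p) := by
  obtain ⟨hm, hK⟩ := hW
  set K := ⨆ t : ℝ≥0, (t : ℝ≥0∞) * (volume {x | (t : ℝ) < ‖W x‖}) ^ (1 / p) with hKdef
  have hp0 : 0 < p := by linarith
  set κ : ℝ := K.toReal ^ p with hκ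
  have hκ0 : 0 ≤ κ := by positivity
  have htail : ∀ t : ℝ, 0 < t → volume {x | t < ‖W x‖} ≤ ENNReal.ofReal (κ * t ^ (-p)) := by
    intro t ht
    have h1 : ENNReal.ofReal t * (volume {x | t < ‖W x‖}) ^ (1 / p) ≤ K := by
      have := le_iSup (fun t : ℝ≥0 => (t : ℝ≥0∞) * (volume {x | (t : ℝ) < ‖W x‖}) ^ (1 / p))
        t.toNNReal
      rw [Real.coe_toNNReal _ ht.le] at this
      exact this
    have h2 : (volume {x | t < ‖W x‖}) ^ (1 / p) ≤ ENNReal.ofReal (K.toReal * t⁻¹) := by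
      rw [ENNReal.ofReal_mul ENNReal.toReal_nonneg, ENNReal.ofReal_toReal hK.ne,
        ENNReal.ofReal_inv_of_pos ht, ← div_eq_mul_inv, ENNReal.le_div_iff_mul_le
          (Or.inl (by simpa using ht)) (Or.inl ENNReal.ofReal_ne_top), mul_comm]
      exact h1
    have h3 := ENNReal.rpow_le_rpow h2 hp0.le
    rw [← ENNReal.rpow_mul, one_div_mul_cancel hp0.ne', ENNReal.rpow_one,
      ENNReal.ofReal_rpow_of_nonneg (by positivity) hp0.le,
      Real.mul_rpow ENNReal.toReal_nonneg (by positivity), Real.inv_rpow ht.le,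
      ← Real.rpow_neg ht.le] at h3
    exact h3
  refine ⟨ENNReal.ofReal (1 + κ / (p - 1)), ENNReal.ofReal_ne_top, fun D hD hDt => ?_⟩
  rcases eq_or_ne (volume D) 0 with h0 | h0
  · rw [Measure.restrict_eq_zero.2 h0]; simp
  set d : ℝ := (volume D).toReal with hd
  have hd0 : 0 < d := ENNReal.toReal_pos h0 hDt
  have hDd : volume D = ENNReal.ofReal d := (ENNReal.ofReal_toReal hDt).symm
  -- The layer-cake integral is cut at the height where τ^(-p) = |D|: below it the measure is at
  -- most |D|, above it the weak bound κ t^(-p) is used, and both pieces scale like |D|^(1 - 1/p).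
  set τ : ℝ := d ^ (-(1 / p)) with hτ
  have hτ0 : 0 < τ := Real.rpow_pos_of_pos hd0 _
  have e1 : ∫⁻ x in D, ‖W x‖ₑ = ∫⁻ t in Set.Ioi (0 : ℝ), volume.restrict D {x | t < ‖W x‖} := by
    rw [← lintegral_eq_lintegral_meas_lt _ (ae_of_all _ fun x => norm_nonneg _)
      hm.norm.aemeasurable.restrict]
    simp_rw [ofReal_norm]
  rw [e1, ← Set.Ioc_union_Ioi_eq_Ioi hτ0.le, lintegral_union measurableSet_Ioi
    (Set.Ioc_disjoint_Ioi le_rfl)]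
  have b1 : ∫⁻ t in Set.Ioc 0 τ, volume.restrict D {x | t < ‖W x‖} ≤ ENNReal.ofReal (τ * d) := by
    calc _ ≤ ∫⁻ _ in Set.Ioc 0 τ, volume D := by
          refine lintegral_mono fun t => ?_
          calc _ ≤ volume.restrict D Set.univ := measure_mono (Set.subset_univ _)
            _ = _ := by simp
      _ = _ := by
        rw [lintegral_const, Measure.restrict_apply_univ, Real.volume_Ioc, sub_zero, hDd,
          ← ENNReal.ofReal_mul hd0.le, mul_comm]
  have b2 : ∫⁻ t in Set.Ioi τ, volume.restrict D {x | t < ‖W x‖} ≤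
      ENNReal.ofReal (κ * (τ ^ (1 - p) / (p - 1))) := by
    have hint := integrableOn_Ioi_rpow_of_lt (a := -p) (by linarith) hτ0
    calc _ ≤ ∫⁻ t in Set.Ioi τ, ENNReal.ofReal (κ * t ^ (-p)) := by
          refine setLIntegral_mono' measurableSet_Ioi fun t ht => ?_
          exact (Measure.restrict_apply_le D _).trans (htail t (hτ0.trans ht))
      _ = ENNReal.ofReal (∫ t in Set.Ioi τ, κ * t ^ (-p)) := by
        rw [ofReal_integral_eq_lintegral_ofReal (hint.const_mul κ)]
        filter_upwards [ae_restrict_mem measurableSet_Ioi] with t ht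
        have : 0 < t := hτ0.trans ht
        positivity
      _ = _ := by
        rw [integral_const_mul, integral_Ioi_rpow_of_lt (by linarith) hτ0]
        congr 2
        rw [show -p + 1 = 1 - p by ring, show (1 - p) = -(p - 1) by ring, neg_div_neg_eq]
  refine (add_le_add b1 b2).trans (le_of_eq ?_)
  have t1 : τ * d = d ^ (1 - 1 / p) := by
    rw [hτ]
    nth_rewrite 2 [← Real.rpow_one d]
    rw [← Real.rpow_add hd0]
    ring_nf
  have t2 : τ ^ (1 - p) = d ^ (1 - 1 / p) := by
    rw [hτ, ← Real.rpow_mul hd0.le]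
    congr 1
    field_simp
    ring
  have hp1 : 0 < p - 1 := by linarith
  rw [t1, t2, hDd, ENNReal.ofReal_rpow_of_pos hd0, ← ENNReal.ofReal_mul (by positivity),
    ← ENNReal.ofReal_add (by positivity) (by positivity)]
  congr 1
  field_simp

theorem deriv_smoothTransition_eq_zero {t : ℝ} (h : t ≤ 0 ∨ 1 ≤ t) :
    deriv Real.smoothTransition t = 0 := by
  rcases h with h | h
  · refine IsLocalMin.deriv_eq_zero (Eventually.of_forall fun s => ?_)
    rw [Real.smoothTransition.zero_of_nonpos h]
    exact Real.smoothTransition.nonneg s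
  · refine IsLocalMax.deriv_eq_zero (Eventually.of_forall fun s => ?_)
    rw [Real.smoothTransition.one_of_one_le h]
    exact Real.smoothTransition.le_one s

theorem exists_bound_deriv_smoothTransition :
    ∃ M : ℝ, 0 ≤ M ∧ ∀ t, |deriv Real.smoothTransition t| ≤ M := by
  have hc : Continuous (deriv Real.smoothTransition) :=
    (Real.smoothTransition.contDiff (n := 1)).continuous_deriv le_rfl
  obtain ⟨M, hM⟩ := (isCompact_Icc (a := (0 : ℝ)) (b := 1)).exists_bound_of_continuousOn
    hc.continuousOn
  have h0 := (norm_nonneg _).trans (hM 0 (by simp))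
  refine ⟨M, h0, fun t => ?_⟩
  by_cases ht : t ∈ Set.Icc (0 : ℝ) 1
  · exact hM t ht
  · rw [deriv_smoothTransition_eq_zero]
    · simpa using h0
    · rw [Set.mem_Icc, not_and_or, not_le, not_le] at ht
      exact ht.imp le_of_lt le_of_lt

theorem norm_fderiv_apply_sq_le (φ : E n → ℂ) (x v : E n) :
    ‖fderiv ℝ φ x v‖ ^ 2 ≤ gradSq φ x * ‖v‖ ^ 2 := by
  rw [fderiv_apply_eq_sum, gradSq, EuclideanSpace.real_norm_sq_eq, mul_comm]
  have h1 : ‖∑ i, (v i : ℂ) * partialDeriv i φ x‖ ≤ ∑ i, |v i| * ‖partialDeriv i φ x‖ := by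
    refine (norm_sum_le _ _).trans (Finset.sum_le_sum fun i _ => ?_)
    rw [norm_mul, Complex.norm_real, Real.norm_eq_abs]
  calc _ ≤ (∑ i, |v i| * ‖partialDeriv i φ x‖) ^ 2 := by gcongr
    _ ≤ (∑ i, |v i| ^ 2) * ∑ i, ‖partialDeriv i φ x‖ ^ 2 := Finset.sum_mul_sq_le_sq_mul_sq _ _ _
    _ = _ := by simp_rw [sq_abs]

theorem gradSq_nonneg (φ : E n → ℂ) (x : E n) : 0 ≤ gradSq φ x :=
  Finset.sum_nonneg fun _ _ => by positivity

/-- A truncated Sobolev inequality of weak type. -/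
theorem exists_weak_sobolev (hn : 3 ≤ n) : ∃ C : ℝ≥0∞, C ≠ ∞ ∧ ∀ φ : E n → ℂ, IsTestFunction φ →
    ∀ a : ℝ, 0 < a → ENNReal.ofReal a ^ 2 * volume {x | 2 * a ≤ ‖φ x‖} ^ (1 - 2 / (n : ℝ)) ≤
      C * ∫⁻ x in {x | a < ‖φ x‖ ∧ ‖φ x‖ < 2 * a}, ENNReal.ofReal (gradSq φ x) := by
  have hn' : (3 : ℝ) ≤ n := by exact_mod_cast hn
  obtain ⟨M, hM0, hM⟩ := exists_bound_deriv_smoothTransition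
  -- The Sobolev exponent 2n/(n-2) associated with gradients in L².
  set q : ℝ≥0 := ⟨2 * n / (n - 2), div_nonneg (by linarith) (by linarith)⟩ with hq
  have hqv : (q : ℝ) = 2 * n / (n - 2) := rfl
  have hq0 : (0 : ℝ) < q := by rw [hqv]; apply div_pos <;> linarith
  have hq0' : q ≠ 0 := fun h => by rw [h] at hq0; simp at hq0
  set S : ℝ≥0 := eLpNormLESNormFDerivOfEqInnerConst (volume : Measure (E n)) (2 : ℝ≥0) with hS
  refine ⟨(S : ℝ≥0∞) ^ 2 * ENNReal.ofReal ((4 / 3 * M) ^ 2), by finiteness, fun φ hφ a ha => ?_⟩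
  -- The truncation χ(|φ|²) vanishes where |φ| ≤ a and equals a where |φ| ≥ 2a: the inner argument
  -- runs from 0 to 1 as |φ|² goes from a² to 4a². Using |φ|² in place of |φ| keeps it
  -- differentiable at zeros of φ.
  set χ : ℝ → ℝ := fun s => a * Real.smoothTransition ((s / a ^ 2 - 1) / 3) with hχ
  have hχd : ∀ s, HasDerivAt χ
      (a * (deriv Real.smoothTransition ((s / a ^ 2 - 1) / 3) * (1 / a ^ 2 / 3))) s := fun s => by
    have h1 : HasDerivAt (fun s : ℝ => (s / a ^ 2 - 1) / 3) (1 / a ^ 2 / 3) s :=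
      (((hasDerivAt_id s).div_const _).sub_const 1).div_const 3
    have h2 := (Real.smoothTransition.contDiff (n := 1)).differentiable (by simp)
      ((s / a ^ 2 - 1) / 3)
    exact (h2.hasDerivAt.comp s h1).const_mul a
  set h : E n → ℝ := fun x => χ (‖φ x‖ ^ 2) with hh
  have hNc : ContDiff ℝ 1 fun x => ‖φ x‖ ^ 2 := (hφ.1.of_le (by simp)).norm_sq ℝ
  have hhc : ContDiff ℝ 1 h := by
    have : ContDiff ℝ 1 χ := contDiff_const.mul (Real.smoothTransition.contDiff.comp (by fun_prop))
    exact this.comp hNc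
  have hhs : HasCompactSupport h := by
    refine hφ.2.comp_left (g := fun z => χ (‖z‖ ^ 2)) ?_
    simp only [hχ]
    rw [Real.smoothTransition.zero_of_nonpos (by norm_num)]
    ring
  have hfin : Module.finrank ℝ (E n) = n := by simp
  have hsob : eLpNorm h q volume ≤ S * eLpNorm (fderiv ℝ h) (2 : ℝ≥0) volume := by
    refine eLpNorm_le_eLpNorm_fderiv_of_eq_inner volume hhc hhs (by norm_num)
      (by rw [hfin]; omega) ?_
    rw [hfin, hqv]
    push_cast
    field_simp
  have hfd : ∀ x, ‖fderiv ℝ h x‖ₑ ^ 2 ≤ Set.indicator {x | a < ‖φ x‖ ∧ ‖φ x‖ < 2 * a}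
      (fun x => ENNReal.ofReal ((4 / 3 * M) ^ 2) * ENNReal.ofReal (gradSq φ x)) x := by
    intro x
    have hN : HasFDerivAt (fun y => ‖φ y‖ ^ 2) (2 • (innerSL ℝ (φ x)).comp (fderiv ℝ φ x)) x :=
      (hφ.differentiable x).hasFDerivAt.norm_sq
    have hd := (hχd (‖φ x‖ ^ 2)).comp_hasFDerivAt x hN
    have hd' : fderiv ℝ h x = _ := hd.fderiv
    by_cases hx : a < ‖φ x‖ ∧ ‖φ x‖ < 2 * a
    · rw [Set.indicator_of_mem (by exact hx), ← ENNReal.ofReal_mul (by positivity), ← ofReal_norm,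
        ← ENNReal.ofReal_pow (norm_nonneg _)]
      refine ENNReal.ofReal_le_ofReal ?_
      -- The constant: a · M/(3a²) from χ', times 2|φ| ≤ 4a from the derivative of |φ|², is 4M/3,
      -- independent of the level a.
      have hop : ‖fderiv ℝ h x‖ ≤ 4 / 3 * M * √(gradSq φ x) := by
        refine ContinuousLinearMap.opNorm_le_bound _ (by positivity) fun v => ?_
        rw [hd']
        simp only [smul_apply, ContinuousLinearMap.comp_apply,
          innerSL_apply_apply, smul_eq_mul, norm_mul, nsmul_eq_mul, Nat.cast_ofNat, Real.norm_ofNat]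
        have i1 : ‖inner ℝ (φ x) (fderiv ℝ φ x v)‖ ≤ 2 * a * (√(gradSq φ x) * ‖v‖) := by
          refine (norm_inner_le_norm _ _).trans ?_
          have : ‖fderiv ℝ φ x v‖ ≤ √(gradSq φ x) * ‖v‖ := by
            refine le_of_sq_le_sq ?_ (by positivity)
            rw [mul_pow, Real.sq_sqrt (gradSq_nonneg φ x)]
            exact norm_fderiv_apply_sq_le φ x v
          exact mul_le_mul hx.2.le this (norm_nonneg _) (by positivity)
        have i2 := hM ((‖φ x‖ ^ 2 / a ^ 2 - 1) / 3)
        rw [← Real.norm_eq_abs] at i2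
        have e1 : ‖a‖ = a := Real.norm_of_nonneg ha.le
        have e2 : ‖1 / a ^ 2 / 3‖ = 1 / a ^ 2 / 3 := Real.norm_of_nonneg (by positivity)
        rw [e1, e2]
        calc _ ≤ a * (M * (1 / a ^ 2 / 3)) * (2 * (2 * a * (√(gradSq φ x) * ‖v‖))) := by gcongr
          _ = _ := by field_simp; ring
      calc _ ≤ (4 / 3 * M * √(gradSq φ x)) ^ 2 := by gcongr
        _ = _ := by rw [mul_pow, Real.sq_sqrt (gradSq_nonneg φ x)]
    · have h0 : deriv Real.smoothTransition ((‖φ x‖ ^ 2 / a ^ 2 - 1) / 3) = 0 := by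
        refine deriv_smoothTransition_eq_zero ?_
        rw [not_and_or, not_lt, not_lt] at hx
        have ha2 : 0 < a ^ 2 := by positivity
        rcases hx with hx | hx
        · left
          have : ‖φ x‖ ^ 2 / a ^ 2 ≤ 1 := by
            rw [div_le_one ha2]
            exact pow_le_pow_left₀ (norm_nonneg _) hx 2
          linarith
        · right
          have : 4 ≤ ‖φ x‖ ^ 2 / a ^ 2 := by
            rw [le_div_iff₀ ha2]
            nlinarith
          linarith
      have h00 : fderiv ℝ h x = 0 := by rw [hd', h0, zero_mul, mul_zero, zero_smul]
      have h01 : ‖fderiv ℝ h x‖ₑ = 0 := by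
        rw [← ofReal_norm, h00, norm_zero, ENNReal.ofReal_zero]
      rw [h01, zero_pow two_ne_zero]
      exact zero_le
  have hAm : MeasurableSet {x | a < ‖φ x‖ ∧ ‖φ x‖ < 2 * a} :=
    ((isOpen_lt continuous_const hφ.continuous.norm).inter
      (isOpen_lt hφ.continuous.norm continuous_const)).measurableSet
  have hgrad : eLpNorm (fderiv ℝ h) (2 : ℝ≥0) volume ^ 2 ≤ ENNReal.ofReal ((4 / 3 * M) ^ 2) *
      ∫⁻ x in {x | a < ‖φ x‖ ∧ ‖φ x‖ < 2 * a}, ENNReal.ofReal (gradSq φ x) := by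
    have e : eLpNorm (fderiv ℝ h) (2 : ℝ≥0) volume ^ 2 = ∫⁻ x, ‖fderiv ℝ h x‖ₑ ^ 2 := by
      rw [eLpNorm_nnreal_eq_lintegral (by norm_num), ← ENNReal.rpow_natCast, ← ENNReal.rpow_mul]
      simp
    rw [e]
    refine (lintegral_mono hfd).trans (le_of_eq ?_)
    rw [lintegral_indicator hAm, lintegral_const_mul' _ _ ENNReal.ofReal_ne_top]
  -- Chebyshev's inequality for the truncation, which equals a on {|φ| ≥ 2a}. Together with Sobolev
  -- it bounds the measure of that set by the gradient on the shell alone.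
  have hcheb := mul_meas_ge_le_pow_eLpNorm' (volume : Measure (E n)) (p := q)
    (by exact_mod_cast hq0') (by simp) hhc.continuous.aestronglyMeasurable (ENNReal.ofReal a)
  have hsub : {x | 2 * a ≤ ‖φ x‖} ⊆ {x | ENNReal.ofReal a ≤ ‖h x‖ₑ} := by
    intro x hx
    have hx' : 2 * a ≤ ‖φ x‖ := hx
    have : h x = a := by
      simp only [hh, hχ]
      rw [Real.smoothTransition.one_of_one_le, mul_one]
      have : 4 ≤ ‖φ x‖ ^ 2 / a ^ 2 := by
        rw [le_div_iff₀ (by positivity)]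
        nlinarith
      linarith
    change ENNReal.ofReal a ≤ ‖h x‖ₑ
    rw [this, ← ofReal_norm, Real.norm_of_nonneg ha.le]
  have hpow : (1 - 2 / (n : ℝ)) = 2 / q := by
    rw [hqv]
    field_simp
  have h1 : ENNReal.ofReal a ^ (q : ℝ) * volume {x | 2 * a ≤ ‖φ x‖} ≤ eLpNorm h q volume ^ (q : ℝ) := by
    refine le_trans ?_ hcheb
    rw [ENNReal.coe_toReal]
    gcongr
  have h2 := ENNReal.rpow_le_rpow h1 (by positivity : 0 ≤ 2 / (q : ℝ))
  rw [ENNReal.mul_rpow_of_nonneg _ _ (by positivity), ← ENNReal.rpow_mul, ← ENNReal.rpow_mul,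
    mul_div_cancel₀ _ hq0.ne', ENNReal.rpow_ofNat, ENNReal.rpow_ofNat] at h2
  rw [hpow]
  calc _ ≤ _ := h2
    _ ≤ (S * eLpNorm (fderiv ℝ h) (2 : ℝ≥0) volume) ^ 2 := by gcongr
    _ = S ^ 2 * eLpNorm (fderiv ℝ h) (2 : ℝ≥0) volume ^ 2 := mul_pow _ _ _
    _ ≤ S ^ 2 * (ENNReal.ofReal ((4 / 3 * M) ^ 2) *
        ∫⁻ x in {x | a < ‖φ x‖ ∧ ‖φ x‖ < 2 * a}, ENNReal.ofReal (gradSq φ x)) := by gcongr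
    _ = _ := by ring

theorem sum_sqNorm_eq_lintegral {φ : E n → ℂ} (hφ : IsTestFunction φ) :
    ∑ i, sqNorm (partialDeriv i φ) = ∫⁻ x, ENNReal.ofReal (gradSq φ x) := by
  unfold sqNorm gradSq
  rw [← lintegral_finsetSum' _ fun i _ =>
    ((hφ.partialDeriv i).continuous.enorm.measurable.pow_const 2).aemeasurable]
  congr 1 with x
  rw [ENNReal.ofReal_sum_of_nonneg fun i _ => by positivity]
  refine Finset.sum_congr rfl fun i _ => ?_
  rw [ENNReal.ofReal_pow (norm_nonneg _), ofReal_norm]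

/-- Potentials in weak `L^{n/2}` are form bounded. -/
theorem MemWeakLp.exists_lintegral_le (hn : 3 ≤ n) {W : E n → ℝ} (hW : MemWeakLp W ((n : ℝ) / 2)) :
    ∃ C : ℝ≥0∞, C ≠ ∞ ∧ ∀ φ : E n → ℂ, IsTestFunction φ →
      ∫⁻ x, ‖W x‖ₑ * ‖φ x‖ₑ ^ 2 ≤ C * ∑ i, sqNorm (partialDeriv i φ) := by
  have hn' : (3 : ℝ) ≤ n := by exact_mod_cast hn
  obtain ⟨C₁, hC₁, h1⟩ := hW.setLIntegral_le (by linarith)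
  obtain ⟨C₂, hC₂, h2⟩ := exists_weak_sobolev hn
  refine ⟨16 * C₁ * C₂, by finiteness, fun φ hφ => ?_⟩
  have hpow : 1 - 1 / ((n : ℝ) / 2) = 1 - 2 / (n : ℝ) := by field_simp
  rw [hpow] at h1
  -- Dyadic levels. On `B k` one has |φ| < 4 a_k, which gives the factor 16, and the measure of {|φ|
  -- ≥ 2 a_k} is controlled by the gradient on the next lower shell `A k`. The shells are disjoint,
  -- so the sum over k is at most the full Dirichlet integral.
  set a : ℤ → ℝ := fun k => 2 ^ k with ha
  have ha0 : ∀ k, 0 < a k := fun k => by positivity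
  have ha1 : ∀ k, a (k + 1) = 2 * a k := fun k => by
    rw [ha]
    simp only
    rw [zpow_add_one₀ (by norm_num)]
    ring
  have hc := hφ.continuous.norm
  set B : ℤ → Set (E n) := fun k => {x | 2 * a k ≤ ‖φ x‖ ∧ ‖φ x‖ < 4 * a k} with hB
  set A : ℤ → Set (E n) := fun k => {x | a k < ‖φ x‖ ∧ ‖φ x‖ < 2 * a k} with hA
  have hBm : ∀ k, MeasurableSet (B k) := fun k =>
    (measurableSet_le measurable_const hc.measurable).inter
      (measurableSet_lt hc.measurable measurable_const)
  have hAm : ∀ k, MeasurableSet (A k) := fun k =>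
    (measurableSet_lt measurable_const hc.measurable).inter
      (measurableSet_lt hc.measurable measurable_const)
  have hDm : ∀ k, MeasurableSet {x | 2 * a k ≤ ‖φ x‖} := fun k =>
    measurableSet_le measurable_const hc.measurable
  have hDf : ∀ k, volume {x | 2 * a k ≤ ‖φ x‖} ≠ ∞ := fun k => by
    refine ((measure_mono fun x hx => ?_).trans_lt hφ.2.isCompact.measure_lt_top).ne
    refine subset_tsupport _ fun h0 => ?_
    have hx' : 2 * a k ≤ ‖φ x‖ := hx
    rw [h0, norm_zero] at hx'
    linarith [ha0 k]
  have hAd : Pairwise (Function.onFun Disjoint A) := by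
    have hmono : ∀ i j : ℤ, i < j → 2 * a i ≤ a j := fun i j hij => by
      rw [← ha1]
      exact zpow_le_zpow_right₀ (by norm_num) hij
    intro i j hij
    rw [Function.onFun, Set.disjoint_left]
    rintro x ⟨h1, h2⟩ ⟨h3, h4⟩
    rcases lt_or_gt_of_ne hij with h | h
    · linarith [hmono i j h]
    · linarith [hmono j i h]
  have hcov : ∀ x, ‖W x‖ₑ * ‖φ x‖ₑ ^ 2 ≤
      ∑' k, Set.indicator (B k) (fun x => ‖W x‖ₑ * ENNReal.ofReal (4 * a k) ^ 2) x := by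
    intro x
    by_cases hx : φ x = 0
    · simp [hx]
    obtain ⟨m, hm⟩ := exists_mem_Ico_zpow (x := ‖φ x‖) (y := 2) (norm_pos_iff.2 hx) (by norm_num)
    have e1 : (2 : ℝ) ^ m = 2 * a (m - 1) := by rw [← ha1]; simp [ha]
    have e2 : (2 : ℝ) ^ (m + 1) = 4 * a (m - 1) := by
      rw [zpow_add_one₀ (by norm_num), e1]; ring
    have hxB : x ∈ B (m - 1) := ⟨e1 ▸ hm.1, e2 ▸ hm.2⟩
    refine le_trans ?_ (ENNReal.le_tsum (m - 1))
    rw [Set.indicator_of_mem hxB]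
    gcongr
    rw [← ofReal_norm]
    exact ENNReal.ofReal_le_ofReal hxB.2.le
  calc ∫⁻ x, ‖W x‖ₑ * ‖φ x‖ₑ ^ 2
      ≤ ∫⁻ x, ∑' k, Set.indicator (B k) (fun x => ‖W x‖ₑ * ENNReal.ofReal (4 * a k) ^ 2) x :=
        lintegral_mono hcov
    _ = ∑' k, ∫⁻ x in B k, ‖W x‖ₑ * ENNReal.ofReal (4 * a k) ^ 2 := by
        rw [lintegral_tsum fun k => ((hW.1.enorm.mul_const _).indicator (hBm k))]
        congr 1 with k
        rw [lintegral_indicator (hBm k)]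
    _ ≤ ∑' k, 16 * C₁ * C₂ * ∫⁻ x in A k, ENNReal.ofReal (gradSq φ x) := by
        refine ENNReal.tsum_le_tsum fun k => ?_
        rw [lintegral_mul_const' _ _ (by finiteness)]
        calc _ ≤ (∫⁻ x in {x | 2 * a k ≤ ‖φ x‖}, ‖W x‖ₑ) * ENNReal.ofReal (4 * a k) ^ 2 := by
              gcongr
              exact fun x hx => hx.1
          _ ≤ (C₁ * volume {x | 2 * a k ≤ ‖φ x‖} ^ (1 - 2 / (n : ℝ))) *
              ENNReal.ofReal (4 * a k) ^ 2 := by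
              gcongr
              exact h1 _ (hDm k) (hDf k)
          _ = 16 * C₁ * (ENNReal.ofReal (a k) ^ 2 *
              volume {x | 2 * a k ≤ ‖φ x‖} ^ (1 - 2 / (n : ℝ))) := by
              rw [ENNReal.ofReal_mul (by norm_num), mul_pow, ENNReal.ofReal_ofNat]
              ring
          _ ≤ 16 * C₁ * (C₂ * ∫⁻ x in A k, ENNReal.ofReal (gradSq φ x)) :=
              mul_le_mul_right (h2 φ hφ _ (ha0 k)) _
          _ = _ := by ring
    _ = 16 * C₁ * C₂ * ∫⁻ x in ⋃ k, A k, ENNReal.ofReal (gradSq φ x) := by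
        rw [ENNReal.tsum_mul_left, lintegral_iUnion hAm hAd]
    _ ≤ 16 * C₁ * C₂ * ∑ i, sqNorm (partialDeriv i φ) := by
        rw [sum_sqNorm_eq_lintegral hφ]
        exact mul_le_mul_right (setLIntegral_le_lintegral _ _) _

theorem enorm_sqrt_mul_sq (V : E n → ℝ) (φ : E n → ℂ) (x : E n) :
    ‖((√|V x| : ℝ) : ℂ) * φ x‖ₑ ^ 2 = ‖V x‖ₑ * ‖φ x‖ₑ ^ 2 := by
  rw [enorm_mul, mul_pow]
  congr 1
  rw [← ofReal_norm, ← ENNReal.ofReal_pow (norm_nonneg _), Complex.norm_real,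
    Real.norm_of_nonneg (Real.sqrt_nonneg _), Real.sq_sqrt (abs_nonneg _), ← ofReal_norm,
    Real.norm_eq_abs]

theorem FormBounded.of_lintegral_le {V : E n → ℝ} (hm : AEStronglyMeasurable V volume) {C : ℝ≥0∞}
    (hC : C ≠ ∞) (h : ∀ φ : E n → ℂ, IsTestFunction φ →
      ∫⁻ x, ‖V x‖ₑ * ‖φ x‖ₑ ^ 2 ≤ C * ∑ i, sqNorm (partialDeriv i φ)) : FormBounded V C := by
  refine ⟨hm, ⟨?_, hC, fun φ hφ => ?_⟩⟩
  · exact (Complex.continuous_ofReal.comp (Real.continuous_sqrt.comp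
      continuous_abs)).comp_aestronglyMeasurable hm
  · unfold sqNorm
    simp_rw [enorm_sqrt_mul_sq]
    exact h φ hφ

theorem MemWeakLp.exists_formBounded (hn : 3 ≤ n) {W : E n → ℝ}
    (hW : MemWeakLp W ((n : ℝ) / 2)) : ∃ C, FormBounded W C := by
  obtain ⟨C, hC, h⟩ := hW.exists_lintegral_le hn
  exact ⟨C, .of_lintegral_le hW.1 hC h⟩

theorem MemWeakLp.sq {f : E n → ℝ} {p : ℝ} (hp : 0 < p) (hf : MemWeakLp f p) :
    MemWeakLp (fun x => f x ^ 2) (p / 2) := by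
  refine ⟨hf.1.pow 2, ?_⟩
  set K := ⨆ t : ℝ≥0, (t : ℝ≥0∞) * (volume {x | (t : ℝ) < ‖f x‖}) ^ (1 / p) with hK
  refine lt_of_le_of_lt (iSup_le fun t => ?_) (ENNReal.pow_lt_top hf.2 (n := 2))
  have h1 := le_iSup (fun t : ℝ≥0 => (t : ℝ≥0∞) * (volume {x | (t : ℝ) < ‖f x‖}) ^ (1 / p))
    (NNReal.sqrt t)
  have h2 := pow_le_pow_left₀ (zero_le) h1 2
  refine le_trans (le_of_eq ?_) h2
  have e1 : {x | (t : ℝ) < ‖f x ^ 2‖} = {x | ((NNReal.sqrt t : ℝ≥0) : ℝ) < ‖f x‖} := by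
    ext x
    simp only [Set.mem_ofPred_eq, norm_pow, Real.coe_sqrt]
    rw [Real.sqrt_lt t.coe_nonneg (norm_nonneg _)]
  rw [e1, mul_pow, ← ENNReal.coe_pow, NNReal.sq_sqrt, ← ENNReal.rpow_natCast, ← ENNReal.rpow_mul]
  congr 2
  push_cast
  field_simp

/-- Potentials with `|x| V` in weak `L^n` are form bounded. -/
theorem MemWeakLp.exists_formBounded_of_norm_mul (hn : 3 ≤ n) {V : E n → ℝ}
    (hV : MemWeakLp (fun x => ‖x‖ * V x) n) : ∃ C, FormBounded V C := by
  have hn0 : (0 : ℝ) < n := by positivity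
  obtain ⟨C, hC, h⟩ := (hV.sq hn0).exists_lintegral_le hn
  have : Nontrivial (E n) := by
    have : NeZero n := ⟨by omega⟩
    infer_instance
  have hae : ∀ᵐ x : E n, x ≠ 0 := by simp [ae_iff]
  have hVm : AEStronglyMeasurable V volume := by
    have h1 : AEStronglyMeasurable (fun x : E n => ‖x‖⁻¹ * (‖x‖ * V x)) volume :=
      (measurable_norm.inv.aestronglyMeasurable).mul hV.1
    refine h1.congr ?_
    filter_upwards [hae] with x hx
    rw [← mul_assoc, inv_mul_cancel₀ (norm_ne_zero_iff.2 hx), one_mul]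
  obtain ⟨-, -, hH⟩ := gradBounded_norm_inv hn
  refine ⟨C + 4, .of_lintegral_le hVm (by finiteness) fun φ hφ => ?_⟩
  rw [add_mul]
  refine le_trans ?_ (add_le_add (h φ hφ) (hH φ hφ))
  unfold sqNorm
  rw [← lintegral_add_right]
  · refine lintegral_mono_ae ?_
    filter_upwards [hae] with x hx
    have hx' : 0 < ‖x‖ := norm_pos_iff.2 hx
    rw [enorm_mul ((‖x‖⁻¹ : ℝ) : ℂ), mul_pow _ ‖φ x‖ₑ, ← add_mul]
    refine mul_le_mul_left ?_ _
    rw [← ofReal_norm, ← ofReal_norm, ← ofReal_norm, ← ENNReal.ofReal_pow (norm_nonneg _),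
      ← ENNReal.ofReal_add (norm_nonneg _) (by positivity)]
    refine ENNReal.ofReal_le_ofReal ?_
    rw [Complex.norm_real, norm_inv, norm_norm, norm_pow, norm_mul, norm_norm]
    -- Arithmetic-geometric mean: |V| ≤ (|x||V|)² + |x|⁻². The first term lies in weak L^{n/2} and
    -- the second is handled by Hardy.
    have h1 : ‖V x‖ = (‖x‖ * ‖V x‖) * ‖x‖⁻¹ := by field_simp
    nlinarith [sq_nonneg (‖x‖ * ‖V x‖ - ‖x‖⁻¹), sq_nonneg (‖x‖ * ‖V x‖ + ‖x‖⁻¹)]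
  · have : Measurable fun x : E n => ((‖x‖⁻¹ : ℝ) : ℂ) := by fun_prop
    exact ((this.mul hφ.continuous.measurable).enorm.pow_const 2)
end

/-! ### Dilations -/

/-- The unitary group of dilations, `(U_t u)(x) = e^{nt/2} u(e^t x)`. -/
def dil {n : ℕ} (t : ℝ) (u : E n → ℂ) (x : E n) : ℂ :=
  ((Real.exp (n / 2 * t) : ℝ) : ℂ) * u (Real.exp t • x)

section
variable {n : ℕ}

theorem lintegral_comp_exp_smul (F : E n → ℝ≥0∞) (t : ℝ) :
    ∫⁻ x, F (Real.exp t • x) = ENNReal.ofReal (Real.exp (-(n * t))) * ∫⁻ x, F x := by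
  have h0 : Real.exp t ≠ 0 := (Real.exp_pos t).ne'
  have he : MeasurableEmbedding (fun x : E n => Real.exp t • x) :=
    (Homeomorph.smulOfNeZero _ h0).measurableEmbedding
  rw [← he.lintegral_map, Measure.map_addHaar_smul volume h0, lintegral_smul_measure,
    smul_eq_mul]
  congr 2
  rw [abs_of_pos (by positivity), finrank_euclideanSpace_fin, ← Real.exp_nat_mul, Real.exp_neg]

theorem sqNorm_dil (t : ℝ) (u : E n → ℂ) : sqNorm (dil t u) = sqNorm u := by
  unfold sqNorm dil
  have : ∀ x : E n, ‖((Real.exp (n / 2 * t) : ℝ) : ℂ) * u (Real.exp t • x)‖ₑ ^ 2 =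
      ENNReal.ofReal (Real.exp (n * t)) * ‖u (Real.exp t • x)‖ₑ ^ 2 := fun x => by
    rw [enorm_mul, mul_pow, ← ofReal_norm, Complex.norm_real, Real.norm_of_nonneg (Real.exp_pos _).le,
      ← ENNReal.ofReal_pow (Real.exp_pos _).le, ← Real.exp_nat_mul]
    congr 3
    push_cast
    ring
  simp_rw [this]
  rw [lintegral_const_mul' _ _ ENNReal.ofReal_ne_top,
    lintegral_comp_exp_smul (fun x => ‖u x‖ₑ ^ 2), ← mul_assoc,
    ← ENNReal.ofReal_mul (Real.exp_pos _).le, ← Real.exp_add]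
  simp

theorem aestronglyMeasurable_dil {u : E n → ℂ} (hu : AEStronglyMeasurable u volume) (t : ℝ) :
    AEStronglyMeasurable (dil t u) volume :=
  aestronglyMeasurable_const.mul (hu.comp_quasiMeasurePreserving
    (Measure.quasiMeasurePreserving_smul volume (Real.exp_pos t).ne'))

theorem memLp_dil {u : E n → ℂ} (hu : MemLp u 2) (t : ℝ) : MemLp (dil t u) 2 :=
  memLp_of_sqNorm_lt_top (aestronglyMeasurable_dil hu.1 t) (by
    rw [sqNorm_dil]; exact hu.sqNorm_lt_top)

theorem dil_zero (u : E n → ℂ) : dil 0 u = u := by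
  ext x; simp [dil]

theorem pairing_dil (t : ℝ) (u w : E n → ℂ) : pairing (dil t u) w = pairing u (dil (-t) w) := by
  unfold pairing
  have h := Measure.integral_comp_smul (volume : Measure (E n))
    (fun x => u x * conj (dil (-t) w x)) (Real.exp t)
  have e : ∀ x, dil t u x * conj (w x) =
      ((Real.exp (n * t) : ℝ) : ℂ) * (u (Real.exp t • x) * conj (dil (-t) w (Real.exp t • x))) := by
    intro x
    unfold dil
    rw [smul_smul, ← Real.exp_add, neg_add_cancel, Real.exp_zero, one_smul, map_mul,
      Complex.conj_ofReal]
    have : Real.exp (n * t) * Real.exp (n / 2 * -t) = Real.exp (n / 2 * t) := by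
      rw [← Real.exp_add]; ring_nf
    rw [← this]
    push_cast
    ring
  simp_rw [e]
  rw [integral_const_mul, h, finrank_euclideanSpace_fin, abs_of_pos (by positivity),
    ← Real.exp_nat_mul, Complex.real_smul, ← mul_assoc, ← Complex.ofReal_mul,
    mul_inv_cancel₀ (Real.exp_pos _).ne']
  simp

variable {ι : Type*} {l : Filter ι} {F : ι → E n → ℂ} {f : E n → ℂ}

theorem L2Tendsto.dil (hF : L2Tendsto l F f) (t : ℝ) :
    L2Tendsto l (fun i => WeightedResolvent.dil t (F i)) (WeightedResolvent.dil t f) := by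
  refine ⟨fun i => memLp_dil (hF.mem i) t, memLp_dil hF.lim t, hF.tendsto.congr fun i => ?_⟩
  rw [← sqNorm_dil t]
  congr 1 with x
  simp only [WeightedResolvent.dil]
  ring

theorem exists_test_L2Tendsto (hf : MemLp f 2) :
    ∃ φ : ℕ → E n → ℂ, (∀ k, IsTestFunction (φ k)) ∧ L2Tendsto atTop φ f := by
  have hex : ∀ k : ℕ, ∃ φ : E n → ℂ, IsTestFunction φ ∧
      sqNorm (fun x => φ x - f x) ≤ ENNReal.ofReal ((1 / ((k : ℝ) + 1)) ^ 2) := by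
    intro k
    obtain ⟨φ, hφs, hφ, h⟩ := hf.exist_eLpNorm_sub_le (ε := 1 / ((k : ℝ) + 1)) (by norm_num)
      (by norm_num) (by positivity)
    refine ⟨φ, ⟨hφ, hφs⟩, ?_⟩
    rw [← eLpNorm_sq_eq, ENNReal.ofReal_pow (by positivity)]
    have e : eLpNorm (fun x => φ x - f x) 2 volume = eLpNorm (f - φ) 2 volume :=
      eLpNorm_sub_comm φ f 2 volume
    rw [e]
    gcongr
  choose φ h1 h2 using hex
  refine ⟨φ, h1, fun k => (h1 k).memLp, hf, ?_⟩
  have h0 : Tendsto (fun k : ℕ => ENNReal.ofReal ((1 / ((k : ℝ) + 1)) ^ 2)) atTop (𝓝 0) := by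
    have := (tendsto_one_div_add_atTop_nhds_zero_nat (𝕜 := ℝ)).pow 2
    have := ENNReal.tendsto_ofReal this
    simpa using this
  exact tendsto_of_tendsto_of_tendsto_of_le_of_le tendsto_const_nhds h0 (fun _ => zero_le) h2

theorem IsTestFunction.dil {φ : E n → ℂ} (hφ : IsTestFunction φ) (t : ℝ) :
    IsTestFunction (WeightedResolvent.dil t φ) :=
  ⟨contDiff_const.mul (hφ.1.comp (contDiff_const_smul _)),
    (hφ.2.comp_homeomorph (Homeomorph.smulOfNeZero _ (Real.exp_pos t).ne')).mul_left⟩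

theorem fderiv_exp_smul {φ : E n → ℂ} (hφ : Differentiable ℝ φ) (t : ℝ) (c : ℂ) (x v : E n) :
    fderiv ℝ (fun y => c * φ (Real.exp t • y)) x v =
      c * (Real.exp t * fderiv ℝ φ (Real.exp t • x) v) := by
  have h1 : HasFDerivAt (fun y : E n => Real.exp t • y) (Real.exp t • ContinuousLinearMap.id ℝ (E n)) x :=
    (hasFDerivAt_id x).fun_const_smul _
  have h2 := ((hφ (Real.exp t • x)).hasFDerivAt.comp x h1).const_mul c
  have h3 : fderiv ℝ (fun y => c * φ (Real.exp t • y)) x = _ := h2.fderiv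
  rw [h3]
  simp

theorem partialDeriv_dil {φ : E n → ℂ} (hφ : IsTestFunction φ) (t : ℝ) (i : Fin n) :
    partialDeriv i (dil t φ) = fun x => ((Real.exp t : ℝ) : ℂ) * dil t (partialDeriv i φ) x := by
  ext x
  have := fderiv_exp_smul hφ.differentiable t ((Real.exp (n / 2 * t) : ℝ) : ℂ) x
    (EuclideanSpace.single i 1)
  unfold partialDeriv dil
  rw [this]
  ring

theorem IsH1.dil {u : E n → ℂ} {G : Fin n → E n → ℂ} (h : IsH1 u G) (t : ℝ) :
    IsH1 (WeightedResolvent.dil t u)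
      (fun i x => ((Real.exp t : ℝ) : ℂ) * WeightedResolvent.dil t (G i) x) := by
  obtain ⟨φ, h1, h2, h3⟩ := h
  refine ⟨fun k => WeightedResolvent.dil t (φ k), fun k => (h1 k).dil t, h2.dil t, fun i => ?_⟩
  simp_rw [fun k => partialDeriv_dil (h1 k) t i]
  exact ((h3 i).dil t).const_mul _

/-- A single ball and a single bound serve all dilates with |t| ≤ T. This is the domination needed
for limits and derivatives in t. -/
theorem exists_bound_comp_exp_smul {ψ : E n → ℂ} (hψ : Continuous ψ) (hs : HasCompactSupport ψ)
    (T : ℝ) : ∃ M R : ℝ, 0 ≤ M ∧ ∀ t, |t| ≤ T → ∀ x : E n,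
      ‖ψ (Real.exp t • x)‖ ≤ (Metric.closedBall (0 : E n) R).indicator (fun _ => M) x := by
  obtain ⟨M, hM⟩ := hs.exists_bound_of_continuous hψ
  obtain ⟨R, hR⟩ := hs.isCompact.isBounded.subset_closedBall (0 : E n)
  have hM0 : 0 ≤ M := (norm_nonneg _).trans (hM 0)
  refine ⟨M, Real.exp T * R, hM0, fun t ht x => ?_⟩
  by_cases h0 : ψ (Real.exp t • x) = 0
  · rw [h0, norm_zero]
    exact Set.indicator_nonneg (fun _ _ => hM0) x
  · have hx := hR (subset_tsupport _ h0)
    rw [mem_closedBall_zero_iff, norm_smul, Real.norm_of_nonneg (Real.exp_pos t).le] at hx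
    rw [Set.indicator_of_mem]
    · exact hM _
    · rw [mem_closedBall_zero_iff]
      have h1 : Real.exp T * Real.exp t ≥ 1 := by
        rw [← Real.exp_add]
        exact Real.one_le_exp (by linarith [neg_abs_le t])
      calc ‖x‖ ≤ (Real.exp T * Real.exp t) * ‖x‖ := le_mul_of_one_le_left (norm_nonneg _) h1
        _ = Real.exp T * (Real.exp t * ‖x‖) := by ring
        _ ≤ _ := by gcongr

theorem IsTestFunction.tendsto_dil {φ : E n → ℂ} (hφ : IsTestFunction φ) (s : ℝ) :
    Tendsto (fun t => sqNorm (fun x => WeightedResolvent.dil t φ x - WeightedResolvent.dil s φ x))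
      (𝓝 s) (𝓝 0) := by
  have hs : s ∈ Metric.ball s 1 := Metric.mem_ball_self one_pos
  obtain ⟨M, R, hM, hb⟩ := exists_bound_comp_exp_smul hφ.continuous hφ.2 (|s| + 1)
  set b : E n → ℝ := fun x => Real.exp (n / 2 * (|s| + 1)) *
    (Metric.closedBall (0 : E n) R).indicator (fun _ => M) x with hbdef
  have hle : ∀ t ∈ Metric.ball s 1, ∀ x, ‖WeightedResolvent.dil t φ x‖ ≤ b x := fun t ht x => by
    rw [Metric.mem_ball, Real.dist_eq] at ht
    have h1 : |t| ≤ |s| + 1 := by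
      have := abs_sub_abs_le_abs_sub t s
      linarith
    rw [WeightedResolvent.dil, norm_mul, Complex.norm_real, Real.norm_of_nonneg (Real.exp_pos _).le]
    have h2 : t ≤ |s| + 1 := (le_abs_self t).trans h1
    exact mul_le_mul (Real.exp_le_exp.2 (by gcongr)) (hb t h1 x) (norm_nonneg _) (by positivity)
  -- The index set is restricted to a ball around s because the dominated convergence criterion asks
  -- for the bound at every index.
  have key : L2Tendsto (𝓝 (⟨s, hs⟩ : Metric.ball s 1))
      (fun t => WeightedResolvent.dil (t : ℝ) φ) (WeightedResolvent.dil s φ) := by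
    refine .of_dominated (b := b) (fun t => (hφ.dil _).continuous.aestronglyMeasurable)
      (hφ.dil _).continuous.aestronglyMeasurable ?_ (fun t => ae_of_all _ (hle t t.2))
      (ae_of_all _ (hle s hs)) (ae_of_all _ fun x => ?_)
    · exact (memLp_indicator_const 2 measurableSet_closedBall M
        (Or.inr measure_closedBall_lt_top.ne)).const_mul _
    · have hc : Continuous fun t : Metric.ball s 1 => WeightedResolvent.dil (t : ℝ) φ x := by
        have := hφ.continuous
        unfold WeightedResolvent.dil
        fun_prop
      exact hc.tendsto _
  have h2 := key.tendsto
  rw [← map_nhds_subtype_coe_eq_nhds hs (Metric.isOpen_ball.mem_nhds hs)]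
  exact tendsto_map'_iff.2 h2

/-- Strong continuity of the dilation group. -/
theorem l2Tendsto_dil (hf : MemLp f 2) (s : ℝ) :
    L2Tendsto (𝓝 s) (fun t => dil t f) (dil s f) := by
  refine ⟨fun t => memLp_dil hf t, memLp_dil hf s, ?_⟩
  obtain ⟨φ, h1, h2⟩ := exists_test_L2Tendsto hf
  have hsub : ∀ t k, sqNorm (fun x => dil t f x - dil t (φ k) x) =
      sqNorm (fun x => φ k x - f x) := fun t k => by
    rw [← sqNorm_dil t (fun x => φ k x - f x)]
    unfold sqNorm
    congr 1 with x
    rw [← enorm_neg]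
    congr 2
    simp only [dil]
    ring
  rw [ENNReal.tendsto_nhds_zero]
  intro ε hε
  -- Two uses of the quasi-triangle inequality: by unitarity the two approximation errors contribute
  -- 2 + 4 = 6 copies of ‖φ_k - f‖², and the dilation error of φ_k enters 4 times.
  have h3 : Tendsto (fun k => 6 * sqNorm (fun x => φ k x - f x)) atTop (𝓝 0) := by
    have := ENNReal.Tendsto.const_mul (a := 6) h2.tendsto (Or.inr (by norm_num))
    simpa using this
  obtain ⟨k, hk⟩ := (ENNReal.tendsto_nhds_zero.1 h3 (ε / 2) (ENNReal.half_pos hε.ne')).exists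
  have h4 : Tendsto (fun t => 4 * sqNorm (fun x => dil t (φ k) x -
      dil s (φ k) x)) (𝓝 s) (𝓝 0) := by
    have := ENNReal.Tendsto.const_mul (a := 4) ((h1 k).tendsto_dil s) (Or.inr (by norm_num))
    simpa using this
  filter_upwards [ENNReal.tendsto_nhds_zero.1 h4 (ε / 2) (ENNReal.half_pos hε.ne')] with t ht
  have i1 := sqNorm_sub_le (h := dil s f) (memLp_dil hf t)
    (memLp_dil (h1 k).memLp t)
  have i2 := sqNorm_sub_le (h := dil s f) (memLp_dil (h1 k).memLp t)
    (memLp_dil (h1 k).memLp s)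
  have i3 : sqNorm (fun x => dil s (φ k) x - dil s f x) =
      sqNorm (fun x => φ k x - f x) := by
    rw [← hsub s k]
    unfold sqNorm
    simp_rw [enorm_sub_rev]
  rw [hsub] at i1
  rw [i3] at i2
  calc _ ≤ _ := i1
    _ ≤ 2 * sqNorm (fun x => φ k x - f x) + 2 * (2 * sqNorm (fun x =>
        dil t (φ k) x - dil s (φ k) x) +
        2 * sqNorm (fun x => φ k x - f x)) := by gcongr
    _ = 6 * sqNorm (fun x => φ k x - f x) + 4 * sqNorm (fun x =>
        dil t (φ k) x - dil s (φ k) x) := by ring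
    _ ≤ ε / 2 + ε / 2 := add_le_add hk ht
    _ = ε := ENNReal.add_halves ε

/-- Differentiation of dilates against a locally integrable function. -/
theorem hasDerivAt_integral_exp_smul {g : E n → ℂ} (hg : LocallyIntegrable g) {ψ : E n → ℂ}
    (hψ : IsTestFunction ψ) (c t : ℝ) :
    HasDerivAt (fun t => ∫ x, g x * (((Real.exp (c * t) : ℝ) : ℂ) * ψ (Real.exp t • x)))
      (∫ x, g x * ((c : ℂ) * (((Real.exp (c * t) : ℝ) : ℂ) * ψ (Real.exp t • x)) +
        fderiv ℝ (fun y => ((Real.exp (c * t) : ℝ) : ℂ) * ψ (Real.exp t • y)) x x)) t := by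
  -- With this χ the t-derivative of e^{ct} ψ(e^t x) is e^{ct} χ(e^t x), so derivatives of dilates
  -- are again dilates of one fixed function.
  set χ : E n → ℂ := fun y => (c : ℂ) * ψ y + fderiv ℝ ψ y y with hχ
  have hfd : Continuous (fderiv ℝ ψ) := hψ.1.continuous_fderiv (by simp)
  have hψc := hψ.continuous
  have hχc : Continuous χ := by
    have : Continuous fun y => fderiv ℝ ψ y y := hfd.clm_apply continuous_id
    fun_prop
  have hχs : HasCompactSupport χ := by
    refine hψ.2.mul_left.add (hψ.2.fderiv (𝕜 := ℝ) |>.mono' ?_)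
    intro y hy
    refine subset_tsupport _ fun h0 => hy ?_
    simp [h0]
  have e : ∀ t x, (c : ℂ) * (((Real.exp (c * t) : ℝ) : ℂ) * ψ (Real.exp t • x)) +
      fderiv ℝ (fun y => ((Real.exp (c * t) : ℝ) : ℂ) * ψ (Real.exp t • y)) x x =
      ((Real.exp (c * t) : ℝ) : ℂ) * χ (Real.exp t • x) := fun t x => by
    rw [fderiv_exp_smul hψ.differentiable, hχ]
    simp only [map_smul, Complex.real_smul]
    ring
  simp_rw [e]
  obtain ⟨M, R, hM, hb⟩ := exists_bound_comp_exp_smul hχc hχs (|t| + 1)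
  obtain ⟨M', R', hM', hb'⟩ := exists_bound_comp_exp_smul hψc hψ.2 (|t| + 1)
  have hint : ∀ R M : ℝ, Integrable fun x =>
      ‖g x‖ * (Metric.closedBall (0 : E n) R).indicator (fun _ => M) x := fun R M => by
    have h1 : IntegrableOn (fun x => ‖g x‖ * M) (Metric.closedBall (0 : E n) R) :=
      (hg.integrableOn_isCompact (isCompact_closedBall (0 : E n) R)).norm.mul_const M
    rw [← integrable_indicator_iff measurableSet_closedBall] at h1
    refine h1.congr (ae_of_all _ fun x => ?_)
    by_cases hx : x ∈ Metric.closedBall (0 : E n) R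
    · simp only [Set.indicator_of_mem hx]
    · simp only [Set.indicator_of_notMem hx, mul_zero]
  have hgm := hg.aestronglyMeasurable
  refine (hasDerivAt_integral_of_dominated_loc_of_deriv_le
    (F := fun t x => g x * (((Real.exp (c * t) : ℝ) : ℂ) * ψ (Real.exp t • x)))
    (F' := fun t x => g x * (((Real.exp (c * t) : ℝ) : ℂ) * χ (Real.exp t • x)))
    (bound := fun x => Real.exp (|c| * (|t| + 1)) *
      (‖g x‖ * (Metric.closedBall (0 : E n) R).indicator (fun _ => M) x))
    (Metric.ball_mem_nhds t one_pos) ?_ ?_ ?_ ?_ ((hint R M).const_mul _) ?_).2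
  · refine Eventually.of_forall fun s => hgm.mul ?_
    exact Continuous.aestronglyMeasurable (by fun_prop)
  · refine ((hint R' M').const_mul (Real.exp (c * t))).mono' (hgm.mul
      (Continuous.aestronglyMeasurable (by fun_prop))) (ae_of_all _ fun x => ?_)
    have := hb' t (by linarith) x
    rw [norm_mul, norm_mul, Complex.norm_real, Real.norm_of_nonneg (Real.exp_pos _).le]
    calc _ = Real.exp (c * t) * (‖g x‖ * ‖ψ (Real.exp t • x)‖) := by ring
      _ ≤ _ := by gcongr
  · exact hgm.mul (Continuous.aestronglyMeasurable (by fun_prop))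
  · refine ae_of_all _ fun x s hs => ?_
    rw [Metric.mem_ball, Real.dist_eq] at hs
    have h1 : |s| ≤ |t| + 1 := by
      have := abs_sub_abs_le_abs_sub s t
      linarith
    have h2 : c * s ≤ |c| * (|t| + 1) :=
      (le_abs_self _).trans (by rw [abs_mul]; gcongr)
    rw [norm_mul, norm_mul, Complex.norm_real, Real.norm_of_nonneg (Real.exp_pos _).le]
    calc _ = Real.exp (c * s) * (‖g x‖ * ‖χ (Real.exp s • x)‖) := by ring
      _ ≤ _ := by
        have := hb s h1 x
        gcongr
  · refine ae_of_all _ fun x s _ => ?_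
    have d1 : HasDerivAt (fun s : ℝ => ((Real.exp (c * s) : ℝ) : ℂ))
        ((Real.exp (c * s) * c : ℝ) : ℂ) s := by
      have := ((hasDerivAt_id s).const_mul c).exp
      simp only [mul_one, id] at this
      exact this.ofReal_comp
    have d2 : HasDerivAt (fun s : ℝ => Real.exp s • x) (Real.exp s • x) s :=
      (Real.hasDerivAt_exp s).smul_const x
    have d3 := (hψ.differentiable (Real.exp s • x)).hasFDerivAt.comp_hasDerivAt s d2
    refine ((d1.mul d3).const_mul (g x)).congr_deriv ?_
    simp only [hχ, Function.comp_apply]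
    push_cast
    ring

end

/-! ### The virial identity -/

section
variable {n : ℕ} {V W : E n → ℝ} {C C' : ℝ≥0∞} {u : E n → ℂ} {G : Fin n → E n → ℂ}

theorem exists_test_eq_one_on {K : Set (E n)} (hK : IsCompact K) :
    ∃ χ : E n → ℂ, IsTestFunction χ ∧ ∀ x ∈ K, χ x = 1 := by
  obtain ⟨R, hR0, hR⟩ := hK.isBounded.subset_closedBall_lt 0 (0 : E n)
  obtain ⟨χ, hχ⟩ : ∃ χ : ContDiffBump (0 : E n), χ.rIn = R := ⟨⟨R, R + 1, hR0, by linarith⟩, rfl⟩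
  refine ⟨fun x => ((χ x : ℝ) : ℂ), ⟨Complex.ofRealCLM.contDiff.comp χ.contDiff,
    χ.hasCompactSupport.comp_left Complex.ofReal_zero⟩, fun x hx => ?_⟩
  change ((χ x : ℝ) : ℂ) = 1
  rw [χ.one_of_mem_closedBall (hχ ▸ hR hx), Complex.ofReal_one]

/-- Apply form integrability to a test function equal to 1 on the given compact set. -/
theorem FormBounded.locallyIntegrable (hV : FormBounded V C) :
    LocallyIntegrable (fun x => (V x : ℂ)) := by
  rw [locallyIntegrable_iff]
  intro K hK
  obtain ⟨χ, ht, h1⟩ := exists_test_eq_one_on hK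
  refine (hV.integrable ht.isH1 ht.isH1).integrableOn.congr_fun (fun x hx => ?_) hK.measurableSet
  simp only [h1 x hx, map_one, mul_one]

theorem norm_sub_sq_complex (a b : ℂ) :
    ‖a - b‖ ^ 2 = ‖a‖ ^ 2 + ‖b‖ ^ 2 - 2 * (b * conj a).re := by
  rw [← Complex.normSq_eq_norm_sq, ← Complex.normSq_eq_norm_sq, ← Complex.normSq_eq_norm_sq,
    Complex.normSq_sub]
  simp only [Complex.mul_re, Complex.conj_re, Complex.conj_im]
  ring

theorem integral_norm_sub_sq {f g : E n → ℂ} (hf : MemLp f 2) (hg : MemLp g 2) :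
    ∫ x, ‖f x - g x‖ ^ 2 = (∫ x, ‖f x‖ ^ 2) + (∫ x, ‖g x‖ ^ 2) - 2 * (pairing g f).re := by
  have i1 : Integrable fun x => ‖f x‖ ^ 2 := hf.integrable_norm_pow (by norm_num)
  have i2 : Integrable fun x => ‖g x‖ ^ 2 := hg.integrable_norm_pow (by norm_num)
  have i3 := integrable_mul_conj hg hf
  simp_rw [norm_sub_sq_complex]
  have i4 : Integrable fun x => 2 * (g x * conj (f x)).re := i3.re.const_mul 2
  have i5 : Integrable fun x => ‖f x‖ ^ 2 + ‖g x‖ ^ 2 := i1.add i2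
  rw [integral_sub i5 i4, integral_add i1 i2, integral_const_mul]
  congr 2
  exact integral_re i3

theorem FormBounded.integral_sub_sq (hV : FormBounded V C) (hu : IsH1 u G) {w : E n → ℂ}
    {K : Fin n → E n → ℂ} (hw : IsH1 w K) :
    ∫ x, V x * ‖w x - u x‖ ^ 2 = (∫ x, V x * ‖w x‖ ^ 2) + (∫ x, V x * ‖u x‖ ^ 2)
      - 2 * (∫ x, (V x : ℂ) * u x * conj (w x)).re := by
  have i1 := hV.integrable_sq hw
  have i2 := hV.integrable_sq hu
  have i3 := hV.integrable hu hw
  have i4 : Integrable fun x => 2 * ((V x : ℂ) * u x * conj (w x)).re := i3.re.const_mul 2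
  have i5 : Integrable fun x => V x * ‖w x‖ ^ 2 + V x * ‖u x‖ ^ 2 := i1.add i2
  have e : ∀ x, V x * ‖w x - u x‖ ^ 2 = V x * ‖w x‖ ^ 2 + V x * ‖u x‖ ^ 2
      - 2 * ((V x : ℂ) * u x * conj (w x)).re := fun x => by
    rw [norm_sub_sq_complex, mul_assoc (V x : ℂ), Complex.re_ofReal_mul]
    ring
  simp_rw [e]
  rw [integral_sub i5 i4, integral_add i1 i2, integral_const_mul]
  congr 2
  exact integral_re i3

theorem norm_dil_sq (V : E n → ℝ) (φ : E n → ℂ) (t : ℝ) (x : E n) :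
    ((V x * ‖dil t φ x‖ ^ 2 : ℝ) : ℂ) = (V x : ℂ) * (((Real.exp (n * t) : ℝ) : ℂ) *
      (φ (Real.exp t • x) * conj (φ (Real.exp t • x)))) := by
  rw [Complex.mul_conj, Complex.normSq_eq_norm_sq, dil, norm_mul, mul_pow, Complex.norm_real,
    Real.norm_of_nonneg (Real.exp_pos _).le, ← Real.exp_nat_mul]
  have : Real.exp (((2 : ℕ) : ℝ) * (n / 2 * t)) = Real.exp (n * t) := by
    congr 1; push_cast; ring
  rw [this]
  push_cast
  ring

/-- The density |U_t φ|² is e^{nt}|φ|²(e^t x), so its t-derivative has the shape nψ + x·∇ψ, and the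
distributional definition of W = x·∇V applies with ψ = |U_t φ|². -/
theorem IsTestFunction.hasDerivAt_potential_dil (hV : FormBounded V C)
    (hE : IsWeakEulerDerivative V W) {φ : E n → ℂ} (hφ : IsTestFunction φ) (t : ℝ) :
    HasDerivAt (fun t => ∫ x, V x * ‖WeightedResolvent.dil t φ x‖ ^ 2)
      (-∫ x, W x * ‖WeightedResolvent.dil t φ x‖ ^ 2) t := by
  have hψ : IsTestFunction fun x => φ x * conj (φ x) := hφ.conj.smooth_mul hφ.1
  have h := hasDerivAt_integral_exp_smul hV.locallyIntegrable hψ n t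
  have hψt : IsTestFunction fun x => ((Real.exp (n * t) : ℝ) : ℂ) *
      (φ (Real.exp t • x) * conj (φ (Real.exp t • x))) := by
    have := (hφ.dil t).conj.smooth_mul (hφ.dil t).1
    convert this using 2 with x
    have := norm_dil_sq (fun _ => 1) φ t x
    rw [Complex.mul_conj (WeightedResolvent.dil t φ x), Complex.normSq_eq_norm_sq]
    rw [Complex.ofReal_one, one_mul, one_mul] at this
    exact this.symm
  simp_rw [Complex.ofReal_natCast] at h
  rw [hE _ hψt] at h
  simp_rw [← norm_dil_sq, integral_complex_ofReal, ← Complex.ofReal_neg] at h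
  have h2 := Complex.reCLM.hasFDerivAt.comp_hasDerivAt t h
  exact h2

theorem FormBounded.abs_integral_le (hW : FormBounded W C) (hu : IsH1 u G) :
    |∫ x, W x * ‖u x‖ ^ 2| ≤ C.toReal * ∑ i, ∫ x, ‖G i x‖ ^ 2 := by
  have h1 : |∫ x, W x * ‖u x‖ ^ 2| ≤ ∫ x, ‖((√|W x| : ℝ) : ℂ) * u x‖ ^ 2 := by
    rw [← Real.norm_eq_abs]
    refine (norm_integral_le_integral_norm _).trans (le_of_eq ?_)
    congr 1 with x
    rw [norm_mul, norm_mul, mul_pow, Complex.norm_real, Real.norm_of_nonneg (Real.sqrt_nonneg _),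
      Real.sq_sqrt (abs_nonneg _), norm_pow, norm_norm, Real.norm_eq_abs]
  refine h1.trans ?_
  have hm := hW.bdd.memLp hu
  rw [integral_norm_sq_eq hm.1]
  have e : ∑ i, ∫ x, ‖G i x‖ ^ 2 = (∑ i, sqNorm (G i)).toReal := by
    rw [ENNReal.toReal_sum fun i _ => (hu.memLp_grad i).sqNorm_lt_top.ne]
    exact Finset.sum_congr rfl fun i _ => integral_norm_sq_eq (hu.memLp_grad i).1
  rw [e, ← ENNReal.toReal_mul]
  exact ENNReal.toReal_mono (ENNReal.mul_lt_top hW.bdd.ne_top.lt_top hu.sum_sqNorm_lt_top).ne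
    (hW.bdd.bound_isH1 hu)

theorem FormBounded.tendsto_sq {ι : Type*} {l : Filter ι} (hW : FormBounded W C)
    {U : ι → E n → ℂ} {D : ι → Fin n → E n → ℂ}
    (hU : ∀ k, IsH1 (U k) (D k)) (hu : IsH1 u G) (hD : ∀ i, L2Tendsto l (fun k => D k i) (G i)) :
    Tendsto (fun k => ∫ x, W x * ‖U k x‖ ^ 2) l (𝓝 (∫ x, W x * ‖u x‖ ^ 2)) := by
  have h := hW.tendsto hU hu hD hU hu hD
  simp_rw [FormBounded.integral_self] at h
  exact (Complex.continuous_re.tendsto _).comp h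

theorem FormBounded.continuous_dil (hW : FormBounded W C) (hu : IsH1 u G) :
    Continuous fun t => ∫ x, W x * ‖dil t u x‖ ^ 2 := by
  refine continuous_iff_continuousAt.2 fun s => ?_
  refine hW.tendsto_sq (fun t => hu.dil t) (hu.dil s) fun i => ?_
  have h1 := l2Tendsto_dil (hu.memLp_grad i) s
  refine ⟨fun t => (hu.dil t).memLp_grad i, (hu.dil s).memLp_grad i, ?_⟩
  have b : ∀ t, sqNorm (fun x => ((Real.exp t : ℝ) : ℂ) * dil t (G i) x -
      ((Real.exp s : ℝ) : ℂ) * dil s (G i) x) ≤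
      2 * (ENNReal.ofReal (Real.exp t) ^ 2 * sqNorm (fun x => dil t (G i) x - dil s (G i) x)) +
      2 * (ENNReal.ofReal |Real.exp t - Real.exp s| ^ 2 * sqNorm (G i)) := fun t => by
    have a := sqNorm_add_le (f := fun x => ((Real.exp t : ℝ) : ℂ) * (dil t (G i) x - dil s (G i) x))
      (g := fun x => ((Real.exp t - Real.exp s : ℝ) : ℂ) * dil s (G i) x)
      (aestronglyMeasurable_const.mul ((h1.mem t).1.sub (h1.lim).1))
    refine le_trans (le_of_eq ?_) (a.trans (add_le_add (mul_le_mul_right ?_ _)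
      (mul_le_mul_right ?_ _)))
    · congr 1 with x
      push_cast
      ring
    · refine sqNorm_mul_le (by finiteness) (ae_of_all _ fun x => ?_)
      rw [enorm_mul, mul_pow, ← ofReal_norm ((Real.exp t : ℝ) : ℂ), Complex.norm_real,
        Real.norm_of_nonneg (Real.exp_pos _).le]
    · rw [← sqNorm_dil s (G i)]
      refine sqNorm_mul_le (by finiteness) (ae_of_all _ fun x => ?_)
      rw [enorm_mul, mul_pow, ← ofReal_norm ((Real.exp t - Real.exp s : ℝ) : ℂ), Complex.norm_real,
        Real.norm_eq_abs]
  have c1 : Tendsto (fun t => ENNReal.ofReal (Real.exp t) ^ 2) (𝓝 s)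
      (𝓝 (ENNReal.ofReal (Real.exp s) ^ 2)) :=
    ((ENNReal.continuous_pow 2).comp (ENNReal.continuous_ofReal.comp Real.continuous_exp)).tendsto s
  have c2 : Tendsto (fun t => ENNReal.ofReal |Real.exp t - Real.exp s| ^ 2) (𝓝 s) (𝓝 0) := by
    have : Continuous fun t => ENNReal.ofReal |Real.exp t - Real.exp s| ^ 2 :=
      (ENNReal.continuous_pow 2).comp (ENNReal.continuous_ofReal.comp (by fun_prop))
    simpa using this.tendsto s
  have c3 := ENNReal.Tendsto.mul c1 (Or.inr (by simp)) h1.tendsto (Or.inr (by finiteness))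
  have c4 := ENNReal.Tendsto.mul_const c2 (b := sqNorm (G i))
    (Or.inr (hu.memLp_grad i).sqNorm_lt_top.ne)
  have c5 := (ENNReal.Tendsto.const_mul (a := 2) c3 (Or.inr (by simp))).add
    (ENNReal.Tendsto.const_mul (a := 2) c4 (Or.inr (by simp)))
  simp only [mul_zero, zero_mul, add_zero] at c5
  exact tendsto_of_tendsto_of_tendsto_of_le_of_le tendsto_const_nhds c5 (fun _ => zero_le) b

theorem integral_norm_sq_dil {f : E n → ℂ} (hf : MemLp f 2) (t : ℝ) :
    ∫ x, ‖dil t f x‖ ^ 2 = ∫ x, ‖f x‖ ^ 2 := by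
  rw [integral_norm_sq_eq (memLp_dil hf t).1, integral_norm_sq_eq hf.1, sqNorm_dil]

theorem integral_norm_sq_exp_dil {f : E n → ℂ} (hf : MemLp f 2) (t : ℝ) :
    ∫ x, ‖((Real.exp t : ℝ) : ℂ) * dil t f x‖ ^ 2 = Real.exp (2 * t) * ∫ x, ‖f x‖ ^ 2 := by
  rw [← integral_norm_sq_dil hf t, ← integral_const_mul]
  congr 1 with x
  rw [norm_mul, mul_pow, Complex.norm_real, Real.norm_of_nonneg (Real.exp_pos _).le,
    ← Real.exp_nat_mul]
  norm_num

/-- For test functions this is the fundamental theorem of calculus. The integrated form is what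
passes to H¹ limits, by form boundedness of V and W. Differentiability for general u is recovered
from it afterwards. -/
theorem potential_dil_eq_integral (hV : FormBounded V C) (hW : FormBounded W C')
    (hE : IsWeakEulerDerivative V W) (hu : IsH1 u G) (t : ℝ) :
    (∫ x, V x * ‖dil t u x‖ ^ 2) - ∫ x, V x * ‖u x‖ ^ 2 =
      ∫ s in (0 : ℝ)..t, -∫ x, W x * ‖dil s u x‖ ^ 2 := by
  obtain ⟨φ, h1, h2, h3⟩ := id hu
  have hφ1 := fun k => (h1 k).isH1
  have e : ∀ k, (∫ x, V x * ‖dil t (φ k) x‖ ^ 2) - ∫ x, V x * ‖φ k x‖ ^ 2 =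
      ∫ s in (0 : ℝ)..t, -∫ x, W x * ‖dil s (φ k) x‖ ^ 2 := fun k => by
    rw [intervalIntegral.integral_eq_sub_of_hasDerivAt
      (fun s _ => (h1 k).hasDerivAt_potential_dil hV hE s)
      ((hW.continuous_dil (hφ1 k)).neg.intervalIntegrable _ _)]
    rw [dil_zero]
  have l1 : Tendsto (fun k => (∫ x, V x * ‖dil t (φ k) x‖ ^ 2) - ∫ x, V x * ‖φ k x‖ ^ 2) atTop
      (𝓝 ((∫ x, V x * ‖dil t u x‖ ^ 2) - ∫ x, V x * ‖u x‖ ^ 2)) :=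
    (hV.tendsto_sq (fun k => (hφ1 k).dil t) (hu.dil t) fun i => ((h3 i).dil t).const_mul _).sub
      (hV.tendsto_sq hφ1 hu h3)
  refine tendsto_nhds_unique l1 ?_
  simp_rw [e]
  have hN : Tendsto (fun k => ∑ i, ∫ x, ‖partialDeriv i (φ k) x‖ ^ 2) atTop
      (𝓝 (∑ i, ∫ x, ‖G i x‖ ^ 2)) := tendsto_finsetSum _ fun i _ => (h3 i).integral_norm_sq
  obtain ⟨M, hM⟩ := hN.bddAbove_range
  refine intervalIntegral.tendsto_integral_filter_of_dominated_convergence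
    (fun s => C'.toReal * (Real.exp (2 * s) * M)) ?_ ?_ ?_ ?_
  · exact Eventually.of_forall fun k =>
      (hW.continuous_dil (hφ1 k)).neg.aestronglyMeasurable
  · refine Eventually.of_forall fun k => ae_of_all _ fun s _ => ?_
    rw [norm_neg, Real.norm_eq_abs]
    refine (hW.abs_integral_le ((hφ1 k).dil s)).trans ?_
    simp_rw [fun i => integral_norm_sq_exp_dil ((h1 k).partialDeriv i).memLp s]
    rw [← Finset.mul_sum]
    have := hM ⟨k, rfl⟩
    simp only at this
    gcongr
  · exact (Continuous.intervalIntegrable (by fun_prop) _ _)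
  · refine ae_of_all _ fun s _ => ?_
    exact (hW.tendsto_sq (fun k => (hφ1 k).dil s) (hu.dil s) fun i => ((h3 i).dil s).const_mul _).neg

theorem hasDerivAt_potential_dil (hV : FormBounded V C) (hW : FormBounded W C')
    (hE : IsWeakEulerDerivative V W) (hu : IsH1 u G) :
    HasDerivAt (fun t => ∫ x, V x * ‖dil t u x‖ ^ 2) (-∫ x, W x * ‖u x‖ ^ 2) 0 := by
  have hc := (hW.continuous_dil hu).neg
  have h := intervalIntegral.integral_hasDerivAt_right (hc.intervalIntegrable 0 0)
    (hc.stronglyMeasurableAtFilter _ _) hc.continuousAt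
  have h2 := h.add_const (∫ x, V x * ‖u x‖ ^ 2)
  simp_rw [Pi.neg_apply, ← potential_dil_eq_integral hV hW hE hu] at h2
  simpa [dil_zero] using h2

/-- The generator of dilations, `A u = x · ∇u + (n/2) u`. -/
def dilGen (u : E n → ℂ) (G : Fin n → E n → ℂ) (x : E n) : ℂ :=
  ∑ i, (x i : ℂ) * G i x + ((n / 2 : ℝ) : ℂ) * u x

/-- Skew symmetry of the dilation generator. Only first weak derivatives are used, by testing with
the functions xᵢψ and summing. -/
theorem IsH1.integral_mul_euler (hu : IsH1 u G) {ψ : E n → ℂ} (hψ : IsTestFunction ψ) :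
    ∫ x, u x * (((n / 2 : ℝ) : ℂ) * ψ x + fderiv ℝ ψ x x) = -∫ x, dilGen u G x * ψ x := by
  have hc : ∀ i : Fin n, ContDiff ℝ (⊤ : ℕ∞) (fun x : E n => ((x i : ℝ) : ℂ)) := fun i =>
    Complex.ofRealCLM.contDiff.comp (EuclideanSpace.proj (𝕜 := ℝ) i).contDiff
  have hpc : ∀ (i : Fin n) (x : E n), partialDeriv i (fun x : E n => ((x i : ℝ) : ℂ)) x = 1 := by
    intro i x
    have h1 : HasFDerivAt (fun x : E n => ((x i : ℝ) : ℂ))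
        (Complex.ofRealCLM.comp (EuclideanSpace.proj (𝕜 := ℝ) i)) x :=
      (Complex.ofRealCLM.hasFDerivAt).comp x (EuclideanSpace.proj (𝕜 := ℝ) i).hasFDerivAt
    unfold partialDeriv
    rw [h1.fderiv]
    simp
  have ht : ∀ i : Fin n, IsTestFunction fun x => (x i : ℂ) * ψ x := fun i => hψ.smooth_mul (hc i)
  have hp : ∀ i, ∀ x, partialDeriv i (fun x => (x i : ℂ) * ψ x) x =
      (x i : ℂ) * partialDeriv i ψ x + ψ x := fun i x => by
    rw [partialDeriv_mul i ((hc i).differentiable (by simp) x) (hψ.differentiable x), hpc, one_mul]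
  have hmul : ∀ {f φ : E n → ℂ}, MemLp f 2 → IsTestFunction φ → Integrable fun x => f x * φ x :=
    fun hf hφ => hf.integrable_mul hφ.memLp
  have h1 : ∀ i, ∫ x, u x * partialDeriv i (fun x => (x i : ℂ) * ψ x) x =
      -∫ x, G i x * ((x i : ℂ) * ψ x) := fun i => by
    have := hu.integral_mul_partialDeriv (ht i).conj i
    unfold pairing at this
    simp_rw [partialDeriv_conj i ((ht i).differentiable _), Complex.conj_conj] at this
    exact this
  have i1 : ∀ i, Integrable fun x => u x * partialDeriv i (fun x => (x i : ℂ) * ψ x) x :=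
    fun i => hmul hu.memLp ((ht i).partialDeriv i)
  have i2 : ∀ i, Integrable fun x => G i x * ((x i : ℂ) * ψ x) :=
    fun i => hmul (hu.memLp_grad i) (ht i)
  have i3 : Integrable fun x => u x * ψ x := hmul hu.memLp hψ
  have h2 := Finset.sum_congr (s₁ := Finset.univ) rfl fun i _ => h1 i
  rw [← integral_finsetSum _ fun i _ => i1 i, Finset.sum_neg_distrib,
    ← integral_finsetSum _ fun i _ => i2 i] at h2
  have e1 : ∀ x, u x * (((n / 2 : ℝ) : ℂ) * ψ x + fderiv ℝ ψ x x) =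
      ∑ i, u x * partialDeriv i (fun x => (x i : ℂ) * ψ x) x - ((n / 2 : ℝ) : ℂ) * (u x * ψ x) := by
    intro x
    simp_rw [hp, ← Finset.mul_sum, Finset.sum_add_distrib]
    rw [fderiv_apply_eq_sum]
    simp only [Finset.sum_const, Finset.card_univ, Fintype.card_fin, nsmul_eq_mul]
    push_cast
    ring
  have e2 : ∀ x, dilGen u G x * ψ x = ∑ i, G i x * ((x i : ℂ) * ψ x) +
      ((n / 2 : ℝ) : ℂ) * (u x * ψ x) := fun x => by
    rw [dilGen, add_mul, Finset.sum_mul]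
    congr 1
    · exact Finset.sum_congr rfl fun i _ => by ring
    · ring
  simp_rw [e1, e2]
  rw [integral_sub (integrable_finsetSum _ fun i _ => i1 i) (i3.const_mul _),
    integral_add (integrable_finsetSum _ fun i _ => i2 i) (i3.const_mul _), h2]
  ring

theorem hasDerivAt_pairing_dil_test (hu : IsH1 u G) {ψ : E n → ℂ} (hψ : IsTestFunction ψ) (t : ℝ) :
    HasDerivAt (fun t => pairing (dil t u) ψ) (pairing (dil t (dilGen u G)) ψ) t := by
  have hg : LocallyIntegrable u := hu.memLp.locallyIntegrable (by norm_num)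
  have h := (hasDerivAt_integral_exp_smul hg hψ.conj (n / 2) (-t)).scomp t (hasDerivAt_neg t)
  simp_rw [pairing_dil]
  have ht : IsTestFunction (fun x => ((Real.exp (n / 2 * -t) : ℝ) : ℂ) * conj (ψ (Real.exp (-t) • x))) :=
    hψ.conj.dil (-t)
  rw [hu.integral_mul_euler ht] at h
  have e : ∀ t x, conj (dil t ψ x) = ((Real.exp (n / 2 * t) : ℝ) : ℂ) * conj (ψ (Real.exp t • x)) :=
    fun t x => by rw [dil, map_mul, Complex.conj_ofReal]
  simp_rw [← e] at h
  rw [neg_smul, one_smul, neg_neg] at h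
  exact h

/-- The same device as for the potential: integrate the derivative known for test functions g, then
let g range over L² by density. The assumption that Au lies in L² makes the integrand continuous in
s. -/
theorem pairing_dil_sub_eq_integral (hu : IsH1 u G) (hA : MemLp (dilGen u G) 2) {g : E n → ℂ}
    (hg : MemLp g 2) (t : ℝ) :
    pairing (dil t u) g - pairing u g = ∫ s in (0 : ℝ)..t, pairing (dil s (dilGen u G)) g := by
  obtain ⟨ψ, h1, h2⟩ := exists_test_L2Tendsto hg
  have hc : ∀ {g : E n → ℂ}, MemLp g 2 → Continuous fun s => pairing (dil s (dilGen u G)) g :=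
    fun hg => continuous_iff_continuousAt.2 fun s => (l2Tendsto_dil hA s).pairing (.const _ hg)
  have e : ∀ k, pairing (dil t u) (ψ k) - pairing u (ψ k) =
      ∫ s in (0 : ℝ)..t, pairing (dil s (dilGen u G)) (ψ k) := fun k => by
    rw [intervalIntegral.integral_eq_sub_of_hasDerivAt
      (fun s _ => hasDerivAt_pairing_dil_test hu (h1 k) s)
      ((hc (h1 k).memLp).intervalIntegrable _ _)]
    rw [dil_zero]
  have l1 := ((L2Tendsto.const atTop (memLp_dil hu.memLp t)).pairing h2).sub
    ((L2Tendsto.const atTop hu.memLp).pairing h2)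
  refine tendsto_nhds_unique l1 ?_
  simp_rw [e]
  obtain ⟨M, hM⟩ := h2.integral_norm_sq.bddAbove_range
  refine intervalIntegral.tendsto_integral_filter_of_dominated_convergence
    (fun s => √(∫ x, ‖dilGen u G x‖ ^ 2) * √M) ?_ ?_ ?_ ?_
  · exact Eventually.of_forall fun k => (hc (h1 k).memLp).aestronglyMeasurable
  · refine Eventually.of_forall fun k => ae_of_all _ fun s _ => ?_
    refine (norm_pairing_le (memLp_dil hA s) (h1 k).memLp).trans ?_
    rw [integral_norm_sq_dil hA]
    have := hM ⟨k, rfl⟩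
    simp only at this
    gcongr
  · exact intervalIntegrable_const
  · exact ae_of_all _ fun s _ => (L2Tendsto.const atTop (memLp_dil hA s)).pairing h2

theorem hasDerivAt_pairing_dil (hu : IsH1 u G) (hA : MemLp (dilGen u G) 2) {g : E n → ℂ}
    (hg : MemLp g 2) :
    HasDerivAt (fun t => pairing (dil t u) g) (pairing (dilGen u G) g) 0 := by
  have hc : Continuous fun s => pairing (dil s (dilGen u G)) g :=
    continuous_iff_continuousAt.2 fun s => (l2Tendsto_dil hA s).pairing (.const _ hg)
  have h := intervalIntegral.integral_hasDerivAt_right (hc.intervalIntegrable 0 0)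
    (hc.stronglyMeasurableAtFilter _ _) hc.continuousAt
  have h2 := h.add_const (pairing u g)
  simp_rw [← pairing_dil_sub_eq_integral hu hA hg] at h2
  simpa [dil_zero] using h2

/-- The virial identity for weak solutions of `(-Δ + V) u = g`. -/
theorem virial (hV : FormBounded V C) (hW : FormBounded W C') (hE : IsWeakEulerDerivative V W)
    (hpos : ∀ w K, IsH1 w K → 0 ≤ ∑ i, (∫ x, ‖K i x‖ ^ 2) + ∫ x, V x * ‖w x‖ ^ 2)
    (hu : IsH1 u G) (hA : MemLp (dilGen u G) 2) {g : E n → ℂ} (hg : MemLp g 2)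
    (heq : ∀ w K, IsH1 w K →
      ∑ i, pairing (G i) (K i) + ∫ x, (V x : ℂ) * u x * conj (w x) = pairing g w) :
    ∑ i, (∫ x, ‖G i x‖ ^ 2) - (∫ x, W x * ‖u x‖ ^ 2) / 2 = (pairing (dilGen u G) g).re := by
  set N := ∑ i, ∫ x, ‖G i x‖ ^ 2 with hN
  have d1 : HasDerivAt (fun t => Real.exp (2 * t) * N + ∫ x, V x * ‖dil t u x‖ ^ 2)
      (2 * N - ∫ x, W x * ‖u x‖ ^ 2) 0 := by
    have h1 : HasDerivAt (fun t : ℝ => Real.exp (2 * t)) 2 0 := by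
      have := ((hasDerivAt_id (0 : ℝ)).const_mul 2).exp
      simpa using this
    refine ((h1.mul_const N).add (hasDerivAt_potential_dil hV hW hE hu)).congr_deriv (by ring)
  have d2 : HasDerivAt (fun t => 2 * (pairing (dil t u) g).re) (2 * (pairing (dilGen u G) g).re) 0 :=
    ((Complex.reCLM.hasFDerivAt.comp_hasDerivAt 0 (hasDerivAt_pairing_dil hu hA hg))).const_mul 2
  -- This is q(U_t u - u) ≥ 0, expanded with the equation used to rewrite the cross term as Re⟨U_t
  -- u, g⟩. The expression vanishes at t = 0, so its derivative there is zero. Thus Au never has to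
  -- be inserted as a test function.
  have key : ∀ t, 0 ≤ Real.exp (2 * t) * N + (∫ x, V x * ‖dil t u x‖ ^ 2) -
      2 * (pairing (dil t u) g).re + (N + ∫ x, V x * ‖u x‖ ^ 2) := by
    intro t
    have h := hpos _ _ ((hu.dil t).sub hu)
    have e1 : ∀ i, ∫ x, ‖((Real.exp t : ℝ) : ℂ) * dil t (G i) x - G i x‖ ^ 2 =
        Real.exp (2 * t) * (∫ x, ‖G i x‖ ^ 2) + (∫ x, ‖G i x‖ ^ 2) -
        2 * (pairing (G i) (fun x => ((Real.exp t : ℝ) : ℂ) * dil t (G i) x)).re := fun i => by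
      rw [← integral_norm_sq_exp_dil (hu.memLp_grad i)]
      exact integral_norm_sub_sq ((hu.dil t).memLp_grad i) (hu.memLp_grad i)
    have e2 : ∫ x, V x * ‖dil t u x - u x‖ ^ 2 = (∫ x, V x * ‖dil t u x‖ ^ 2) +
        (∫ x, V x * ‖u x‖ ^ 2) - 2 * (∫ x, (V x : ℂ) * u x * conj (dil t u x)).re := hV.integral_sub_sq hu (hu.dil t)
    have e3 := congrArg Complex.re (heq _ _ (hu.dil t))
    rw [← conj_pairing, Complex.conj_re, Complex.add_re, Complex.re_sum] at e3
    simp_rw [e1] at h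
    rw [e2, Finset.sum_sub_distrib, Finset.sum_add_distrib, ← Finset.mul_sum, ← Finset.mul_sum] at h
    linarith
  have h0 : Real.exp (2 * 0) * N + (∫ x, V x * ‖dil 0 u x‖ ^ 2) -
      2 * (pairing (dil 0 u) g).re + (N + ∫ x, V x * ‖u x‖ ^ 2) = 0 := by
    have e3 := congrArg Complex.re (heq _ _ hu)
    simp_rw [pairing_self, FormBounded.integral_self] at e3
    rw [← conj_pairing, Complex.conj_re, Complex.add_re, Complex.re_sum] at e3
    simp only [Complex.ofReal_re] at e3
    rw [dil_zero, mul_zero, Real.exp_zero]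
    linarith
  have d3 := ((d1.sub d2).add_const (N + ∫ x, V x * ‖u x‖ ^ 2))
  have hmin : IsLocalMin (fun t => Real.exp (2 * t) * N + (∫ x, V x * ‖dil t u x‖ ^ 2) -
      2 * (pairing (dil t u) g).re + (N + ∫ x, V x * ‖u x‖ ^ 2)) 0 :=
    Eventually.of_forall fun t => h0.trans_le (key t)
  have := hmin.hasDerivAt_eq_zero d3
  linarith
end

/-! ### Weak solutions and radial multipliers -/

/-- The `L²` norm as a real number. -/
def l2 {n : ℕ} (f : E n → ℂ) : ℝ := √(∫ x, ‖f x‖ ^ 2)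

section
variable {n : ℕ} {f g : E n → ℂ}

theorem l2_nonneg (f : E n → ℂ) : 0 ≤ l2 f := Real.sqrt_nonneg _

theorem l2_sq (f : E n → ℂ) : l2 f ^ 2 = ∫ x, ‖f x‖ ^ 2 :=
  Real.sq_sqrt (integral_nonneg fun x => by positivity)

theorem l2_eq_norm (hf : MemLp f 2) : l2 f = ‖hf.toLp f‖ := by
  have h0 : 0 ≤ ‖hf.toLp f‖ := norm_nonneg _
  rw [l2, ← norm_toLp_sq hf, Real.sqrt_sq h0]

theorem l2_add_le (hf : MemLp f 2) (hg : MemLp g 2) : l2 (fun x => f x + g x) ≤ l2 f + l2 g := by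
  rw [l2_eq_norm hf, l2_eq_norm hg, l2_eq_norm (f := fun x => f x + g x) (hf.add hg)]
  exact norm_add_le (hf.toLp f) (hg.toLp g)

theorem l2_mono (hg : MemLp g 2) (h : ∀ x, ‖f x‖ ≤ ‖g x‖) : l2 f ≤ l2 g := by
  refine Real.sqrt_le_sqrt (integral_mono_of_nonneg (ae_of_all _ fun x => by positivity)
    (hg.integrable_norm_pow (by norm_num)) (ae_of_all _ fun x => ?_))
  exact pow_le_pow_left₀ (norm_nonneg _) (h x) 2

theorem norm_pairing_le_l2 (hf : MemLp f 2) (hg : MemLp g 2) : ‖pairing f g‖ ≤ l2 f * l2 g :=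
  norm_pairing_le hf hg

theorem sqNorm_eq_l2 (hf : MemLp f 2) : sqNorm f = ENNReal.ofReal (l2 f ^ 2) := by
  rw [l2_sq, sqNorm_eq_ofReal hf]

/-- Fatou's lemma for the `L²` norm. -/
theorem memLp_of_tendsto_ae {F : ℕ → E n → ℂ} (hF : ∀ k, MemLp (F k) 2) {M : ℝ}
    (hM : ∀ k, l2 (F k) ≤ M) (h : ∀ x, Tendsto (fun k => F k x) atTop (𝓝 (f x))) :
    MemLp f 2 := by
  have hm : AEStronglyMeasurable f volume :=
    aestronglyMeasurable_of_tendsto_ae atTop (fun k => (hF k).1) (ae_of_all _ h)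
  refine memLp_of_sqNorm_lt_top hm (lt_of_le_of_lt ?_ (ENNReal.ofReal_lt_top (r := M ^ 2)))
  have e : ∀ x, ‖f x‖ₑ ^ 2 = liminf (fun k => ‖F k x‖ₑ ^ 2) atTop := fun x =>
    (((ENNReal.continuous_pow 2).tendsto _).comp ((continuous_enorm.tendsto _).comp
      (h x))).liminf_eq.symm
  unfold sqNorm
  simp_rw [e]
  refine (lintegral_liminf_le' fun k => (hF k).1.enorm.pow_const 2).trans ?_
  refine liminf_le_of_frequently_le' (Frequently.of_forall fun k => ?_)
  refine (sqNorm_eq_l2 (hF k)).trans_le (ENNReal.ofReal_le_ofReal ?_)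
  exact pow_le_pow_left₀ (l2_nonneg _) (hM k) 2

/-- `u` is a weak solution of `(-Δ + V - z) u = f` with gradient `G`, for a weighted `f`. -/
structure IsWeakSolution (V : E n → ℝ) (z : ℂ) (f u : E n → ℂ) (G : Fin n → E n → ℂ) : Prop where
  isH1 : IsH1 u G
  memLp : MemLp f 2
  memLp_norm : MemLp (fun x => ((‖x‖ : ℝ) : ℂ) * f x) 2
  weak_eq : ∀ φ : E n → ℂ, IsTestFunction φ →
    ∑ i, pairing (G i) (partialDeriv i φ) + ∫ x, (V x : ℂ) * u x * conj (φ x) =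
      pairing (fun x => z * u x + f x) φ

variable {V : E n → ℝ} {C : ℝ≥0∞} {z : ℂ} {u : E n → ℂ} {G : Fin n → E n → ℂ}

theorem IsWeakSolution.memLp_rhs (h : IsWeakSolution V z f u G) :
    MemLp (fun x => z * u x + f x) 2 := (h.isH1.memLp.const_mul z).add h.memLp

theorem IsWeakSolution.weak_eq_isH1 (h : IsWeakSolution V z f u G) (hV : FormBounded V C)
    {w : E n → ℂ} {K : Fin n → E n → ℂ} (hw : IsH1 w K) :
    ∑ i, pairing (G i) (K i) + ∫ x, (V x : ℂ) * u x * conj (w x) =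
      pairing (fun x => z * u x + f x) w := by
  obtain ⟨φ, h1, h2, h3⟩ := id hw
  have l1 : Tendsto (fun k => ∑ i, pairing (G i) (partialDeriv i (φ k)) +
      ∫ x, (V x : ℂ) * u x * conj (φ k x)) atTop
      (𝓝 (∑ i, pairing (G i) (K i) + ∫ x, (V x : ℂ) * u x * conj (w x))) :=
    (tendsto_finsetSum _ fun i _ => (L2Tendsto.const _ (h.isH1.memLp_grad i)).pairing (h3 i)).add
      (hV.tendsto (fun _ => h.isH1) h.isH1 (fun i => .const _ (h.isH1.memLp_grad i))
        (fun k => (h1 k).isH1) hw h3)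
  refine tendsto_nhds_unique l1 ?_
  simp_rw [fun k => h.weak_eq _ (h1 k)]
  exact (L2Tendsto.const _ h.memLp_rhs).pairing h2

/-- The regularized radial derivative `∑ᵢ (xᵢ / m) Gᵢ`, `m = reg η`. -/
def radDer (η : ℝ) (G : Fin n → E n → ℂ) (x : E n) : ℂ :=
  ∑ i, ((x i / reg η x : ℝ) : ℂ) * G i x

/-- `Im (∂_r u conj u)`. -/
def radFlux (η : ℝ) (u : E n → ℂ) (G : Fin n → E n → ℂ) (x : E n) : ℝ :=
  (radDer η G x * conj (u x)).im

theorem aestronglyMeasurable_coord_div_reg (η : ℝ) (i : Fin n) :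
    AEStronglyMeasurable (fun x : E n => ((x i / reg η x : ℝ) : ℂ)) volume := by
  have h1 : Measurable (reg η : E n → ℝ) := (continuous_reg η).measurable
  have h2 : Measurable fun x : E n => x i := (EuclideanSpace.proj (𝕜 := ℝ) i).continuous.measurable
  exact (Complex.measurable_ofReal.comp (h2.div h1)).aestronglyMeasurable

theorem memLp_coord_mul {η : ℝ} (hη : 0 < η) (i : Fin n) (hf : MemLp f 2) :
    MemLp (fun x => ((x i / reg η x : ℝ) : ℂ) * f x) 2 :=
  memLp_mul_bdd (aestronglyMeasurable_coord_div_reg η i)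
    (fun x => abs_coord_div_reg_le hη x i) hf

theorem memLp_radDer {η : ℝ} (hη : 0 < η) {G : Fin n → E n → ℂ} (hG : ∀ i, MemLp (G i) 2) :
    MemLp (radDer η G) 2 :=
  memLp_finsetSum _ fun i _ => memLp_coord_mul hη i (hG i)

theorem sum_sq_coord_div_reg (η : ℝ) (x : E n) :
    ∑ i, (x i / reg η x) ^ 2 = ‖x‖ ^ 2 / reg η x ^ 2 := by
  simp_rw [div_pow]
  rw [← Finset.sum_div, EuclideanSpace.real_norm_sq_eq]

/-- The pointwise localization identity, with a = ∇u, b = u, c = x/m: the difference between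
|∇(ψu)|² and Re ∇u · conj ∇(|ψ|²u) involves only |ψ'|² and the radial flux Im(∂ᵣu ū). -/
theorem sum_norm_sq_sub_re (a : Fin n → ℂ) (b ψ ψ' : ℂ) (c : Fin n → ℝ) :
    ∑ i, ‖ψ * a i + ψ' * (c i : ℂ) * b‖ ^ 2 - (∑ i, a i * conj (((‖ψ‖ ^ 2 : ℝ) : ℂ) * a i +
      ((2 * (ψ * conj ψ').re : ℝ) : ℂ) * (c i : ℂ) * b)).re =
    ‖ψ'‖ ^ 2 * ∑ i, c i ^ 2 * ‖b‖ ^ 2 -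
      2 * (ψ * conj ψ').im * ((∑ i, (c i : ℂ) * a i) * conj b).im := by
  rw [Complex.re_sum, ← Finset.sum_sub_distrib, Finset.mul_sum, Finset.sum_mul, Complex.im_sum,
    Finset.mul_sum, ← Finset.sum_sub_distrib]
  refine Finset.sum_congr rfl fun i _ => ?_
  simp only [← Complex.normSq_eq_norm_sq, Complex.normSq_apply, Complex.mul_re, Complex.mul_im,
    Complex.add_re, Complex.add_im, Complex.conj_re, Complex.conj_im, Complex.ofReal_re,
    Complex.ofReal_im]
  ring

/-- For a real radial multiplier the imaginary part sees only its derivative, through the flux. -/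
theorem im_sum_mul_conj (a : Fin n → ℂ) (b : ℂ) (p p' : ℝ) (c : Fin n → ℝ) :
    (∑ i, a i * conj ((p : ℂ) * a i + (p' : ℂ) * (c i : ℂ) * b)).im =
      p' * ((∑ i, (c i : ℂ) * a i) * conj b).im := by
  rw [Complex.im_sum, Finset.sum_mul, Complex.im_sum, Finset.mul_sum]
  refine Finset.sum_congr rfl fun i _ => ?_
  simp only [Complex.mul_re, Complex.mul_im,
    Complex.add_re, Complex.add_im, Complex.conj_re, Complex.conj_im, Complex.ofReal_re,
    Complex.ofReal_im]
  ring

/-- Testing the equation with a radial multiple of `u`: imaginary part. -/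
theorem IsWeakSolution.integral_flux (h : IsWeakSolution V z f u G) (hV : FormBounded V C) {η : ℝ}
    {p p' : ℝ → ℝ}
    (hp : IsH1 (fun x => (p (reg η x) : ℂ) * u x) (fun i x => (p (reg η x) : ℂ) * G i x +
      (p' (reg η x) : ℂ) * ((x i / reg η x : ℝ) : ℂ) * u x)) :
    ∫ x, p' (reg η x) * radFlux η u G x =
      (pairing (fun x => z * u x + f x) (fun x => (p (reg η x) : ℂ) * u x)).im := by
  have h1 := congrArg Complex.im (h.weak_eq_isH1 hV hp)
  rw [← h1]
  have i1 : ∀ i, Integrable fun x => G i x * conj ((p (reg η x) : ℂ) * G i x +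
      (p' (reg η x) : ℂ) * ((x i / reg η x : ℝ) : ℂ) * u x) := fun i =>
    integrable_mul_conj (h.isH1.memLp_grad i) (hp.memLp_grad i)
  unfold pairing
  rw [← integral_finsetSum _ fun i _ => i1 i, Complex.add_im]
  have e1 : (∫ x, (V x : ℂ) * u x * conj ((p (reg η x) : ℂ) * u x)).im = 0 := by
    have : ∀ x, (V x : ℂ) * u x * conj ((p (reg η x) : ℂ) * u x) =
        ((V x * p (reg η x) * ‖u x‖ ^ 2 : ℝ) : ℂ) := fun x => by
      rw [map_mul, Complex.conj_ofReal]
      push_cast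
      rw [← Complex.ofReal_pow, ← Complex.normSq_eq_norm_sq, ← Complex.mul_conj]
      ring
    simp_rw [this]
    rw [integral_complex_ofReal, Complex.ofReal_im]
  rw [e1, add_zero]
  have e2 := integral_im (𝕜 := ℂ) (integrable_finsetSum Finset.univ fun i _ => i1 i)
  simp only [RCLike.im_to_complex] at e2
  rw [← e2]
  congr 1 with x
  exact (im_sum_mul_conj (fun i => G i x) (u x) _ _ fun i => x i / reg η x).symm

/-- Testing the equation with a radial multiple of `u`: real part. -/
theorem IsWeakSolution.form_radial_mul (h : IsWeakSolution V z f u G) (hV : FormBounded V C) {η : ℝ}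
    {ψ ψ' : ℝ → ℂ}
    (hψ : IsH1 (fun x => ψ (reg η x) * u x) (fun i x => ψ (reg η x) * G i x +
      ψ' (reg η x) * ((x i / reg η x : ℝ) : ℂ) * u x))
    (hp : IsH1 (fun x => ((‖ψ (reg η x)‖ ^ 2 : ℝ) : ℂ) * u x)
      (fun i x => ((‖ψ (reg η x)‖ ^ 2 : ℝ) : ℂ) * G i x +
      ((2 * (ψ (reg η x) * conj (ψ' (reg η x))).re : ℝ) : ℂ) * ((x i / reg η x : ℝ) : ℂ) * u x)) :
    ∑ i, (∫ x, ‖ψ (reg η x) * G i x + ψ' (reg η x) * ((x i / reg η x : ℝ) : ℂ) * u x‖ ^ 2) +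
      ∫ x, V x * ‖ψ (reg η x) * u x‖ ^ 2 =
      (pairing (fun x => z * u x + f x) (fun x => ((‖ψ (reg η x)‖ ^ 2 : ℝ) : ℂ) * u x)).re +
      ∫ x, (‖ψ' (reg η x)‖ ^ 2 * (‖x‖ ^ 2 / reg η x ^ 2) * ‖u x‖ ^ 2 -
        2 * (ψ (reg η x) * conj (ψ' (reg η x))).im * radFlux η u G x) := by
  have h1 := congrArg Complex.re (h.weak_eq_isH1 hV hp)
  rw [← h1]
  have i1 : ∀ i, Integrable fun x => G i x * conj (((‖ψ (reg η x)‖ ^ 2 : ℝ) : ℂ) * G i x +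
      ((2 * (ψ (reg η x) * conj (ψ' (reg η x))).re : ℝ) : ℂ) * ((x i / reg η x : ℝ) : ℂ) * u x) :=
    fun i => integrable_mul_conj (h.isH1.memLp_grad i) (hp.memLp_grad i)
  have i2 : ∀ i, Integrable fun x => ‖ψ (reg η x) * G i x +
      ψ' (reg η x) * ((x i / reg η x : ℝ) : ℂ) * u x‖ ^ 2 := fun i =>
    (hψ.memLp_grad i).integrable_norm_pow (by norm_num)
  unfold pairing
  rw [← integral_finsetSum _ fun i _ => i1 i, Complex.add_re, ← integral_finsetSum _ fun i _ => i2 i]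
  have e1 : (∫ x, (V x : ℂ) * u x * conj (((‖ψ (reg η x)‖ ^ 2 : ℝ) : ℂ) * u x)).re =
      ∫ x, V x * ‖ψ (reg η x) * u x‖ ^ 2 := by
    have : ∀ x, (V x : ℂ) * u x * conj (((‖ψ (reg η x)‖ ^ 2 : ℝ) : ℂ) * u x) =
        ((V x * ‖ψ (reg η x) * u x‖ ^ 2 : ℝ) : ℂ) := fun x => by
      rw [map_mul, Complex.conj_ofReal, norm_mul, mul_pow]
      push_cast
      rw [← Complex.ofReal_pow ‖u x‖, ← Complex.normSq_eq_norm_sq (u x), ← Complex.mul_conj]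
      ring
    simp_rw [this]
    rw [integral_complex_ofReal, Complex.ofReal_re]
  rw [e1]
  have i3 := integrable_finsetSum Finset.univ fun i _ => i1 i
  have i4 := integrable_finsetSum Finset.univ fun i _ => i2 i
  have e2 := integral_re (𝕜 := ℂ) i3
  simp only [RCLike.re_to_complex] at e2
  have i5 := i3.re
  simp only [RCLike.re_to_complex] at i5
  have e3 := integral_sub i4 i5
  rw [← e2]
  have e4 : ∀ x, ∑ i, ‖ψ (reg η x) * G i x + ψ' (reg η x) * ((x i / reg η x : ℝ) : ℂ) * u x‖ ^ 2 -
      (∑ i, G i x * conj (((‖ψ (reg η x)‖ ^ 2 : ℝ) : ℂ) * G i x +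
      ((2 * (ψ (reg η x) * conj (ψ' (reg η x))).re : ℝ) : ℂ) * ((x i / reg η x : ℝ) : ℂ) * u x)).re =
      ‖ψ' (reg η x)‖ ^ 2 * (‖x‖ ^ 2 / reg η x ^ 2) * ‖u x‖ ^ 2 -
        2 * (ψ (reg η x) * conj (ψ' (reg η x))).im * radFlux η u G x := fun x => by
    rw [sum_norm_sq_sub_re (fun i => G i x) (u x) (ψ (reg η x)) (ψ' (reg η x))
      fun i => x i / reg η x, ← Finset.sum_mul, sum_sq_coord_div_reg, radFlux, radDer]
    ring
  simp_rw [e4] at e3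
  linarith

theorem IsWeakSolution.pairing_rhs (h : IsWeakSolution V z f u G) {p : ℝ → ℝ} {η : ℝ}
    (hp : MemLp (fun x => (p (reg η x) : ℂ) * u x) 2) :
    pairing (fun x => z * u x + f x) (fun x => (p (reg η x) : ℂ) * u x) =
      z * ((∫ x, p (reg η x) * ‖u x‖ ^ 2 : ℝ) : ℂ) + pairing f (fun x => (p (reg η x) : ℂ) * u x) := by
  have i1 := integrable_mul_conj h.isH1.memLp hp
  have i2 := integrable_mul_conj h.memLp hp
  unfold pairing
  simp_rw [add_mul, mul_assoc]
  rw [integral_add (i1.const_mul z) i2, integral_const_mul, ← integral_complex_ofReal]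
  congr 3 with x
  rw [map_mul, Complex.conj_ofReal]
  push_cast
  rw [← Complex.ofReal_pow, ← Complex.normSq_eq_norm_sq, ← Complex.mul_conj]
  ring

end

/-! ### Decay of weak solutions -/

section
variable {n : ℕ} {V : E n → ℝ} {C : ℝ≥0∞} {z : ℂ} {f g u : E n → ℂ} {G : Fin n → E n → ℂ} {η : ℝ}

theorem reg_le_norm_add (hη : 0 ≤ η) (x : E n) : reg η x ≤ ‖x‖ + η := by
  refine Real.sqrt_le_iff.2 ⟨by positivity, ?_⟩
  nlinarith [norm_nonneg x]

theorem memLp_reg_mul (hη : 0 ≤ η) (hf : MemLp f 2) (hr : MemLp (fun x => ((‖x‖ : ℝ) : ℂ) * f x) 2) :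
    MemLp (fun x => ((reg η x : ℝ) : ℂ) * f x) 2 ∧
      l2 (fun x => ((reg η x : ℝ) : ℂ) * f x) ≤ l2 (fun x => ((‖x‖ : ℝ) : ℂ) * f x) + η * l2 f := by
  have h1 : MemLp (fun x => ((‖x‖ : ℝ) : ℂ) * ((‖f x‖ : ℝ) : ℂ)) 2 := by
    refine hr.congr_norm ?_ (ae_of_all _ fun x => by simp)
    have : Measurable fun x : E n => ((‖x‖ : ℝ) : ℂ) := by fun_prop
    exact this.aestronglyMeasurable.mul
      (Complex.continuous_ofReal.comp_aestronglyMeasurable hf.1.norm)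
  have h2 : MemLp (fun x => (η : ℂ) * ((‖f x‖ : ℝ) : ℂ)) 2 := hf.norm.ofReal.const_mul _
  have h3 : MemLp (fun x => ((‖x‖ : ℝ) : ℂ) * ((‖f x‖ : ℝ) : ℂ) + (η : ℂ) * ((‖f x‖ : ℝ) : ℂ)) 2 :=
    h1.add h2
  have hle : ∀ x, ‖((reg η x : ℝ) : ℂ) * f x‖ ≤
      ‖((‖x‖ : ℝ) : ℂ) * ((‖f x‖ : ℝ) : ℂ) + (η : ℂ) * ((‖f x‖ : ℝ) : ℂ)‖ := fun x => by
    have hr0 : 0 ≤ reg η x := Real.sqrt_nonneg _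
    rw [← add_mul, norm_mul, norm_mul, Complex.norm_real ‖f x‖, norm_norm, ← Complex.ofReal_add,
      Complex.norm_real, Complex.norm_real, Real.norm_of_nonneg hr0,
      Real.norm_of_nonneg (by positivity)]
    exact mul_le_mul_of_nonneg_right (reg_le_norm_add hη x) (norm_nonneg _)
  have hm : AEStronglyMeasurable (fun x => ((reg η x : ℝ) : ℂ) * f x) volume :=
    ((Complex.continuous_ofReal.comp (continuous_reg η)).aestronglyMeasurable).mul hf.1
  refine ⟨h3.mono hm (ae_of_all _ hle), (l2_mono h3 hle).trans ((l2_add_le h1 h2).trans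
    (add_le_add (le_of_eq ?_) (le_of_eq ?_)))⟩
  · unfold l2
    simp
  · unfold l2
    simp only [norm_mul, Complex.norm_real, norm_norm, mul_pow]
    rw [integral_const_mul, Real.sqrt_mul (by positivity), Real.sqrt_sq (norm_nonneg _),
      Real.norm_of_nonneg hη]

theorem pairing_im (hf : MemLp f 2) (hg : MemLp g 2) :
    (pairing f g).im = ∫ x, (f x * conj (g x)).im :=
  (integral_im (integrable_mul_conj hf hg)).symm

theorem integral_mul_radFlux (hη : 0 < η) (hG : ∀ i, MemLp (G i) 2) {q : ℝ → ℝ}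
    (hq : MemLp (fun x => (q (reg η x) : ℂ) * u x) 2) :
    ∫ x, q (reg η x) * radFlux η u G x =
      (pairing (radDer η G) (fun x => (q (reg η x) : ℂ) * u x)).im := by
  rw [pairing_im (memLp_radDer hη hG) hq]
  congr 1 with x
  rw [radFlux, map_mul, Complex.conj_ofReal, mul_left_comm, Complex.im_ofReal_mul]

theorem pairing_sq_mul (f u : E n → ℂ) (θ : ℝ → ℝ) :
    pairing f (fun x => ((θ (reg η x) ^ 2 : ℝ) : ℂ) * u x) =
      pairing (fun x => (θ (reg η x) : ℂ) * f x) (fun x => (θ (reg η x) : ℂ) * u x) := by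
  unfold pairing
  congr 1 with x
  simp only [map_mul, Complex.conj_ofReal]
  push_cast
  ring

/-- Testing with a real radial multiple: real part. -/
theorem IsWeakSolution.form_radial_mul_real (h : IsWeakSolution V z f u G) (hV : FormBounded V C)
    {θ θ' : ℝ → ℝ}
    (hθ : IsH1 (fun x => (θ (reg η x) : ℂ) * u x) (fun i x => (θ (reg η x) : ℂ) * G i x +
      (θ' (reg η x) : ℂ) * ((x i / reg η x : ℝ) : ℂ) * u x))
    (hp : IsH1 (fun x => ((θ (reg η x) ^ 2 : ℝ) : ℂ) * u x)
      (fun i x => ((θ (reg η x) ^ 2 : ℝ) : ℂ) * G i x +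
      ((2 * (θ (reg η x) * θ' (reg η x)) : ℝ) : ℂ) * ((x i / reg η x : ℝ) : ℂ) * u x)) :
    ∑ i, (∫ x, ‖(θ (reg η x) : ℂ) * G i x +
      (θ' (reg η x) : ℂ) * ((x i / reg η x : ℝ) : ℂ) * u x‖ ^ 2) +
      ∫ x, V x * ‖(θ (reg η x) : ℂ) * u x‖ ^ 2 =
      (pairing (fun x => z * u x + f x) (fun x => ((θ (reg η x) ^ 2 : ℝ) : ℂ) * u x)).re +
      ∫ x, θ' (reg η x) ^ 2 * (‖x‖ ^ 2 / reg η x ^ 2) * ‖u x‖ ^ 2 := by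
  have e1 : ∀ t : ℝ, ‖(t : ℂ)‖ ^ 2 = t ^ 2 := fun t => by rw [Complex.norm_real, Real.norm_eq_abs, sq_abs]
  have e2 : ∀ s t : ℝ, ((s : ℂ) * conj (t : ℂ)).re = s * t := fun s t => by
    rw [Complex.conj_ofReal, ← Complex.ofReal_mul, Complex.ofReal_re]
  have e3 : ∀ s t : ℝ, ((s : ℂ) * conj (t : ℂ)).im = 0 := fun s t => by
    rw [Complex.conj_ofReal, ← Complex.ofReal_mul, Complex.ofReal_im]
  have := h.form_radial_mul hV (ψ := fun s => (θ s : ℂ)) (ψ' := fun s => (θ' s : ℂ)) hθ (by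
    simp_rw [e1, e2]; exact hp)
  simp_rw [e1, e3, mul_zero, zero_mul, sub_zero] at this
  exact this

/-- Weak solutions with weighted data decay. -/
theorem IsWeakSolution.memLp_reg_mul (h : IsWeakSolution V z f u G) (hV : FormBounded V C)
    (hη : 0 < η) (hz : z.im ≠ 0) {δ : ℝ} (hδ : 0 < δ)
    (hQ : ∀ (ψ : ℝ → ℂ) (K : Fin n → E n → ℂ), IsH1 (fun x => ψ (reg η x) * u x) K →
      δ * ∑ i, ∫ x, ‖K i x‖ ^ 2 ≤ ∑ i, (∫ x, ‖K i x‖ ^ 2) + ∫ x, V x * ‖ψ (reg η x) * u x‖ ^ 2) :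
    MemLp (fun x => ((reg η x : ℝ) : ℂ) * u x) 2 ∧
      ∀ i, MemLp (fun x => ((reg η x : ℝ) : ℂ) * G i x) 2 := by
  have hm := (continuous_reg (n := n) η)
  have hG := h.isH1.memLp_grad
  have hu := h.isH1.memLp
  obtain ⟨hmf, -⟩ := WeightedResolvent.memLp_reg_mul hη.le h.memLp h.memLp_norm
  set F := l2 (fun x => ((reg η x : ℝ) : ℂ) * f x) with hF
  set S := l2 (radDer η G) with hS
  set ε := |z.im| with hε
  have hε0 : 0 < ε := abs_pos.2 hz
  set M := (2 * S + F) / ε with hM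
  set a : ℕ → ℝ := fun k => 1 / ((k : ℝ) + 1) with ha
  have ha0 : ∀ k, 0 < a k := fun k => by positivity
  -- Bounded substitutes for the weight s: each θ_k is bounded, has derivative between 0 and 1,
  -- satisfies θ_k(s) ≤ s, and tends to s as k → ∞.
  set θ : ℕ → ℝ → ℝ := fun k s => s / (1 + a k * s) with hθ
  set θ' : ℕ → ℝ → ℝ := fun k s => 1 / (1 + a k * s) ^ 2 with hθ'
  have hpos : ∀ k s, 0 < s → 0 < 1 + a k * s := fun k s hs => by
    have := ha0 k; positivity
  have hθ0 : ∀ k s, 0 < s → 0 ≤ θ k s := fun k s hs => div_nonneg hs.le (hpos k s hs).le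
  have hθs : ∀ k s, 0 < s → θ k s ≤ s := fun k s hs => by
    refine div_le_self hs.le ?_
    have := mul_pos (ha0 k) hs
    linarith
  have hθa : ∀ k s, 0 < s → θ k s ≤ 1 / a k := fun k s hs => by
    rw [hθ, div_le_div_iff₀ (hpos k s hs) (ha0 k)]
    nlinarith [ha0 k]
  have hθ'0 : ∀ k s, 0 < s → 0 ≤ θ' k s := fun k s hs => by
    have := hpos k s hs; positivity
  have hθ'1 : ∀ k s, 0 < s → θ' k s ≤ 1 := fun k s hs => by
    refine div_le_one_of_le₀ ?_ (by positivity)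
    have := mul_pos (ha0 k) hs
    nlinarith
  have hθc : ∀ k, ContDiffOn ℝ (⊤ : ℕ∞) (θ k) (Set.Ioi 0) := fun k =>
    contDiffOn_id.div (contDiffOn_const.add (contDiffOn_const.mul contDiffOn_id))
      fun s hs => (hpos k s hs).ne'
  have hθd : ∀ k s, 0 < s → HasDerivAt (θ k) (θ' k s) s := fun k s hs => by
    have h1 : HasDerivAt (fun s => 1 + a k * s) (a k) s := by
      simpa using ((hasDerivAt_id s).const_mul (a k)).const_add 1
    refine ((hasDerivAt_id s).div h1 (hpos k s hs).ne').congr_deriv ?_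
    simp only [hθ', id]
    congr 1
    ring
  have H1 : ∀ k, IsH1 (fun x => (θ k (reg η x) : ℂ) * u x) (fun i x => (θ k (reg η x) : ℂ) * G i x +
      (θ' k (reg η x) : ℂ) * ((x i / reg η x : ℝ) : ℂ) * u x) := fun k => by
    refine h.isH1.radial_mul hη (f := fun s => (θ k s : ℂ)) (f' := fun s => (θ' k s : ℂ))
      (Complex.ofRealCLM.contDiff.comp_contDiffOn (hθc k)) (fun s hs => (hθd k s hs).ofReal_comp)
      (C := 1 / a k + 1) (fun s hs => ?_) (fun s hs => ?_)
    · have hs0 : 0 < s := hη.trans_le hs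
      rw [Complex.norm_real, Real.norm_of_nonneg (hθ0 k s hs0)]
      linarith [hθa k s hs0]
    · have hs0 : 0 < s := hη.trans_le hs
      rw [Complex.norm_real, Real.norm_of_nonneg (hθ'0 k s hs0)]
      have : 0 < 1 / a k := by have := ha0 k; positivity
      linarith [hθ'1 k s hs0]
  have H2 : ∀ k, IsH1 (fun x => ((θ k (reg η x) ^ 2 : ℝ) : ℂ) * u x)
      (fun i x => ((θ k (reg η x) ^ 2 : ℝ) : ℂ) * G i x +
      ((2 * (θ k (reg η x) * θ' k (reg η x)) : ℝ) : ℂ) * ((x i / reg η x : ℝ) : ℂ) * u x) := fun k => by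
    refine h.isH1.radial_mul hη (f := fun s => ((θ k s ^ 2 : ℝ) : ℂ))
      (f' := fun s => ((2 * (θ k s * θ' k s) : ℝ) : ℂ))
      (Complex.ofRealCLM.contDiff.comp_contDiffOn ((hθc k).pow 2)) (fun s hs => ?_)
      (C := (1 / a k) ^ 2 + 2 * (1 / a k)) (fun s hs => ?_) (fun s hs => ?_)
    · refine (((hθd k s hs).pow 2).congr_deriv ?_).ofReal_comp
      push_cast
      ring
    · have hs0 : 0 < s := hη.trans_le hs
      have : 0 < 1 / a k := by have := ha0 k; positivity
      rw [Complex.norm_real, Real.norm_of_nonneg (by positivity)]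
      have := pow_le_pow_left₀ (hθ0 k s hs0) (hθa k s hs0) 2
      linarith
    · have hs0 : 0 < s := hη.trans_le hs
      have h0 : 0 < 1 / a k := by have := ha0 k; positivity
      have h1 := hθ0 k s hs0
      have h2 := hθ'0 k s hs0
      rw [Complex.norm_real, Real.norm_of_nonneg (by positivity)]
      have := mul_le_mul (hθa k s hs0) (hθ'1 k s hs0) h2 h0.le
      nlinarith [sq_nonneg (1 / a k)]
  have hfA : ∀ k, ‖pairing f (fun x => ((θ k (reg η x) ^ 2 : ℝ) : ℂ) * u x)‖ ≤
      F * l2 (fun x => (θ k (reg η x) : ℂ) * u x) := fun k => by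
    have hle : ∀ x, ‖(θ k (reg η x) : ℂ) * f x‖ ≤ ‖((reg η x : ℝ) : ℂ) * f x‖ := fun x => by
      rw [norm_mul, norm_mul, Complex.norm_real, Complex.norm_real,
        Real.norm_of_nonneg (hθ0 k _ (reg_pos hη x)), Real.norm_of_nonneg (reg_pos hη x).le]
      exact mul_le_mul_of_nonneg_right (hθs k _ (reg_pos hη x)) (norm_nonneg _)
    have hθm : AEStronglyMeasurable (fun x : E n => (θ k (reg η x) : ℂ) * f x) volume := by
      refine AEStronglyMeasurable.mul ?_ h.memLp.1
      exact (contDiff_comp_reg hη (Complex.ofRealCLM.contDiff.comp_contDiffOn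
        (hθc k))).continuous.aestronglyMeasurable
    rw [pairing_sq_mul]
    refine (norm_pairing_le_l2 (hmf.mono hθm (ae_of_all _ hle)) (H1 k).memLp).trans ?_
    exact mul_le_mul_of_nonneg_right (l2_mono hmf hle) (l2_nonneg _)
  -- Imaginary part of the equation tested with θ_k² u. The flux term carries (θ_k²)' = 2θ_kθ_k'
  -- with θ_k' ≤ 1, whence |Im z| A² ≤ (2S + F) A, uniformly in k. This is where Im z ≠ 0 is used.
  have hA : ∀ k, l2 (fun x => (θ k (reg η x) : ℂ) * u x) ≤ M := fun k => by
    set A := l2 (fun x => (θ k (reg η x) : ℂ) * u x) with hAdef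
    have h1 := h.integral_flux hV (p := fun s => θ k s ^ 2) (p' := fun s => 2 * (θ k s * θ' k s))
      (H2 k)
    have hle : ∀ x, ‖((θ k (reg η x) * θ' k (reg η x) : ℝ) : ℂ) * u x‖ ≤
        ‖(θ k (reg η x) : ℂ) * u x‖ := fun x => by
      have h1 := hθ0 k _ (reg_pos hη x)
      have h2 := hθ'0 k _ (reg_pos hη x)
      rw [norm_mul, norm_mul, Complex.norm_real, Complex.norm_real,
        Real.norm_of_nonneg (by positivity), Real.norm_of_nonneg h1]
      exact mul_le_mul_of_nonneg_right (mul_le_of_le_one_right h1 (hθ'1 k _ (reg_pos hη x)))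
        (norm_nonneg _)
    have hmem : MemLp (fun x => ((θ k (reg η x) * θ' k (reg η x) : ℝ) : ℂ) * u x) 2 := by
      refine (H1 k).memLp.mono ?_ (ae_of_all _ hle)
      refine AEStronglyMeasurable.mul ?_ hu.1
      refine Continuous.aestronglyMeasurable (Complex.continuous_ofReal.comp ?_)
      have hp := fun x : E n => (hpos k _ (reg_pos hη x)).ne'
      exact (hm.div (by fun_prop) hp).mul (continuous_const.div (by fun_prop) fun x =>
        pow_ne_zero _ (hp x))
    have h2 : ∫ x, 2 * (θ k (reg η x) * θ' k (reg η x)) * radFlux η u G x = 2 *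
        (pairing (radDer η G) (fun x => ((θ k (reg η x) * θ' k (reg η x) : ℝ) : ℂ) * u x)).im := by
      rw [← integral_mul_radFlux hη hG (q := fun s => θ k s * θ' k s) hmem, ← integral_const_mul]
      congr 1 with x
      ring
    have h3 : |(pairing (radDer η G)
        (fun x => ((θ k (reg η x) * θ' k (reg η x) : ℝ) : ℂ) * u x)).im| ≤ S * A :=
      (Complex.abs_im_le_norm _).trans ((norm_pairing_le_l2 (memLp_radDer hη hG) hmem).trans
        (mul_le_mul_of_nonneg_left (l2_mono (H1 k).memLp hle) (l2_nonneg _)))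
    have h4 := (Complex.abs_im_le_norm _).trans (hfA k)
    rw [h2, h.pairing_rhs (p := fun s => θ k s ^ 2) (H2 k).memLp, Complex.add_im,
      Complex.im_mul_ofReal] at h1
    have h5 : ∫ x, θ k (reg η x) ^ 2 * ‖u x‖ ^ 2 = A ^ 2 := by
      rw [hAdef, l2_sq]
      congr 1 with x
      rw [norm_mul, mul_pow, Complex.norm_real, Real.norm_eq_abs, sq_abs]
    rw [h5] at h1
    have hA0 : 0 ≤ A := l2_nonneg _
    have h6 : ε * A ^ 2 ≤ (2 * S + F) * A := by
      have e : ε * A ^ 2 = |z.im * A ^ 2| := by rw [abs_mul, abs_of_nonneg (sq_nonneg A)]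
      rw [e, abs_le]
      rw [abs_le] at h3 h4
      constructor <;> nlinarith
    rw [hM, le_div_iff₀ hε0]
    rcases hA0.eq_or_lt with h0 | h0
    · rw [← h0, zero_mul]
      have : 0 ≤ S := l2_nonneg _
      have : 0 ≤ F := l2_nonneg _
      positivity
    · nlinarith
  have hlim : ∀ s, Tendsto (fun k => (θ k s : ℂ)) atTop (𝓝 (s : ℂ)) := fun s => by
    have h1 : Tendsto a atTop (𝓝 0) := tendsto_one_div_add_atTop_nhds_zero_nat
    have h2 : Tendsto (fun k => θ k s) atTop (𝓝 (s / (1 + 0 * s))) :=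
      tendsto_const_nhds.div (tendsto_const_nhds.add (h1.mul_const s)) (by simp)
    simp only [zero_mul, add_zero, div_one] at h2
    exact (Complex.continuous_ofReal.tendsto _).comp h2
  refine ⟨memLp_of_tendsto_ae (fun k => (H1 k).memLp) hA fun x =>
    (hlim _).mul tendsto_const_nhds, fun i => ?_⟩
  -- The uniform bound for ‖∇(θ_k u)‖², obtained from coercivity and the real part of the equation
  -- tested with θ_k² u.
  set B := (|z.re| * M ^ 2 + F * M + l2 u ^ 2) / δ with hB
  have hM0 : 0 ≤ M := (l2_nonneg _).trans (hA 0)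
  have hF0 : 0 ≤ F := l2_nonneg _
  have hN : ∀ k, ∑ i, (∫ x, ‖(θ k (reg η x) : ℂ) * G i x +
      (θ' k (reg η x) : ℂ) * ((x i / reg η x : ℝ) : ℂ) * u x‖ ^ 2) ≤ B := fun k => by
    set A := l2 (fun x => (θ k (reg η x) : ℂ) * u x) with hAdef
    have h1 := hQ (fun s => (θ k s : ℂ)) _ (H1 k)
    rw [h.form_radial_mul_real hV (H1 k) (H2 k),
      h.pairing_rhs (p := fun s => θ k s ^ 2) (H2 k).memLp, Complex.add_re,
      Complex.re_mul_ofReal] at h1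
    have h5 : ∫ x, θ k (reg η x) ^ 2 * ‖u x‖ ^ 2 = A ^ 2 := by
      rw [hAdef, l2_sq]
      congr 1 with x
      rw [norm_mul, mul_pow, Complex.norm_real, Real.norm_eq_abs, sq_abs]
    rw [h5] at h1
    have h4 := (Complex.re_le_norm _).trans (hfA k)
    have h6 : ∫ x, θ' k (reg η x) ^ 2 * (‖x‖ ^ 2 / reg η x ^ 2) * ‖u x‖ ^ 2 ≤ l2 u ^ 2 := by
      rw [l2_sq]
      refine integral_mono_of_nonneg (ae_of_all _ fun x => by positivity)
        (hu.integrable_norm_pow (by norm_num)) (ae_of_all _ fun x => ?_)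
      have a1 : θ' k (reg η x) ^ 2 ≤ 1 :=
        pow_le_one₀ (hθ'0 k _ (reg_pos hη x)) (hθ'1 k _ (reg_pos hη x))
      have a2 : ‖x‖ ^ 2 / reg η x ^ 2 ≤ 1 :=
        div_le_one_of_le₀ (pow_le_pow_left₀ (norm_nonneg _) (norm_le_reg η x) 2) (by positivity)
      exact mul_le_of_le_one_left (by positivity) (mul_le_one₀ a1 (by positivity) a2)
    have hAM := hA k
    have hA0 : 0 ≤ A := l2_nonneg _
    have h7 : z.re * A ^ 2 ≤ |z.re| * M ^ 2 :=
      mul_le_mul (le_abs_self _) (pow_le_pow_left₀ hA0 hAM 2) (sq_nonneg _) (abs_nonneg _)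
    have h8 : F * A ≤ F * M := mul_le_mul_of_nonneg_left hAM hF0
    rw [hB, le_div_iff₀ hδ]
    linarith
  -- Since ∂ᵢ(θ_k u) = θ_k Gᵢ + θ_k'(xᵢ/m)u and the last term is bounded by ‖u‖, the bound on ∇(θ_k
  -- u) transfers to θ_k Gᵢ. Fatou then gives m Gᵢ in L².
  have hKi : ∀ k, MemLp (fun x => (θ' k (reg η x) : ℂ) * ((x i / reg η x : ℝ) : ℂ) * u x) 2 ∧
      l2 (fun x => (θ' k (reg η x) : ℂ) * ((x i / reg η x : ℝ) : ℂ) * u x) ≤ l2 u := fun k => by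
    have hle : ∀ x, ‖(θ' k (reg η x) : ℂ) * ((x i / reg η x : ℝ) : ℂ) * u x‖ ≤ ‖u x‖ := fun x => by
      rw [norm_mul, norm_mul, Complex.norm_real (θ' k _), Real.norm_of_nonneg (hθ'0 k _ (reg_pos hη x))]
      exact mul_le_of_le_one_left (norm_nonneg _) (mul_le_one₀ (hθ'1 k _ (reg_pos hη x))
        (norm_nonneg _) (abs_coord_div_reg_le hη x i))
    refine ⟨hu.mono ?_ (ae_of_all _ hle), l2_mono hu hle⟩
    refine (AEStronglyMeasurable.mul ?_ (aestronglyMeasurable_coord_div_reg η i)).mul hu.1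
    refine Continuous.aestronglyMeasurable (Complex.continuous_ofReal.comp ?_)
    have hp := fun x : E n => (hpos k _ (reg_pos hη x)).ne'
    exact continuous_const.div (by fun_prop) fun x => pow_ne_zero _ (hp x)
  have hθG : ∀ k, MemLp (fun x => (θ k (reg η x) : ℂ) * G i x) 2 ∧
      l2 (fun x => (θ k (reg η x) : ℂ) * G i x) ≤ √B + l2 u := fun k => by
    have m1 := (H1 k).memLp_grad i
    have m2 := ((hKi k).1).const_mul (-1)
    have m3 := m1.add m2
    have e : (fun x => ((θ k (reg η x) : ℂ) * G i x +
        (θ' k (reg η x) : ℂ) * ((x i / reg η x : ℝ) : ℂ) * u x) +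
        (-1) * ((θ' k (reg η x) : ℂ) * ((x i / reg η x : ℝ) : ℂ) * u x)) =
        fun x => (θ k (reg η x) : ℂ) * G i x := by
      ext x; ring
    have l := l2_add_le m1 m2
    have m4 : MemLp (fun x => ((θ k (reg η x) : ℂ) * G i x +
        (θ' k (reg η x) : ℂ) * ((x i / reg η x : ℝ) : ℂ) * u x) +
        (-1) * ((θ' k (reg η x) : ℂ) * ((x i / reg η x : ℝ) : ℂ) * u x)) 2 := m3
    rw [e] at l m4
    refine ⟨m4, l.trans (add_le_add ?_ ?_)⟩
    · refine Real.sqrt_le_sqrt (le_trans ?_ (hN k))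
      exact Finset.single_le_sum (f := fun i => ∫ x, ‖(θ k (reg η x) : ℂ) * G i x +
        (θ' k (reg η x) : ℂ) * ((x i / reg η x : ℝ) : ℂ) * u x‖ ^ 2)
        (fun i _ => integral_nonneg fun x => by positivity) (Finset.mem_univ i)
    · refine le_trans (l2_mono (hKi k).1 fun x => ?_) (hKi k).2
      rw [neg_one_mul, norm_neg]
  exact memLp_of_tendsto_ae (fun k => (hθG k).1) (fun k => (hθG k).2) fun x =>
    (hlim _).mul tendsto_const_nhds
end

/-! ### The weighted resolvent estimate -/

/-- Here y stands for ‖∇v‖ and e for the error that vanishes with η. After multiplication by δ,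
Young's inequality absorbs the term √(2Fy) y/4 into δ²y²/8. A further factor δ² leaves, for Y = δ²y,
a quadratic inequality with constants independent of δ, which explains the power δ². -/
theorem le_of_quadratic_estimate {N F y e δ : ℝ} (hN : 0 ≤ N) (hF : 0 ≤ F) (hy : 0 ≤ y) (he : 0 ≤ e)
    (hδ : 0 < δ) (hδ1 : δ ≤ 1)
    (h : δ / 2 * y ^ 2 ≤ N * F * y + √(2 * F * y) * (F + y / 2) / 2 + e) :
    δ ^ 2 * y ≤ 3 * (N + 2) * F + 2 * √e := by
  set s := √(2 * F * y) with hs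
  have hs2 : s ^ 2 = 2 * F * y := Real.sq_sqrt (by positivity)
  have hs0 : 0 ≤ s := Real.sqrt_nonneg _
  set q := √e with hq
  have hq2 : q ^ 2 = e := Real.sq_sqrt he
  have hq0 : 0 ≤ q := Real.sqrt_nonneg _
  have hFy : 0 ≤ F * y := by positivity
  have hδ2 : δ ^ 2 ≤ 1 := pow_le_one₀ hδ.le hδ1
  have h1 : 3 / 8 * δ ^ 2 * y ^ 2 ≤ (N + 3 / 4) * (F * y) + F ^ 2 / 4 + e := by
    have a1 : δ * (N * F * y) ≤ N * F * y := mul_le_of_le_one_left (by positivity) hδ1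
    have a2 : δ * (s * F / 2) ≤ s * F / 2 := mul_le_of_le_one_left (by positivity) hδ1
    have a3 : s * F / 2 ≤ F * y / 2 + F ^ 2 / 4 := by nlinarith [sq_nonneg (s - F)]
    have a4 : δ * (s * y / 4) ≤ δ ^ 2 * y ^ 2 / 8 + F * y / 4 := by nlinarith [sq_nonneg (δ * y - s)]
    have a5 : δ * e ≤ e := mul_le_of_le_one_left he hδ1
    have a6 := mul_le_mul_of_nonneg_left h hδ.le
    nlinarith
  set Y := δ ^ 2 * y with hY
  have hY0 : 0 ≤ Y := by positivity
  have h2 : 3 / 8 * Y ^ 2 ≤ (N + 3 / 4) * (F * Y) + F ^ 2 / 4 + e := by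
    have a6 := mul_le_mul_of_nonneg_left h1 (sq_nonneg δ)
    have a7 : δ ^ 2 * (F ^ 2 / 4 + e) ≤ F ^ 2 / 4 + e :=
      mul_le_of_le_one_left (by positivity) hδ2
    have e1 : 3 / 8 * Y ^ 2 = δ ^ 2 * (3 / 8 * δ ^ 2 * y ^ 2) := by rw [hY]; ring
    have e2 : (N + 3 / 4) * (F * Y) = δ ^ 2 * ((N + 3 / 4) * (F * y)) := by rw [hY]; ring
    rw [e1, e2]
    linarith
  -- A value of Y above the claimed bound exceeds both F and 2√e, so each term on the right of the
  -- quadratic inequality is at most a multiple of Y, too small in total.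
  by_contra! hc
  have hNF : 0 ≤ N * F := by positivity
  have b1 : F ≤ Y := by nlinarith
  have b2 : 2 * q ≤ Y := by nlinarith
  have hYp : 0 < Y := lt_of_le_of_lt (by positivity) hc
  have b3 : (3 * (N + 2) * F + 2 * q) * Y < Y * Y := mul_lt_mul_of_pos_right hc hYp
  have b4 : F * F ≤ F * Y := mul_le_mul_of_nonneg_left b1 hF
  have b5 : q * (2 * q) ≤ q * Y := mul_le_mul_of_nonneg_left b2 hq0
  have b6 : 0 ≤ N * (F * Y) := by positivity
  nlinarith

/-- Dictionary, with v = e^{-iκm}u: Nu, Nv are the squared gradient norms of u and v. Vu, Wu are the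
potential terms. U, M, R, T are the integrals of |u|² against 1, m, |x|²/m², |x|²/m³. J, Y are the
radial flux integrated against 1 and m. The data terms are a = Re⟨f,u⟩, b = Im⟨f,mu⟩, c = Re⟨f,mu⟩,
d = Re⟨x·∇u,f⟩, and n₀ is the dimension. -/
theorem quadratic_estimate {Nu Nv Vu Wu U M Y J R T a b c d lam ε κ δ n₀ B Fm X : ℝ}
    (hlam : κ ^ 2 = lam) (hκ : κ ≠ 0) (hκε : 0 ≤ κ * ε) (hεlam : |ε| ≤ lam)
    (h2 : Nu + Vu = lam * U + a) (h3 : J = ε * M + b) (hNv : Nv = Nu + κ ^ 2 * R - 2 * κ * J)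
    (h1 : Nu - Wu / 2 = ε * Y + d + n₀ / 2 * a) (hQ' : δ * Nv ≤ Nv - (Vu + Wu))
    (h4 : 0 ≤ lam * M + c + κ ^ 2 * M + T / 4 - 2 * κ * Y) (hR : R ≤ U) (hT : T ≤ X * √U)
    (hc : c ≤ Fm * √U) (h5 : d - κ * b ≤ B) (hFm : 0 ≤ Fm) (hX : 0 ≤ X) :
    δ / 2 * Nv ≤ √(|ε| * U) * (Fm + X / 4) / 2 + B + (n₀ - 1) / 2 * a := by
  have hlam0 : 0 < lam := hlam ▸ by positivity
  -- Virial minus half the energy minus κ times the flux identity. The λ-terms cancel up to λ(R -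
  -- U)/2 ≤ 0, and the phase makes the left side a coercive form of v.
  have s1 : δ / 2 * Nv ≤ ε * (Y - κ * M) + (d - κ * b) + (n₀ - 1) / 2 * a := by
    subst h3 hNv
    have : lam * R ≤ lam * U := mul_le_mul_of_nonneg_left hR hlam0.le
    rw [hlam] at *
    nlinarith
  -- Nonnegativity of the form at √m v, with λ + κ² = 2κ². Only this one-sided bound on κ(Y - κM) is
  -- available.
  have s2 : 2 * (κ * (Y - κ * M)) ≤ (Fm + X / 4) * √U := by
    rw [hlam] at h4
    have : κ * (Y - κ * M) = κ * Y - lam * M := by rw [← hlam]; ring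
    nlinarith
  have s3 : ε * (Y - κ * M) = (κ * ε / lam) * (κ * (Y - κ * M)) := by
    rw [← hlam]; field_simp
  -- κε/λ = |ε|/√λ, and |ε| ≤ λ. The resulting √|ε| pairs with √U to give √(|ε|U), which the data
  -- control.
  have s4 : κ * ε / lam ≤ √|ε| := by
    rw [div_le_iff₀ hlam0]
    refine le_of_sq_le_sq ?_ (by positivity)
    rw [mul_pow, mul_pow, hlam, Real.sq_sqrt (abs_nonneg _), ← sq_abs ε]
    have : |ε| * (lam * |ε|) ≤ |ε| * (lam * lam) := by gcongr
    nlinarith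
  have s5 : 0 ≤ κ * ε / lam := div_nonneg hκε hlam0.le
  have s6 : ε * (Y - κ * M) ≤ √(|ε| * U) * (Fm + X / 4) / 2 := by
    rw [s3, Real.sqrt_mul (abs_nonneg _)]
    have t1 : (κ * ε / lam) * (κ * (Y - κ * M)) ≤ (κ * ε / lam) * ((Fm + X / 4) * √U / 2) :=
      mul_le_mul_of_nonneg_left (by linarith) s5
    have t2 : (κ * ε / lam) * ((Fm + X / 4) * √U / 2) ≤ √|ε| * ((Fm + X / 4) * √U / 2) :=
      mul_le_mul_of_nonneg_right s4 (by positivity)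
    linarith
  linarith

section
variable {n : ℕ} {V W : E n → ℝ} {C C' : ℝ≥0∞} {z : ℂ} {f g u : E n → ℂ} {G : Fin n → E n → ℂ}
  {η : ℝ}

theorem sq_norm_div_reg_le_one (η : ℝ) (x : E n) : ‖x‖ ^ 2 / reg η x ^ 2 ≤ 1 :=
  div_le_one_of_le₀ (pow_le_pow_left₀ (norm_nonneg _) (norm_le_reg η x) 2) (by positivity)

theorem integrable_bdd_mul_norm_sq {q : E n → ℝ} (hq : AEStronglyMeasurable q volume) {C : ℝ}
    (hC : ∀ x, ‖q x‖ ≤ C) (hu : MemLp u 2) : Integrable fun x => q x * ‖u x‖ ^ 2 :=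
  (hu.integrable_norm_pow (by norm_num)).bdd_mul hq (ae_of_all _ hC)

theorem nontrivial_euclidean (hn : 3 ≤ n) : Nontrivial (E n) := by
  have : NeZero n := ⟨by omega⟩
  infer_instance

theorem ae_ne_zero (hn : 3 ≤ n) : ∀ᵐ x : E n, x ≠ 0 := by
  have := nontrivial_euclidean hn
  simp [ae_iff]

theorem pairing_norm_mul (hn : 3 ≤ n) (f g : E n → ℂ) :
    pairing (fun x => ((‖x‖ : ℝ) : ℂ) * f x) (fun x => ((‖x‖⁻¹ : ℝ) : ℂ) * g x) = pairing f g := by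
  refine integral_congr_ae ?_
  filter_upwards [ae_ne_zero hn] with x hx
  have : (‖x‖ : ℂ) ≠ 0 := by exact_mod_cast norm_ne_zero_iff.2 hx
  rw [map_mul, Complex.conj_ofReal, Complex.ofReal_inv]
  field_simp

theorem IsH1.hardy (hn : 3 ≤ n) (hu : IsH1 u G) :
    MemLp (fun x => ((‖x‖⁻¹ : ℝ) : ℂ) * u x) 2 ∧
      l2 (fun x => ((‖x‖⁻¹ : ℝ) : ℂ) * u x) ^ 2 ≤ 4 * ∑ i, ∫ x, ‖G i x‖ ^ 2 := by
  have hb := gradBounded_norm_inv hn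
  have hm := hb.memLp hu
  refine ⟨hm, ?_⟩
  have h := hb.bound_isH1 hu
  have e : ∑ i, sqNorm (G i) = ENNReal.ofReal (∑ i, ∫ x, ‖G i x‖ ^ 2) := by
    rw [ENNReal.ofReal_sum_of_nonneg fun i _ => integral_nonneg fun x => by positivity]
    exact Finset.sum_congr rfl fun i _ => sqNorm_eq_ofReal (hu.memLp_grad i)
  have h0 : 0 ≤ ∑ i, ∫ x, ‖G i x‖ ^ 2 :=
    Finset.sum_nonneg fun i _ => integral_nonneg fun x => by positivity
  rw [sqNorm_eq_l2 hm, e, show (4 : ℝ≥0∞) = ENNReal.ofReal 4 by simp,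
    ← ENNReal.ofReal_mul (by norm_num), ENNReal.ofReal_le_ofReal_iff (by positivity)] at h
  exact h

theorem memLp_dilGen (hη : 0 < η) (hu : MemLp u 2)
    (hmG : ∀ i, MemLp (fun x => ((reg η x : ℝ) : ℂ) * G i x) 2) :
    (∀ i, MemLp (fun x => (x i : ℂ) * G i x) 2) ∧ MemLp (dilGen u G) 2 := by
  have h1 : ∀ i, MemLp (fun x => (x i : ℂ) * G i x) 2 := fun i => by
    refine (memLp_coord_mul hη i (hmG i)).ae_eq (ae_of_all _ fun x => ?_)
    have := (reg_pos hη x).ne'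
    have : (reg η x : ℂ) ≠ 0 := by exact_mod_cast this
    push_cast
    field_simp
  exact ⟨h1, (memLp_finsetSum _ fun i _ => h1 i).add (hu.const_mul _)⟩

theorem coord_mul_eq_reg_mul_radDer (hη : 0 < η) (G : Fin n → E n → ℂ) (x : E n) :
    ∑ i, (x i : ℂ) * G i x = (reg η x : ℂ) * radDer η G x := by
  rw [radDer, Finset.mul_sum]
  refine Finset.sum_congr rfl fun i _ => ?_
  have : (reg η x : ℂ) ≠ 0 := by exact_mod_cast (reg_pos hη x).ne'
  push_cast
  field_simp

/-- Re⟨U_t u, u⟩ is maximal at t = 0 by unitarity, so its derivative Re⟨Au, u⟩ vanishes. The term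
n/2 contributes only a real number, so the imaginary part is the flux weighted by m. -/
theorem pairing_dilGen_self (hu : IsH1 u G) (hη : 0 < η)
    (hmG : ∀ i, MemLp (fun x => ((reg η x : ℝ) : ℂ) * G i x) 2) :
    (pairing (dilGen u G) u).re = 0 ∧
      (pairing (dilGen u G) u).im = ∫ x, reg η x * radFlux η u G x := by
  have hA := (memLp_dilGen hη hu.memLp hmG).2
  constructor
  · have d := Complex.reCLM.hasFDerivAt.comp_hasDerivAt 0 (hasDerivAt_pairing_dil hu hA hu.memLp)
    have hmax : IsLocalMax (Complex.reCLM ∘ fun t => pairing (dil t u) u) 0 := by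
      refine Eventually.of_forall fun t => ?_
      simp only [Function.comp_apply, Complex.reCLM_apply, dil_zero]
      refine (Complex.re_le_norm _).trans ((norm_pairing_le_l2 (memLp_dil hu.memLp t)
        hu.memLp).trans (le_of_eq ?_))
      rw [pairing_self, Complex.ofReal_re, ← l2_sq, l2, integral_norm_sq_dil hu.memLp, ← l2, sq]
    exact hmax.hasDerivAt_eq_zero d
  · rw [pairing_im hA hu.memLp]
    congr 1 with x
    rw [dilGen, coord_mul_eq_reg_mul_radDer hη, add_mul, Complex.add_im, mul_assoc,
      Complex.im_ofReal_mul, mul_assoc, Complex.mul_conj, ← Complex.ofReal_mul, Complex.ofReal_im,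
      add_zero, radFlux]

theorem IsWeakSolution.pairing_rhs_self (h : IsWeakSolution V z f u G) :
    pairing (fun x => z * u x + f x) u = z * ((∫ x, ‖u x‖ ^ 2 : ℝ) : ℂ) + pairing f u := by
  have := h.pairing_rhs (p := fun _ => 1) (η := 0) (by simpa using h.isH1.memLp)
  simpa using this

theorem IsWeakSolution.energy (h : IsWeakSolution V z f u G) (hV : FormBounded V C) :
    ∑ i, (∫ x, ‖G i x‖ ^ 2) + ∫ x, V x * ‖u x‖ ^ 2 =
      z.re * (∫ x, ‖u x‖ ^ 2) + (pairing f u).re ∧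
    0 = z.im * (∫ x, ‖u x‖ ^ 2) + (pairing f u).im := by
  have h1 := h.weak_eq_isH1 hV h.isH1
  simp_rw [h.pairing_rhs_self, pairing_self, FormBounded.integral_self] at h1
  have h2 := congrArg Complex.re h1
  have h3 := congrArg Complex.im h1
  simp only [Complex.add_re, Complex.add_im, Complex.re_sum, Complex.im_sum, Complex.ofReal_re,
    Complex.ofReal_im, Complex.re_mul_ofReal, Complex.im_mul_ofReal, Finset.sum_const_zero,
    add_zero] at h2 h3
  exact ⟨h2, h3⟩

theorem isH1_reg_mul (hη : 0 < η) (hu : IsH1 u G)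
    (hmu : MemLp (fun x => ((reg η x : ℝ) : ℂ) * u x) 2)
    (hmG : ∀ i, MemLp (fun x => ((reg η x : ℝ) : ℂ) * G i x) 2) :
    IsH1 (fun x => (reg η x : ℂ) * u x) (fun i x => (reg η x : ℂ) * G i x +
      ((1 : ℝ) : ℂ) * ((x i / reg η x : ℝ) : ℂ) * u x) := by
  refine hu.radial_mul_of_weighted hη hmu hmG (f := fun s => (s : ℂ)) (f' := fun s => ((1 : ℝ) : ℂ))
    Complex.ofRealCLM.contDiff.contDiffOn (fun s _ => (hasDerivAt_id s).ofReal_comp)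
    (C := 1 + 1 / η) (fun s hs => ?_) (fun s hs => ?_)
  · have hs0 : 0 < s := hη.trans_le hs
    rw [Complex.norm_real, Real.norm_of_nonneg hs0.le]
    have : 0 < 1 / η * s := by positivity
    linarith
  · have hs0 : 0 < s := hη.trans_le hs
    have : 1 ≤ 1 / η * s := by
      rw [div_mul_eq_mul_div, one_mul, le_div_iff₀ hη]; linarith
    simp only [Complex.ofReal_one, norm_one]
    linarith

/-- The phase `e^{-iκs}`. -/
def phase (κ s : ℝ) : ℂ := Complex.exp (((-κ * s : ℝ) : ℂ) * Complex.I)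

theorem norm_phase (κ s : ℝ) : ‖phase κ s‖ = 1 := Complex.norm_exp_ofReal_mul_I _

theorem phase_mul_conj (κ s : ℝ) : phase κ s * conj (phase κ s) = 1 := by
  rw [Complex.mul_conj, Complex.normSq_eq_norm_sq, norm_phase]
  simp

theorem hasDerivAt_phase (κ s : ℝ) : HasDerivAt (phase κ) (-(κ : ℂ) * Complex.I * phase κ s) s := by
  have h1 : HasDerivAt (fun s : ℝ => ((-κ * s : ℝ) : ℂ) * Complex.I) (((-κ : ℝ) : ℂ) * Complex.I) s := by
    have : HasDerivAt (fun s : ℝ => -κ * s) (-κ) s := by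
      simpa using (hasDerivAt_id s).const_mul (-κ)
    exact this.ofReal_comp.mul_const _
  refine h1.cexp.congr_deriv ?_
  rw [phase]
  push_cast
  ring

theorem contDiff_phase (κ : ℝ) : ContDiff ℝ (⊤ : ℕ∞) (phase κ) := by
  unfold phase
  refine ContDiff.cexp (ContDiff.mul (Complex.ofRealCLM.contDiff.comp ?_) contDiff_const)
  exact contDiff_const.mul contDiff_id

theorem isH1_phase_mul (hη : 0 < η) (hu : IsH1 u G) (κ : ℝ) :
    IsH1 (fun x => phase κ (reg η x) * u x) (fun i x => phase κ (reg η x) * G i x +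
      (-(κ : ℂ) * Complex.I * phase κ (reg η x)) * ((x i / reg η x : ℝ) : ℂ) * u x) := by
  refine hu.radial_mul hη (f := phase κ) (f' := fun s => -(κ : ℂ) * Complex.I * phase κ s)
    (contDiff_phase κ).contDiffOn (fun s _ => hasDerivAt_phase κ s) (C := 1 + |κ|)
    (fun s _ => ?_) (fun s _ => ?_)
  · rw [norm_phase]
    linarith [abs_nonneg κ]
  · rw [norm_mul, norm_mul, norm_phase, norm_neg, Complex.norm_I, Complex.norm_real,
      Real.norm_eq_abs]
    linarith

/-- The energy of `e^{-iκm} u`. -/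
theorem IsWeakSolution.phase_energy (h : IsWeakSolution V z f u G) (hV : FormBounded V C)
    (hη : 0 < η) (κ : ℝ) :
    ∑ i, (∫ x, ‖phase κ (reg η x) * G i x +
      (-(κ : ℂ) * Complex.I * phase κ (reg η x)) * ((x i / reg η x : ℝ) : ℂ) * u x‖ ^ 2) =
    ∑ i, (∫ x, ‖G i x‖ ^ 2) + κ ^ 2 * (∫ x, ‖x‖ ^ 2 / reg η x ^ 2 * ‖u x‖ ^ 2) -
      2 * κ * ∫ x, radFlux η u G x := by
  have e1 : ∀ s, ‖phase κ s‖ ^ 2 = 1 := fun s => by rw [norm_phase, one_pow]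
  -- For a pure phase ψ conj ψ' is imaginary, so |ψ|² has zero derivative and the real part of the
  -- equation is tested with u itself. Only the flux and κ²|x|²/m² remain.
  have e2 : ∀ s, phase κ s * conj (-(κ : ℂ) * Complex.I * phase κ s) = (κ : ℂ) * Complex.I := fun s => by
    have := phase_mul_conj κ s
    simp only [map_mul, map_neg, Complex.conj_ofReal, Complex.conj_I]
    linear_combination (κ : ℂ) * Complex.I * this
  have e3 : ∀ s, ‖-(κ : ℂ) * Complex.I * phase κ s‖ ^ 2 = κ ^ 2 := fun s => by
    rw [norm_mul, norm_mul, norm_phase, norm_neg, Complex.norm_I, Complex.norm_real,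
      Real.norm_eq_abs, mul_one, mul_one, sq_abs]
  have h1 := h.form_radial_mul hV (ψ := phase κ)
    (ψ' := fun s => -(κ : ℂ) * Complex.I * phase κ s) (isH1_phase_mul hη h.isH1 κ) (by
    simp_rw [e1, e2]
    refine h.isH1.congr (ae_of_all _ fun x => ?_) fun i => ae_of_all _ fun x => ?_
    · simp
    · simp)
  have hv : ∫ x, V x * ‖phase κ (reg η x) * u x‖ ^ 2 = ∫ x, V x * ‖u x‖ ^ 2 := by
    congr 1 with x
    rw [norm_mul, norm_phase, one_mul]
  simp_rw [e1, e2, e3] at h1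
  rw [hv] at h1
  have h2 := (h.energy hV).1
  have e4 : pairing (fun x => z * u x + f x) (fun x => ((1 : ℝ) : ℂ) * u x) =
      z * ((∫ x, ‖u x‖ ^ 2 : ℝ) : ℂ) + pairing f u := by
    rw [← h.pairing_rhs_self]
    simp
  rw [e4, Complex.add_re, Complex.re_mul_ofReal, ← h2] at h1
  have i1 : Integrable fun x => κ ^ 2 * (‖x‖ ^ 2 / reg η x ^ 2) * ‖u x‖ ^ 2 := by
    refine integrable_bdd_mul_norm_sq (q := fun x => κ ^ 2 * (‖x‖ ^ 2 / reg η x ^ 2)) ?_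
      (C := κ ^ 2) (fun x => ?_) h.isH1.memLp
    · exact (continuous_const.mul ((continuous_norm.pow 2).div ((continuous_reg η).pow 2)
        fun x => pow_ne_zero _ (reg_pos hη x).ne')).aestronglyMeasurable
    · rw [Real.norm_of_nonneg (by positivity)]
      exact mul_le_of_le_one_right (sq_nonneg _) (sq_norm_div_reg_le_one η x)
  have i2 : Integrable fun x => radFlux η u G x :=
    (integrable_mul_conj (memLp_radDer hη h.isH1.memLp_grad) h.isH1.memLp).im
  have i3 : Integrable fun x => 2 * ((κ : ℂ) * Complex.I).im * radFlux η u G x := i2.const_mul _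
  rw [integral_sub i1 i3, integral_const_mul] at h1
  simp_rw [mul_assoc (κ ^ 2)] at h1
  rw [integral_const_mul] at h1
  simp only [Complex.im_ofReal_mul, Complex.I_im, mul_one] at h1
  linarith

theorem sqrt_le_div_mul {s : ℝ} (hη : 0 < η) (hs : η ≤ s) : √s ≤ 1 / √η * s := by
  have hse : 0 < √η := Real.sqrt_pos.2 hη
  rw [div_mul_eq_mul_div, one_mul, le_div_iff₀ hse]
  calc √s * √η ≤ √s * √s := by gcongr
    _ = s := Real.mul_self_sqrt (hη.le.trans hs)

theorem isH1_sqrt_phase_mul (hη : 0 < η) (hu : IsH1 u G)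
    (hmu : MemLp (fun x => ((reg η x : ℝ) : ℂ) * u x) 2)
    (hmG : ∀ i, MemLp (fun x => ((reg η x : ℝ) : ℂ) * G i x) 2) (κ : ℝ) :
    IsH1 (fun x => ((√(reg η x) : ℝ) : ℂ) * phase κ (reg η x) * u x)
      (fun i x => ((√(reg η x) : ℝ) : ℂ) * phase κ (reg η x) * G i x +
      ((((1 / (2 * √(reg η x)) : ℝ) : ℂ) - ((κ * √(reg η x) : ℝ) : ℂ) * Complex.I) *
        phase κ (reg η x)) * ((x i / reg η x : ℝ) : ℂ) * u x) := by
  have hse : 0 < √η := Real.sqrt_pos.2 hη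
  refine hu.radial_mul_of_weighted hη hmu hmG (f := fun s => ((√s : ℝ) : ℂ) * phase κ s)
    (f' := fun s => (((1 / (2 * √s) : ℝ) : ℂ) - ((κ * √s : ℝ) : ℂ) * Complex.I) * phase κ s)
    (ContDiffOn.mul (Complex.ofRealCLM.contDiff.comp_contDiffOn (contDiffOn_id.sqrt
      fun s hs => (Set.mem_Ioi.1 hs).ne')) (contDiff_phase κ).contDiffOn)
    (fun s hs => ?_) (C := (1 + |κ|) / √η + 1 / (2 * √η * η))
    (fun s hs => ?_) (fun s hs => ?_)
  · have h1 : HasDerivAt (fun s : ℝ => ((√s : ℝ) : ℂ)) ((1 / (2 * √s) : ℝ) : ℂ) s :=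
      (Real.hasDerivAt_sqrt hs.ne').ofReal_comp
    refine (h1.mul (hasDerivAt_phase κ s)).congr_deriv ?_
    push_cast
    ring
  · have hs0 : 0 < s := hη.trans_le hs
    have h1 := sqrt_le_div_mul hη hs
    rw [norm_mul, norm_phase, mul_one, Complex.norm_real, Real.norm_of_nonneg (Real.sqrt_nonneg _)]
    have h2 : 0 ≤ (|κ| / √η + 1 / (2 * √η * η)) * s := by positivity
    calc √s ≤ 1 / √η * s := h1
      _ ≤ 1 / √η * s + (|κ| / √η + 1 / (2 * √η * η)) * s := by linarith
      _ = _ := by ring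
  · have hs0 : 0 < s := hη.trans_le hs
    have h1 := sqrt_le_div_mul hη hs
    rw [norm_mul, norm_phase, mul_one]
    refine (norm_sub_le _ _).trans ?_
    rw [norm_mul, Complex.norm_I, mul_one, Complex.norm_real, Complex.norm_real, norm_mul,
      Real.norm_of_nonneg (by positivity : 0 ≤ 1 / (2 * √s)), Real.norm_eq_abs,
      Real.norm_of_nonneg (Real.sqrt_nonneg s)]
    have h2 : 1 / (2 * √s) ≤ 1 / (2 * √η) := by gcongr
    have h3 : 1 / (2 * √η) ≤ 1 / (2 * √η * η) * s := by
      rw [div_mul_eq_mul_div, one_mul, div_le_div_iff₀ (by positivity) (by positivity)]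
      nlinarith
    have h4 : |κ| * √s ≤ |κ| * (1 / √η * s) := by gcongr
    have h5 : 0 ≤ 1 / √η * s := by positivity
    calc _ ≤ 1 / (2 * √η * η) * s + |κ| * (1 / √η * s) := by linarith
      _ ≤ 1 / (2 * √η * η) * s + |κ| * (1 / √η * s) + 1 / √η * s := by linarith
      _ = _ := by ring

/-- The nonnegativity of the form at `√m e^{-iκm} u`. -/
theorem IsWeakSolution.sqrt_phase_energy (h : IsWeakSolution V z f u G) (hV : FormBounded V C)
    (hpos : ∀ w K, IsH1 w K → 0 ≤ ∑ i, (∫ x, ‖K i x‖ ^ 2) + ∫ x, V x * ‖w x‖ ^ 2)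
    (hη : 0 < η) (hmu : MemLp (fun x => ((reg η x : ℝ) : ℂ) * u x) 2)
    (hmG : ∀ i, MemLp (fun x => ((reg η x : ℝ) : ℂ) * G i x) 2) (κ : ℝ) :
    0 ≤ z.re * (∫ x, reg η x * ‖u x‖ ^ 2) + (pairing f (fun x => (reg η x : ℂ) * u x)).re +
      κ ^ 2 * (∫ x, reg η x * ‖u x‖ ^ 2) +
      (∫ x, (reg η x)⁻¹ * (‖x‖ ^ 2 / reg η x ^ 2) * ‖u x‖ ^ 2) / 4 -
      2 * κ * ∫ x, reg η x * radFlux η u G x := by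
  have hm := continuous_reg (n := n) η
  have hsq : ∀ x : E n, 0 < √(reg η x) := fun x => Real.sqrt_pos.2 (reg_pos hη x)
  have hss : ∀ x : E n, √(reg η x) ^ 2 = reg η x := fun x => Real.sq_sqrt (reg_pos hη x).le
  have e1 : ∀ x : E n, ‖((√(reg η x) : ℝ) : ℂ) * phase κ (reg η x)‖ ^ 2 = reg η x := fun x => by
    rw [norm_mul, norm_phase, mul_one, Complex.norm_real, Real.norm_of_nonneg (hsq x).le, hss]
  -- For ψ = √s e^{-iκs}, ψ conj ψ' = 1/2 + iκs. The real part is half the derivative of |ψ|² = s,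
  -- and the imaginary part produces the flux weighted by m.
  have e2 : ∀ x : E n, ((√(reg η x) : ℝ) : ℂ) * phase κ (reg η x) *
      conj ((((1 / (2 * √(reg η x)) : ℝ) : ℂ) - ((κ * √(reg η x) : ℝ) : ℂ) * Complex.I) *
        phase κ (reg η x)) = ((1 / 2 : ℝ) : ℂ) + ((κ * reg η x : ℝ) : ℂ) * Complex.I := fun x => by
    have h1 := phase_mul_conj κ (reg η x)
    have h2 : ((√(reg η x) : ℝ) : ℂ) * ((1 / (2 * √(reg η x)) : ℝ) : ℂ) = ((1 / 2 : ℝ) : ℂ) := by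
      rw [← Complex.ofReal_mul]
      congr 1
      have := (hsq x).ne'
      field_simp
    have h3 : ((√(reg η x) : ℝ) : ℂ) * ((κ * √(reg η x) : ℝ) : ℂ) = ((κ * reg η x : ℝ) : ℂ) := by
      rw [← Complex.ofReal_mul]
      congr 1
      nth_rewrite 3 [← hss x]
      ring
    simp only [map_mul, map_sub, Complex.conj_ofReal, Complex.conj_I]
    rw [← h2, ← h3]
    linear_combination (((√(reg η x) : ℝ) : ℂ) * (((1 / (2 * √(reg η x)) : ℝ) : ℂ) +
      ((κ * √(reg η x) : ℝ) : ℂ) * Complex.I)) * h1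
  have e2r : ∀ x : E n, (((1 / 2 : ℝ) : ℂ) + ((κ * reg η x : ℝ) : ℂ) * Complex.I).re = 1 / 2 :=
    fun x => by rw [Complex.add_re, Complex.re_ofReal_mul, Complex.I_re, Complex.ofReal_re]; ring
  have e2i : ∀ x : E n, (((1 / 2 : ℝ) : ℂ) + ((κ * reg η x : ℝ) : ℂ) * Complex.I).im =
      κ * reg η x := fun x => by
    rw [Complex.add_im, Complex.im_ofReal_mul, Complex.I_im, Complex.ofReal_im]; ring
  have e3 : ∀ x : E n, ‖(((1 / (2 * √(reg η x)) : ℝ) : ℂ) - ((κ * √(reg η x) : ℝ) : ℂ) * Complex.I) *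
        phase κ (reg η x)‖ ^ 2 = (reg η x)⁻¹ / 4 + κ ^ 2 * reg η x := fun x => by
    rw [norm_mul, norm_phase, mul_one, ← Complex.normSq_eq_norm_sq, Complex.normSq_apply]
    simp only [Complex.sub_re, Complex.sub_im, Complex.re_ofReal_mul, Complex.im_ofReal_mul,
      Complex.I_re, Complex.I_im, Complex.ofReal_re, Complex.ofReal_im]
    have key : ∀ t : ℝ, t ≠ 0 → 1 / (2 * t) * (1 / (2 * t)) + κ * t * (κ * t) =
        (t ^ 2)⁻¹ / 4 + κ ^ 2 * t ^ 2 := fun t ht => by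
      field_simp
      ring
    have h1 := key _ (hsq x).ne'
    rw [hss] at h1
    rw [← h1]
    ring
  have hH := isH1_reg_mul hη h.isH1 hmu hmG
  have h1 := h.form_radial_mul hV (ψ := fun s => ((√s : ℝ) : ℂ) * phase κ s)
    (ψ' := fun s => (((1 / (2 * √s) : ℝ) : ℂ) - ((κ * √s : ℝ) : ℂ) * Complex.I) * phase κ s)
    (isH1_sqrt_phase_mul hη h.isH1 hmu hmG κ) (by
      simp_rw [e1, e2, e2r]
      norm_num
      simpa using hH)
  have h0 := hpos _ _ (isH1_sqrt_phase_mul hη h.isH1 hmu hmG κ)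
  rw [h1] at h0
  simp_rw [e1, e2, e2i, e3] at h0
  have hrhs := h.pairing_rhs (p := fun s => s) hmu
  rw [hrhs, Complex.add_re, Complex.re_mul_ofReal] at h0
  have iM : Integrable fun x => reg η x * ‖u x‖ ^ 2 := by
    have := (integrable_mul_conj hmu h.isH1.memLp).re
    refine this.congr (ae_of_all _ fun x => ?_)
    simp only [mul_assoc, Complex.mul_conj, Complex.normSq_eq_norm_sq]
    rw [← Complex.ofReal_mul]
    exact Complex.ofReal_re _
  have iT : Integrable fun x => (reg η x)⁻¹ * (‖x‖ ^ 2 / reg η x ^ 2) * ‖u x‖ ^ 2 := by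
    refine integrable_bdd_mul_norm_sq (q := fun x => (reg η x)⁻¹ * (‖x‖ ^ 2 / reg η x ^ 2)) ?_
      (C := η⁻¹) (fun x => ?_) h.isH1.memLp
    · exact ((hm.inv₀ fun x => (reg_pos hη x).ne').mul ((continuous_norm.pow 2).div (hm.pow 2)
        fun x => pow_ne_zero _ (reg_pos hη x).ne')).aestronglyMeasurable
    · have := reg_pos hη x
      rw [Real.norm_of_nonneg (by positivity)]
      refine (mul_le_of_le_one_right (by positivity) (sq_norm_div_reg_le_one η x)).trans ?_
      gcongr
      exact le_reg η x
  have iF : Integrable fun x => reg η x * radFlux η u G x := by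
    have := (integrable_mul_conj (memLp_radDer hη h.isH1.memLp_grad) hmu).im
    refine this.congr (ae_of_all _ fun x => ?_)
    simp only [map_mul, Complex.conj_ofReal, RCLike.im_to_complex]
    rw [radFlux, mul_left_comm, Complex.im_ofReal_mul]
  have iR : Integrable fun x => reg η x * (‖x‖ ^ 2 / reg η x ^ 2) * ‖u x‖ ^ 2 := by
    refine (iM.bdd_mul (f := fun x => ‖x‖ ^ 2 / reg η x ^ 2) (c := 1) ?_ (ae_of_all _ fun x => ?_)).congr
      (ae_of_all _ fun x => ?_)
    · exact ((continuous_norm.pow 2).div (hm.pow 2)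
        fun x => pow_ne_zero _ (reg_pos hη x).ne').aestronglyMeasurable
    · rw [Real.norm_of_nonneg (by positivity)]
      exact sq_norm_div_reg_le_one η x
    · simp only
      ring
  -- Replacing |x|²/m² by 1 in the κ² term only enlarges the right side, so the defect caused by η
  -- has a favourable sign.
  have hR : ∫ x, reg η x * (‖x‖ ^ 2 / reg η x ^ 2) * ‖u x‖ ^ 2 ≤ ∫ x, reg η x * ‖u x‖ ^ 2 := by
    refine integral_mono iR iM fun x => ?_
    have := mul_le_of_le_one_right (reg_pos hη x).le (sq_norm_div_reg_le_one η x)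
    exact mul_le_mul_of_nonneg_right this (by positivity)
  have es : ∀ x, ((reg η x)⁻¹ / 4 + κ ^ 2 * reg η x) * (‖x‖ ^ 2 / reg η x ^ 2) * ‖u x‖ ^ 2 -
      2 * (κ * reg η x) * radFlux η u G x =
      4⁻¹ * ((reg η x)⁻¹ * (‖x‖ ^ 2 / reg η x ^ 2) * ‖u x‖ ^ 2) +
      κ ^ 2 * (reg η x * (‖x‖ ^ 2 / reg η x ^ 2) * ‖u x‖ ^ 2) -
      2 * κ * (reg η x * radFlux η u G x) := fun x => by ring
  simp_rw [es] at h0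
  have i1 : Integrable fun x => 4⁻¹ * ((reg η x)⁻¹ * (‖x‖ ^ 2 / reg η x ^ 2) * ‖u x‖ ^ 2) +
      κ ^ 2 * (reg η x * (‖x‖ ^ 2 / reg η x ^ 2) * ‖u x‖ ^ 2) :=
    (iT.const_mul _).add (iR.const_mul _)
  rw [integral_sub i1 (iF.const_mul _), integral_add (iT.const_mul _) (iR.const_mul _),
    integral_const_mul, integral_const_mul, integral_const_mul] at h0
  have := mul_le_mul_of_nonneg_left hR (sq_nonneg κ)
  linarith

end

/-! ### The commutator term and the closing of the estimate -/

section
variable {n : ℕ} {V W : E n → ℝ} {C C' : ℝ≥0∞} {z : ℂ} {f g u : E n → ℂ} {G : Fin n → E n → ℂ}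
  {η : ℝ}

theorem memLp_coord_mul_of_norm_mul (hf : AEStronglyMeasurable f volume)
    (hr : MemLp (fun x => ((‖x‖ : ℝ) : ℂ) * f x) 2) :
    (∀ i, MemLp (fun x => (x i : ℂ) * f x) 2) ∧
    ∑ i, l2 (fun x => (x i : ℂ) * f x) ^ 2 = l2 (fun x => ((‖x‖ : ℝ) : ℂ) * f x) ^ 2 := by
  have h1 : ∀ i, MemLp (fun x => (x i : ℂ) * f x) 2 := fun i => by
    refine hr.mono ?_ (ae_of_all _ fun x => ?_)
    · have : Continuous fun x : E n => ((x i : ℝ) : ℂ) := by fun_prop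
      exact this.aestronglyMeasurable.mul hf
    · rw [norm_mul, norm_mul, Complex.norm_real, Complex.norm_real, norm_norm]
      exact mul_le_mul_of_nonneg_right (PiLp.norm_apply_le x i) (norm_nonneg _)
  refine ⟨h1, ?_⟩
  simp_rw [l2_sq]
  rw [← integral_finsetSum _ fun i _ => (h1 i).integrable_norm_pow (by norm_num)]
  congr 1 with x
  simp_rw [norm_mul, mul_pow, Complex.norm_real]
  rw [← Finset.sum_mul, norm_norm, EuclideanSpace.real_norm_sq_eq]
  simp_rw [Real.norm_eq_abs, sq_abs]

/-- The commutator term is controlled by the gradient of `e^{-iκm} u`. -/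
theorem re_pairing_euler_sub_le (hη : 0 < η) (hu : IsH1 u G)
    (hmu : MemLp (fun x => ((reg η x : ℝ) : ℂ) * u x) 2)
    (hmG : ∀ i, MemLp (fun x => ((reg η x : ℝ) : ℂ) * G i x) 2) (hf : MemLp f 2)
    (hr : MemLp (fun x => ((‖x‖ : ℝ) : ℂ) * f x) 2) (κ : ℝ) :
    (pairing (fun x => ∑ i, (x i : ℂ) * G i x) f).re -
      κ * (pairing f (fun x => (reg η x : ℂ) * u x)).im ≤
    √(∑ i, (∫ x, ‖phase κ (reg η x) * G i x +
      (-(κ : ℂ) * Complex.I * phase κ (reg η x)) * ((x i / reg η x : ℝ) : ℂ) * u x‖ ^ 2)) *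
      l2 (fun x => ((‖x‖ : ℝ) : ℂ) * f x) + |κ| * η * (l2 u * l2 f) := by
  set D : Fin n → E n → ℂ := fun i x => phase κ (reg η x) * G i x +
      (-(κ : ℂ) * Complex.I * phase κ (reg η x)) * ((x i / reg η x : ℝ) : ℂ) * u x with hD
  have hDm : ∀ i, MemLp (D i) 2 := (isH1_phase_mul hη hu κ).memLp_grad
  obtain ⟨hxf, hxs⟩ := memLp_coord_mul_of_norm_mul hf.1 hr
  have hm := continuous_reg (n := n) η
  have hph : Continuous fun x : E n => phase κ (reg η x) := (contDiff_phase κ).continuous.comp hm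
  have hem : ∀ i, MemLp (fun x => phase κ (reg η x) * ((x i : ℂ) * f x)) 2 := fun i =>
    memLp_mul_bdd hph.aestronglyMeasurable (C := 1) (fun x => (norm_phase _ _).le) (hxf i)
  have hel : ∀ i, l2 (fun x => phase κ (reg η x) * ((x i : ℂ) * f x)) =
      l2 (fun x => (x i : ℂ) * f x) := fun i => by
    unfold l2
    simp_rw [norm_mul, norm_phase, one_mul]
  have hxG := (memLp_dilGen hη hu.memLp hmG).1
  have hxGs : MemLp (fun x => ∑ i, (x i : ℂ) * G i x) 2 := memLp_finsetSum _ fun i _ => hxG i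
  have hq : MemLp (fun x => ((η ^ 2 / reg η x : ℝ) : ℂ) * u x) 2 ∧
      l2 (fun x => ((η ^ 2 / reg η x : ℝ) : ℂ) * u x) ≤ η * l2 u := by
    have hle : ∀ x, ‖((η ^ 2 / reg η x : ℝ) : ℂ) * u x‖ ≤ ‖(η : ℂ) * u x‖ := fun x => by
      have := reg_pos hη x
      rw [norm_mul, norm_mul, Complex.norm_real, Complex.norm_real, Real.norm_of_nonneg hη.le,
        Real.norm_of_nonneg (by positivity)]
      refine mul_le_mul_of_nonneg_right ?_ (norm_nonneg _)
      rw [div_le_iff₀ this, sq]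
      exact mul_le_mul_of_nonneg_left (le_reg η x) hη.le
    have hηu : MemLp (fun x => (η : ℂ) * u x) 2 := hu.memLp.const_mul _
    refine ⟨hηu.mono ?_ (ae_of_all _ hle), (l2_mono hηu hle).trans (le_of_eq ?_)⟩
    · exact (Complex.continuous_ofReal.comp (continuous_const.div hm fun x =>
        (reg_pos hη x).ne')).aestronglyMeasurable.mul hu.memLp.1
    · unfold l2
      simp_rw [norm_mul, mul_pow]
      rw [integral_const_mul, Real.sqrt_mul (by positivity), Real.sqrt_sq (norm_nonneg _),
        Complex.norm_real, Real.norm_of_nonneg hη.le]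
  have i1 : ∀ i, Integrable fun x => D i x * conj (phase κ (reg η x) * ((x i : ℂ) * f x)) :=
    fun i => integrable_mul_conj (hDm i) (hem i)
  have i2 := integrable_mul_conj hxGs hf
  have i3 := integrable_mul_conj hmu hf
  have i4 := integrable_mul_conj hq.1 hf
  have i5 : Integrable fun x => (∑ i, (x i : ℂ) * G i x) * conj (f x) -
      (κ : ℂ) * Complex.I * ((reg η x : ℂ) * u x * conj (f x)) := i2.sub (i3.const_mul _)
  -- Pairing ∇v with e^{-iκm} x f removes the phase and leaves (x·∇u - iκ(|x|²/m)u) against f. Since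
  -- |x|²/m = m - η²/m, this is the wanted combination plus a remainder with η²/m ≤ η.
  have key : ∑ i, pairing (D i) (fun x => phase κ (reg η x) * ((x i : ℂ) * f x)) =
      pairing (fun x => ∑ i, (x i : ℂ) * G i x) f -
      ((κ : ℂ) * Complex.I) * pairing (fun x => (reg η x : ℂ) * u x) f +
      ((κ : ℂ) * Complex.I) * pairing (fun x => ((η ^ 2 / reg η x : ℝ) : ℂ) * u x) f := by
    unfold pairing
    rw [← integral_finsetSum _ fun i _ => i1 i, ← integral_const_mul, ← integral_const_mul,
      ← integral_sub i2 (i3.const_mul _)]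
    beta_reduce
    rw [← integral_add i5 (i4.const_mul _)]
    congr 1 with x
    have hph1 := phase_mul_conj κ (reg η x)
    have hmx : (reg η x : ℂ) ≠ 0 := by exact_mod_cast (reg_pos hη x).ne'
    have e1 : ∀ i, D i x * conj (phase κ (reg η x) * ((x i : ℂ) * f x)) =
        (x i : ℂ) * G i x * conj (f x) - (κ : ℂ) * Complex.I * u x * conj (f x) / (reg η x : ℂ) *
          (((x i) ^ 2 : ℝ) : ℂ) := fun i => by
      simp only [hD, map_mul, Complex.conj_ofReal]
      push_cast
      field_simp
      linear_combination ((x i : ℂ) * conj (f x) * ((reg η x : ℂ) * G i x -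
        (κ : ℂ) * Complex.I * (x i : ℂ) * u x)) * hph1
    simp_rw [e1]
    rw [Finset.sum_sub_distrib, ← Finset.sum_mul, ← Finset.mul_sum, ← Complex.ofReal_sum,
      ← EuclideanSpace.real_norm_sq_eq]
    have e2 : ‖x‖ ^ 2 = reg η x ^ 2 - η ^ 2 := by rw [reg_sq]; ring
    rw [e2]
    push_cast
    field_simp
    ring
  -- The two data terms are bounded jointly, by the gradient of v. Separate bounds would involve ∇u
  -- and κu, which are not controlled uniformly in z.
  have b1 : ‖∑ i, pairing (D i) (fun x => phase κ (reg η x) * ((x i : ℂ) * f x))‖ ≤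
      √(∑ i, ∫ x, ‖D i x‖ ^ 2) * l2 (fun x => ((‖x‖ : ℝ) : ℂ) * f x) := by
    calc _ ≤ ∑ i, l2 (D i) * l2 (fun x => (x i : ℂ) * f x) := by
          refine (norm_sum_le _ _).trans (Finset.sum_le_sum fun i _ => ?_)
          rw [← hel i]
          exact norm_pairing_le_l2 (hDm i) (hem i)
      _ ≤ √(∑ i, l2 (D i) ^ 2) * √(∑ i, l2 (fun x => (x i : ℂ) * f x) ^ 2) :=
          Real.sum_mul_le_sqrt_mul_sqrt _ _ _
      _ = _ := by
        rw [hxs, Real.sqrt_sq (l2_nonneg _)]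
        simp_rw [l2_sq]
  have b2 : ‖((κ : ℂ) * Complex.I) * pairing (fun x => ((η ^ 2 / reg η x : ℝ) : ℂ) * u x) f‖ ≤
      |κ| * η * (l2 u * l2 f) := by
    rw [norm_mul, norm_mul, Complex.norm_I, mul_one, Complex.norm_real, Real.norm_eq_abs, mul_assoc,
      ← mul_assoc η]
    refine mul_le_mul_of_nonneg_left ((norm_pairing_le_l2 hq.1 hf).trans ?_) (abs_nonneg _)
    exact mul_le_mul_of_nonneg_right hq.2 (l2_nonneg _)
  have e3 : (pairing (fun x => ∑ i, (x i : ℂ) * G i x) f).re -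
      κ * (pairing f (fun x => (reg η x : ℂ) * u x)).im =
      (pairing (fun x => ∑ i, (x i : ℂ) * G i x) f -
      ((κ : ℂ) * Complex.I) * pairing (fun x => (reg η x : ℂ) * u x) f).re := by
    rw [← conj_pairing (fun x => (reg η x : ℂ) * u x) f, Complex.sub_re, mul_assoc,
      Complex.re_ofReal_mul, Complex.I_mul_re,
      Complex.conj_im]
  have e4 := congrArg Complex.re key
  rw [Complex.add_re] at e4
  rw [e3]
  have c1 := (Complex.re_le_norm _).trans b1
  have c2 := (neg_le_abs _).trans ((Complex.abs_re_le_norm _).trans b2)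
  linarith

/-- Hardy in the form X ≤ 2√A replaces X by the gradient norm throughout, and every term with a
factor η is collected in the error of the quadratic inequality. -/
theorem mul_sq_le_of_quadratic_estimate {N F X A lu lf η δ k e a : ℝ} (hN : 3 ≤ N) (hF0 : 0 ≤ F)
    (hX0 : 0 ≤ X) (hlu : 0 ≤ lu) (hlf : 0 ≤ lf) (hη : 0 ≤ η) (hδ : 0 < δ) (hδ1 : δ ≤ 1) (hk : 0 ≤ k)
    (hA : 0 ≤ A) (he : e ≤ F * X) (ha : a ≤ F * X) (hXA : X ^ 2 ≤ 4 * A)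
    (main : δ / 2 * A ≤ √e * (F + η * lf + X / 4) / 2 + (√A * F + k * η * (lu * lf)) +
      (N - 1) / 2 * a) :
    X * δ ^ 2 ≤ 6 * (N + 2) * F + 4 * √(η * (k * (lu * lf) + √(F * X) * lf / 2)) := by
  set y := √A with hy
  have hy2 : y ^ 2 = A := Real.sq_sqrt hA
  have hy0 : 0 ≤ y := Real.sqrt_nonneg _
  have hXy : X ≤ 2 * y := le_of_sq_le_sq (by rw [mul_pow, hy2]; linarith) (by positivity)
  have s1 : √e ≤ √(F * X) := Real.sqrt_le_sqrt he
  have s2 : √(F * X) ≤ √(2 * F * y) := Real.sqrt_le_sqrt (by nlinarith)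
  have s3 : √e * (F + η * lf + X / 4) / 2 ≤
      √(2 * F * y) * (F + y / 2) / 2 + η * (√(F * X) * lf / 2) := by
    calc _ ≤ √(F * X) * (F + η * lf + X / 4) / 2 := by gcongr
      _ = √(F * X) * (F + X / 4) / 2 + η * (√(F * X) * lf / 2) := by ring
      _ ≤ √(2 * F * y) * (F + y / 2) / 2 + η * (√(F * X) * lf / 2) := by
        have : X / 4 ≤ y / 2 := by linarith
        gcongr
  have s4 : (N - 1) / 2 * a ≤ (N - 1) * (F * y) := by
    have t1 : (N - 1) / 2 * a ≤ (N - 1) / 2 * (F * X) :=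
      mul_le_mul_of_nonneg_left ha (by linarith)
    have t2 : (N - 1) / 2 * (F * X) ≤ (N - 1) / 2 * (F * (2 * y)) :=
      mul_le_mul_of_nonneg_left (mul_le_mul_of_nonneg_left hXy hF0) (by linarith)
    linarith
  have fin := le_of_quadratic_estimate (N := N) (F := F) (y := y)
    (e := η * (k * (lu * lf) + √(F * X) * lf / 2)) (by linarith) hF0 hy0
    (by positivity) hδ hδ1 (by
      rw [hy2]
      have : η * (k * (lu * lf) + √(F * X) * lf / 2) =
        k * η * (lu * lf) + η * (√(F * X) * lf / 2) := by ring
      rw [this]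
      linarith)
  have : X * δ ^ 2 ≤ 2 * (δ ^ 2 * y) := by nlinarith [sq_nonneg δ]
  linarith

set_option maxHeartbeats 400000 in
/-- The weighted resolvent estimate for weak solutions. -/
theorem IsWeakSolution.weighted_estimate (hn : 3 ≤ n) (h : IsWeakSolution V z f u G)
    (hV : FormBounded V C) (hW : FormBounded W C') (hE : IsWeakEulerDerivative V W)
    (hpos : ∀ w K, IsH1 w K → 0 ≤ ∑ i, (∫ x, ‖K i x‖ ^ 2) + ∫ x, V x * ‖w x‖ ^ 2)
    (hz : ¬ ∃ t : ℝ, 0 ≤ t ∧ z = (t : ℂ)) {δ : ℝ} (hδ : 0 < δ) (hδ1 : δ ≤ 1)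
    (hQ : ∀ η > 0, ∀ (ψ : ℝ → ℂ) (K : Fin n → E n → ℂ), IsH1 (fun x => ψ (reg η x) * u x) K →
      δ * ∑ i, ∫ x, ‖K i x‖ ^ 2 ≤ ∑ i, (∫ x, ‖K i x‖ ^ 2) + ∫ x, V x * ‖ψ (reg η x) * u x‖ ^ 2)
    (hQ' : ∀ η > 0, ∀ (ψ : ℝ → ℂ) (K : Fin n → E n → ℂ), IsH1 (fun x => ψ (reg η x) * u x) K →
      δ * ∑ i, ∫ x, ‖K i x‖ ^ 2 ≤ ∑ i, (∫ x, ‖K i x‖ ^ 2) -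
        ((∫ x, V x * ‖ψ (reg η x) * u x‖ ^ 2) + ∫ x, W x * ‖ψ (reg η x) * u x‖ ^ 2)) :
    l2 (fun x => ((‖x‖⁻¹ : ℝ) : ℂ) * u x) * δ ^ 2 ≤
      6 * (n + 2) * l2 (fun x => ((‖x‖ : ℝ) : ℂ) * f x) := by
  have hn' : (3 : ℝ) ≤ n := by exact_mod_cast hn
  have hu := h.isH1.memLp
  have hf := h.memLp
  obtain ⟨hXm, hX4⟩ := h.isH1.hardy hn
  set X := l2 (fun x => ((‖x‖⁻¹ : ℝ) : ℂ) * u x) with hX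
  set F := l2 (fun x => ((‖x‖ : ℝ) : ℂ) * f x) with hF
  have hX0 : 0 ≤ X := l2_nonneg _
  have hF0 : 0 ≤ F := l2_nonneg _
  have hfu : ‖pairing f u‖ ≤ F * X := by
    rw [← pairing_norm_mul hn]
    exact norm_pairing_le_l2 h.memLp_norm hXm
  obtain ⟨en1, en2⟩ := h.energy hV
  set U := ∫ x, ‖u x‖ ^ 2 with hU
  have hU0 : 0 ≤ U := integral_nonneg fun x => by positivity
  have hεU : |z.im| * U ≤ F * X := by
    have h1 := (Complex.abs_im_le_norm _).trans hfu
    have h2 : |z.im| * U = |(pairing f u).im| := by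
      have e : (pairing f u).im = -(z.im * U) := by linarith
      rw [e, abs_neg, abs_mul, abs_of_nonneg hU0]
    rw [h2]
    exact h1
  have hre := (Complex.re_le_norm _).trans hfu
  have hδ2 : δ ^ 2 ≤ 1 := pow_le_one₀ hδ.le hδ1
  -- Away from the positive axis: Re z ‖u‖² ≤ |Im z|‖u‖² ≤ FX, so the energy identity, coercivity
  -- and Hardy already give δX ≤ 8F.
  by_cases hcase : z.re ≤ |z.im|
  · have h1 := hQ 1 one_pos (fun _ => 1) G (by simpa using h.isH1)
    simp only [one_mul] at h1
    have h2 : z.re * U ≤ |z.im| * U := mul_le_mul_of_nonneg_right hcase hU0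
    have h3 : δ * ∑ i, ∫ x, ‖G i x‖ ^ 2 ≤ 2 * (F * X) := by linarith
    have h4 : δ * X ^ 2 ≤ 8 * (F * X) := by nlinarith
    have h5 : δ * X ≤ 8 * F := by
      rcases hX0.eq_or_lt with h0 | h0
      · rw [← h0]; linarith
      · nlinarith
    have h6 : X * δ ^ 2 ≤ δ * X := by
      have := mul_le_mul_of_nonneg_right hδ1 (mul_nonneg hδ.le hX0)
      nlinarith
    nlinarith
  push Not at hcase
  have hlam0 : 0 < z.re := (abs_nonneg _).trans_lt hcase
  have hε : z.im ≠ 0 := fun h0 => hz ⟨z.re, hlam0.le, by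
    apply Complex.ext
    · simp
    · simp [h0]⟩
  -- The sign of κ follows that of Im z, so that the one-sided bound on κ(Y - κM) may be multiplied
  -- by κ Im z ≥ 0.
  obtain ⟨κ, hκ2, hκ0, hκε⟩ : ∃ κ : ℝ, κ ^ 2 = z.re ∧ κ ≠ 0 ∧ 0 ≤ κ * z.im := by
    rcases le_total 0 z.im with h0 | h0
    · exact ⟨√z.re, Real.sq_sqrt hlam0.le, (Real.sqrt_pos.2 hlam0).ne', by positivity⟩
    · refine ⟨-√z.re, by rw [neg_sq]; exact Real.sq_sqrt hlam0.le,
        neg_ne_zero.2 (Real.sqrt_pos.2 hlam0).ne', ?_⟩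
      have := Real.sqrt_nonneg z.re
      nlinarith
  set L := |κ| * (l2 u * l2 f) + √(F * X) * l2 f / 2 with hL
  have hL0 : 0 ≤ L := by
    have := l2_nonneg u
    have := l2_nonneg f
    positivity
  -- The bound with an explicit error. L may depend on z, κ and the unweighted norms of u and f,
  -- which is harmless because it is multiplied by η before the limit.
  have key : ∀ η > 0, X * δ ^ 2 ≤ 6 * (n + 2) * F + 4 * √(η * L) := by
    intro η hη
    obtain ⟨hmu, hmG⟩ := h.memLp_reg_mul hV hη hε hδ (hQ η hη)
    obtain ⟨hmf, hmfle⟩ := WeightedResolvent.memLp_reg_mul hη.le hf h.memLp_norm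
    have hA := (memLp_dilGen hη hu hmG).2
    have hxGs : MemLp (fun x => ∑ i, (x i : ℂ) * G i x) 2 :=
      memLp_finsetSum _ fun i _ => (memLp_dilGen hη hu hmG).1 i
    set Nv := ∑ i, (∫ x, ‖phase κ (reg η x) * G i x +
      (-(κ : ℂ) * Complex.I * phase κ (reg η x)) * ((x i / reg η x : ℝ) : ℂ) * u x‖ ^ 2) with hNv
    have hNv0 : 0 ≤ Nv := Finset.sum_nonneg fun i _ => integral_nonneg fun x => by positivity
    have hph : ∀ x, ‖phase κ (reg η x) * u x‖ = ‖u x‖ := fun x => by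
      rw [norm_mul, norm_phase, one_mul]
    have f3 := h.integral_flux hV (p := fun s => s) (p' := fun _ => 1) (isH1_reg_mul hη h.isH1 hmu hmG)
    have hrhs := h.pairing_rhs (p := fun s => s) hmu
    rw [hrhs, Complex.add_im, Complex.im_mul_ofReal] at f3
    simp only [one_mul] at f3
    have fNv := h.phase_energy hV hη κ
    have f1 := virial hV hW hE hpos h.isH1 hA h.memLp_rhs fun w K hw => h.weak_eq_isH1 hV hw
    have fA := pairing_dilGen_self h.isH1 hη hmG
    have hpA : pairing (dilGen u G) (fun x => z * u x + f x) =
        conj z * pairing (dilGen u G) u + pairing (dilGen u G) f := by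
      have i1 := integrable_mul_conj hA hu
      have i2 := integrable_mul_conj hA hf
      unfold pairing
      rw [← integral_const_mul, ← integral_add (i1.const_mul _) i2]
      congr 1 with x
      rw [map_add, map_mul]
      ring
    have hpf : pairing (dilGen u G) f = pairing (fun x => ∑ i, (x i : ℂ) * G i x) f +
        ((n / 2 : ℝ) : ℂ) * pairing u f := by
      have i1 := integrable_mul_conj hxGs hf
      have i2 := integrable_mul_conj hu hf
      unfold pairing
      rw [← integral_const_mul, ← integral_add i1 (i2.const_mul _)]
      congr 1 with x
      rw [dilGen]
      ring
    rw [hpA, hpf, Complex.add_re, Complex.add_re, Complex.mul_re, fA.1, fA.2, Complex.conj_re,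
      Complex.conj_im, Complex.re_ofReal_mul, ← conj_pairing f u, Complex.conj_re] at f1
    -- The second coercivity hypothesis is applied to v, whose potential terms equal those of u
    -- because |v| = |u|.
    have fQ := hQ' η hη (phase κ) _ (isH1_phase_mul hη h.isH1 κ)
    simp_rw [hph] at fQ
    have f4 := h.sqrt_phase_energy hV hpos hη hmu hmG κ
    have f5 := re_pairing_euler_sub_le hη h.isH1 hmu hmG hf h.memLp_norm κ
    have hR : ∫ x, ‖x‖ ^ 2 / reg η x ^ 2 * ‖u x‖ ^ 2 ≤ U := by
      refine integral_mono_of_nonneg (ae_of_all _ fun x => by positivity)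
        (hu.integrable_norm_pow (by norm_num)) (ae_of_all _ fun x => ?_)
      exact mul_le_of_le_one_left (by positivity) (sq_norm_div_reg_le_one η x)
    have hUl : √U = l2 u := rfl
    -- m⁻¹ ≤ |x|⁻¹ and |x|² ≤ m² bound T by ∫|x|⁻¹|u|², then Cauchy-Schwarz between |x|⁻¹u and u.
    have hT : ∫ x, (reg η x)⁻¹ * (‖x‖ ^ 2 / reg η x ^ 2) * ‖u x‖ ^ 2 ≤ X * √U := by
      have i1 := (integrable_mul_conj hXm hu).re
      have hle : ∀ᵐ x : E n, (reg η x)⁻¹ * (‖x‖ ^ 2 / reg η x ^ 2) * ‖u x‖ ^ 2 ≤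
          RCLike.re (((‖x‖⁻¹ : ℝ) : ℂ) * u x * conj (u x)) := by
        filter_upwards [ae_ne_zero hn] with x hx
        have hx0 := norm_pos_iff.2 hx
        have hr0 := reg_pos hη x
        rw [mul_assoc ((‖x‖⁻¹ : ℝ) : ℂ), Complex.mul_conj, Complex.normSq_eq_norm_sq, ← Complex.ofReal_mul,
          RCLike.re_to_complex, Complex.ofReal_re]
        refine mul_le_mul_of_nonneg_right ?_ (by positivity)
        refine (mul_le_of_le_one_right (by positivity) (sq_norm_div_reg_le_one η x)).trans ?_
        exact inv_anti₀ hx0 (norm_le_reg η x)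
      refine (integral_mono_of_nonneg (ae_of_all _ fun x => ?_) i1 hle).trans ?_
      · have hr0 := reg_pos hη x
        positivity
      · rw [integral_re (integrable_mul_conj hXm hu)]
        exact (Complex.re_le_norm _).trans (norm_pairing_le_l2 hXm hu)
    have hc : (pairing f (fun x => (reg η x : ℂ) * u x)).re ≤ (F + η * l2 f) * √U := by
      have e : pairing f (fun x => (reg η x : ℂ) * u x) =
          pairing (fun x => ((reg η x : ℝ) : ℂ) * f x) u := by
        unfold pairing
        congr 1 with x
        rw [map_mul, Complex.conj_ofReal]
        ring
      rw [e]
      exact (Complex.re_le_norm _).trans ((norm_pairing_le_l2 hmf hu).trans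
        (mul_le_mul_of_nonneg_right hmfle (l2_nonneg _)))
    have f1' : ∑ i, (∫ x, ‖G i x‖ ^ 2) - (∫ x, W x * ‖u x‖ ^ 2) / 2 =
        z.im * (∫ x, reg η x * radFlux η u G x) +
        (pairing (fun x => ∑ i, (x i : ℂ) * G i x) f).re + n / 2 * (pairing f u).re := by
      linarith
    have main := quadratic_estimate (n₀ := n) (δ := δ) (U := U) hκ2 hκ0 hκε hcase.le en1 f3 fNv
      f1' fQ f4 hR hT hc f5 (by have := l2_nonneg f; positivity) hX0
    -- Hardy is applied to v and not to u: it bounds the same X, but by the gradient that the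
    -- estimate controls.
    have h1 := ((isH1_phase_mul hη h.isH1 κ).hardy hn).2
    have h2 : l2 (fun x => ((‖x‖⁻¹ : ℝ) : ℂ) * (phase κ (reg η x) * u x)) = X := by
      rw [hX]
      unfold l2
      simp_rw [norm_mul, norm_phase, one_mul]
    rw [h2] at h1
    exact mul_sq_le_of_quadratic_estimate (by linarith) hF0 hX0 (l2_nonneg u) (l2_nonneg f) hη.le
      hδ hδ1 (abs_nonneg κ) hNv0 hεU hre h1 main
  -- X, F and L do not depend on η, so η → 0 removes the error.
  have hlim : Tendsto (fun η => 6 * ((n : ℝ) + 2) * F + 4 * √(η * L)) (𝓝[>] 0)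
      (𝓝 (6 * (n + 2) * F)) := by
    have : Continuous fun η => 6 * ((n : ℝ) + 2) * F + 4 * √(η * L) := by fun_prop
    have h0 := (this.tendsto 0).mono_left (nhdsWithin_le_nhds (s := Set.Ioi 0))
    simpa using h0
  refine ge_of_tendsto hlim ?_
  filter_upwards [self_mem_nhdsWithin] with η hη
  exact key η hη

end

section
variable {n : ℕ} {V W : E n → ℝ} {C C' : ℝ≥0∞} {u w : E n → ℂ} {G K : Fin n → E n → ℂ} {δ : ℝ}

/-! ### Subcritical potentials -/

theorem integral_gradSq {φ : E n → ℂ} (hφ : IsTestFunction φ) :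
    ∫ x, gradSq φ x = ∑ i, ∫ x, ‖partialDeriv i φ x‖ ^ 2 :=
  integral_finsetSum _ fun i _ => (hφ.partialDeriv i).memLp.integrable_norm_pow (by norm_num)

theorem integrable_gradSq {φ : E n → ℂ} (hφ : IsTestFunction φ) : Integrable (gradSq φ) :=
  integrable_finsetSum _ fun i _ => (hφ.partialDeriv i).memLp.integrable_norm_pow (by norm_num)

theorem FormBounded.integral_form (hV : FormBounded V C) {φ : E n → ℂ} (hφ : IsTestFunction φ) :
    ∫ x, (gradSq φ x + V x * ‖φ x‖ ^ 2) =
      ∑ i, (∫ x, ‖partialDeriv i φ x‖ ^ 2) + ∫ x, V x * ‖φ x‖ ^ 2 := by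
  rw [integral_add (integrable_gradSq hφ) (hV.integrable_sq hφ.isH1), integral_gradSq hφ]

theorem L2Tendsto.tendsto_sum_integral {ι : Type*} {l : Filter ι} {D : ι → Fin n → E n → ℂ}
    (hD : ∀ i, L2Tendsto l (fun k => D k i) (G i)) :
    Tendsto (fun k => ∑ i, ∫ x, ‖D k i x‖ ^ 2) l (𝓝 (∑ i, ∫ x, ‖G i x‖ ^ 2)) :=
  tendsto_finsetSum _ fun i _ => (hD i).integral_norm_sq

/-- A form inequality on test functions extends to `H¹`. -/
theorem FormBounded.lower_bound_isH1 (hV : FormBounded V C)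
    (h : ∀ φ : E n → ℂ, IsTestFunction φ → δ * ∑ i, (∫ x, ‖partialDeriv i φ x‖ ^ 2) ≤
      ∑ i, (∫ x, ‖partialDeriv i φ x‖ ^ 2) + ∫ x, V x * ‖φ x‖ ^ 2) (hw : IsH1 w K) :
    δ * ∑ i, (∫ x, ‖K i x‖ ^ 2) ≤ ∑ i, (∫ x, ‖K i x‖ ^ 2) + ∫ x, V x * ‖w x‖ ^ 2 := by
  obtain ⟨φ, h1, h2, h3⟩ := id hw
  have l1 := L2Tendsto.tendsto_sum_integral h3
  have l2 := hV.tendsto_sq (fun k => (h1 k).isH1) hw h3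
  exact le_of_tendsto_of_tendsto' (l1.const_mul δ) (l1.add l2) fun k => h _ (h1 k)

theorem FormBounded.lower_bound_isH1_sub (hV : FormBounded V C) (hW : FormBounded W C')
    (h : ∀ φ : E n → ℂ, IsTestFunction φ → δ * ∑ i, (∫ x, ‖partialDeriv i φ x‖ ^ 2) ≤
      ∑ i, (∫ x, ‖partialDeriv i φ x‖ ^ 2) -
        ((∫ x, V x * ‖φ x‖ ^ 2) + ∫ x, W x * ‖φ x‖ ^ 2)) (hw : IsH1 w K) :
    δ * ∑ i, (∫ x, ‖K i x‖ ^ 2) ≤ ∑ i, (∫ x, ‖K i x‖ ^ 2) -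
      ((∫ x, V x * ‖w x‖ ^ 2) + ∫ x, W x * ‖w x‖ ^ 2) := by
  obtain ⟨φ, h1, h2, h3⟩ := id hw
  have l1 := L2Tendsto.tendsto_sum_integral h3
  have l2 := hV.tendsto_sq (fun k => (h1 k).isH1) hw h3
  have l3 := hW.tendsto_sq (fun k => (h1 k).isH1) hw h3
  exact le_of_tendsto_of_tendsto' (l1.const_mul δ) (l1.sub (l2.add l3)) fun k => h _ (h1 k)

theorem ae_eq_zero_of_pairing_test {f : E n → ℂ} (hf : MemLp f 2)
    (h : ∀ ψ, IsTestFunction ψ → pairing f ψ = 0) : f =ᵐ[volume] 0 := by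
  obtain ⟨ψ, h1, h2⟩ := exists_test_L2Tendsto hf
  have l := (L2Tendsto.const atTop hf).pairing h2
  have e := tendsto_nhds_unique l (tendsto_const_nhds.congr fun k => (h _ (h1 k)).symm)
  rw [pairing_self, Complex.ofReal_eq_zero] at e
  rw [integral_eq_zero_iff_of_nonneg (fun x => by positivity)
    (hf.integrable_norm_pow (by norm_num))] at e
  filter_upwards [e] with x hx
  simpa using hx

theorem IsH1.grad_eq_zero (h : IsH1 (fun _ => 0) G) (i : Fin n) : G i =ᵐ[volume] 0 := by
  refine ae_eq_zero_of_pairing_test (h.memLp_grad i) fun ψ hψ => ?_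
  have e := h.integral_mul_partialDeriv hψ i
  rw [← neg_eq_zero, ← e]
  simp [pairing]

/-- Sequences of test functions which are Cauchy for a coercive form converge in `H¹`. -/
theorem FormBounded.exists_isH1_of_cauchy (hV : FormBounded V C) (hδ : 0 < δ)
    (h : ∀ φ : E n → ℂ, IsTestFunction φ → δ * ∑ i, (∫ x, ‖partialDeriv i φ x‖ ^ 2) ≤
      ∑ i, (∫ x, ‖partialDeriv i φ x‖ ^ 2) + ∫ x, V x * ‖φ x‖ ^ 2)
    {φ : ℕ → E n → ℂ} (ht : ∀ k, IsTestFunction (φ k)) (hu : L2Tendsto atTop φ u)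
    (hc : Tendsto (fun p : ℕ × ℕ => schrodingerForm V (φ p.1 - φ p.2) (φ p.1 - φ p.2))
      atTop (𝓝 0)) :
    ∃ G, IsH1 u G ∧ ∀ i, L2Tendsto atTop (fun k => partialDeriv i (φ k)) (G i) := by
  have key : ∀ i : Fin n, ∃ g, L2Tendsto atTop (fun k => partialDeriv i (φ k)) g := fun i => by
    refine exists_L2Tendsto_of_cauchy (fun k => ((ht k).partialDeriv i).memLp) ?_
    have hre := (Complex.continuous_re.tendsto 0).comp hc
    have hre' := ENNReal.tendsto_ofReal (hre.const_mul δ⁻¹)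
    rw [Complex.zero_re, mul_zero, ENNReal.ofReal_zero] at hre'
    refine tendsto_of_tendsto_of_tendsto_of_le_of_le tendsto_const_nhds hre' (fun _ => zero_le) ?_
    intro p
    have hp := (ht p.1).sub (ht p.2)
    have e : (fun x => partialDeriv i (φ p.1) x - partialDeriv i (φ p.2) x) =
        partialDeriv i (fun x => φ p.1 x - φ p.2 x) := by
      ext x
      rw [partialDeriv_sub i ((ht p.1).differentiable x) ((ht p.2).differentiable x)]
    simp only [e]
    rw [sqNorm_eq_ofReal (hp.partialDeriv i).memLp]
    refine ENNReal.ofReal_le_ofReal ?_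
    simp only [Function.comp_apply, schrodingerForm_self, Complex.ofReal_re]
    have h2 := hV.integral_form hp
    have h3 := h _ hp
    rw [← h2] at h3
    have h4 : ∫ x, ‖partialDeriv i (fun x => φ p.1 x - φ p.2 x) x‖ ^ 2 ≤
        ∑ i, ∫ x, ‖partialDeriv i (fun x => φ p.1 x - φ p.2 x) x‖ ^ 2 :=
      Finset.single_le_sum (f := fun i => ∫ x, ‖partialDeriv i (fun x => φ p.1 x - φ p.2 x) x‖ ^ 2)
        (fun i _ => integral_nonneg fun x => by positivity) (Finset.mem_univ i)
    rw [inv_mul_eq_div, le_div_iff₀ hδ, mul_comm]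
    exact (mul_le_mul_of_nonneg_left h4 hδ.le).trans h3
  choose G hG using key
  exact ⟨G, ⟨φ, ht, hu, hG⟩, hG⟩

/-- Coercivity makes form-Cauchy sequences converge in H¹. If the L² limit is 0, so is the gradient,
and the form is continuous for H¹ convergence. -/
theorem FormBounded.isClosableForm (hV : FormBounded V C) (hδ : 0 < δ)
    (h : ∀ φ : E n → ℂ, IsTestFunction φ → δ * ∑ i, (∫ x, ‖partialDeriv i φ x‖ ^ 2) ≤
      ∑ i, (∫ x, ‖partialDeriv i φ x‖ ^ 2) + ∫ x, V x * ‖φ x‖ ^ 2) : IsClosableForm V where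
  meas := hV.meas
  integrable φ hφ := hV.integrable_sq hφ.isH1
  nonneg φ hφ := by
    rw [schrodingerForm_self, Complex.ofReal_re, hV.integral_form hφ]
    refine le_trans ?_ (h φ hφ)
    exact mul_nonneg hδ.le (Finset.sum_nonneg fun i _ => integral_nonneg fun x => by positivity)
  closable φ ht h0 hc := by
    have hu : L2Tendsto atTop φ (fun _ => (0 : ℂ)) :=
      ⟨fun k => (ht k).memLp, MemLp.zero', by simpa using h0⟩
    obtain ⟨G, hG, hlim⟩ := hV.exists_isH1_of_cauchy hδ h ht hu hc
    have hlim' : ∀ i, L2Tendsto atTop (fun k => partialDeriv i (φ k)) (fun _ => (0 : ℂ)) :=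
      fun i => (hlim i).congr' (fun _ => ae_eq_rfl) (hG.grad_eq_zero i)
    have h00 : IsH1 (fun _ => (0 : ℂ)) (fun (_ : Fin n) (_ : E n) => (0 : ℂ)) :=
      ⟨φ, ht, hu, hlim'⟩
    have l1 := (L2Tendsto.tendsto_sum_integral hlim').add
      (hV.tendsto_sq (fun k => (ht k).isH1) h00 hlim')
    have l2 := (Complex.continuous_ofReal.tendsto _).comp l1
    simp only [norm_zero, ne_eq, OfNat.ofNat_ne_zero, not_false_eq_true, zero_pow, integral_zero,
      Finset.sum_const_zero, mul_zero, add_zero, Complex.ofReal_zero] at l2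
    refine l2.congr fun k => ?_
    rw [Function.comp_apply, schrodingerForm_self, hV.integral_form (ht k)]

theorem IsFormApprox.l2Tendsto {φ : ℕ → E n → ℂ} {u : L2 n} (h : IsFormApprox V φ u) :
    L2Tendsto atTop φ u :=
  ⟨fun k => (h.test k).memLp, Lp.memLp u, tendsto_eLpNorm_iff.1 h.tendsto⟩

theorem l2_congr_ae {f g : E n → ℂ} (h : f =ᵐ[volume] g) : l2 f = l2 g := by
  unfold l2
  congr 1
  refine integral_congr_ae ?_
  filter_upwards [h] with x hx
  rw [hx]

theorem eLpNorm_eq_l2 {f : E n → ℂ} (hf : MemLp f 2) :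
    eLpNorm f 2 volume = ENNReal.ofReal (l2 f) := by
  rw [l2_eq_norm hf, Lp.norm_toLp, ENNReal.ofReal_toReal hf.2.ne]

theorem norm_eq_l2 (f : L2 n) : ‖f‖ = l2 f := by
  rw [l2_eq_norm (Lp.memLp f), Lp.toLp_coeFn]

theorem ae_eq_norm_mul (hn : 3 ≤ n) {f g : E n → ℂ}
    (h : g =ᵐ[volume] fun x => ((‖x‖⁻¹ : ℝ) : ℂ) * f x) :
    (fun x => ((‖x‖ : ℝ) : ℂ) * g x) =ᵐ[volume] f := by
  filter_upwards [h, ae_ne_zero hn] with x hx h0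
  have : ((‖x‖ : ℝ) : ℂ) ≠ 0 := Complex.ofReal_ne_zero.2 (norm_ne_zero_iff.2 h0)
  rw [hx, Complex.ofReal_inv]
  field_simp

end

/-! ### The bound δ ≤ 1 and the uniform estimate for subcritical potentials -/

section
variable {n : ℕ} {V W : E n → ℝ} {C C' : ℝ≥0∞} {u w : E n → ℂ} {G K : Fin n → E n → ℂ} {δ : ℝ}

theorem contDiff_plane_wave (i : Fin n) (N : ℝ) :
    ContDiff ℝ (⊤ : ℕ∞) (fun x : E n => Complex.exp ((x i : ℂ) * (N * Complex.I))) :=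
  ((Complex.ofRealCLM.contDiff.comp (EuclideanSpace.proj (𝕜 := ℝ) i).contDiff).mul
    contDiff_const).cexp

theorem partialDeriv_plane_wave (i : Fin n) (N : ℝ) (x : E n) :
    partialDeriv i (fun x : E n => Complex.exp ((x i : ℂ) * (N * Complex.I))) x =
      Complex.exp ((x i : ℂ) * (N * Complex.I)) * (N * Complex.I) := by
  have h : HasFDerivAt (fun x : E n => ((x i : ℝ) : ℂ))
      (Complex.ofRealCLM.comp (EuclideanSpace.proj (𝕜 := ℝ) i)) x :=
    (Complex.ofRealCLM.comp (EuclideanSpace.proj (𝕜 := ℝ) i)).hasFDerivAt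
  rw [partialDeriv, ((h.mul_const ((N : ℂ) * Complex.I)).cexp).fderiv]
  simp

/-- The constant in a coercivity estimate cannot exceed one: test with plane waves. -/
theorem FormBounded.le_one_of_lower_bound (hn : 0 < n)
    (h : ∀ φ : E n → ℂ, IsTestFunction φ → δ * ∑ i, (∫ x, ‖partialDeriv i φ x‖ ^ 2) ≤
      ∑ i, (∫ x, ‖partialDeriv i φ x‖ ^ 2) + ∫ x, V x * ‖φ x‖ ^ 2) : δ ≤ 1 := by
  by_contra! hδ
  obtain ⟨b, hb, hb1⟩ := exists_test_eq_one_on (isCompact_closedBall (0 : E n) 1)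
  let i : Fin n := ⟨0, hn⟩
  set B := ∫ x, ‖b x‖ ^ 2 with hB
  set D := ∫ x, ‖partialDeriv i b x‖ ^ 2 with hD
  set M := ∫ x, V x * ‖b x‖ ^ 2 with hM
  have ib := hb.memLp.integrable_norm_pow (p := 2) (by norm_num)
  have id := (hb.partialDeriv i).memLp.integrable_norm_pow (p := 2) (by norm_num)
  have hB0 : 0 < B := by
    rw [hB, integral_pos_iff_support_of_nonneg (fun x => by positivity) (by simpa using ib)]
    refine lt_of_lt_of_le ?_ (measure_mono (s := Metric.ball (0 : E n) 1) fun x hx => ?_)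
    · exact Metric.measure_ball_pos _ _ one_pos
    · simp [hb1 x (Metric.ball_subset_closedBall hx)]
  -- Modulation e^{iNxᵢ}b leaves the potential term unchanged, while |∂ᵢ(e^{iNxᵢ}b)|² ≥ N²|b|²/2 -
  -- |∂ᵢb|² makes the gradient term grow like N².
  have key : ∀ N : ℝ, (δ - 1) * (N ^ 2 / 2 * B - D) ≤ M := by
    intro N
    have hφ := hb.smooth_mul (contDiff_plane_wave i N)
    have h1 := h _ hφ
    have hnorm : ∀ x : E n, ‖Complex.exp ((x i : ℂ) * (N * Complex.I))‖ = 1 := fun x => by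
      rw [← mul_assoc, ← Complex.ofReal_mul, Complex.norm_exp_ofReal_mul_I]
    simp only [norm_mul, hnorm, one_mul] at h1
    have h2 : N ^ 2 / 2 * B - D ≤ ∑ i, ∫ x, ‖partialDeriv i (fun x : E n =>
        Complex.exp ((x ⟨0, hn⟩ : ℂ) * (N * Complex.I)) * b x) x‖ ^ 2 := by
      refine le_trans ?_ (Finset.single_le_sum
        (f := fun j => ∫ x, ‖partialDeriv j (fun x : E n =>
          Complex.exp ((x ⟨0, hn⟩ : ℂ) * (N * Complex.I)) * b x) x‖ ^ 2)
        (fun i _ => integral_nonneg fun x => by positivity) (Finset.mem_univ i))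
      rw [hB, hD, ← integral_const_mul, ← integral_sub (by exact ib.const_mul _) (by exact id)]
      refine integral_mono ((ib.const_mul (N ^ 2 / 2)).sub id)
        ((hφ.partialDeriv i).memLp.integrable_norm_pow (p := 2) (by norm_num)) fun x => ?_
      simp only []
      rw [partialDeriv_mul i ((contDiff_plane_wave i N).differentiable (by simp) x)
        (hb.differentiable x), partialDeriv_plane_wave, mul_assoc, ← mul_add, norm_mul, hnorm,
        one_mul]
      have e : ‖(N : ℂ) * Complex.I * b x‖ = |N| * ‖b x‖ := by simp
      have t := norm_sub_le (partialDeriv i b x + N * Complex.I * b x) (partialDeriv i b x)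
      rw [add_sub_cancel_left, e] at t
      have t2 := pow_le_pow_left₀ (by positivity) t 2
      rw [mul_pow, sq_abs] at t2
      have t3 := add_sq_le (a := ‖partialDeriv i b x + N * Complex.I * b x‖)
        (b := ‖partialDeriv i b x‖)
      linarith
    have h3 := mul_le_mul_of_nonneg_left h2 (sub_pos.2 hδ).le
    refine h3.trans ?_
    change _ ≤ ∫ x, V x * ‖b x‖ ^ 2
    have h1' := sub_le_iff_le_add'.2 h1
    refine le_trans (le_of_eq ?_) h1'
    ring
  have hδ0 := sub_pos.2 hδ
  -- With N = q + 1, N² ≥ q + 1, and N²B/2 exceeds |M|/(δ-1) + |D| by at least B/2 > 0,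
  -- contradicting the bound above.
  set q := 2 * (|M| / (δ - 1) + |D|) / B with hq
  have hq0 : 0 ≤ q := by positivity
  have h1 := key (q + 1)
  have h2 : q * B = 2 * (|M| / (δ - 1) + |D|) := by rw [hq]; field_simp
  have h3 : (δ - 1) * (|M| / (δ - 1)) = |M| := by field_simp
  have h4 : q + 1 ≤ (q + 1) ^ 2 := by nlinarith
  have h5 : (|M| / (δ - 1) + |D|) + B / 2 - D ≤ (q + 1) ^ 2 / 2 * B - D := by nlinarith
  have h6 := mul_le_mul_of_nonneg_left h5 hδ0.le
  have h7 := le_abs_self M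
  have h8 := le_abs_self D
  nlinarith

/-- The resolvent produces weak solutions. -/
theorem FormBounded.exists_isWeakSolution (hV : FormBounded V C) (hδ : 0 < δ)
    (h : ∀ φ : E n → ℂ, IsTestFunction φ → δ * ∑ i, (∫ x, ‖partialDeriv i φ x‖ ^ 2) ≤
      ∑ i, (∫ x, ‖partialDeriv i φ x‖ ^ 2) + ∫ x, V x * ‖φ x‖ ^ 2)
    {z : ℂ} {f u : L2 n} {φ : ℕ → E n → ℂ} (hφ : IsFormApprox V φ u)
    (hf : MemLp (fun x => ((‖x‖ : ℝ) : ℂ) * f x) 2)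
    (heq : ∀ ψ, IsTestFunction ψ → Tendsto (fun k => schrodingerForm V (φ k) ψ) atTop
      (𝓝 (pairing f ψ + z * pairing u ψ))) : ∃ G, IsWeakSolution V z f u G := by
  obtain ⟨G, hG, hlim⟩ := hV.exists_isH1_of_cauchy hδ h hφ.test hφ.l2Tendsto hφ.cauchy
  refine ⟨G, hG, Lp.memLp f, hf, fun ψ hψ => ?_⟩
  have l1 : Tendsto (fun k => ∑ i, pairing (partialDeriv i (φ k)) (partialDeriv i ψ) +
      ∫ x, (V x : ℂ) * φ k x * conj (ψ x)) atTop
      (𝓝 (∑ i, pairing (G i) (partialDeriv i ψ) + ∫ x, (V x : ℂ) * u x * conj (ψ x))) :=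
    (tendsto_finsetSum _ fun i _ => (hlim i).pairing (.const _ (hψ.partialDeriv i).memLp)).add
      (hV.tendsto (fun k => (hφ.test k).isH1) hG hlim (fun _ => hψ.isH1) hψ.isH1
        fun i => .const _ (hψ.partialDeriv i).memLp)
  have e := tendsto_nhds_unique l1 ((heq ψ hψ).congr fun k =>
    schrodingerForm_eq (hφ.test k) hψ (hV.integrable (hφ.test k).isH1 hψ.isH1))
  rw [e]
  have i1 := integrable_mul_conj (Lp.memLp u) hψ.memLp
  have i2 := integrable_mul_conj (Lp.memLp f) hψ.memLp
  unfold pairing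
  rw [← integral_const_mul, add_comm, ← integral_add (i1.const_mul _) i2]
  congr 1 with x
  ring

/-- The uniform weighted resolvent estimate for subcritical potentials. -/
theorem IsSubcritical.weightedBound (hn : 3 ≤ n) (hδ : 0 < δ) (hV : IsSubcritical δ V) :
    ∃ H : L2 n →ₗ.[ℂ] L2 n, IsSchrodingerOperator V H ∧
      ∀ z : ℂ, (¬ ∃ t : ℝ, 0 ≤ t ∧ z = (t : ℂ)) → ∃ R : L2 n →L[ℂ] L2 n, IsResolvent H z R ∧
        WeightedBound R (6 * (n + 2) * δ ^ (-2 : ℤ)) := by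
  obtain ⟨hVm, W, hE, hWm, hlow, hlow'⟩ := hV
  obtain ⟨C, hC⟩ := MemWeakLp.exists_formBounded_of_norm_mul hn hVm
  obtain ⟨C', hC'⟩ := MemWeakLp.exists_formBounded hn hWm
  have h1 : ∀ φ : E n → ℂ, IsTestFunction φ → δ * ∑ i, (∫ x, ‖partialDeriv i φ x‖ ^ 2) ≤
      ∑ i, (∫ x, ‖partialDeriv i φ x‖ ^ 2) + ∫ x, V x * ‖φ x‖ ^ 2 := fun φ hφ => by
    rw [← hC.integral_form hφ, ← integral_gradSq hφ]
    exact hlow φ hφ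
  have h2 : ∀ φ : E n → ℂ, IsTestFunction φ → δ * ∑ i, (∫ x, ‖partialDeriv i φ x‖ ^ 2) ≤
      ∑ i, (∫ x, ‖partialDeriv i φ x‖ ^ 2) -
        ((∫ x, V x * ‖φ x‖ ^ 2) + ∫ x, W x * ‖φ x‖ ^ 2) := fun φ hφ => by
    rw [← integral_gradSq hφ]
    refine (hlow' φ hφ).trans (le_of_eq ?_)
    have i1 := hC.integrable_sq hφ.isH1
    have i2 := hC'.integrable_sq hφ.isH1
    have i12 : Integrable fun x => V x * ‖φ x‖ ^ 2 + W x * ‖φ x‖ ^ 2 := i1.add i2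
    rw [← integral_add i1 i2, ← integral_sub (integrable_gradSq hφ) i12]
    congr 1 with x
    ring
  -- Needed because the estimate absorbs powers of δ into 1.
  have hδ1 : δ ≤ 1 := FormBounded.le_one_of_lower_bound (by omega) h1
  obtain ⟨H, hH, hres⟩ := (hC.isClosableForm hδ h1).exists_operator
  refine ⟨H, hH, fun z hz => ?_⟩
  obtain ⟨R, hR, happ⟩ := hres z hz
  refine ⟨R, hR, fun f g hfg => ?_⟩
  obtain ⟨φ, hφ, hlim⟩ := happ g
  have hae := ae_eq_norm_mul hn hfg
  obtain ⟨G, hG⟩ := hC.exists_isWeakSolution hδ h1 hφ ((memLp_congr_ae hae).2 (Lp.memLp f)) hlim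
  have hm := (hG.isH1.hardy hn).1
  refine ⟨hm, ?_⟩
  have est := hG.weighted_estimate hn hC hC' hE (fun w K hw => ?_) hz hδ hδ1
    (fun η _ ψ K hK => hC.lower_bound_isH1 h1 hK)
    (fun η _ ψ K hK => hC.lower_bound_isH1_sub hC' h2 hK)
  · rw [l2_congr_ae hae, ← norm_eq_l2] at est
    rw [eLpNorm_eq_l2 hm]
    refine ENNReal.ofReal_le_ofReal ?_
    have e : 6 * ((n : ℝ) + 2) * δ ^ (-2 : ℤ) * ‖f‖ = 6 * (n + 2) * ‖f‖ / δ ^ 2 := by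
      rw [zpow_neg, div_eq_mul_inv]
      norm_cast
      ring
    rw [e, le_div_iff₀ (by positivity)]
    exact est
  · refine le_trans ?_ (hC.lower_bound_isH1 h1 hw)
    exact mul_nonneg hδ.le (Finset.sum_nonneg fun i _ => integral_nonneg fun x => by positivity)

end

section
variable {n : ℕ} {f g : E n → ℂ}

/-! ### The projection onto radial functions -/

theorem norm_smul_sphere {x : E n} (θ : Metric.sphere (0 : E n) 1) : ‖‖x‖ • (θ : E n)‖ = ‖x‖ := by
  rw [norm_smul, norm_eq_of_mem_sphere, mul_one, norm_norm]

theorem norm_smul_sphere_Ioi (θ : Metric.sphere (0 : E n) 1) (r : Set.Ioi (0 : ℝ)) :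
    ‖r.1 • (θ : E n)‖ = r.1 := by
  rw [norm_smul, norm_eq_of_mem_sphere, mul_one, Real.norm_eq_abs, abs_of_pos (Set.mem_Ioi.1 r.2)]

/-- Integration over spheres in polar coordinates. -/
theorem lintegral_lintegral_sphere [Nontrivial (E n)] {F : E n → ℝ≥0∞} (hF : Measurable F) :
    ∫⁻ x : E n, ∫⁻ θ : Metric.sphere (0 : E n) 1, F (‖x‖ • (θ : E n))
      ∂(volume : Measure (E n)).toSphere =
    (volume : Measure (E n)).toSphere Set.univ * ∫⁻ x, F x := by
  set σ := (volume : Measure (E n)).toSphere with hσ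
  rw [lintegral_polar, lintegral_polar F]
  simp_rw [norm_smul_sphere_Ioi]
  have hm : Measurable
      (fun p : Metric.sphere (0 : E n) 1 × Set.Ioi (0 : ℝ) => F (p.2.1 • (p.1 : E n))) :=
    hF.comp (by fun_prop)
  have hm' : Measurable (fun r : Set.Ioi (0 : ℝ) =>
      ∫⁻ θ : Metric.sphere (0 : E n) 1, F (r.1 • (θ : E n)) ∂σ) := hm.lintegral_prod_left'
  have hm'' : Measurable (fun p : Metric.sphere (0 : E n) 1 × Set.Ioi (0 : ℝ) =>
      ∫⁻ θ : Metric.sphere (0 : E n) 1, F (p.2.1 • (θ : E n)) ∂σ) := hm'.comp measurable_snd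
  rw [lintegral_prod_symm _ hm.aemeasurable, lintegral_prod_symm _ hm''.aemeasurable,
    ← lintegral_const_mul _ hm']
  refine lintegral_congr fun r => ?_
  simp only [lintegral_const]
  rw [mul_comm]

theorem toSphere_univ_ne_zero [Nontrivial (E n)] :
    (volume : Measure (E n)).toSphere Set.univ ≠ 0 := by
  rw [Measure.measure_univ_ne_zero]
  exact Measure.toSphere_ne_zero volume

/-- The polar formula applied to the indicator of a measurable null set containing the exceptional
points: for almost every x its trace on the sphere of radius |x| has zero surface measure. -/
theorem ae_sphere [Nontrivial (E n)] {p : E n → Prop} (h : ∀ᵐ x, p x) :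
    ∀ᵐ x : E n, ∀ᵐ θ : Metric.sphere (0 : E n) 1 ∂(volume : Measure (E n)).toSphere,
      p (‖x‖ • (θ : E n)) := by
  obtain ⟨s, hs, hsm, hs0⟩ := exists_measurable_superset_of_null (ae_iff.1 h)
  have h1 := lintegral_lintegral_sphere (F := s.indicator 1) (measurable_one.indicator hsm)
  rw [lintegral_indicator_one hsm, hs0, mul_zero, lintegral_eq_zero_iff] at h1
  · filter_upwards [h1] with x hx
    have hmx : Measurable (fun θ : Metric.sphere (0 : E n) 1 =>
        (s.indicator 1 (‖x‖ • (θ : E n)) : ℝ≥0∞)) :=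
      (measurable_one.indicator hsm).comp (by fun_prop)
    rw [Pi.zero_apply, lintegral_eq_zero_iff hmx] at hx
    filter_upwards [hx] with θ hθ
    by_contra hp
    have : ‖x‖ • (θ : E n) ∈ s := hs hp
    simp [this] at hθ
  · have hm : Measurable (fun p : E n × Metric.sphere (0 : E n) 1 =>
        (s.indicator 1 (‖p.1‖ • (p.2 : E n)) : ℝ≥0∞)) :=
      (measurable_one.indicator hsm).comp (by fun_prop)
    exact hm.lintegral_prod_right'

/-- This makes the spherical mean well defined on L² classes, although each mean is an integral over
a null set. -/
theorem radialAverage_congr_ae [Nontrivial (E n)] (h : f =ᵐ[volume] g) :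
    radialAverage f =ᵐ[volume] radialAverage g := by
  filter_upwards [ae_sphere h] with x hx
  unfold radialAverage
  exact average_congr hx

theorem aestronglyMeasurable_radialAverage [Nontrivial (E n)] (hf : AEStronglyMeasurable f volume) :
    AEStronglyMeasurable (radialAverage f) volume :=
  (stronglyMeasurable_radialAverage hf.stronglyMeasurable_mk).aestronglyMeasurable.congr
    (radialAverage_congr_ae hf.ae_eq_mk).symm

/-- Jensen's inequality on each sphere, followed by integration in polar coordinates. A measurable
representative replaces f. -/
theorem sqNorm_radialAverage_le [Nontrivial (E n)] (hf : AEStronglyMeasurable f volume) :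
    sqNorm (radialAverage f) ≤ sqNorm f := by
  have e1 : sqNorm (radialAverage f) = sqNorm (radialAverage (hf.mk f)) := by
    refine lintegral_congr_ae ?_
    filter_upwards [radialAverage_congr_ae hf.ae_eq_mk] with x hx
    rw [hx]
  have e2 : sqNorm f = sqNorm (hf.mk f) := by
    refine lintegral_congr_ae ?_
    filter_upwards [hf.ae_eq_mk] with x hx
    rw [← hx]
  rw [e1, e2]
  have hm := hf.stronglyMeasurable_mk
  unfold sqNorm
  have hle : ∀ x, ‖radialAverage (hf.mk f) x‖ₑ ^ 2 ≤ ((volume : Measure (E n)).toSphere Set.univ)⁻¹ *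
      ∫⁻ θ : Metric.sphere (0 : E n) 1, ‖hf.mk f (‖x‖ • (θ : E n))‖ₑ ^ 2
        ∂(volume : Measure (E n)).toSphere := fun x => enorm_average_sq_le _
    (hm.comp_measurable (by fun_prop)).aestronglyMeasurable
  refine (lintegral_mono hle).trans (le_of_eq ?_)
  rw [lintegral_const_mul, lintegral_lintegral_sphere (hm.measurable.enorm.pow_const 2), ← mul_assoc,
    ENNReal.inv_mul_cancel toSphere_univ_ne_zero (measure_ne_top _ _), one_mul]
  have h3 : Measurable (fun p : E n × Metric.sphere (0 : E n) 1 =>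
      ‖hf.mk f (‖p.1‖ • (p.2 : E n))‖ₑ ^ 2) :=
    (hm.measurable.enorm.pow_const 2).comp (by fun_prop)
  exact h3.lintegral_prod_right'

theorem MemLp.radialAverage [Nontrivial (E n)] (hf : MemLp f 2) : MemLp (radialAverage f) 2 :=
  memLp_of_sqNorm_lt_top (aestronglyMeasurable_radialAverage hf.1)
    ((sqNorm_radialAverage_le hf.1).trans_lt hf.sqNorm_lt_top)

theorem integrable_sphere [Nontrivial (E n)] (hf : MemLp f 2) : ∀ᵐ x : E n,
    Integrable (fun θ : Metric.sphere (0 : E n) 1 => f (‖x‖ • (θ : E n)))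
      (volume : Measure (E n)).toSphere := by
  have hm := hf.1.stronglyMeasurable_mk
  have h1 := lintegral_lintegral_sphere (hm.measurable.enorm.pow_const 2)
  have h3 : Measurable (fun p : E n × Metric.sphere (0 : E n) 1 =>
      ‖hf.1.mk f (‖p.1‖ • (p.2 : E n))‖ₑ ^ 2) :=
    (hm.measurable.enorm.pow_const 2).comp (by fun_prop)
  have h2 : ∫⁻ x, ‖hf.1.mk f x‖ₑ ^ 2 < ∞ := by
    refine lt_of_eq_of_lt (lintegral_congr_ae ?_) hf.sqNorm_lt_top
    filter_upwards [hf.1.ae_eq_mk] with x hx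
    rw [← hx]
  have h4 := ae_lt_top h3.lintegral_prod_right'
    (h1.trans_lt (ENNReal.mul_lt_top (measure_lt_top _ _) h2)).ne
  filter_upwards [h4, ae_sphere hf.1.ae_eq_mk] with x hx hx'
  refine Integrable.congr ?_ (EventuallyEq.symm hx')
  refine MemLp.integrable (q := 2) (by norm_num)
    ⟨(hm.comp_measurable (by fun_prop)).aestronglyMeasurable, ?_⟩
  rw [eLpNorm_lt_top_iff_lintegral_rpow_enorm_lt_top (by norm_num) (by norm_num)]
  simpa using hx

theorem radialAverage_add_ae [Nontrivial (E n)] (hf : MemLp f 2) (hg : MemLp g 2) :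
    radialAverage (fun x => f x + g x) =ᵐ[volume] fun x => radialAverage f x + radialAverage g x := by
  filter_upwards [integrable_sphere hf, integrable_sphere hg] with x h1 h2
  unfold radialAverage
  rw [average_eq, average_eq, average_eq, integral_add h1 h2, smul_add]

theorem radialAverage_sub_ae [Nontrivial (E n)] (hf : MemLp f 2) (hg : MemLp g 2) :
    radialAverage (fun x => f x - g x) =ᵐ[volume] fun x => radialAverage f x - radialAverage g x := by
  filter_upwards [integrable_sphere hf, integrable_sphere hg] with x h1 h2
  unfold radialAverage
  rw [average_eq, average_eq, average_eq, integral_sub h1 h2, smul_sub]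

theorem L2Tendsto.radialAverage [Nontrivial (E n)] {ι : Type*} {l : Filter ι} {F : ι → E n → ℂ}
    (h : L2Tendsto l F f) : L2Tendsto l (fun k => radialAverage (F k)) (radialAverage f) := by
  refine ⟨fun k => WeightedResolvent.MemLp.radialAverage (h.mem k),
    WeightedResolvent.MemLp.radialAverage h.lim, ?_⟩
  refine tendsto_of_tendsto_of_tendsto_of_le_of_le tendsto_const_nhds h.tendsto
    (fun _ => zero_le) fun k => ?_
  refine le_trans (le_of_eq ?_) (sqNorm_radialAverage_le ((h.mem k).1.sub h.lim.1))
  refine lintegral_congr_ae ?_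
  filter_upwards [radialAverage_sub_ae (h.mem k) h.lim] with x hx
  rw [← hx]

/-- Radial functions commute with the spherical mean. -/
theorem radialAverage_mul {k : E n → ℂ} (hk : ∀ x y, ‖x‖ = ‖y‖ → k x = k y) (f : E n → ℂ) (x : E n) :
    radialAverage (fun y => k y * f y) x = k x * radialAverage f x := by
  unfold radialAverage
  simp_rw [hk _ x (norm_smul_sphere _)]
  rw [average_eq, average_eq, integral_const_mul, mul_smul_comm]

theorem radialAverage_of_radial [Nontrivial (E n)] {k : E n → ℂ}
    (hk : ∀ x y, ‖x‖ = ‖y‖ → k x = k y) (x : E n) : radialAverage k x = k x := by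
  unfold radialAverage
  simp_rw [hk _ x (norm_smul_sphere _)]
  have : NeZero (volume : Measure (E n)).toSphere := ⟨Measure.toSphere_ne_zero volume⟩
  exact average_const _ _

theorem radialAverage_eq_of_norm_eq (f : E n → ℂ) {x y : E n} (h : ‖x‖ = ‖y‖) :
    radialAverage f x = radialAverage f y := by
  unfold radialAverage
  rw [h]

theorem radialAverage_conj (f : E n → ℂ) (x : E n) :
    radialAverage (fun y => conj (f y)) x = conj (radialAverage f x) := by
  unfold radialAverage
  rw [average_eq, average_eq, integral_conj]
  simp

theorem integral_polar [Nontrivial (E n)] (f : E n → ℂ) :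
    ∫ x, f x = ∫ p : Metric.sphere (0 : E n) 1 × Set.Ioi (0 : ℝ), f (p.2.1 • (p.1 : E n))
      ∂((volume : Measure (E n)).toSphere.prod
        (Measure.volumeIoiPow (Module.finrank ℝ (E n) - 1))) ∧
    (Integrable f → Integrable (fun p : Metric.sphere (0 : E n) 1 × Set.Ioi (0 : ℝ) =>
      f (p.2.1 • (p.1 : E n))) ((volume : Measure (E n)).toSphere.prod
        (Measure.volumeIoiPow (Module.finrank ℝ (E n) - 1)))) := by
  have h := (volume : Measure (E n)).measurePreserving_homeomorphUnitSphereProd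
  have he := (homeomorphUnitSphereProd (E n)).measurableEmbedding
  have key : ∀ x : ({0}ᶜ : Set (E n)),
      f ((homeomorphUnitSphereProd (E n) x).2.1 • ((homeomorphUnitSphereProd (E n) x).1 : E n))
        = f x := by
    intro x
    have h2 := congrArg Subtype.val ((homeomorphUnitSphereProd (E n)).symm_apply_apply x)
    rw [homeomorphUnitSphereProd_symm_apply_coe] at h2
    rw [h2]
  have hr : (volume : Measure (E n)).restrict {0}ᶜ = volume := by
    rw [Measure.restrict_eq_self_of_ae_mem]
    simp [ae_iff]
  constructor
  · rw [← h.integral_comp he]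
    simp_rw [key]
    rw [integral_subtype_comap (measurableSet_singleton _).compl f, hr]
  · intro hf
    rw [← h.integrable_comp_emb he]
    have : (fun p : Metric.sphere (0 : E n) 1 × Set.Ioi (0 : ℝ) => f (p.2.1 • (p.1 : E n))) ∘
        (homeomorphUnitSphereProd (E n)) = f ∘ ((↑) : ({0}ᶜ : Set (E n)) → E n) := funext key
    rw [this, ← MeasurableEmbedding.integrable_map_iff
      (MeasurableEmbedding.subtype_coe (measurableSet_singleton _).compl),
      map_comap_subtype_coe (measurableSet_singleton _).compl, hr]
    exact hf

theorem integral_radialAverage [Nontrivial (E n)] (hf : Integrable f)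
    (hP : Integrable (radialAverage f)) : ∫ x, radialAverage f x = ∫ x, f x := by
  rw [(integral_polar f).1, (integral_polar (radialAverage f)).1,
    integral_prod_symm _ ((integral_polar f).2 hf),
    integral_prod_symm _ ((integral_polar (radialAverage f)).2 hP)]
  refine integral_congr_ae (ae_of_all _ fun r => ?_)
  have : ∀ θ : Metric.sphere (0 : E n) 1, radialAverage f (r.1 • (θ : E n)) =
      ⨍ θ' : Metric.sphere (0 : E n) 1, f (r.1 • (θ' : E n)) ∂(volume : Measure (E n)).toSphere := by
    intro θ
    rw [radialAverage, norm_smul_sphere_Ioi]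
  simp only [this, integral_const]
  exact measure_smul_average _ _

/-- `P` is symmetric. -/
theorem pairing_radialAverage [Nontrivial (E n)] (hf : MemLp f 2) (hg : MemLp g 2) :
    pairing (radialAverage f) g = pairing f (radialAverage g) := by
  -- Spherical averaging preserves integrals, and Pf is radial, so averaging Pf · conj g gives ⟨Pf,
  -- g⟩ = ⟨Pf, Pg⟩, an expression symmetric in f and g.
  have key : ∀ {f g : E n → ℂ}, MemLp f 2 → MemLp g 2 →
      pairing (radialAverage f) g = pairing (radialAverage f) (radialAverage g) := by
    intro f g hf hg
    have hPf := WeightedResolvent.MemLp.radialAverage hf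
    have hPg := WeightedResolvent.MemLp.radialAverage hg
    have e : radialAverage (fun x => radialAverage f x * conj (g x)) =
        fun x => radialAverage f x * conj (radialAverage g x) := by
      funext x
      rw [radialAverage_mul (fun x y h => radialAverage_eq_of_norm_eq f h), radialAverage_conj]
    unfold pairing
    rw [← integral_radialAverage (integrable_mul_conj hPf hg)
      (by rw [e]; exact integrable_mul_conj hPf hPg), e]
  rw [key hf hg, ← conj_pairing (radialAverage g), ← key hg hf, conj_pairing]

end

section
variable {n : ℕ} {f g u : E n → ℂ} {G : Fin n → E n → ℂ}

/-! ### Spherical means of Sobolev functions -/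

/-- Ψ depends on both sθ and θ so that the derivative is an integral of the same kind, with Ψ
replaced by its derivative in the direction (θ, 0). The induction for smoothness then closes on
itself. -/
theorem hasDerivAt_integral_sphere (μ : Measure (Metric.sphere (0 : E n) 1)) [IsFiniteMeasure μ]
    {Ψ : E n × E n → ℂ} (hΨ : ContDiff ℝ (⊤ : ℕ∞) Ψ) (s₀ : ℝ) :
    HasDerivAt (fun s : ℝ => ∫ θ : Metric.sphere (0 : E n) 1, Ψ (s • (θ : E n), θ) ∂μ)
      (∫ θ : Metric.sphere (0 : E n) 1, fderiv ℝ Ψ (s₀ • (θ : E n), θ) (θ, 0) ∂μ) s₀ := by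
  have hc := hΨ.continuous
  have hd : Continuous fun p : ℝ × Metric.sphere (0 : E n) 1 =>
      fderiv ℝ Ψ (p.1 • (p.2 : E n), p.2) (p.2, 0) := by
    refine ((hΨ.continuous_fderiv (by simp)).comp (by fun_prop)).clm_apply (by fun_prop)
  have hi : ∀ {F : Metric.sphere (0 : E n) 1 → ℂ}, Continuous F → Integrable F μ := fun hF => by
    rw [← integrableOn_univ]
    exact hF.continuousOn.integrableOn_compact isCompact_univ
  obtain ⟨M, hM⟩ := ((isCompact_closedBall s₀ 1).prod
    (isCompact_univ (X := Metric.sphere (0 : E n) 1))).exists_bound_of_continuousOn hd.continuousOn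
  refine (hasDerivAt_integral_of_dominated_loc_of_deriv_le (bound := fun _ => M)
    (F' := fun s (θ : Metric.sphere (0 : E n) 1) => fderiv ℝ Ψ (s • (θ : E n), θ) (θ, 0))
    (Metric.closedBall_mem_nhds s₀ one_pos) (Eventually.of_forall fun s => ?_) ?_ ?_
    (ae_of_all _ fun θ s hs => hM (s, θ) ⟨hs, Set.mem_univ _⟩) (integrable_const _)
    (ae_of_all _ fun θ s _ => ?_)).2
  · exact (hc.comp (by fun_prop)).aestronglyMeasurable
  · exact hi (hc.comp (by fun_prop))
  · exact (hd.comp (Continuous.prodMk_right s₀)).aestronglyMeasurable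
  · have h1 : HasDerivAt (fun s : ℝ => (s • (θ : E n), (θ : E n))) ((θ : E n), 0) s := by
      have := ((hasDerivAt_id s).smul_const (θ : E n)).prodMk (hasDerivAt_const s (θ : E n))
      simpa using this
    exact (hΨ.differentiable (by simp) _).hasFDerivAt.comp_hasDerivAt s h1

theorem contDiff_integral_sphere (μ : Measure (Metric.sphere (0 : E n) 1)) [IsFiniteMeasure μ]
    {Ψ : E n × E n → ℂ} (hΨ : ContDiff ℝ (⊤ : ℕ∞) Ψ) :
    ContDiff ℝ (⊤ : ℕ∞) (fun s : ℝ => ∫ θ : Metric.sphere (0 : E n) 1, Ψ (s • (θ : E n), θ) ∂μ) := by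
  refine contDiff_infty.2 fun m => ?_
  induction m generalizing Ψ with
  | zero =>
    refine contDiff_zero.2 (continuous_iff_continuousAt.2 fun s => ?_)
    exact (hasDerivAt_integral_sphere μ hΨ s).continuousAt
  | succ m ih =>
    refine contDiff_succ_iff_deriv (n := m).2 ⟨fun s => (hasDerivAt_integral_sphere μ hΨ s).differentiableAt,
      by simp, ?_⟩
    have e : deriv (fun s : ℝ => ∫ θ : Metric.sphere (0 : E n) 1, Ψ (s • (θ : E n), θ) ∂μ) =
        fun s => ∫ θ : Metric.sphere (0 : E n) 1, fderiv ℝ Ψ (s • (θ : E n), θ) (θ, 0) ∂μ :=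
      funext fun s => (hasDerivAt_integral_sphere μ hΨ s).deriv
    rw [e]
    exact ih (Ψ := fun p => fderiv ℝ Ψ p (p.2, 0))
      ((hΨ.fderiv_right (m := ((⊤ : ℕ∞) : WithTop ℕ∞)) (by simp)).clm_apply
        (contDiff_snd.prodMk contDiff_const))

/-- The coordinates of `x / |x|`. -/
def unitCoord (i : Fin n) (x : E n) : ℂ := ((x i / ‖x‖ : ℝ) : ℂ)

/-- The radial component of a vector field. -/
def radialPart (G : Fin n → E n → ℂ) (x : E n) : ℂ := ∑ i, unitCoord i x * G i x

theorem norm_unitCoord_le (i : Fin n) (x : E n) : ‖unitCoord i x‖ ≤ 1 := by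
  rw [unitCoord, Complex.norm_real, norm_div, norm_norm]
  exact div_le_one_of_le₀ (PiLp.norm_apply_le x i) (norm_nonneg _)

theorem aestronglyMeasurable_unitCoord (i : Fin n) :
    AEStronglyMeasurable (unitCoord i : E n → ℂ) volume := by
  have h2 : Measurable fun x : E n => x i := (EuclideanSpace.proj (𝕜 := ℝ) i).continuous.measurable
  exact (Complex.measurable_ofReal.comp (h2.div measurable_norm)).aestronglyMeasurable

theorem sum_unitCoord_mul_self {x : E n} (hx : x ≠ 0) : ∑ i, unitCoord i x * unitCoord i x = 1 := by
  have h : ∑ i, (x i / ‖x‖) * (x i / ‖x‖) = 1 := by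
    simp_rw [← sq, div_pow]
    rw [← Finset.sum_div, ← EuclideanSpace.real_norm_sq_eq]
    have := norm_ne_zero_iff.2 hx
    field_simp
  simp_rw [unitCoord, ← Complex.ofReal_mul]
  rw [← Complex.ofReal_sum, h, Complex.ofReal_one]

theorem conj_unitCoord (i : Fin n) (x : E n) : conj (unitCoord i x) = unitCoord i x :=
  Complex.conj_ofReal _

theorem memLp_radialPart (hG : ∀ i, MemLp (G i) 2) : MemLp (radialPart G) 2 :=
  memLp_finsetSum _ fun i _ =>
    memLp_mul_bdd (aestronglyMeasurable_unitCoord i) (norm_unitCoord_le i) (hG i)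

theorem L2Tendsto.unitCoord_mul {ι : Type*} {l : Filter ι} {F : ι → E n → ℂ}
    (h : L2Tendsto l F f) (i : Fin n) :
    L2Tendsto l (fun k x => unitCoord i x * F k x) (fun x => unitCoord i x * f x) :=
  h.mul_bdd (aestronglyMeasurable_unitCoord i) (norm_unitCoord_le i)

theorem L2Tendsto.finsetSum {ι κ : Type*} {l : Filter ι} (s : Finset κ) {F : κ → ι → E n → ℂ}
    {f : κ → E n → ℂ} (h : ∀ j ∈ s, L2Tendsto l (F j) (f j)) :
    L2Tendsto l (fun k x => ∑ j ∈ s, F j k x) (fun x => ∑ j ∈ s, f j x) := by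
  classical
  induction s using Finset.induction_on with
  | empty => simpa using L2Tendsto.const l (MemLp.zero' (ε := ℂ))
  | insert a s ha ih =>
    simp_rw [Finset.sum_insert ha]
    exact (h a (Finset.mem_insert_self a s)).add (ih fun j hj => h j (Finset.mem_insert_of_mem hj))

theorem L2Tendsto.radialPart {ι : Type*} {l : Filter ι} {D : ι → Fin n → E n → ℂ}
    (h : ∀ i, L2Tendsto l (fun k => D k i) (G i)) :
    L2Tendsto l (fun k => radialPart (D k)) (radialPart G) :=
  L2Tendsto.finsetSum _ fun i _ => (h i).unitCoord_mul i

/-- The profile of the spherical mean of a test function. -/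
theorem exists_profile {φ : E n → ℂ} (hφ : IsTestFunction φ) :
    ∃ p p' : ℝ → ℂ, ContDiff ℝ (⊤ : ℕ∞) p ∧ (∀ s, HasDerivAt p (p' s) s) ∧ Continuous p' ∧
      (∃ R M : ℝ, 0 < R ∧ (∀ s, R ≤ |s| → p s = 0) ∧ (∀ s, R ≤ |s| → p' s = 0) ∧
        (∀ s, ‖p s‖ ≤ M) ∧ ∀ s, ‖p' s‖ ≤ M) ∧
      (∀ x, radialAverage φ x = p ‖x‖) ∧ ∀ x : E n, x ≠ 0 →
        radialAverage (radialPart fun i => partialDeriv i φ) x = p' ‖x‖ := by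
  set σ := (volume : Measure (E n)).toSphere
  have hΨ : ContDiff ℝ (⊤ : ℕ∞) (fun q : E n × E n => φ q.1) := hφ.1.comp contDiff_fst
  set μ := (σ Set.univ)⁻¹ • σ with hμ
  have : IsFiniteMeasure μ := by
    refine ⟨?_⟩
    rw [hμ, Measure.smul_apply, smul_eq_mul]
    rcases eq_or_ne (σ Set.univ) 0 with h0 | h0
    · simp [h0]
    · rw [ENNReal.inv_mul_cancel h0 (measure_ne_top _ _)]
      exact ENNReal.one_lt_top
  set p : ℝ → ℂ := fun s => ∫ θ : Metric.sphere (0 : E n) 1, φ (s • (θ : E n)) ∂μ with hp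
  have hpd : ∀ s, HasDerivAt p
      (∫ θ : Metric.sphere (0 : E n) 1, fderiv ℝ φ (s • (θ : E n)) θ ∂μ) s := fun s => by
    refine (hasDerivAt_integral_sphere μ hΨ s).congr_deriv ?_
    refine integral_congr_ae (ae_of_all _ fun θ => ?_)
    have h1 := ((hφ.differentiable (s • (θ : E n))).hasFDerivAt.comp (s • (θ : E n), (θ : E n))
      (hasFDerivAt_fst (𝕜 := ℝ)))
    have h2 : HasFDerivAt (fun q : E n × E n => φ q.1) _ (s • (θ : E n), (θ : E n)) := h1
    simp only [h2.fderiv]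
    rfl
  have hps : ContDiff ℝ (⊤ : ℕ∞) p := contDiff_integral_sphere μ hΨ
  have hp'c : Continuous (deriv p) := hps.continuous_deriv (by simp)
  obtain ⟨R, hR0, hR⟩ := hφ.2.isBounded.subset_closedBall_lt 0 (0 : E n)
  have hout : ∀ s, R < |s| → p s = 0 := fun s hs => by
    rw [hp]
    refine integral_eq_zero_of_ae (ae_of_all _ fun θ => image_eq_zero_of_notMem_tsupport fun h => ?_)
    have := hR h
    rw [mem_closedBall_zero_iff, norm_smul, norm_eq_of_mem_sphere, mul_one, Real.norm_eq_abs] at this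
    linarith
  have hout' : ∀ s, R < |s| → deriv p s = 0 := fun s hs => by
    have : p =ᶠ[𝓝 s] fun _ => 0 := by
      filter_upwards [continuous_abs.continuousAt.eventually (lt_mem_nhds hs)] with t ht
      exact hout t ht
    rw [this.deriv_eq, deriv_const]
  have hb : ∀ {q : ℝ → ℂ}, Continuous q → (∀ s, R < |s| → q s = 0) → ∃ M, ∀ s, ‖q s‖ ≤ M := by
    intro q hq h0
    obtain ⟨M, hM⟩ := (isCompact_closedBall (0 : ℝ) R).exists_bound_of_continuousOn hq.continuousOn
    refine ⟨max M 0, fun s => ?_⟩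
    rcases le_or_gt |s| R with h | h
    · exact (hM s (by simpa using h)).trans (le_max_left _ _)
    · rw [h0 s h, norm_zero]
      exact le_max_right _ _
  obtain ⟨M₁, hM₁⟩ := hb hps.continuous hout
  obtain ⟨M₂, hM₂⟩ := hb hp'c hout'
  refine ⟨p, deriv p, hps, fun s => (hpd s).differentiableAt.hasDerivAt, hp'c,
    ⟨R + 1, max M₁ M₂, by linarith, fun s hs => hout s (by linarith),
      fun s hs => hout' s (by linarith), fun s => (hM₁ s).trans (le_max_left _ _),
      fun s => (hM₂ s).trans (le_max_right _ _)⟩, fun x => ?_, fun x hx => ?_⟩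
  · rw [radialAverage, average_eq']
  · rw [radialAverage, average_eq', (hpd ‖x‖).deriv]
    refine integral_congr_ae (ae_of_all _ fun θ => ?_)
    have hx0 := norm_ne_zero_iff.2 hx
    simp only [radialPart]
    rw [fderiv_apply_eq_sum]
    refine Finset.sum_congr rfl fun i _ => ?_
    congr 1
    rw [unitCoord, norm_smul_sphere]
    congr 1
    simp only [PiLp.smul_apply, smul_eq_mul]
    field_simp

/-- The mean is p(|x|) for a smooth profile p, and smoothness at the origin is not needed: the
functions p(√(|x|² + η²)) are test functions and converge with their gradients by dominated
convergence as η → 0. -/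
theorem IsTestFunction.isH1_radialAverage (hn : 3 ≤ n) {φ : E n → ℂ} (hφ : IsTestFunction φ) :
    IsH1 (radialAverage φ) (fun i x => unitCoord i x *
      radialAverage (radialPart fun i => WeightedResolvent.partialDeriv i φ) x) := by
  obtain ⟨p, p', hps, hpd, hp'c, ⟨R, M, hR, h0, h0', hM, hM'⟩, he, he'⟩ := exists_profile hφ
  set η : ℕ → ℝ := fun k => 1 / ((k : ℝ) + 1) with hη
  have hη0 : ∀ k, 0 < η k := fun k => by positivity
  have hηlim : Tendsto η atTop (𝓝 0) := tendsto_one_div_add_atTop_nhds_zero_nat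
  have hreg : ∀ x : E n, Tendsto (fun k => reg (η k) x) atTop (𝓝 ‖x‖) := fun x => by
    have h1 : Continuous fun t : ℝ => √(‖x‖ ^ 2 + t ^ 2) := by fun_prop
    have h2 := (h1.tendsto 0).comp hηlim
    simp only [ne_eq, OfNat.ofNat_ne_zero, not_false_eq_true, zero_pow, add_zero,
      Real.sqrt_sq (norm_nonneg x)] at h2
    exact h2
  set b : E n → ℝ := (Metric.closedBall (0 : E n) R).indicator fun _ => M with hb
  have hbm : MemLp b 2 := by
    rw [hb]
    exact memLp_indicator_const 2 measurableSet_closedBall M (Or.inr measure_closedBall_lt_top.ne)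
  have hb1 : ∀ (x : E n) (a : ℂ), ‖a‖ ≤ M → (R ≤ ‖x‖ → a = 0) → ‖a‖ ≤ b x := fun x a ha h => by
    by_cases hx : x ∈ Metric.closedBall (0 : E n) R
    · rw [hb, Set.indicator_of_mem hx]
      exact ha
    · rw [hb, Set.indicator_of_notMem hx, h, norm_zero]
      rw [mem_closedBall_zero_iff, not_le] at hx
      exact hx.le
  have habs : ∀ (k : ℕ) (x : E n), R ≤ ‖x‖ → R ≤ |reg (η k) x| := fun k x h =>
    (h.trans (norm_le_reg _ x)).trans (le_abs_self _)
  have hmc : ∀ (c w : ℂ), ‖c‖ ≤ 1 → ‖w‖ ≤ M → ‖w * c‖ ≤ M := fun c w hc hw => by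
    rw [norm_mul]
    exact (mul_le_of_le_one_right (norm_nonneg _) hc).trans hw
  refine ⟨fun k x => p (reg (η k) x), fun k => ⟨contDiff_comp_reg (hη0 k) hps.contDiffOn, ?_⟩, ?_,
    fun i => ?_⟩
  · refine HasCompactSupport.intro (isCompact_closedBall (0 : E n) R) fun x hx => h0 _ (habs k x ?_)
    rw [mem_closedBall_zero_iff, not_le] at hx
    exact hx.le
  · have e : radialAverage φ = fun x => p ‖x‖ := funext he
    rw [e]
    refine L2Tendsto.of_dominated
      (fun k => (hps.continuous.comp (continuous_reg (η k))).aestronglyMeasurable)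
      (hps.continuous.comp continuous_norm).aestronglyMeasurable hbm
      (fun k => ae_of_all _ fun x => hb1 x _ (hM _) fun h => h0 _ (habs k x h))
      (ae_of_all _ fun x => hb1 x _ (hM _) fun h => h0 _ (by rwa [abs_norm]))
      (ae_of_all _ fun x => (hps.continuous.tendsto _).comp (hreg x))
  · have e : ∀ k, WeightedResolvent.partialDeriv i (fun y : E n => p (reg (η k) y)) =
        fun x => p' (reg (η k) x) * ((x i / reg (η k) x : ℝ) : ℂ) := fun k =>
      funext fun x => partialDeriv_comp_reg (hη0 k) (hpd _) i
    simp_rw [e]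
    have hlim : L2Tendsto atTop (fun (k : ℕ) (x : E n) => p' (reg (η k) x) *
        ((x i / reg (η k) x : ℝ) : ℂ)) (fun x => p' ‖x‖ * unitCoord i x) := by
      refine L2Tendsto.of_dominated
        (fun k => (hp'c.comp (continuous_reg (η k))).aestronglyMeasurable.mul
          (aestronglyMeasurable_coord_div_reg _ i))
        ((hp'c.comp continuous_norm).aestronglyMeasurable.mul (aestronglyMeasurable_unitCoord i)) hbm
        (fun k => ae_of_all _ fun x => hb1 x _ (hmc _ _ (abs_coord_div_reg_le (hη0 k) x i) (hM' _))
          fun h => by rw [h0' _ (habs k x h), zero_mul])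
        (ae_of_all _ fun x => hb1 x _ (hmc _ _ (norm_unitCoord_le i x) (hM' _))
          fun h => by rw [h0' _ (by rwa [abs_norm]), zero_mul]) ?_
      filter_upwards [ae_ne_zero hn] with x hx
      refine ((hp'c.tendsto _).comp (hreg x)).mul ?_
      refine (Complex.continuous_ofReal.tendsto _).comp ?_
      exact tendsto_const_nhds.div (hreg x) (norm_ne_zero_iff.2 hx)
    refine hlim.congr' (fun _ => ae_eq_rfl) ?_
    filter_upwards [ae_ne_zero hn] with x hx
    rw [he' x hx, mul_comm]

/-- Spherical means of `H¹` functions belong to `H¹`. -/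
theorem IsH1.radialAverage (hn : 3 ≤ n) (hu : IsH1 u G) :
    IsH1 (radialAverage u) (fun i x => unitCoord i x * radialAverage (radialPart G) x) := by
  have := nontrivial_euclidean hn
  obtain ⟨φ, h1, h2, h3⟩ := hu
  exact IsH1.of_tendsto (fun k => (h1 k).isH1_radialAverage hn) h2.radialAverage
    fun i => (L2Tendsto.radialPart h3).radialAverage.unitCoord_mul i

end

section
variable {n : ℕ} {f g u : E n → ℂ} {G : Fin n → E n → ℂ}

/-! ### A Poincaré inequality on spheres -/

/-- The fundamental theorem of calculus and Cauchy-Schwarz on the unit interval. The hypothesis on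
the line keeps it away from the possible singularity at the origin. -/
theorem enorm_sub_sq_le_lintegral_segment {F : E n → ℂ} (hF : ContDiffOn ℝ 1 F {0}ᶜ) {x v : E n}
    (hxv : ∀ t : ℝ, x + t • v ≠ 0) :
    ‖F (x + v) - F x‖ₑ ^ 2 ≤
      ∫⁻ t in Set.Ioc (0 : ℝ) 1, ‖fderiv ℝ F (x + t • v)‖ₑ ^ 2 * ‖v‖ₑ ^ 2 := by
  have hline : Continuous fun t : ℝ => x + t • v := by fun_prop
  have hd : Continuous fun t : ℝ => fderiv ℝ F (x + t • v) v :=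
    ((hF.continuousOn_fderiv_of_isOpen isOpen_compl_singleton le_rfl).comp_continuous hline
      hxv).clm_apply continuous_const
  have hderiv : ∀ t : ℝ, HasDerivAt (fun t : ℝ => F (x + t • v)) (fderiv ℝ F (x + t • v) v) t := by
    intro t
    have h1 : HasDerivAt (fun t : ℝ => x + t • v) v t := by
      simpa using ((hasDerivAt_id t).smul_const v).const_add x
    have h2 := ((hF.contDiffAt (isOpen_compl_singleton.mem_nhds (hxv t))).differentiableAt
      (by simp)).hasFDerivAt
    exact h2.comp_hasDerivAt t h1
  have ftc := intervalIntegral.integral_eq_sub_of_hasDerivAt (a := 0) (b := 1)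
    (fun t _ => hderiv t) (hd.intervalIntegrable 0 1)
  simp only [one_smul, zero_smul, add_zero] at ftc
  rw [← ftc, intervalIntegral.integral_of_le zero_le_one]
  have hμ : (volume.restrict (Set.Ioc (0 : ℝ) 1)) Set.univ = 1 := by simp
  have h1 := enorm_average_sq_le (volume.restrict (Set.Ioc (0 : ℝ) 1))
    hd.aestronglyMeasurable
  rw [average_eq', hμ, inv_one, one_smul, one_mul] at h1
  refine h1.trans (lintegral_mono fun t => ?_)
  rw [← mul_pow]
  gcongr
  exact ContinuousLinearMap.le_opENorm _ _

/-- The exceptional x lie in the span of v, a proper subspace and hence a null set. -/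
theorem ae_line_ne_zero (hn : 3 ≤ n) (v : E n) : ∀ᵐ x : E n, ∀ t : ℝ, x + t • v ≠ 0 := by
  have hs : (Submodule.span ℝ {v} : Submodule ℝ (E n)) ≠ ⊤ := by
    intro h
    have h1 := finrank_span_le_card (R := ℝ) ({v} : Set (E n))
    rw [h, finrank_top, finrank_euclideanSpace, Fintype.card_fin] at h1
    simp at h1
    omega
  have h0 := Measure.addHaar_submodule volume (Submodule.span ℝ {v} : Submodule ℝ (E n)) hs
  refine ae_iff.2 (measure_mono_null (fun x hx => ?_) h0)
  simp only [Set.mem_ofPred_eq, not_forall, not_not] at hx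
  obtain ⟨t, ht⟩ := hx
  rw [add_eq_zero_iff_eq_neg] at ht
  rw [ht, ← neg_smul]
  exact Submodule.smul_mem _ _ (Submodule.mem_span_singleton_self v)

/-- A Poincaré inequality on the unit ball for functions which may be singular at the origin. -/
theorem lintegral_ball_sub_sq_le (hn : 3 ≤ n) {F : E n → ℂ} (hF : ContDiffOn ℝ 1 F {0}ᶜ)
    (hFm : Measurable F) :
    ∫⁻ x in Metric.closedBall (0 : E n) 1, ∫⁻ y in Metric.closedBall (0 : E n) 1,
      ‖F y - F x‖ₑ ^ 2 ≤ 4 * volume (Metric.closedBall (0 : E n) 2) *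
        ∫⁻ x in Metric.closedBall (0 : E n) 1, ‖fderiv ℝ F x‖ₑ ^ 2 := by
  set B := Metric.closedBall (0 : E n) 1 with hB
  have hBm : MeasurableSet B := measurableSet_closedBall
  set χ : E n → ℝ≥0∞ := B.indicator 1 with hχ
  have hχm : Measurable χ := measurable_one.indicator hBm
  have hset : ∀ k : E n → ℝ≥0∞, ∫⁻ x in B, k x = ∫⁻ x, χ x * k x := fun k => by
    rw [← lintegral_indicator hBm]
    refine lintegral_congr fun x => ?_
    by_cases hx : x ∈ B
    · rw [hχ, Set.indicator_of_mem hx, Set.indicator_of_mem hx, Pi.one_apply, one_mul]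
    · rw [hχ, Set.indicator_of_notMem hx, Set.indicator_of_notMem hx, zero_mul]
  have hdm : Measurable fun p : E n × ℝ × E n => χ (p.1 + p.2.1 • p.2.2) *
      ‖fderiv ℝ F (p.1 + p.2.1 • p.2.2)‖ₑ ^ 2 := by
    have h1 : Measurable fun p : E n × ℝ × E n => p.1 + p.2.1 • p.2.2 := by fun_prop
    exact (hχm.comp h1).mul ((((measurable_fderiv ℝ F).comp h1).enorm).pow_const 2)
  set D := ∫⁻ x in B, ‖fderiv ℝ F x‖ₑ ^ 2 with hD
  have e1 : ∫⁻ x in B, ∫⁻ y in B, ‖F y - F x‖ₑ ^ 2 =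
      ∫⁻ x, ∫⁻ v, χ x * (χ (x + v) * ‖F (x + v) - F x‖ₑ ^ 2) := by
    rw [hset]
    refine lintegral_congr fun x => ?_
    have hm : Measurable fun y => χ y * ‖F y - F x‖ₑ ^ 2 :=
      hχm.mul ((hFm.sub_const _).enorm.pow_const 2)
    have hm' : Measurable fun v => χ (x + v) * ‖F (x + v) - F x‖ₑ ^ 2 :=
      hm.comp (measurable_const_add x)
    rw [hset, lintegral_const_mul _ hm',
      lintegral_add_left_eq_self (fun y => χ y * ‖F y - F x‖ₑ ^ 2) x]
  -- After the substitution y = x + v the integral is taken over x first. By convexity the segment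
  -- stays in the ball, and translation invariance bounds each inner integral by |v|²D ≤ 4D. Only
  -- |v| ≤ 2 contributes, whence the volume of the ball of radius 2.
  rw [e1, lintegral_lintegral_swap]
  · have key : ∀ v : E n, ∫⁻ x, χ x * (χ (x + v) * ‖F (x + v) - F x‖ₑ ^ 2) ≤
        (Metric.closedBall (0 : E n) 2).indicator (fun _ => 4 * D) v := by
      intro v
      by_cases hv : v ∈ Metric.closedBall (0 : E n) 2
      · rw [Set.indicator_of_mem hv]
        have hv2 : ‖v‖ₑ ^ 2 ≤ 4 := by
          rw [mem_closedBall_zero_iff] at hv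
          have : ‖v‖ₑ ≤ 2 := by
            rw [← ofReal_norm]
            exact (ENNReal.ofReal_le_ofReal hv).trans (by simp)
          calc ‖v‖ₑ ^ 2 ≤ 2 ^ 2 := by gcongr
            _ = 4 := by norm_num
        calc ∫⁻ x, χ x * (χ (x + v) * ‖F (x + v) - F x‖ₑ ^ 2)
            ≤ ∫⁻ x, ∫⁻ t in Set.Ioc (0 : ℝ) 1,
              4 * (χ (x + t • v) * ‖fderiv ℝ F (x + t • v)‖ₑ ^ 2) := by
              refine lintegral_mono_ae ?_
              filter_upwards [ae_line_ne_zero hn v] with x hx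
              by_cases hxB : x ∈ B ∧ x + v ∈ B
              · have h1 := enorm_sub_sq_le_lintegral_segment hF hx
                rw [hχ, Set.indicator_of_mem hxB.1, Set.indicator_of_mem hxB.2, Pi.one_apply, one_mul,
                  Pi.one_apply, one_mul]
                refine h1.trans (setLIntegral_mono' measurableSet_Ioc fun t ht => ?_)
                have hmem : x + t • v ∈ B := by
                  have := (convex_closedBall (0 : E n) 1).add_smul_mem hxB.1 hxB.2
                    ⟨ht.1.le, ht.2⟩
                  exact this
                rw [Set.indicator_of_mem hmem, Pi.one_apply, one_mul, mul_comm]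
                gcongr
              · have : χ x * (χ (x + v) * ‖F (x + v) - F x‖ₑ ^ 2) = 0 := by
                  rw [not_and_or] at hxB
                  rcases hxB with h | h
                  · rw [hχ, Set.indicator_of_notMem h, zero_mul]
                  · rw [hχ, Set.indicator_of_notMem h, zero_mul, mul_zero]
                rw [this]
                exact zero_le
          _ = ∫⁻ t in Set.Ioc (0 : ℝ) 1, ∫⁻ x,
              4 * (χ (x + t • v) * ‖fderiv ℝ F (x + t • v)‖ₑ ^ 2) := by
              refine lintegral_lintegral_swap (Measurable.aemeasurable ?_)
              have h1 : Measurable fun p : E n × ℝ => (p.1, p.2, v) := by fun_prop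
              exact (hdm.comp h1).const_mul 4
          _ = ∫⁻ t in Set.Ioc (0 : ℝ) 1, 4 * D := by
              refine lintegral_congr fun t => ?_
              rw [lintegral_add_right_eq_self (fun y => 4 * (χ y * ‖fderiv ℝ F y‖ₑ ^ 2)) (t • v),
                lintegral_const_mul, ← hset]
              exact hχm.mul ((measurable_fderiv ℝ F).enorm.pow_const 2)
          _ = 4 * D := by simp
      · rw [Set.indicator_of_notMem hv]
        refine le_of_eq ?_
        have : ∀ x, χ x * (χ (x + v) * ‖F (x + v) - F x‖ₑ ^ 2) = 0 := fun x => by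
          by_cases hx : x ∈ B
          · have : x + v ∉ B := fun h => hv (by
              rw [hB, mem_closedBall_zero_iff] at hx h
              rw [mem_closedBall_zero_iff]
              have := norm_sub_le (x + v) x
              rw [add_sub_cancel_left] at this
              linarith)
            rw [hχ, Set.indicator_of_notMem this, zero_mul, mul_zero]
          · rw [hχ, Set.indicator_of_notMem hx, zero_mul]
        simp_rw [this, lintegral_zero]
    refine (lintegral_mono key).trans (le_of_eq ?_)
    rw [lintegral_indicator measurableSet_closedBall, lintegral_const, Measure.restrict_apply_univ]
    ring
  · have h1 : Measurable fun p : E n × E n => p.1 + p.2 := by fun_prop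
    exact ((hχm.comp measurable_fst).mul ((hχm.comp h1).mul
      (((hFm.comp h1).sub (hFm.comp measurable_fst)).enorm.pow_const 2))).aemeasurable

/-- The tangential component of a vector field. -/
def tangPart (G : Fin n → E n → ℂ) (i : Fin n) (x : E n) : ℂ :=
  G i x - unitCoord i x * radialPart G x

theorem sum_norm_tangPart_sq (G : Fin n → E n → ℂ) {x : E n} (hx : x ≠ 0) :
    ∑ i, ‖tangPart G i x‖ ^ 2 = ∑ i, ‖G i x‖ ^ 2 - ‖radialPart G x‖ ^ 2 := by
  have h : ∀ i, (‖tangPart G i x‖ ^ 2 : ℂ) = (‖G i x‖ ^ 2 : ℂ) -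
      (unitCoord i x * G i x * conj (radialPart G x) +
        unitCoord i x * conj (G i x) * radialPart G x) +
      unitCoord i x * unitCoord i x * (radialPart G x * conj (radialPart G x)) := fun i => by
    rw [← Complex.mul_conj', ← Complex.mul_conj', tangPart, map_sub, map_mul, conj_unitCoord]
    ring
  have h2 : ∑ i, unitCoord i x * conj (G i x) = conj (radialPart G x) := by
    rw [radialPart, map_sum]
    exact Finset.sum_congr rfl fun i _ => by rw [map_mul, conj_unitCoord]
  have h3 : ∑ i, unitCoord i x * G i x = radialPart G x := rfl
  have h4 : (∑ i, (‖tangPart G i x‖ ^ 2 : ℂ)) = ∑ i, (‖G i x‖ ^ 2 : ℂ) - ‖radialPart G x‖ ^ 2 := by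
    simp_rw [h]
    rw [Finset.sum_add_distrib, Finset.sum_sub_distrib, Finset.sum_add_distrib, ← Finset.sum_mul,
      ← Finset.sum_mul, ← Finset.sum_mul, sum_unitCoord_mul_self hx, h2, h3, ← Complex.mul_conj']
    ring
  exact_mod_cast h4

theorem hasFDerivAt_norm_of_ne {x : E n} (hx : x ≠ 0) :
    HasFDerivAt (fun y : E n => ‖y‖) (‖x‖⁻¹ • innerSL ℝ x) x := by
  have h : HasFDerivAt (fun y : E n => ‖y‖ ^ 2) (2 • innerSL ℝ x) x :=
    (hasStrictFDerivAt_norm_sq x).hasFDerivAt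
  have h0 := norm_ne_zero_iff.2 hx
  have h2 := h.sqrt (by positivity)
  simp only [Real.sqrt_sq (norm_nonneg _)] at h2
  refine h2.congr_fderiv ?_
  ext v
  simp
  field_simp

/-- The derivative of the degree zero extension of a function on a sphere. -/
theorem norm_fderiv_homogeneous_le {φ : E n → ℂ} (hφ : IsTestFunction φ) {s : ℝ} (hs : 0 < s)
    {p : E n} (hp : p ≠ 0) :
    ‖fderiv ℝ (fun x : E n => φ ((s * ‖x‖⁻¹) • x)) p‖ ≤ s * ‖p‖⁻¹ *
      √(∑ i, ‖tangPart (fun i => partialDeriv i φ) i ((s * ‖p‖⁻¹) • p)‖ ^ 2) := by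
  have h0 := norm_pos_iff.2 hp
  set c := s * ‖p‖⁻¹ with hc
  have hc0 : 0 < c := by positivity
  set y := c • p with hy
  have h1 := (((hasDerivAt_inv h0.ne').comp_hasFDerivAt p
    (hasFDerivAt_norm_of_ne hp)).const_mul s).smul (hasFDerivAt_id p)
  -- The derivative of x ↦ s x/|x| is c times the orthogonal projection off the direction of p. Its
  -- values d are therefore tangent to the sphere, and the radial part of ∇φ drops out.
  obtain ⟨L, hL, hLv⟩ : ∃ L : E n →L[ℝ] E n, HasFDerivAt (fun x : E n => (s * ‖x‖⁻¹) • x) L p ∧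
      ∀ v, L v = c • (v - (‖p‖⁻¹ ^ 2 * inner ℝ p v) • p) := ⟨_, h1, fun v => by
    simp only [Function.comp_apply, add_apply, smul_apply,
      ContinuousLinearMap.smulRight_apply, id_eq, innerSL_apply_apply, ContinuousLinearMap.id_apply,
      smul_eq_mul]
    rw [smul_sub, sub_eq_add_neg, smul_smul, ← neg_smul, hc]
    congr 2
    field_simp⟩
  have h3 : HasFDerivAt (fun x : E n => φ ((s * ‖x‖⁻¹) • x)) ((fderiv ℝ φ y).comp L) p :=
    (hφ.differentiable y).hasFDerivAt.comp p hL
  rw [h3.fderiv]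
  refine ContinuousLinearMap.opNorm_le_bound _ (by positivity) fun v => ?_
  rw [ContinuousLinearMap.comp_apply]
  set d : E n := L v with hd
  have hpp : inner ℝ p p = ‖p‖ ^ 2 := real_inner_self_eq_norm_sq p
  have horth : inner ℝ y d = 0 := by
    rw [hd, hLv, hy, inner_smul_left, inner_smul_right, inner_sub_right, inner_smul_right, hpp]
    field_simp
    simp
  have hdn : ‖d‖ ≤ c * ‖v‖ := by
    rw [hd, hLv, norm_smul, Real.norm_of_nonneg hc0.le]
    refine mul_le_mul_of_nonneg_left (le_of_sq_le_sq ?_ (norm_nonneg _)) hc0.le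
    rw [norm_sub_sq_real, inner_smul_right, norm_smul, mul_pow, Real.norm_eq_abs, sq_abs,
      real_inner_comm p v]
    have : (‖p‖⁻¹ ^ 2 * inner ℝ p v) ^ 2 * ‖p‖ ^ 2 =
        ‖p‖⁻¹ ^ 2 * inner ℝ p v * inner ℝ p v := by field_simp
    rw [this]
    have : 0 ≤ ‖p‖⁻¹ ^ 2 * inner ℝ p v * inner ℝ p v := by
      rw [mul_assoc]
      exact mul_nonneg (by positivity) (mul_self_nonneg _)
    linarith
  have hsum : ∑ i, (d i : ℂ) * unitCoord i y = 0 := by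
    have : ∑ i, d i * (y i / ‖y‖) = 0 := by
      simp_rw [← mul_div_assoc]
      rw [← Finset.sum_div]
      have e : ∑ i, d i * y i = inner ℝ y d := by simp [PiLp.inner_apply]
      rw [e, horth, zero_div]
    simp_rw [unitCoord, ← Complex.ofReal_mul]
    rw [← Complex.ofReal_sum, this, Complex.ofReal_zero]
  have e2 : fderiv ℝ φ y d = ∑ i, (d i : ℂ) * tangPart (fun i => partialDeriv i φ) i y := by
    simp_rw [tangPart, mul_sub, ← mul_assoc]
    rw [Finset.sum_sub_distrib, ← Finset.sum_mul, hsum, zero_mul, sub_zero, fderiv_apply_eq_sum]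
  rw [e2]
  refine (norm_sum_le _ _).trans ?_
  simp_rw [norm_mul, Complex.norm_real]
  refine (Real.sum_mul_le_sqrt_mul_sqrt _ _ _).trans ?_
  rw [mul_right_comm]
  refine mul_le_mul_of_nonneg_right ?_ (Real.sqrt_nonneg _)
  rw [← EuclideanSpace.norm_eq]
  exact hdn

theorem formBounded_const_mul_inv_norm_sq (hn : 3 ≤ n) (c : ℝ) :
    ∃ C : ℝ≥0∞, FormBounded (fun x : E n => c * (‖x‖ ^ 2)⁻¹) C := by
  obtain ⟨h1, h2, h3⟩ := gradBounded_norm_inv hn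
  refine ⟨‖((√|c| : ℝ) : ℂ)‖ₑ ^ 2 * 4, ?_, ?_⟩
  · exact (((measurable_norm.pow_const 2).inv).const_mul c).aestronglyMeasurable
  · have e : (fun x : E n => ((√|c * (‖x‖ ^ 2)⁻¹| : ℝ) : ℂ)) =
        fun x => ((√|c| : ℝ) : ℂ) * ((‖x‖⁻¹ : ℝ) : ℂ) := by
      funext x
      rw [abs_mul, Real.sqrt_mul (abs_nonneg _), ← inv_pow, abs_pow, Real.sqrt_sq (abs_nonneg _),
        abs_of_nonneg (inv_nonneg.2 (norm_nonneg x)), Complex.ofReal_mul]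
    rw [e]
    refine ⟨h1.const_mul _, by finiteness, fun φ hφ => ?_⟩
    have e2 : (fun x => ((√|c| : ℝ) : ℂ) * ((‖x‖⁻¹ : ℝ) : ℂ) * φ x) =
        fun x => ((√|c| : ℝ) : ℂ) * (((‖x‖⁻¹ : ℝ) : ℂ) * φ x) := funext fun x => mul_assoc _ _ _
    rw [e2, mul_assoc]
    refine le_trans (le_of_eq ?_) (mul_le_mul_right (h3 φ hφ) _)
    unfold sqNorm
    rw [← lintegral_const_mul']
    · congr 1 with x
      rw [enorm_mul, mul_pow]
    · finiteness

theorem lintegral_polar_product [Nontrivial (E n)] {w : ℝ → ℝ≥0∞} (hw : Measurable w)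
    {H : E n → ℝ≥0∞} {h : Metric.sphere (0 : E n) 1 → ℝ≥0∞} (hh : Measurable h)
    (hH : ∀ (θ : Metric.sphere (0 : E n) 1) (r : ℝ), 0 < r → H (r • (θ : E n)) = h θ) :
    ∫⁻ x, w ‖x‖ * H x =
      (∫⁻ r : Set.Ioi (0 : ℝ), w r ∂(Measure.volumeIoiPow (Module.finrank ℝ (E n) - 1))) *
        ∫⁻ θ, h θ ∂(volume : Measure (E n)).toSphere := by
  rw [lintegral_polar]
  simp_rw [norm_smul_sphere_Ioi]
  have e : ∀ p : Metric.sphere (0 : E n) 1 × Set.Ioi (0 : ℝ),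
      w p.2.1 * H (p.2.1 • (p.1 : E n)) = h p.1 * w p.2.1 := fun p => by
    rw [hH _ _ p.2.2, mul_comm]
  simp_rw [e]
  have hw' : Measurable fun r : Set.Ioi (0 : ℝ) => w r := hw.comp measurable_subtype_coe
  rw [lintegral_prod_mul hh.aemeasurable hw'.aemeasurable, mul_comm]

theorem measurable_tangPart {G : Fin n → E n → ℂ} (hG : ∀ i, Measurable (G i)) (i : Fin n) :
    Measurable (tangPart G i) := by
  have hu : ∀ i : Fin n, Measurable (unitCoord i : E n → ℂ) := fun i => by
    have h2 : Measurable fun x : E n => x i := (EuclideanSpace.proj (𝕜 := ℝ) i).continuous.measurable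
    exact Complex.measurable_ofReal.comp (h2.div measurable_norm)
  exact (hG i).sub ((hu i).mul (Finset.measurable_fun_sum _ fun i _ => (hu i).mul (hG i)))

/-- The Poincaré inequality on the sphere of radius `s`. -/
theorem exists_sphere_poincare (hn : 3 ≤ n) : ∃ K : ℝ≥0∞, K ≠ ∞ ∧
    ∀ φ : E n → ℂ, IsTestFunction φ → ∀ s : ℝ, 0 < s →
      ∫⁻ θ : Metric.sphere (0 : E n) 1, ‖φ (s • (θ : E n)) -
        ⨍ ω : Metric.sphere (0 : E n) 1, φ (s • (ω : E n)) ∂(volume : Measure (E n)).toSphere‖ₑ ^ 2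
        ∂(volume : Measure (E n)).toSphere ≤
      K * ∫⁻ θ : Metric.sphere (0 : E n) 1, ENNReal.ofReal (s ^ 2 *
        ∑ i, ‖tangPart (fun i => partialDeriv i φ) i (s • (θ : E n))‖ ^ 2)
        ∂(volume : Measure (E n)).toSphere := by
  have := nontrivial_euclidean hn
  set σ := (volume : Measure (E n)).toSphere with hσ
  set ν := Measure.volumeIoiPow (Module.finrank ℝ (E n) - 1) with hν
  set χ : ℝ → ℝ≥0∞ := (Set.Iic (1 : ℝ)).indicator 1 with hχ
  have hχm : Measurable χ := measurable_one.indicator measurableSet_Iic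
  have hset : ∀ k : E n → ℝ≥0∞, ∫⁻ x in Metric.closedBall (0 : E n) 1, k x = ∫⁻ x, χ ‖x‖ * k x := by
    intro k
    rw [← lintegral_indicator measurableSet_closedBall]
    refine lintegral_congr fun x => ?_
    by_cases hx : ‖x‖ ≤ 1
    · rw [hχ, Set.indicator_of_mem (by simpa using hx), Set.indicator_of_mem (by simpa using hx),
        Pi.one_apply, one_mul]
    · rw [hχ, Set.indicator_of_notMem (by simpa using hx), Set.indicator_of_notMem (by simpa using hx),
        zero_mul]
  have hσ0 : σ Set.univ ≠ 0 := toSphere_univ_ne_zero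
  have hσt : σ Set.univ ≠ ∞ := measure_ne_top _ _
  set A := ∫⁻ r : Set.Ioi (0 : ℝ), χ r ∂ν with hA
  have hAσ : A * σ Set.univ = volume (Metric.closedBall (0 : E n) 1) := by
    have h1 := lintegral_polar_product (n := n) hχm (H := fun _ => 1) (h := fun _ => 1)
      measurable_const (fun _ _ _ => rfl)
    rw [← hset (fun _ => 1), setLIntegral_one, lintegral_one] at h1
    exact h1.symm
  have hA0 : A ≠ 0 := fun h0 => by
    rw [h0, zero_mul] at hAσ
    exact (Metric.measure_closedBall_pos volume (0 : E n) one_pos).ne hAσ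
  have hAt : A ≠ ∞ := fun h0 => by
    rw [h0, ENNReal.top_mul hσ0] at hAσ
    exact (measure_closedBall_lt_top (μ := (volume : Measure (E n)))).ne hAσ.symm
  set A' := ∫⁻ r : Set.Ioi (0 : ℝ), χ r * ENNReal.ofReal (r.1⁻¹ ^ 2) ∂ν with hA'
  have hwm : Measurable fun r : ℝ => χ r * ENNReal.ofReal (r⁻¹ ^ 2) :=
    hχm.mul (measurable_inv.pow_const 2).ennreal_ofReal
  -- The degree zero extension has gradient of size |x|⁻¹ near the origin. The constant is finite
  -- because |x|⁻² is locally integrable for n ≥ 3.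
  have hA't : A' ≠ ∞ := fun h0 => by
    obtain ⟨C, hC⟩ := formBounded_const_mul_inv_norm_sq hn 1
    have h1 := (hC.locallyIntegrable.integrableOn_isCompact (isCompact_closedBall (0 : E n) 1)).2
    have h2 := lintegral_polar_product (n := n) hwm (H := fun _ => 1) (h := fun _ => 1)
      measurable_const (fun _ _ _ => rfl)
    rw [← hA', h0, lintegral_one, ENNReal.top_mul hσ0] at h2
    simp_rw [mul_one] at h2
    rw [← hset (fun x => ENNReal.ofReal (‖x‖⁻¹ ^ 2))] at h2
    refine h1.ne (Eq.trans (lintegral_congr fun x => ?_) h2)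
    simp only []
    rw [one_mul, ← inv_pow, ← ofReal_norm, Complex.norm_real, Real.norm_of_nonneg (by positivity)]
  set K := (σ Set.univ * A * A)⁻¹ * (4 * volume (Metric.closedBall (0 : E n) 2) * A') with hK
  have hden0 : σ Set.univ * A * A ≠ 0 := mul_ne_zero (mul_ne_zero hσ0 hA0) hA0
  have hdent : σ Set.univ * A * A ≠ ∞ := by finiteness
  refine ⟨K, ?_, fun φ hφ s hs => ?_⟩
  · have : volume (Metric.closedBall (0 : E n) 2) ≠ ∞ := measure_closedBall_lt_top.ne
    have := ENNReal.inv_ne_top.2 hden0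
    finiteness
  -- The values on the sphere of radius s are extended constantly along rays. The Poincaré
  -- inequality on the ball then separates in polar coordinates into radial constants and integrals
  -- over spheres.
  set F : E n → ℂ := fun x => φ ((s * ‖x‖⁻¹) • x) with hF
  have hFs : ∀ (θ : Metric.sphere (0 : E n) 1) (r : ℝ), 0 < r → F (r • (θ : E n)) = φ (s • (θ : E n)) := by
    intro θ r hr
    rw [hF]
    simp only [norm_smul, norm_eq_of_mem_sphere, mul_one, Real.norm_of_nonneg hr.le, smul_smul]
    rw [mul_assoc, inv_mul_cancel₀ hr.ne', mul_one]
  have hFm : Measurable F := hφ.continuous.measurable.comp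
    ((measurable_norm.inv.const_mul s).smul measurable_id)
  have hFc : ContDiffOn ℝ 1 F {0}ᶜ := by
    refine (hφ.1.of_le (by exact_mod_cast le_top)).comp_contDiffOn ?_
    refine (contDiffOn_const.mul ((contDiffOn_id.norm ℝ fun x hx => hx).inv fun x hx => ?_)).smul
      contDiffOn_id
    exact norm_ne_zero_iff.2 hx
  have main := lintegral_ball_sub_sq_le hn hFc hFm
  set τ : E n → ℝ≥0∞ := fun y => ENNReal.ofReal (s ^ 2 *
    ∑ i, ‖tangPart (fun i => partialDeriv i φ) i y‖ ^ 2) with hτ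
  have hτm : Measurable τ := by
    refine Measurable.ennreal_ofReal (Measurable.const_mul (Finset.measurable_fun_sum _ fun i _ => ?_) _)
    exact (measurable_tangPart (fun i => (hφ.partialDeriv i).continuous.measurable) i).norm.pow_const 2
  have hφθ : Measurable fun θ : Metric.sphere (0 : E n) 1 => φ (s • (θ : E n)) :=
    hφ.continuous.measurable.comp (by fun_prop)
  have hprod : Measurable fun q : Metric.sphere (0 : E n) 1 × Metric.sphere (0 : E n) 1 =>
      ‖φ (s • (q.2 : E n)) - φ (s • (q.1 : E n))‖ₑ ^ 2 :=
    ((hφθ.comp measurable_snd).sub (hφθ.comp measurable_fst)).enorm.pow_const 2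
  set I : Metric.sphere (0 : E n) 1 → ℝ≥0∞ := fun θ =>
    ∫⁻ ω : Metric.sphere (0 : E n) 1, ‖φ (s • (ω : E n)) - φ (s • (θ : E n))‖ₑ ^ 2 ∂σ with hI
  have hIm : Measurable I := hprod.lintegral_prod_right'
  have left : ∫⁻ x in Metric.closedBall (0 : E n) 1, ∫⁻ y in Metric.closedBall (0 : E n) 1,
      ‖F y - F x‖ₑ ^ 2 = A * (A * ∫⁻ θ, I θ ∂σ) := by
    simp_rw [hset]
    rw [lintegral_polar_product hχm (h := fun θ => A * I θ) (hIm.const_mul A), lintegral_const_mul _ hIm]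
    intro θ r hr
    rw [hFs θ r hr]
    refine lintegral_polar_product hχm ((hφθ.sub_const _).enorm.pow_const 2) fun ω ρ hρ => ?_
    rw [hFs ω ρ hρ]
  have right : ∫⁻ x in Metric.closedBall (0 : E n) 1, ‖fderiv ℝ F x‖ₑ ^ 2 ≤
      A' * ∫⁻ θ : Metric.sphere (0 : E n) 1, τ (s • (θ : E n)) ∂σ := by
    have hτs : Measurable fun θ : Metric.sphere (0 : E n) 1 => τ (s • (θ : E n)) :=
      hτm.comp (by fun_prop)
    rw [← lintegral_polar_product hwm (H := fun x => τ ((s * ‖x‖⁻¹) • x)) hτs]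
    · rw [hset]
      refine lintegral_mono_ae ?_
      filter_upwards [ae_ne_zero hn] with x hx
      rw [mul_assoc]
      gcongr
      have h1 := norm_fderiv_homogeneous_le hφ hs hx
      rw [hτ, ← ENNReal.ofReal_mul (by positivity), ← ofReal_norm, ← ENNReal.ofReal_pow (norm_nonneg _)]
      refine ENNReal.ofReal_le_ofReal ((pow_le_pow_left₀ (norm_nonneg _) h1 2).trans (le_of_eq ?_))
      rw [mul_pow, mul_pow, Real.sq_sqrt (Finset.sum_nonneg fun i _ => by positivity)]
      ring
    · intro θ r hr
      simp only [norm_smul, norm_eq_of_mem_sphere, mul_one, Real.norm_of_nonneg hr.le, smul_smul]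
      rw [mul_assoc, inv_mul_cancel₀ hr.ne', mul_one]
  -- The deviation from the mean is the mean of the pairwise differences, so it is dominated by the
  -- double integral already estimated.
  have jensen : ∀ θ : Metric.sphere (0 : E n) 1, ‖φ (s • (θ : E n)) -
      ⨍ ω : Metric.sphere (0 : E n) 1, φ (s • (ω : E n)) ∂σ‖ₑ ^ 2 ≤ (σ Set.univ)⁻¹ * I θ := by
    intro θ
    have hint : Integrable (fun ω : Metric.sphere (0 : E n) 1 => φ (s • (ω : E n))) σ := by
      rw [← integrableOn_univ]
      exact (hφ.continuous.comp (by fun_prop)).continuousOn.integrableOn_compact isCompact_univ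
    have hne : NeZero σ := ⟨Measure.toSphere_ne_zero volume⟩
    have e : φ (s • (θ : E n)) - ⨍ ω : Metric.sphere (0 : E n) 1, φ (s • (ω : E n)) ∂σ =
        -⨍ ω : Metric.sphere (0 : E n) 1, (φ (s • (ω : E n)) - φ (s • (θ : E n))) ∂σ := by
      have h1 := average_const σ (φ (s • (θ : E n)))
      rw [average_eq] at h1
      rw [average_eq, average_eq, integral_sub hint (integrable_const _), smul_sub, h1]
      ring
    rw [e, enorm_neg]
    exact enorm_average_sq_le σ (hφθ.sub_const _).aestronglyMeasurable
  rw [left] at main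
  have main2 := main.trans (mul_le_mul_right right _)
  calc _ ≤ ∫⁻ θ, (σ Set.univ)⁻¹ * I θ ∂σ := lintegral_mono jensen
    _ = (σ Set.univ)⁻¹ * ∫⁻ θ, I θ ∂σ := lintegral_const_mul _ hIm
    _ = (σ Set.univ * A * A)⁻¹ * (A * (A * ∫⁻ θ, I θ ∂σ)) := by
      rw [ENNReal.mul_inv (Or.inl (by finiteness)) (Or.inr hA0),
        ENNReal.mul_inv (Or.inl hσ0) (Or.inr hA0)]
      have hcan := ENNReal.inv_mul_cancel hA0 hAt
      calc _ = (σ Set.univ)⁻¹ * (A⁻¹ * A) * (A⁻¹ * A) * ∫⁻ θ, I θ ∂σ := by rw [hcan]; simp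
        _ = _ := by ring
    _ ≤ (σ Set.univ * A * A)⁻¹ * (4 * volume (Metric.closedBall (0 : E n) 2) *
        (A' * ∫⁻ θ : Metric.sphere (0 : E n) 1, τ (s • (θ : E n)) ∂σ)) := mul_le_mul_right main2 _
    _ = _ := by rw [hK]; ring

/-- The Poincaré inequality on spheres, integrated over all radii. -/
theorem exists_angular_poincare (hn : 3 ≤ n) : ∃ K : ℝ≥0∞, K ≠ ∞ ∧
    ∀ φ : E n → ℂ, IsTestFunction φ →
      sqNorm (fun x => ((‖x‖⁻¹ : ℝ) : ℂ) * (φ x - radialAverage φ x)) ≤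
        K * ∑ i, sqNorm (tangPart (fun i => partialDeriv i φ) i) := by
  have := nontrivial_euclidean hn
  obtain ⟨K, hKt, hK⟩ := exists_sphere_poincare hn
  refine ⟨K, hKt, fun φ hφ => ?_⟩
  set σ := (volume : Measure (E n)).toSphere with hσ
  set T : E n → ℝ := fun y => ∑ i, ‖tangPart (fun i => partialDeriv i φ) i y‖ ^ 2 with hT
  have hTi : ∀ i, Measurable (tangPart (fun i => partialDeriv i φ) i) :=
    measurable_tangPart fun i => (hφ.partialDeriv i).continuous.measurable
  have hTm : Measurable fun y => ENNReal.ofReal (T y) :=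
    Measurable.ennreal_ofReal (Finset.measurable_fun_sum _ fun i _ => (hTi i).norm.pow_const 2)
  have e1 : ∑ i, sqNorm (tangPart (fun i => partialDeriv i φ) i) = ∫⁻ x, ENNReal.ofReal (T x) := by
    unfold sqNorm
    rw [← lintegral_finsetSum _ fun i _ => (hTi i).enorm.pow_const 2]
    congr 1 with x
    rw [hT, ENNReal.ofReal_sum_of_nonneg fun i _ => by positivity]
    refine Finset.sum_congr rfl fun i _ => ?_
    rw [ENNReal.ofReal_pow (norm_nonneg _), ofReal_norm]
  rw [e1]
  unfold sqNorm
  rw [lintegral_polar, lintegral_polar (fun x => ENNReal.ofReal (T x))]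
  have hs : Measurable fun p : Metric.sphere (0 : E n) 1 × Set.Ioi (0 : ℝ) =>
      p.2.1 • (p.1 : E n) := by fun_prop
  have hPm : Measurable (radialAverage φ) :=
    (stronglyMeasurable_radialAverage hφ.continuous.stronglyMeasurable).measurable
  have hLm : Measurable fun x : E n =>
      ‖((‖x‖⁻¹ : ℝ) : ℂ) * (φ x - radialAverage φ x)‖ₑ ^ 2 :=
    ((Complex.measurable_ofReal.comp measurable_norm.inv).mul
      (hφ.continuous.measurable.sub hPm)).enorm.pow_const 2
  have hLs : Measurable fun p : Metric.sphere (0 : E n) 1 × Set.Ioi (0 : ℝ) =>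
      ‖((‖p.2.1 • (p.1 : E n)‖⁻¹ : ℝ) : ℂ) * (φ (p.2.1 • (p.1 : E n)) -
        radialAverage φ (p.2.1 • (p.1 : E n)))‖ₑ ^ 2 := hLm.comp hs
  have hTs : Measurable fun p : Metric.sphere (0 : E n) 1 × Set.Ioi (0 : ℝ) =>
      ENNReal.ofReal (T (p.2.1 • (p.1 : E n))) := hTm.comp hs
  rw [lintegral_prod_symm _ hLs.aemeasurable, lintegral_prod_symm _ hTs.aemeasurable]
  have hTr : Measurable fun r : Set.Ioi (0 : ℝ) =>
      ∫⁻ θ : Metric.sphere (0 : E n) 1, ENNReal.ofReal (T (r.1 • (θ : E n))) ∂σ :=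
    hTs.lintegral_prod_left'
  rw [← lintegral_const_mul _ hTr]
  refine lintegral_mono fun r => ?_
  have hr : 0 < r.1 := r.2
  have e2 : ∀ θ : Metric.sphere (0 : E n) 1,
      ‖((‖r.1 • (θ : E n)‖⁻¹ : ℝ) : ℂ) * (φ (r.1 • (θ : E n)) - radialAverage φ (r.1 • (θ : E n)))‖ₑ ^ 2
      = ENNReal.ofReal (r.1⁻¹ ^ 2) * ‖φ (r.1 • (θ : E n)) -
        ⨍ ω : Metric.sphere (0 : E n) 1, φ (r.1 • (ω : E n)) ∂σ‖ₑ ^ 2 := fun θ => by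
    rw [radialAverage, norm_smul_sphere_Ioi, enorm_mul, mul_pow]
    congr 1
    rw [← ofReal_norm, ← ENNReal.ofReal_pow (norm_nonneg _), Complex.norm_real, norm_inv, inv_pow,
      inv_pow, Real.norm_of_nonneg hr.le]
  have e3 : ∀ θ : Metric.sphere (0 : E n) 1, ENNReal.ofReal (T (r.1 • (θ : E n))) =
      ENNReal.ofReal (r.1⁻¹ ^ 2) * ENNReal.ofReal (r.1 ^ 2 * T (r.1 • (θ : E n))) := fun θ => by
    rw [← ENNReal.ofReal_mul (by positivity)]
    congr 1
    field_simp
  simp only [e2, e3]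
  rw [lintegral_const_mul' _ _ ENNReal.ofReal_ne_top, lintegral_const_mul' _ _ ENNReal.ofReal_ne_top]
  refine (mul_le_mul_right (hK φ hφ r.1 hr) _).trans (le_of_eq ?_)
  ring

end

section
variable {n : ℕ} {f g u w : E n → ℂ} {G K : Fin n → E n → ℂ}

/-! ### The critical inverse-square potential -/

theorem exists_formBounded_criticalPotential (hn : 3 ≤ n) :
    ∃ C : ℝ≥0∞, FormBounded (criticalPotential n) C :=
  formBounded_const_mul_inv_norm_sq hn _

theorem integrable_inv_norm_sq_mul (hn : 3 ≤ n) {ψ : E n → ℂ} (hc : Continuous ψ)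
    (hs : HasCompactSupport ψ) : Integrable fun x : E n => (((‖x‖ ^ 2)⁻¹ : ℝ) : ℂ) * ψ x := by
  obtain ⟨C, hC⟩ := formBounded_const_mul_inv_norm_sq hn 1
  have h := hC.locallyIntegrable.integrable_smul_left_of_hasCompactSupport hc hs
  simp only [one_mul, smul_eq_mul] at h
  simpa only [mul_comm] using h

/-- The limit η → 0 of the regularized identity, by dominated convergence, since |x|⁻² is locally
integrable for n ≥ 3. -/
theorem integral_inv_norm_sq_euler (hn : 3 ≤ n) {ψ : E n → ℂ} (hψ : IsTestFunction ψ) :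
    ∫ x, (((‖x‖ ^ 2)⁻¹ : ℝ) : ℂ) * ((n : ℂ) * ψ x + fderiv ℝ ψ x x) =
      2 * ∫ x, (((‖x‖ ^ 2)⁻¹ : ℝ) : ℂ) * ψ x := by
  set η : ℕ → ℝ := fun k => 1 / ((k : ℝ) + 1) with hη
  have hη0 : ∀ k, 0 < η k := fun k => by positivity
  have hηlim : Tendsto η atTop (𝓝 0) := tendsto_one_div_add_atTop_nhds_zero_nat
  have hreg : ∀ x : E n, Tendsto (fun k => reg (η k) x ^ 2) atTop (𝓝 (‖x‖ ^ 2)) := fun x => by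
    simp_rw [reg_sq]
    simpa using (hηlim.pow 2).const_add (‖x‖ ^ 2)
  have hle : ∀ (k : ℕ) (x : E n), x ≠ 0 → (reg (η k) x ^ 2)⁻¹ ≤ (‖x‖ ^ 2)⁻¹ := fun k x hx => by
    have := norm_pos_iff.2 hx
    exact inv_anti₀ (by positivity) (pow_le_pow_left₀ (norm_nonneg _) (norm_le_reg _ x) 2)
  have hrm : ∀ k, Measurable fun x : E n => (reg (η k) x ^ 2)⁻¹ := fun k =>
    ((continuous_reg (η k)).measurable.pow_const 2).inv
  have hd : Continuous fun x : E n => fderiv ℝ ψ x x :=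
    (hψ.1.continuous_fderiv (by simp)).clm_apply continuous_id
  have hdc : HasCompactSupport fun x : E n => fderiv ℝ ψ x x :=
    HasCompactSupport.intro hψ.2 fun x hx => by
      rw [fderiv_of_notMem_tsupport ℝ hx, zero_apply]
  have hec : Continuous fun x : E n => (n : ℂ) * ψ x + fderiv ℝ ψ x x :=
    (hψ.continuous.const_mul _).add hd
  have hes : HasCompactSupport fun x : E n => (n : ℂ) * ψ x + fderiv ℝ ψ x x :=
    hψ.2.mul_left.add hdc
  have i1 := integrable_inv_norm_sq_mul hn hec hes
  have i2 := integrable_inv_norm_sq_mul hn hψ.continuous hψ.2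
  have l1 : Tendsto (fun k => ∫ x, (((reg (η k) x ^ 2)⁻¹ : ℝ) : ℂ) *
      ((n : ℂ) * ψ x + fderiv ℝ ψ x x)) atTop
      (𝓝 (∫ x, (((‖x‖ ^ 2)⁻¹ : ℝ) : ℂ) * ((n : ℂ) * ψ x + fderiv ℝ ψ x x))) := by
    refine tendsto_integral_of_dominated_convergence _
      (fun k => ((Complex.measurable_ofReal.comp (hrm k)).mul hec.measurable).aestronglyMeasurable)
      i1.norm (fun k => ?_) ?_
    · filter_upwards [ae_ne_zero hn] with x hx
      rw [norm_mul, norm_mul, Complex.norm_real, Complex.norm_real,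
        Real.norm_of_nonneg (by positivity), Real.norm_of_nonneg (by positivity)]
      exact mul_le_mul_of_nonneg_right (hle k x hx) (norm_nonneg _)
    · filter_upwards [ae_ne_zero hn] with x hx
      have h0 := norm_ne_zero_iff.2 hx
      exact ((Complex.continuous_ofReal.tendsto _).comp ((hreg x).inv₀ (by positivity))).mul_const _
  have l2 : Tendsto (fun k => ∫ x, ((2 * ‖x‖ ^ 2 * ((reg (η k) x ^ 2)⁻¹) ^ 2 : ℝ) : ℂ) * ψ x) atTop
      (𝓝 (∫ x, 2 * ((((‖x‖ ^ 2)⁻¹ : ℝ) : ℂ) * ψ x))) := by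
    refine tendsto_integral_of_dominated_convergence _
      (fun k => ((Complex.measurable_ofReal.comp (((measurable_norm.pow_const 2).const_mul 2).mul
        ((hrm k).pow_const 2))).mul hψ.continuous.measurable).aestronglyMeasurable)
      (i2.const_mul 2).norm (fun k => ?_) ?_
    · filter_upwards [ae_ne_zero hn] with x hx
      have h0 := norm_pos_iff.2 hx
      rw [← mul_assoc, norm_mul, norm_mul, norm_mul, Complex.norm_real, Complex.norm_real,
        Real.norm_of_nonneg (by positivity), Real.norm_of_nonneg (by positivity), Complex.norm_ofNat]
      refine mul_le_mul_of_nonneg_right ?_ (norm_nonneg _)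
      have h1 := hle k x hx
      have h2 : 0 ≤ (reg (η k) x ^ 2)⁻¹ := by positivity
      have h3 : ((reg (η k) x ^ 2)⁻¹) ^ 2 ≤ ((‖x‖ ^ 2)⁻¹) ^ 2 := pow_le_pow_left₀ h2 h1 2
      calc 2 * ‖x‖ ^ 2 * ((reg (η k) x ^ 2)⁻¹) ^ 2 ≤ 2 * ‖x‖ ^ 2 * ((‖x‖ ^ 2)⁻¹) ^ 2 := by gcongr
        _ = 2 * (‖x‖ ^ 2)⁻¹ := by field_simp
    · filter_upwards [ae_ne_zero hn] with x hx
      have h0 := norm_ne_zero_iff.2 hx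
      rw [← mul_assoc]
      refine Tendsto.mul_const _ ?_
      have h1 := (((hreg x).inv₀ (by positivity)).pow 2).const_mul (2 * ‖x‖ ^ 2)
      have e : 2 * ‖x‖ ^ 2 * ((‖x‖ ^ 2)⁻¹) ^ 2 = 2 * (‖x‖ ^ 2)⁻¹ := by field_simp
      rw [e] at h1
      have h2 := (Complex.continuous_ofReal.tendsto _).comp h1
      rw [Complex.ofReal_mul, Complex.ofReal_ofNat] at h2
      exact h2
  rw [integral_const_mul] at l2
  refine tendsto_nhds_unique l1 (l2.congr fun k => ?_)
  rw [integral_reg_inv_sq_euler (hη0 k) hψ]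

/-- Homogeneity of degree -2, with no contribution from the origin. Consequently -V - x·∇V = V, and
the two coercivity hypotheses of the estimate become one. -/
theorem isWeakEulerDerivative_criticalPotential (hn : 3 ≤ n) :
    IsWeakEulerDerivative (criticalPotential n) (fun x => -2 * criticalPotential n x) := by
  intro φ hφ
  have h := integral_inv_norm_sq_euler hn hφ
  set c : ℝ := -(((n : ℝ) - 2) ^ 2 / 4) with hc
  have e1 : ∀ x : E n, (criticalPotential n x : ℂ) * ((n : ℂ) * φ x + fderiv ℝ φ x x) =
      (c : ℂ) * ((((‖x‖ ^ 2)⁻¹ : ℝ) : ℂ) * ((n : ℂ) * φ x + fderiv ℝ φ x x)) := fun x => by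
    rw [criticalPotential, ← hc, Complex.ofReal_mul, mul_assoc]
  have e2 : ∀ x : E n, ((-2 * criticalPotential n x : ℝ) : ℂ) * φ x =
      (-2 * (c : ℂ)) * ((((‖x‖ ^ 2)⁻¹ : ℝ) : ℂ) * φ x) := fun x => by
    rw [criticalPotential, ← hc]
    push_cast
    ring
  simp_rw [e1, e2]
  rw [integral_const_mul, integral_const_mul, h]
  ring

/-- The components of `∇u + ((n-2)/2) |x|⁻² x u`, whose norm squared gives the critical form. -/
def hardyGrad (u : E n → ℂ) (G : Fin n → E n → ℂ) (i : Fin n) (x : E n) : ℂ :=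
  G i x + ((((n : ℝ) - 2) / 2 : ℝ) : ℂ) * (unitCoord i x * (((‖x‖⁻¹ : ℝ) : ℂ) * u x))

theorem memLp_hardyGrad (hn : 3 ≤ n) (hu : IsH1 u G) (i : Fin n) : MemLp (hardyGrad u G i) 2 :=
  (hu.memLp_grad i).add ((memLp_mul_bdd (aestronglyMeasurable_unitCoord i) (norm_unitCoord_le i)
    (hu.hardy hn).1).const_mul _)

theorem l2Tendsto_hardyGrad (hn : 3 ≤ n) {ι : Type*} {l : Filter ι} {U : ι → E n → ℂ}
    {D : ι → Fin n → E n → ℂ} (hU : ∀ k, IsH1 (U k) (D k)) (hu : IsH1 u G)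
    (hD : ∀ i, L2Tendsto l (fun k => D k i) (G i)) (i : Fin n) :
    L2Tendsto l (fun k => hardyGrad (U k) (D k) i) (hardyGrad u G i) :=
  (hD i).add ((((gradBounded_norm_inv hn).tendsto hU hu hD).unitCoord_mul i).const_mul _)

theorem sum_unitCoord_mul_eq_fderiv (φ : E n → ℂ) (x : E n) :
    ∑ i, unitCoord i x * (((‖x‖⁻¹ : ℝ) : ℂ) * partialDeriv i φ x) =
      (((‖x‖ ^ 2)⁻¹ : ℝ) : ℂ) * fderiv ℝ φ x x := by
  rw [fderiv_apply_eq_sum, Finset.mul_sum]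
  refine Finset.sum_congr rfl fun i _ => ?_
  rw [unitCoord]
  push_cast
  field_simp

theorem sum_hardyGrad_mul_conj (φ ψ : E n → ℂ) (G K : Fin n → E n → ℂ) {x : E n} (hx : x ≠ 0) :
    ∑ i, hardyGrad φ G i x * conj (hardyGrad ψ K i x) = ∑ i, G i x * conj (K i x) +
      ((((n : ℝ) - 2) / 2 : ℝ) : ℂ) * (((‖x‖⁻¹ : ℝ) : ℂ) * (radialPart G x * conj (ψ x) +
        φ x * conj (radialPart K x))) +
      ((((n : ℝ) - 2) / 2 : ℝ) : ℂ) ^ 2 * ((((‖x‖ ^ 2)⁻¹ : ℝ) : ℂ) * (φ x * conj (ψ x))) := by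
  set a : ℂ := ((((n : ℝ) - 2) / 2 : ℝ) : ℂ) with ha
  set ρ : ℂ := ((‖x‖⁻¹ : ℝ) : ℂ) with hρ
  have hca : conj a = a := Complex.conj_ofReal _
  have hcρ : conj ρ = ρ := Complex.conj_ofReal _
  have hρ2 : (((‖x‖ ^ 2)⁻¹ : ℝ) : ℂ) = ρ * ρ := by
    rw [hρ, ← Complex.ofReal_mul]
    congr 1
    rw [sq, mul_inv]
  have h : ∀ i, hardyGrad φ G i x * conj (hardyGrad ψ K i x) = G i x * conj (K i x) +
      a * ρ * (unitCoord i x * G i x * conj (ψ x) + φ x * (unitCoord i x * conj (K i x))) +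
      unitCoord i x * unitCoord i x * (a ^ 2 * (ρ * ρ) * (φ x * conj (ψ x))) := fun i => by
    rw [hardyGrad, hardyGrad]
    simp only [map_add, map_mul, conj_unitCoord, ← ha, ← hρ, hca, hcρ]
    ring
  have hK : ∑ i, unitCoord i x * conj (K i x) = conj (radialPart K x) := by
    rw [radialPart, map_sum]
    exact Finset.sum_congr rfl fun i _ => by rw [map_mul, conj_unitCoord]
  simp_rw [h]
  rw [Finset.sum_add_distrib, Finset.sum_add_distrib, ← Finset.sum_mul, sum_unitCoord_mul_self hx,
    ← Finset.mul_sum, Finset.sum_add_distrib, ← Finset.sum_mul, ← Finset.mul_sum, hK, hρ2]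
  have : ∑ i, unitCoord i x * G i x = radialPart G x := rfl
  rw [this]
  ring

/-- The critical form is a sum of squares. -/
theorem form_eq_hardyGrad_test (hn : 3 ≤ n) {φ ψ : E n → ℂ} (hφ : IsTestFunction φ)
    (hψ : IsTestFunction ψ) :
    ∑ i, pairing (partialDeriv i φ) (partialDeriv i ψ) +
      ∫ x, (criticalPotential n x : ℂ) * φ x * conj (ψ x) =
    ∑ i, pairing (hardyGrad φ (fun i => partialDeriv i φ) i)
      (hardyGrad ψ (fun i => partialDeriv i ψ) i) := by
  obtain ⟨C, hC⟩ := exists_formBounded_criticalPotential hn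
  set a : ℂ := ((((n : ℝ) - 2) / 2 : ℝ) : ℂ) with ha
  have hχ : IsTestFunction fun x => φ x * conj (ψ x) := hψ.conj.smooth_mul hφ.1
  have hec : Continuous fun x : E n =>
      (n : ℂ) * (φ x * conj (ψ x)) + fderiv ℝ (fun x => φ x * conj (ψ x)) x x :=
    (hχ.continuous.const_mul _).add ((hχ.1.continuous_fderiv (by simp)).clm_apply continuous_id)
  have hes : HasCompactSupport fun x : E n =>
      (n : ℂ) * (φ x * conj (ψ x)) + fderiv ℝ (fun x => φ x * conj (ψ x)) x x :=
    hχ.2.mul_left.add (HasCompactSupport.intro hχ.2 fun x hx => by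
      rw [fderiv_of_notMem_tsupport ℝ hx, zero_apply])
  have i1 := integrable_inv_norm_sq_mul hn hec hes
  have i2 := integrable_inv_norm_sq_mul hn hχ.continuous hχ.2
  have e := integral_inv_norm_sq_euler hn hχ
  have iG := integrable_gradient_mul hφ hψ
  have iV := hC.integrable hφ.isH1 hψ.isH1
  have iD : ∀ i, Integrable fun x => hardyGrad φ (fun i => partialDeriv i φ) i x *
      conj (hardyGrad ψ (fun i => partialDeriv i ψ) i x) := fun i =>
    integrable_mul_conj (memLp_hardyGrad hn hφ.isH1 i) (memLp_hardyGrad hn hψ.isH1 i)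
  have hsum : ∑ i, pairing (hardyGrad φ (fun i => partialDeriv i φ) i)
      (hardyGrad ψ (fun i => partialDeriv i ψ) i) =
      ∫ x, ∑ i, hardyGrad φ (fun i => partialDeriv i φ) i x *
      conj (hardyGrad ψ (fun i => partialDeriv i ψ) i x) := (integral_finsetSum _ fun i _ => iD i).symm
  have hsum' : ∑ i, pairing (partialDeriv i φ) (partialDeriv i ψ) =
      ∫ x, ∑ i, partialDeriv i φ x * conj (partialDeriv i ψ x) :=
    (integral_finsetSum _ fun i _ =>
      integrable_mul_conj (hφ.partialDeriv i).memLp (hψ.partialDeriv i).memLp).symm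
  have i12 : Integrable fun x => a * ((((‖x‖ ^ 2)⁻¹ : ℝ) : ℂ) * ((n : ℂ) * (φ x * conj (ψ x)) +
      fderiv ℝ (fun x => φ x * conj (ψ x)) x x) - 2 * ((((‖x‖ ^ 2)⁻¹ : ℝ) : ℂ) * (φ x * conj (ψ x)))) :=
    (i1.sub (i2.const_mul 2)).const_mul a
  have iGV : Integrable fun x => ∑ i, partialDeriv i φ x * conj (partialDeriv i ψ x) +
      (criticalPotential n x : ℂ) * φ x * conj (ψ x) := iG.add iV
  -- The Euler identity for φ conj ψ, written as an integral equal to zero. Once it is added to the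
  -- left side, the two integrands agree pointwise away from the origin.
  have z12 : ∫ x, a * ((((‖x‖ ^ 2)⁻¹ : ℝ) : ℂ) * ((n : ℂ) * (φ x * conj (ψ x)) +
      fderiv ℝ (fun x => φ x * conj (ψ x)) x x) -
      2 * ((((‖x‖ ^ 2)⁻¹ : ℝ) : ℂ) * (φ x * conj (ψ x)))) = 0 := by
    rw [integral_const_mul, integral_sub i1 (i2.const_mul 2), integral_const_mul, e, sub_self, mul_zero]
  rw [hsum, hsum', ← integral_add iG iV, ← add_zero (∫ x, _ + _), ← z12, ← integral_add iGV i12]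
  refine integral_congr_ae ?_
  filter_upwards [ae_ne_zero hn] with x hx
  rw [sum_hardyGrad_mul_conj _ _ _ _ hx]
  set ρ : ℂ := ((‖x‖⁻¹ : ℝ) : ℂ) with hρ
  have hρ2 : (((‖x‖ ^ 2)⁻¹ : ℝ) : ℂ) = ρ * ρ := by
    rw [hρ, ← Complex.ofReal_mul]
    congr 1
    rw [sq, mul_inv]
  have hfd : ρ * (radialPart (fun i => partialDeriv i φ) x * conj (ψ x) +
      φ x * conj (radialPart (fun i => partialDeriv i ψ) x)) =
      ρ * ρ * fderiv ℝ (fun x => φ x * conj (ψ x)) x x := by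
    rw [← hρ2, ← sum_unitCoord_mul_eq_fderiv, radialPart, radialPart, map_sum, Finset.sum_mul,
      Finset.mul_sum, ← Finset.sum_add_distrib, Finset.mul_sum]
    refine Finset.sum_congr rfl fun i _ => ?_
    rw [partialDeriv_mul i (hφ.differentiable x) (hψ.conj.differentiable x),
      partialDeriv_conj i (hψ.differentiable x), map_mul, conj_unitCoord]
    ring
  rw [hfd]
  have hV : (criticalPotential n x : ℂ) = -(a ^ 2) * (ρ * ρ) := by
    rw [← hρ2, ha, criticalPotential]
    push_cast
    ring
  have han : (n : ℂ) = 2 * a + 2 := by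
    rw [ha]
    push_cast
    ring
  rw [hV, hρ2]
  linear_combination (a * (ρ * ρ) * (φ x * conj (ψ x))) * han

theorem form_eq_hardyGrad (hn : 3 ≤ n) (hu : IsH1 u G) (hw : IsH1 w K) :
    ∑ i, pairing (G i) (K i) + ∫ x, (criticalPotential n x : ℂ) * u x * conj (w x) =
      ∑ i, pairing (hardyGrad u G i) (hardyGrad w K i) := by
  obtain ⟨C, hC⟩ := exists_formBounded_criticalPotential hn
  obtain ⟨φ, h1, h2, h3⟩ := id hu
  obtain ⟨ψ, k1, k2, k3⟩ := id hw
  have l1 := (tendsto_finsetSum Finset.univ fun i _ => (h3 i).pairing (k3 i)).add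
    (hC.tendsto (fun k => (h1 k).isH1) hu h3 (fun k => (k1 k).isH1) hw k3)
  have l2 := tendsto_finsetSum Finset.univ fun i _ =>
    (l2Tendsto_hardyGrad hn (fun k => (h1 k).isH1) hu h3 i).pairing
      (l2Tendsto_hardyGrad hn (fun k => (k1 k).isH1) hw k3 i)
  exact tendsto_nhds_unique (l1.congr fun k => form_eq_hardyGrad_test hn (h1 k) (k1 k)) l2

theorem form_self_eq_hardyGrad (hn : 3 ≤ n) (hu : IsH1 u G) :
    ∑ i, (∫ x, ‖G i x‖ ^ 2) + ∫ x, criticalPotential n x * ‖u x‖ ^ 2 =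
      ∑ i, ∫ x, ‖hardyGrad u G i x‖ ^ 2 := by
  have h := form_eq_hardyGrad hn hu hu
  simp_rw [pairing_self, FormBounded.integral_self] at h
  exact_mod_cast h

theorem schrodingerForm_critical (hn : 3 ≤ n) {φ : E n → ℂ} (hφ : IsTestFunction φ) :
    schrodingerForm (criticalPotential n) φ φ =
      ((∑ i, ∫ x, ‖hardyGrad φ (fun i => partialDeriv i φ) i x‖ ^ 2 : ℝ) : ℂ) := by
  obtain ⟨C, hC⟩ := exists_formBounded_criticalPotential hn
  rw [schrodingerForm_self, hC.integral_form hφ, form_self_eq_hardyGrad hn hφ.isH1]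

/-- Because the form is the sum of the squared norms of the components of `hardyGrad`, form-Cauchy
sequences converge in these components. Nothing is asserted about ∇φ_k and |x|⁻¹φ_k separately. -/
theorem exists_hardyGrad_limit (hn : 3 ≤ n) {φ : ℕ → E n → ℂ} (ht : ∀ k, IsTestFunction (φ k))
    (hc : Tendsto (fun p : ℕ × ℕ => schrodingerForm (criticalPotential n) (φ p.1 - φ p.2)
      (φ p.1 - φ p.2)) atTop (𝓝 0)) :
    ∃ g : Fin n → E n → ℂ, ∀ i, L2Tendsto atTop
      (fun k => hardyGrad (φ k) (fun i => partialDeriv i (φ k)) i) (g i) := by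
  have key : ∀ i : Fin n, ∃ g, L2Tendsto atTop
      (fun k => hardyGrad (φ k) (fun i => partialDeriv i (φ k)) i) g := fun i => by
    refine exists_L2Tendsto_of_cauchy (fun k => memLp_hardyGrad hn (ht k).isH1 i) ?_
    have hre := ENNReal.tendsto_ofReal ((Complex.continuous_re.tendsto 0).comp hc)
    rw [Complex.zero_re, ENNReal.ofReal_zero] at hre
    refine tendsto_of_tendsto_of_tendsto_of_le_of_le tendsto_const_nhds hre (fun _ => zero_le) ?_
    intro p
    have hp := (ht p.1).sub (ht p.2)
    have e : (fun x => hardyGrad (φ p.1) (fun i => partialDeriv i (φ p.1)) i x -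
        hardyGrad (φ p.2) (fun i => partialDeriv i (φ p.2)) i x) =
        hardyGrad (fun x => φ p.1 x - φ p.2 x)
          (fun i => partialDeriv i (fun x => φ p.1 x - φ p.2 x)) i := by
      ext x
      rw [hardyGrad, hardyGrad, hardyGrad,
        partialDeriv_sub i ((ht p.1).differentiable x) ((ht p.2).differentiable x)]
      ring
    simp only [e]
    rw [sqNorm_eq_ofReal (memLp_hardyGrad hn hp.isH1 i)]
    refine ENNReal.ofReal_le_ofReal ?_
    have e2 := schrodingerForm_critical hn hp
    change _ ≤ (schrodingerForm (criticalPotential n) (fun x => φ p.1 x - φ p.2 x)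
      (fun x => φ p.1 x - φ p.2 x)).re
    rw [e2, Complex.ofReal_re]
    exact Finset.single_le_sum (f := fun i => ∫ x, ‖hardyGrad (fun x => φ p.1 x - φ p.2 x)
      (fun i => partialDeriv i (fun x => φ p.1 x - φ p.2 x)) i x‖ ^ 2)
      (fun i _ => integral_nonneg fun x => by positivity) (Finset.mem_univ i)
  choose g hg using key
  exact ⟨g, hg⟩

/-- The formal adjoint sends test functions into L², by Hardy's inequality. This is what makes the
first-order operator closable. -/
theorem pairing_hardyGrad_test (hn : 3 ≤ n) {φ ψ : E n → ℂ} (hφ : IsTestFunction φ)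
    (hψ : IsTestFunction ψ) (i : Fin n) :
    pairing (hardyGrad φ (fun i => partialDeriv i φ) i) ψ = pairing φ (fun x =>
      ((((n : ℝ) - 2) / 2 : ℝ) : ℂ) * (unitCoord i x * (((‖x‖⁻¹ : ℝ) : ℂ) * ψ x)) -
        partialDeriv i ψ x) := by
  have h1 := hφ.isH1.integral_mul_partialDeriv hψ i
  have m1 := memLp_hardyGrad hn hφ.isH1 i
  have m2 : MemLp (fun x => ((((n : ℝ) - 2) / 2 : ℝ) : ℂ) * (unitCoord i x *
      (((‖x‖⁻¹ : ℝ) : ℂ) * ψ x))) 2 := (memLp_mul_bdd (aestronglyMeasurable_unitCoord i)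
    (norm_unitCoord_le i) (hψ.isH1.hardy hn).1).const_mul _
  have m3 : MemLp (fun x => ((((n : ℝ) - 2) / 2 : ℝ) : ℂ) * (unitCoord i x *
      (((‖x‖⁻¹ : ℝ) : ℂ) * φ x))) 2 := (memLp_mul_bdd (aestronglyMeasurable_unitCoord i)
    (norm_unitCoord_le i) (hφ.isH1.hardy hn).1).const_mul _
  have e1 : pairing (hardyGrad φ (fun i => partialDeriv i φ) i) ψ = pairing (partialDeriv i φ) ψ +
      pairing (fun x => ((((n : ℝ) - 2) / 2 : ℝ) : ℂ) * (unitCoord i x *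
      (((‖x‖⁻¹ : ℝ) : ℂ) * φ x))) ψ := by
    unfold pairing
    rw [← integral_add (integrable_mul_conj (hφ.partialDeriv i).memLp hψ.memLp)
      (integrable_mul_conj m3 hψ.memLp)]
    congr 1 with x
    rw [hardyGrad]
    ring
  have e2 : pairing φ (fun x => ((((n : ℝ) - 2) / 2 : ℝ) : ℂ) * (unitCoord i x *
      (((‖x‖⁻¹ : ℝ) : ℂ) * ψ x)) - partialDeriv i ψ x) =
      pairing φ (fun x => ((((n : ℝ) - 2) / 2 : ℝ) : ℂ) * (unitCoord i x *
      (((‖x‖⁻¹ : ℝ) : ℂ) * ψ x))) - pairing φ (partialDeriv i ψ) := by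
    unfold pairing
    rw [← integral_sub (integrable_mul_conj hφ.memLp m2)
      (integrable_mul_conj hφ.memLp (hψ.partialDeriv i).memLp)]
    congr 1 with x
    rw [map_sub]
    ring
  rw [e1, e2, h1, sub_neg_eq_add, add_comm]
  congr 1
  unfold pairing
  congr 1 with x
  simp only [map_mul, conj_unitCoord, Complex.conj_ofReal]
  ring

/-- If φ_k → 0 in L² and the `hardyGrad` components converge, pairing the limits with test functions
and passing to the formal adjoint shows that the limits vanish. Coercivity plays no role. -/
theorem isClosableForm_criticalPotential (hn : 3 ≤ n) : IsClosableForm (criticalPotential n) where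
  meas := (exists_formBounded_criticalPotential hn).choose_spec.meas
  integrable φ hφ := (exists_formBounded_criticalPotential hn).choose_spec.integrable_sq hφ.isH1
  nonneg φ hφ := by
    rw [schrodingerForm_critical hn hφ, Complex.ofReal_re]
    exact Finset.sum_nonneg fun i _ => integral_nonneg fun x => by positivity
  closable φ ht h0 hc := by
    obtain ⟨g, hg⟩ := exists_hardyGrad_limit hn ht hc
    have hu : L2Tendsto atTop φ (fun _ => (0 : ℂ)) :=
      ⟨fun k => (ht k).memLp, MemLp.zero', by simpa using h0⟩
    have hg0 : ∀ i, g i =ᵐ[volume] fun _ => (0 : ℂ) := fun i => by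
      refine ae_eq_zero_of_pairing_test (hg i).lim fun ψ hψ => ?_
      have l1 := (hg i).pairing (.const _ hψ.memLp)
      simp_rw [fun k => pairing_hardyGrad_test hn (ht k) hψ i] at l1
      have m2 : MemLp (fun x => ((((n : ℝ) - 2) / 2 : ℝ) : ℂ) * (unitCoord i x *
          (((‖x‖⁻¹ : ℝ) : ℂ) * ψ x)) - partialDeriv i ψ x) 2 :=
        ((memLp_mul_bdd (aestronglyMeasurable_unitCoord i) (norm_unitCoord_le i)
          (hψ.isH1.hardy hn).1).const_mul _).sub (hψ.partialDeriv i).memLp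
      have l2 := hu.pairing (.const _ m2)
      have e := tendsto_nhds_unique l1 l2
      rw [e]
      simp [pairing]
    have hlim : ∀ i, L2Tendsto atTop
        (fun k => hardyGrad (φ k) (fun i => partialDeriv i (φ k)) i) (fun _ => (0 : ℂ)) := fun i =>
      (hg i).congr' (fun _ => ae_eq_rfl) (hg0 i)
    have l := (Complex.continuous_ofReal.tendsto _).comp (tendsto_finsetSum Finset.univ fun i _ =>
      (hlim i).integral_norm_sq)
    simp only [norm_zero, ne_eq, OfNat.ofNat_ne_zero, not_false_eq_true, zero_pow, integral_zero,
      Finset.sum_const_zero, Complex.ofReal_zero] at l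
    refine l.congr fun k => ?_
    rw [Function.comp_apply, schrodingerForm_critical hn (ht k)]

end

section
variable {n : ℕ} {f g u w : E n → ℂ} {G K : Fin n → E n → ℂ}

/-! ### Coercivity of the critical form on functions with vanishing spherical means -/

theorem radialPart_hardyGrad (u : E n → ℂ) (G : Fin n → E n → ℂ) {x : E n} (hx : x ≠ 0) :
    radialPart (hardyGrad u G) x = radialPart G x +
      ((((n : ℝ) - 2) / 2 : ℝ) : ℂ) * ((‖x‖⁻¹ : ℝ) : ℂ) * u x := by
  set a : ℂ := ((((n : ℝ) - 2) / 2 : ℝ) : ℂ)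
  have h : ∀ i, unitCoord i x * hardyGrad u G i x = unitCoord i x * G i x +
      unitCoord i x * unitCoord i x * (a * ((‖x‖⁻¹ : ℝ) : ℂ) * u x) := fun i => by
    rw [hardyGrad]
    ring
  rw [radialPart]
  simp_rw [h]
  rw [Finset.sum_add_distrib, ← Finset.sum_mul, sum_unitCoord_mul_self hx, one_mul]
  rfl

/-- The correction that completes the square is purely radial, so the critical form controls the
whole tangential gradient. This is the source of the improvement over Hardy. -/
theorem tangPart_hardyGrad (u : E n → ℂ) (G : Fin n → E n → ℂ) (i : Fin n) {x : E n} (hx : x ≠ 0) :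
    tangPart (hardyGrad u G) i x = tangPart G i x := by
  rw [tangPart, radialPart_hardyGrad u G hx, hardyGrad, tangPart]
  ring

theorem memLp_tangPart (hG : ∀ i, MemLp (G i) 2) (i : Fin n) : MemLp (tangPart G i) 2 :=
  (hG i).sub (memLp_mul_bdd (aestronglyMeasurable_unitCoord i) (norm_unitCoord_le i)
    (memLp_radialPart hG))

theorem IsH1.sub_radialAverage (hn : 3 ≤ n) (hu : IsH1 u G) :
    IsH1 (fun x => u x - WeightedResolvent.radialAverage u x)
      (fun i x => G i x - unitCoord i x * WeightedResolvent.radialAverage (radialPart G) x) :=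
  hu.sub (hu.radialAverage hn)

/-- The vector field with the spherical mean of its radial component removed. -/
def perpField (h : Fin n → E n → ℂ) (i : Fin n) (x : E n) : ℂ :=
  h i x - unitCoord i x * radialAverage (radialPart h) x

theorem L2Tendsto.perpField (hn : 3 ≤ n) {ι : Type*} {l : Filter ι} {D : ι → Fin n → E n → ℂ}
    (h : ∀ i, L2Tendsto l (fun k => D k i) (G i)) (i : Fin n) :
    L2Tendsto l (fun k => perpField (D k) i) (perpField G i) := by
  have := nontrivial_euclidean hn
  exact (h i).sub ((L2Tendsto.radialPart h).radialAverage.unitCoord_mul i)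

theorem sum_pairing_unitCoord_mul (hf : MemLp f 2) (hG : ∀ i, MemLp (G i) 2) :
    ∑ i, pairing (fun x => unitCoord i x * f x) (G i) = pairing f (radialPart G) := by
  unfold pairing
  rw [← integral_finsetSum _ fun i _ => integrable_mul_conj
    (memLp_mul_bdd (aestronglyMeasurable_unitCoord i) (norm_unitCoord_le i) hf) (hG i)]
  congr 1 with x
  rw [radialPart, map_sum, Finset.mul_sum]
  refine Finset.sum_congr rfl fun i _ => ?_
  rw [map_mul, conj_unitCoord]
  ring

theorem pairing_sub_left {f g k : E n → ℂ} (hf : MemLp f 2) (hg : MemLp g 2) (hk : MemLp k 2) :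
    pairing (fun x => f x - g x) k = pairing f k - pairing g k := by
  unfold pairing
  rw [← integral_sub (integrable_mul_conj hf hk) (integrable_mul_conj hg hk)]
  congr 1 with x
  ring

theorem pairing_sub_right {f g k : E n → ℂ} (hf : MemLp f 2) (hg : MemLp g 2) (hk : MemLp k 2) :
    pairing k (fun x => f x - g x) = pairing k f - pairing k g := by
  rw [← conj_pairing, pairing_sub_left hf hg hk, map_sub, conj_pairing, conj_pairing]

/-- Only the removed terms matter: summed over i they equal ⟨P(radial part of G), radial part of K⟩,
and P is symmetric. -/
theorem sum_pairing_perpField (hn : 3 ≤ n) (hG : ∀ i, MemLp (G i) 2) (hK : ∀ i, MemLp (K i) 2) :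
    ∑ i, pairing (perpField G i) (K i) = ∑ i, pairing (G i) (perpField K i) := by
  have := nontrivial_euclidean hn
  have hPG := WeightedResolvent.MemLp.radialAverage (memLp_radialPart hG)
  have hPK := WeightedResolvent.MemLp.radialAverage (memLp_radialPart hK)
  have e1 : ∀ i, pairing (perpField G i) (K i) = pairing (G i) (K i) -
      pairing (fun x => unitCoord i x * radialAverage (radialPart G) x) (K i) := fun i =>
    pairing_sub_left (hG i) (memLp_mul_bdd (aestronglyMeasurable_unitCoord i)
      (norm_unitCoord_le i) hPG) (hK i)
  have e2 : ∀ i, pairing (G i) (perpField K i) = pairing (G i) (K i) -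
      pairing (G i) (fun x => unitCoord i x * radialAverage (radialPart K) x) := fun i =>
    pairing_sub_right (hK i) (memLp_mul_bdd (aestronglyMeasurable_unitCoord i)
      (norm_unitCoord_le i) hPK) (hG i)
  simp_rw [e1, e2, ← conj_pairing (fun x => unitCoord _ x * radialAverage (radialPart K) x)]
  rw [Finset.sum_sub_distrib, Finset.sum_sub_distrib, ← map_sum, sum_pairing_unitCoord_mul hPG hK,
    sum_pairing_unitCoord_mul hPK hG, conj_pairing,
    pairing_radialAverage (memLp_radialPart hG) (memLp_radialPart hK)]

/-- Spherical averaging commutes with multiplication by |x|⁻¹ and takes ∇u to the radial field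
carrying the mean of ∂ᵣu, so removing means before or after `hardyGrad` gives the same field. -/
theorem hardyGrad_sub_radialAverage (hn : 3 ≤ n) (hu : IsH1 u G) (i : Fin n) :
    hardyGrad (fun x => u x - radialAverage u x)
      (fun i x => G i x - unitCoord i x * radialAverage (radialPart G) x) i =ᵐ[volume]
      perpField (hardyGrad u G) i := by
  have := nontrivial_euclidean hn
  set a : ℂ := ((((n : ℝ) - 2) / 2 : ℝ) : ℂ) with ha
  have e1 : radialPart (hardyGrad u G) =ᵐ[volume] fun x => radialPart G x +
      a * ((‖x‖⁻¹ : ℝ) : ℂ) * u x := by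
    filter_upwards [ae_ne_zero hn] with x hx
    exact radialPart_hardyGrad u G hx
  have hm : MemLp (fun x => a * ((‖x‖⁻¹ : ℝ) : ℂ) * u x) 2 := by
    simp_rw [mul_assoc]
    exact (hu.hardy hn).1.const_mul a
  filter_upwards [radialAverage_congr_ae e1,
    radialAverage_add_ae (memLp_radialPart hu.memLp_grad) hm] with x h1 h2
  have h3 := radialAverage_mul (k := fun x : E n => a * ((‖x‖⁻¹ : ℝ) : ℂ))
    (fun x y h => by simp only [h]) u x
  rw [perpField, h1, h2, h3, hardyGrad, hardyGrad, ← ha]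
  ring

theorem IsH1.angular_poincare (hn : 3 ≤ n) {C : ℝ≥0∞} (hC : C ≠ ∞)
    (h : ∀ φ : E n → ℂ, IsTestFunction φ →
      sqNorm (fun x => ((‖x‖⁻¹ : ℝ) : ℂ) * (φ x - WeightedResolvent.radialAverage φ x)) ≤
        C * ∑ i, sqNorm (tangPart (fun i => partialDeriv i φ) i)) (hu : IsH1 u G) :
    sqNorm (fun x => ((‖x‖⁻¹ : ℝ) : ℂ) * (u x - WeightedResolvent.radialAverage u x)) ≤
        C * ∑ i, sqNorm (tangPart G i) := by
  have := nontrivial_euclidean hn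
  obtain ⟨φ, h1, h2, h3⟩ := id hu
  have l1 := ((gradBounded_norm_inv hn).tendsto (fun k => (h1 k).isH1.sub_radialAverage hn)
    (hu.sub_radialAverage hn) fun i =>
    (h3 i).sub ((L2Tendsto.radialPart h3).radialAverage.unitCoord_mul i)).sqNorm
  have l2 : Tendsto (fun k => C * ∑ i, sqNorm (tangPart (fun i => partialDeriv i (φ k)) i)) atTop
      (𝓝 (C * ∑ i, sqNorm (tangPart G i))) :=
    ENNReal.Tendsto.const_mul (tendsto_finsetSum _ fun i _ =>
      ((h3 i).sub ((L2Tendsto.radialPart h3).unitCoord_mul i)).sqNorm) (Or.inr hC)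
  exact le_of_tendsto_of_tendsto' l1 l2 fun k => h _ (h1 k)

/-- The improved Hardy inequality. -/
theorem exists_coercive_criticalPotential (hn : 3 ≤ n) : ∃ s : ℝ, 0 < s ∧ s ≤ 1 ∧
    ∀ (w : E n → ℂ) (K : Fin n → E n → ℂ), IsH1 w K → radialAverage w =ᵐ[volume] 0 →
      s * ∑ i, (∫ x, ‖K i x‖ ^ 2) ≤
        ∑ i, (∫ x, ‖K i x‖ ^ 2) + ∫ x, criticalPotential n x * ‖w x‖ ^ 2 := by
  obtain ⟨C, hC, hP⟩ := exists_angular_poincare hn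
  set b : ℝ := ((n : ℝ) - 2) ^ 2 / 4 with hb
  have hb0 : 0 ≤ b := by positivity
  have hC0 : 0 ≤ C.toReal := ENNReal.toReal_nonneg
  -- The constant: with Q the critical form, ‖∇w‖² = Q + b‖|x|⁻¹w‖², and the angular Poincaré
  -- inequality bounds the last norm by C Q, so ‖∇w‖² ≤ (1 + bC) Q.
  refine ⟨(1 + b * C.toReal)⁻¹, by positivity, inv_le_one_of_one_le₀ (by nlinarith [mul_nonneg hb0 hC0]),
    fun w K hw h0 => ?_⟩
  have h1 := hw.angular_poincare hn hC hP
  have e1 : sqNorm (fun x => ((‖x‖⁻¹ : ℝ) : ℂ) * (w x - radialAverage w x)) =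
      sqNorm (fun x => ((‖x‖⁻¹ : ℝ) : ℂ) * w x) := by
    refine lintegral_congr_ae ?_
    filter_upwards [h0] with x hx
    rw [hx, Pi.zero_apply, sub_zero]
  have hD := fun i => memLp_hardyGrad hn hw i
  have e2 : ∀ i, sqNorm (tangPart K i) = ENNReal.ofReal (∫ x, ‖tangPart (hardyGrad w K) i x‖ ^ 2) := by
    intro i
    rw [← sqNorm_eq_ofReal (memLp_tangPart hD i)]
    refine lintegral_congr_ae ?_
    filter_upwards [ae_ne_zero hn] with x hx
    rw [tangPart_hardyGrad w K i hx]
  have hS0 : 0 ≤ ∑ i, ∫ x, ‖tangPart (hardyGrad w K) i x‖ ^ 2 :=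
    Finset.sum_nonneg fun i _ => integral_nonneg fun x => by positivity
  have h2 : ∫ x, ‖((‖x‖⁻¹ : ℝ) : ℂ) * w x‖ ^ 2 ≤
      C.toReal * ∑ i, ∫ x, ‖tangPart (hardyGrad w K) i x‖ ^ 2 := by
    rw [e1, sqNorm_eq_ofReal (hw.hardy hn).1] at h1
    simp_rw [e2] at h1
    rw [← ENNReal.ofReal_sum_of_nonneg fun i _ => integral_nonneg fun x => by positivity,
      ← ENNReal.ofReal_toReal hC, ← ENNReal.ofReal_mul hC0] at h1
    exact (ENNReal.ofReal_le_ofReal_iff (mul_nonneg hC0 hS0)).1 h1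
  -- Pythagoras: discarding the radial component only decreases the norm.
  have h3 : ∑ i, ∫ x, ‖tangPart (hardyGrad w K) i x‖ ^ 2 ≤
      ∑ i, ∫ x, ‖hardyGrad w K i x‖ ^ 2 := by
    have i1 := fun i => (memLp_tangPart hD i).integrable_norm_pow (p := 2) (by norm_num)
    have i2 := fun i => (hD i).integrable_norm_pow (p := 2) (by norm_num)
    rw [← integral_finsetSum _ fun i _ => by exact i1 i, ← integral_finsetSum _ fun i _ => by exact i2 i]
    refine integral_mono_ae (integrable_finsetSum _ fun i _ => by exact i1 i)
      (integrable_finsetSum _ fun i _ => by exact i2 i) ?_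
    filter_upwards [ae_ne_zero hn] with x hx
    rw [sum_norm_tangPart_sq _ hx]
    exact sub_le_self _ (by positivity)
  have h4 := form_self_eq_hardyGrad hn hw
  have h5 : ∫ x, criticalPotential n x * ‖w x‖ ^ 2 = -b * ∫ x, ‖((‖x‖⁻¹ : ℝ) : ℂ) * w x‖ ^ 2 := by
    rw [← integral_const_mul]
    congr 1 with x
    rw [criticalPotential, norm_mul, mul_pow, Complex.norm_real, norm_inv, norm_norm, inv_pow]
    ring
  set Q := ∑ i, ∫ x, ‖hardyGrad w K i x‖ ^ 2
  set N := ∑ i, ∫ x, ‖K i x‖ ^ 2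
  rw [h4]
  rw [h5] at h4
  have h6 : b * ∫ x, ‖((‖x‖⁻¹ : ℝ) : ℂ) * w x‖ ^ 2 ≤ b * (C.toReal * Q) :=
    mul_le_mul_of_nonneg_left (h2.trans (mul_le_mul_of_nonneg_left h3 hC0)) hb0
  rw [inv_mul_le_iff₀ (by positivity)]
  linarith

end

section
variable {n : ℕ} {f g u w : E n → ℂ} {G K : Fin n → E n → ℂ}

/-! ### The resolvent estimate for the critical potential -/

theorem radialAverage_sub_self (hn : 3 ≤ n) (hu : MemLp u 2) :
    radialAverage (fun x => u x - radialAverage u x) =ᵐ[volume] 0 := by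
  have := nontrivial_euclidean hn
  filter_upwards [radialAverage_sub_ae hu (WeightedResolvent.MemLp.radialAverage hu)] with x hx
  rw [hx, radialAverage_of_radial fun x y h => radialAverage_eq_of_norm_eq u h]
  exact sub_self _

/-- After removing spherical means, the resolvent of the critical operator produces weak solutions. -/
theorem exists_isWeakSolution_critical (hn : 3 ≤ n) {z : ℂ} {f u : L2 n} {φ : ℕ → E n → ℂ}
    (hφ : IsFormApprox (criticalPotential n) φ u)
    (hf : MemLp (fun x => ((‖x‖ : ℝ) : ℂ) * f x) 2) (hf0 : radialAverage f =ᵐ[volume] 0)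
    (heq : ∀ ψ, IsTestFunction ψ → Tendsto (fun k => schrodingerForm (criticalPotential n) (φ k) ψ)
      atTop (𝓝 (pairing f ψ + z * pairing u ψ))) :
    ∃ G, IsWeakSolution (criticalPotential n) z f (fun x => u x - radialAverage u x) G := by
  have := nontrivial_euclidean hn
  obtain ⟨C, hC⟩ := exists_formBounded_criticalPotential hn
  obtain ⟨s, hs0, -, hs⟩ := exists_coercive_criticalPotential hn
  obtain ⟨g, hg⟩ := exists_hardyGrad_limit hn hφ.test hφ.cauchy
  have hu := hφ.l2Tendsto
  have eqt : ∀ ψ, IsTestFunction ψ → ∑ i, pairing (g i) (hardyGrad ψ (fun i => partialDeriv i ψ) i) =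
      pairing f ψ + z * pairing u ψ := fun ψ hψ => by
    refine tendsto_nhds_unique (tendsto_finsetSum _ fun i _ => (hg i).pairing
      (.const _ (memLp_hardyGrad hn hψ.isH1 i))) ((heq ψ hψ).congr fun k => ?_)
    rw [schrodingerForm_eq (hφ.test k) hψ (hC.integrable (hφ.test k).isH1 hψ.isH1),
      form_eq_hardyGrad_test hn (hφ.test k) hψ]
  -- The equation is extended to H¹ because it is needed at ψ - Pψ, known only to lie in H¹.
  have eqH : ∀ {w : E n → ℂ} {K : Fin n → E n → ℂ}, IsH1 w K →
      ∑ i, pairing (g i) (hardyGrad w K i) = pairing f w + z * pairing u w := fun hw => by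
    obtain ⟨ψ, k1, k2, k3⟩ := id hw
    refine tendsto_nhds_unique (tendsto_finsetSum _ fun i _ =>
      (L2Tendsto.const atTop (hg i).lim).pairing
        (l2Tendsto_hardyGrad hn (fun k => (k1 k).isH1) hw k3 i)) (Tendsto.congr
      (fun k => (eqt _ (k1 k)).symm) ?_)
    exact ((L2Tendsto.const atTop (Lp.memLp f)).pairing k2).add
      (((L2Tendsto.const atTop (Lp.memLp u)).pairing k2).const_mul z)
  set U : ℕ → E n → ℂ := fun k x => φ k x - radialAverage (φ k) x with hU
  set D : ℕ → Fin n → E n → ℂ := fun k i x => partialDeriv i (φ k) x -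
    unitCoord i x * radialAverage (radialPart fun i => partialDeriv i (φ k)) x with hD
  have hUD : ∀ k, IsH1 (U k) (D k) := fun k => (hφ.test k).isH1.sub_radialAverage hn
  have hUu : L2Tendsto atTop U (fun x => u x - radialAverage u x) := hu.sub hu.radialAverage
  have hgD : ∀ i, L2Tendsto atTop (fun k => hardyGrad (U k) (D k) i) (perpField g i) := fun i =>
    (L2Tendsto.perpField hn hg i).congr'
      (fun k => (hardyGrad_sub_radialAverage hn (hφ.test k).isH1 i).symm) ae_eq_rfl
  -- Coercivity on vanishing spherical means bounds the gradients of differences of φ_k - Pφ_k by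
  -- the convergent `hardyGrad` components. This is how the limit u - Pu acquires an H¹ gradient.
  have hcauchy : ∀ i, ∃ G, L2Tendsto atTop (fun k => D k i) G := fun i => by
    refine exists_L2Tendsto_of_cauchy (fun k => (hUD k).memLp_grad i) ?_
    have lim : Tendsto (fun p : ℕ × ℕ => ENNReal.ofReal (s⁻¹ * ∑ i, ∫ x,
        ‖hardyGrad (U p.1) (D p.1) i x - hardyGrad (U p.2) (D p.2) i x‖ ^ 2)) atTop (𝓝 0) := by
      rw [← prod_atTop_atTop_eq]
      have l := (tendsto_finsetSum Finset.univ fun i _ =>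
        (((hgD i).comp (tendsto_fst (g := (atTop : Filter ℕ)))).sub
          ((hgD i).comp (tendsto_snd (f := (atTop : Filter ℕ))))).integral_norm_sq).const_mul s⁻¹
      have l' := ENNReal.tendsto_ofReal l
      simpa using l'
    refine tendsto_of_tendsto_of_tendsto_of_le_of_le tendsto_const_nhds lim (fun _ => zero_le) ?_
    intro p
    have hsub := (hUD p.1).sub (hUD p.2)
    have h0 : radialAverage (fun x => U p.1 x - U p.2 x) =ᵐ[volume] 0 := by
      filter_upwards [radialAverage_sub_ae (hUD p.1).memLp (hUD p.2).memLp,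
        radialAverage_sub_self hn (hφ.test p.1).memLp,
        radialAverage_sub_self hn (hφ.test p.2).memLp] with x h1 h2 h3
      rw [h1]
      simp only [hU]
      rw [h2, h3]
      simp
    have h1 := hs _ _ hsub h0
    rw [form_self_eq_hardyGrad hn hsub] at h1
    have e : ∀ i x, hardyGrad (fun x => U p.1 x - U p.2 x) (fun i x => D p.1 i x - D p.2 i x) i x =
        hardyGrad (U p.1) (D p.1) i x - hardyGrad (U p.2) (D p.2) i x := fun i x => by
      rw [hardyGrad, hardyGrad, hardyGrad]
      ring
    simp_rw [e] at h1
    have h2 : sqNorm (fun x => D p.1 i x - D p.2 i x) =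
        ENNReal.ofReal (∫ x, ‖D p.1 i x - D p.2 i x‖ ^ 2) := sqNorm_eq_ofReal (hsub.memLp_grad i)
    simp only [h2]
    refine ENNReal.ofReal_le_ofReal ?_
    rw [inv_mul_eq_div, le_div_iff₀ hs0, mul_comm]
    refine le_trans (mul_le_mul_of_nonneg_left ?_ hs0.le) h1
    exact Finset.single_le_sum (f := fun i => ∫ x, ‖D p.1 i x - D p.2 i x‖ ^ 2)
      (fun i _ => integral_nonneg fun x => by positivity) (Finset.mem_univ i)
  choose G hG using hcauchy
  have hH1 : IsH1 (fun x => u x - radialAverage u x) G := IsH1.of_tendsto hUD hUu hG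
  have hgG : ∀ i, hardyGrad (fun x => u x - radialAverage u x) G i =ᵐ[volume] perpField g i :=
    fun i => (l2Tendsto_hardyGrad hn hUD hH1 hG i).unique (hgD i)
  refine ⟨G, hH1, Lp.memLp f, hf, fun ψ hψ => ?_⟩
  have hPψ := WeightedResolvent.MemLp.radialAverage hψ.memLp
  have hPu := WeightedResolvent.MemLp.radialAverage (Lp.memLp u)
  have congr : ∀ {a b c d : E n → ℂ}, a =ᵐ[volume] b → c =ᵐ[volume] d → pairing a c = pairing b d := by
    intro a b c d h1 h2
    refine integral_congr_ae ?_
    filter_upwards [h1, h2] with x h1 h2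
    rw [h1, h2]
  have p1 : pairing f (radialAverage ψ) = 0 := by
    rw [← pairing_radialAverage (Lp.memLp f) hψ.memLp, congr hf0 ae_eq_rfl]
    simp [pairing]
  -- The projection is moved from the solution to the test function: q(u - Pu, ψ) = ∑⟨gᵢ,
  -- hardyGradᵢ(ψ - Pψ)⟩ = ⟨f + zu, ψ - Pψ⟩. The mean of f vanishes, and for u the projection is
  -- moved back.
  rw [form_eq_hardyGrad hn hH1 hψ.isH1, Finset.sum_congr rfl fun i _ => congr (hgG i) ae_eq_rfl,
    sum_pairing_perpField hn (fun i => (hg i).lim) (fun i => memLp_hardyGrad hn hψ.isH1 i),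
    Finset.sum_congr rfl fun i _ =>
      congr ae_eq_rfl (hardyGrad_sub_radialAverage hn hψ.isH1 i).symm,
    eqH (hψ.isH1.sub_radialAverage hn), pairing_sub_right hψ.memLp hPψ (Lp.memLp f), p1, sub_zero,
    pairing_sub_right hψ.memLp hPψ (Lp.memLp u), ← pairing_radialAverage (Lp.memLp u) hψ.memLp,
    ← pairing_sub_left (Lp.memLp u) hPu hψ.memLp]
  have i1 := integrable_mul_conj ((Lp.memLp u).sub hPu) hψ.memLp
  have i2 := integrable_mul_conj (Lp.memLp f) hψ.memLp
  unfold pairing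
  rw [← integral_const_mul, add_comm, ← integral_add (by exact i1.const_mul z) i2]
  congr 1 with x
  ring

theorem radialPerp_ae (f : L2 n) : radialPerp f =ᵐ[volume] fun x => f x - radialAverage f x := by
  unfold radialPerp
  filter_upwards [Lp.coeFn_sub f (radialProj f), MemLp.coeFn_toLp
    (memLp_radialAverage (Lp.stronglyMeasurable f) (Lp.memLp f))] with x h1 h2
  rw [h1, Pi.sub_apply]
  congr 1

theorem l2_sub_radialAverage_le (hn : 3 ≤ n) (hf : MemLp f 2) :
    l2 (fun x => f x - radialAverage f x) ≤ 2 * l2 f := by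
  have := nontrivial_euclidean hn
  have hP := WeightedResolvent.MemLp.radialAverage hf
  have h1 := l2_add_le hf hP.neg
  have h2 : l2 (-radialAverage f) ≤ l2 f := by
    have h3 := sqNorm_radialAverage_le hf.1
    rw [sqNorm_eq_ofReal hP, sqNorm_eq_ofReal hf,
      ENNReal.ofReal_le_ofReal_iff (integral_nonneg fun x => by positivity)] at h3
    have h4 : l2 (-radialAverage f) = l2 (radialAverage f) := by
      unfold l2
      simp
    rw [h4]
    exact Real.sqrt_le_sqrt h3
  simp only [Pi.neg_apply, ← sub_eq_add_neg] at h1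
  linarith

/-- The uniform weighted resolvent estimate for the critical potential. -/
theorem exists_weightedBound_critical (hn : 3 ≤ n) :
    ∃ H₀ : L2 n →ₗ.[ℂ] L2 n, IsSchrodingerOperator (criticalPotential n) H₀ ∧
      ∃ C : ℝ, ∀ z : ℂ, (¬ ∃ t : ℝ, 0 ≤ t ∧ z = (t : ℂ)) →
        ∃ R : L2 n →L[ℂ] L2 n, IsResolvent H₀ z R ∧
          WeightedBound (fun g => radialPerp (R (radialPerp g))) C := by
  have := nontrivial_euclidean hn
  obtain ⟨C, hC⟩ := exists_formBounded_criticalPotential hn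
  obtain ⟨C', hC'⟩ : ∃ C', FormBounded (fun x : E n => -2 * criticalPotential n x) C' := by
    obtain ⟨C', hC'⟩ := formBounded_const_mul_inv_norm_sq hn (-2 * -(((n : ℝ) - 2) ^ 2 / 4))
    refine ⟨C', ?_⟩
    simp_rw [criticalPotential, ← mul_assoc]
    exact hC'
  obtain ⟨s, hs0, hs1, hs⟩ := exists_coercive_criticalPotential hn
  obtain ⟨H, hH, hres⟩ := (isClosableForm_criticalPotential hn).exists_operator
  -- The estimate gives 6(n+2)/s². The extra factor 2 is the crude triangle bound for Id - P applied
  -- to |x|g.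
  refine ⟨H, hH, 12 * (n + 2) / s ^ 2, fun z hz => ?_⟩
  obtain ⟨R, hR, happ⟩ := hres z hz
  refine ⟨R, hR, fun f g hfg => ?_⟩
  set h := radialPerp g with hh
  obtain ⟨φ, hφ, hlim⟩ := happ h
  have hae := ae_eq_norm_mul hn hfg
  have hg := radialPerp_ae g
  have hxg : MemLp (fun x => ((‖x‖ : ℝ) : ℂ) * g x) 2 := (memLp_congr_ae hae).2 (Lp.memLp f)
  -- P commutes with multiplication by |x|, so the projected datum is still weighted.
  have hxh : (fun x => ((‖x‖ : ℝ) : ℂ) * h x) =ᵐ[volume] fun x => ((‖x‖ : ℝ) : ℂ) * g x -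
      radialAverage (fun x => ((‖x‖ : ℝ) : ℂ) * g x) x := by
    filter_upwards [hg] with x hx
    rw [hh, hx, radialAverage_mul (k := fun x : E n => ((‖x‖ : ℝ) : ℂ)) (fun x y h => by simp only [h])]
    ring
  have hf0 : radialAverage h =ᵐ[volume] 0 :=
    (radialAverage_congr_ae hg).trans (radialAverage_sub_self hn (Lp.memLp g))
  obtain ⟨G, hG⟩ := exists_isWeakSolution_critical hn hφ ((memLp_congr_ae hxh).2
    (hxg.sub (WeightedResolvent.MemLp.radialAverage hxg))) hf0 hlim
  have hu0 := radialAverage_sub_self hn (Lp.memLp (R h))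
  -- Radial multipliers preserve vanishing spherical means. For this reason the coercivity
  -- hypotheses of the estimate are imposed only on functions ψ(m)u.
  have hcore : ∀ (η : ℝ) (ψ : ℝ → ℂ) (K : Fin n → E n → ℂ),
      IsH1 (fun x => ψ (reg η x) * (R h x - radialAverage (R h) x)) K →
      s * ∑ i, (∫ x, ‖K i x‖ ^ 2) ≤ ∑ i, (∫ x, ‖K i x‖ ^ 2) +
        ∫ x, criticalPotential n x * ‖ψ (reg η x) * (R h x - radialAverage (R h) x)‖ ^ 2 := by
    intro η ψ K hK
    refine hs _ _ hK ?_
    filter_upwards [hu0] with x hx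
    rw [radialAverage_mul (k := fun x : E n => ψ (reg η x)) (fun x y h => by simp only [reg, h]), hx]
    simp
  have est := hG.weighted_estimate hn hC hC' (isWeakEulerDerivative_criticalPotential hn)
    (fun w K hw => ?_) hz hs0 hs1 (fun η _ ψ K hK => hcore η ψ K hK) (fun η _ ψ K hK => ?_)
  · have hm := (hG.isH1.hardy hn).1
    have hRae : (fun x => ((‖x‖⁻¹ : ℝ) : ℂ) * radialPerp (R h) x) =ᵐ[volume]
        fun x => ((‖x‖⁻¹ : ℝ) : ℂ) * (R h x - radialAverage (R h) x) := by
      filter_upwards [radialPerp_ae (R h)] with x hx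
      rw [hx]
    have hm' := (memLp_congr_ae hRae).2 hm
    refine ⟨hm', ?_⟩
    rw [eLpNorm_eq_l2 hm', l2_congr_ae hRae]
    refine ENNReal.ofReal_le_ofReal ?_
    rw [l2_congr_ae hxh] at est
    have h2 := l2_sub_radialAverage_le hn hxg
    rw [l2_congr_ae hae, ← norm_eq_l2] at h2
    rw [div_mul_eq_mul_div, le_div_iff₀ (by positivity)]
    refine est.trans ?_
    have : (0 : ℝ) ≤ 6 * (n + 2) := by positivity
    have h3 := mul_le_mul_of_nonneg_left h2 this
    linarith
  · rw [form_self_eq_hardyGrad hn hw]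
    exact Finset.sum_nonneg fun i _ => integral_nonneg fun x => by positivity
  -- With W = -2V one has -V - W = V, so the second coercivity hypothesis is the first.
  · refine (hcore η ψ K hK).trans (le_of_eq ?_)
    have e : ∀ x : E n, -2 * criticalPotential n x * ‖ψ (reg η x) *
        (R h x - radialAverage (R h) x)‖ ^ 2 = -2 * (criticalPotential n x * ‖ψ (reg η x) *
        (R h x - radialAverage (R h) x)‖ ^ 2) := fun x => by ring
    simp_rw [e]
    rw [integral_const_mul]
    ring

end

end WeightedResolvent

end

/-! ### The critical and subcritical cases combined -/

theorem mainTheorem7 (n : ℕ) (hn : 3 ≤ n) :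
    (∃ H₀ : WeightedResolvent.L2 n →ₗ.[ℂ] WeightedResolvent.L2 n,
      WeightedResolvent.IsSchrodingerOperator (WeightedResolvent.criticalPotential n) H₀ ∧
      ∃ C : ℝ, ∀ z : ℂ, (¬ ∃ t : ℝ, 0 ≤ t ∧ z = (t : ℂ)) →
        ∃ R : WeightedResolvent.L2 n →L[ℂ] WeightedResolvent.L2 n,
          WeightedResolvent.IsResolvent H₀ z R ∧
          WeightedResolvent.WeightedBound (fun g => WeightedResolvent.radialPerp
            (R (WeightedResolvent.radialPerp g))) C) ∧
    (∃ C : ℝ, 0 < C ∧ ∀ (δ : ℝ) (V : WeightedResolvent.E n → ℝ), 0 < δ →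
      WeightedResolvent.IsSubcritical δ V →
      ∃ H : WeightedResolvent.L2 n →ₗ.[ℂ] WeightedResolvent.L2 n,
        WeightedResolvent.IsSchrodingerOperator V H ∧
        ∀ z : ℂ, (¬ ∃ t : ℝ, 0 ≤ t ∧ z = (t : ℂ)) →
          ∃ R : WeightedResolvent.L2 n →L[ℂ] WeightedResolvent.L2 n,
            WeightedResolvent.IsResolvent H z R ∧
            WeightedResolvent.WeightedBound R (C * δ ^ (-2 : ℤ))) :=
  ⟨WeightedResolvent.exists_weightedBound_critical hn, 6 * (n + 2), by positivity,
    fun _ _ hδ hV => hV.weightedBound hn hδ⟩
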